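/- **Setting.** Let $A_\star\in\mathbb R^{d\times d}$, $B_\star\in\mathbb R^{d\times k}$, let $Q\in\mathbb R^{d\times d}$ and $R\in\mathbb R^{k\times k}$ be symmetric positive definite, and let $\sigma>0$. Starting from $x_1=0$, the system evolves as $x_{t+1}=A_\star x_t+B_\star u_t+w_t$, where $w_1,w_2,\dots$ are i.i.d. $\mathcal N(0,\sigma^2I)$, and the cost at time $t$ is $c_t=x_t^TQx_t+u_t^TRu_t$. For $K\in\mathbb R^{k\times d}$ let $J(K)=\lim_{T\to\infty}\frac1T\mathbb E\sum_{t=1}^Tc_t\in[0,\infty]$ be the average cost of the policy $u_t=Kx_t$. Let $J_\star=\min_KJ(K)$, and let $K_\star$ be the minimizer. The regret over $T$ rounds is $\mathcal R_T=\sum_{t=1}^T(c_t-J_\star)$. All matrix norms are operator norms, except that $\|\cdot\|_F$ is the Frobenius norm. Assume that, for positive constants $\alpha_0,\alpha_1,\vartheta,\nu,\nu_0$ and a controller $K_0$, $$\|Q\|,\|R\|\le\alpha_1,\quad \|Q^{-1}\|,\|R^{-1}\|\le\alpha_0^{-1},\quad \|A_\star\|,\|B_\star\|\le\vartheta,\quad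 J_\star\le\nu,\quad J(K_0)\le\nu_0 .$$ For a system $(A,B)$ write $\mathcal K(A,B)=-(R+B^TPB)^{-1}B^TPA$, where $P\succ0$ solves $P=Q+A^TPA-A^TPB(R+B^TPB)^{-1}B^TPA$ (and $\mathcal K(A,B)=0$ if there is no such $P$). **Algorithm.** The inputs are $Q$, $R$, $B_\star$, $K_0$ and parameters $\tau_0,x_b,\kappa,\lambda$; the matrix $A_\star$ is not an input. For $t<\tau_0$ play $u_t=K_0x_t$. Put $\tau_i=\tau_04^i$ for $i\ge0$. At time $\tau_i$ compute $$A_{\tau_i}=\arg\min_A\sum_{s=1}^{\tau_i-1}\|(x_{s+1}-B_\star u_s)-Ax_s\|^2+\lambda\|A\|_F^2,\qquad K_{\tau_i}=\mathcal K(A_{\tau_i},B_\star).$$ For $\tau_i\le t<\tau_{i+1}$ play $u_t=K_{\tau_i}x_t$, unless $\|x_t\|^2>x_b$ or $\|K_{\tau_i}\|>\kappa$. In that case abort: from time $t$ on (including time $t$), play $K_0$ forever. **Theorem.** (a) *Efficiency.* The running time of the algorithm per time step is polynomial in $d$ and $k$: there is a polynomial $p$ such that for all $d,k$ a single straight-line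 program of at most $p(d,k)$ instructions, run once per time step on a memory of real registers, produces the actions of the algorithm, for all inputs with $\tau_0\ge1$ and $\lambda>0$ and all observed state sequences. An instruction is an exact arithmetic operation, a rational constant, a selection by comparison, an evaluation of $\mathcal K$ (a Riccati solver), or an evaluation of the spectral norm of a $k\times d$ matrix. (b) *Regret.* There are polynomials $p_C,p_\varepsilon,p_T,p_R$ in the nine variables $(\alpha_0^{-1},\alpha_1,\vartheta,\nu,\nu_0,d,k,\sigma,\sigma^{-1})$ such that the following holds for all systems as above, with $C_0=p_C$ and $\varepsilon_0=1/p_\varepsilon$. First, $C_0,\varepsilon_0>0$, and whenever $0\le\varepsilon\le\varepsilon_0$, $\|A-A_\star\|\le\varepsilon$ and $\|B-B_\star\|\le\varepsilon$, the Riccati equation of $(A,B)$ has a positive definite solution and $K=\mathcal K(A,B)$ satisfies $J(K)-J_\star\le C_0\varepsilon^2$ and $\|K-K_\star\|\le C_0\varepsilon$. Second, for every $T\ge p_T$, if the algorithm is run with $$\kappa_0=\sqrt{\tfrac{\nu_0}{\alpha_0\sigma^2}},\quad \kappa=\sqrt{\tfrac{\nu+\varepsilon_0^2C_0}{\alpha_0\sigma^2}},\quad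 \lambda=x_b=135\,d\,\kappa^2\sigma^2\max\{\kappa_0^6,4\kappa^6\}\log(3T),\quad \tau_0=\Big\lceil\tfrac{80\,d\,\lambda(1+\vartheta^2)}{\sigma^2\varepsilon_0^2}\Big\rceil,$$ then $\mathcal R_T$ is integrable and $$\mathbb E[\mathcal R_T]\le p_R\cdot\log^2T .$$ -/

import Mathlib

open MeasureTheory ProbabilityTheory Filter
open scoped ENNReal Matrix Matrix.Norms.L2Operator

noncomputable section

/- Conventions.  States are vectors `Fin d → ℝ`, actions are vectors `Fin k → ℝ`.  The squared
Euclidean norm of `x` is written `x ⬝ᵥ x`.  The norm `‖M‖` of a matrix is the operator norm with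
respect to Euclidean norms (spectral norm).  Time runs over `t = 1, 2, …`; the values at time `0`
of states, actions and noises are never used. -/

namespace LQ

/-! ### The greedy controller -/

/-- `P` is a positive definite solution of the discrete Riccati equation. -/
def IsRiccatiSol {d k : ℕ} (A : Matrix (Fin d) (Fin d) ℝ) (B : Matrix (Fin d) (Fin k) ℝ)
    (Q : Matrix (Fin d) (Fin d) ℝ) (R : Matrix (Fin k) (Fin k) ℝ)
    (P : Matrix (Fin d) (Fin d) ℝ) : Prop :=
  P.PosDef ∧ P = Q + Aᵀ * P * A - Aᵀ * P * B * (R + Bᵀ * P * B)⁻¹ * Bᵀ * P * A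

open Classical in
/-- The infinite-horizon optimal controller `-(R + BᵀPB)⁻¹BᵀPA` of the system `(A, B)`, with `P`
the positive definite solution of the Riccati equation.  (For `Q, R ≻ 0` there is at most one such
`P`; if there is none, that is, if `(A, B)` is not stabilizable, the controller is `0` by
convention.) -/
def optController {d k : ℕ} (A : Matrix (Fin d) (Fin d) ℝ) (B : Matrix (Fin d) (Fin k) ℝ)
    (Q : Matrix (Fin d) (Fin d) ℝ) (R : Matrix (Fin k) (Fin k) ℝ) : Matrix (Fin k) (Fin d) ℝ :=
  if h : ∃ P, IsRiccatiSol A B Q R P then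
    -((R + Bᵀ * h.choose * B)⁻¹ * Bᵀ * h.choose * A)
  else 0

/-! ### Controlled linear dynamics -/

/-- States and actions produced by a policy `π`, starting from `x₁ = 0`, under
`x (t+1) = A x t + B u t + w t` and `u t = π x u t`.  Stage `t` holds the states up to time `t + 1`
and the actions up to time `t`, all later entries being `0`; hence when `π` chooses the action of
time `t` it sees exactly the states of times `1, …, t` and the actions of times `1, …, t - 1`. -/
def hist {d k : ℕ} (A : Matrix (Fin d) (Fin d) ℝ) (B : Matrix (Fin d) (Fin k) ℝ)
    (π : (ℕ → Fin d → ℝ) → (ℕ → Fin k → ℝ) → ℕ → Fin k → ℝ) (w : ℕ → Fin d → ℝ) :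
    ℕ → (ℕ → Fin d → ℝ) × (ℕ → Fin k → ℝ)
  | 0 => (0, 0)
  | t + 1 =>
    let x := (hist A B π w t).1
    let u := Function.update (hist A B π w t).2 (t + 1) (π x (hist A B π w t).2 (t + 1))
    (Function.update x (t + 2) (A *ᵥ x (t + 1) + B *ᵥ u (t + 1) + w (t + 1)), u)

/-- The state at time `t`. -/
def state {d k : ℕ} (A : Matrix (Fin d) (Fin d) ℝ) (B : Matrix (Fin d) (Fin k) ℝ)
    (π : (ℕ → Fin d → ℝ) → (ℕ → Fin k → ℝ) → ℕ → Fin k → ℝ) (w : ℕ → Fin d → ℝ) (t : ℕ) :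
    Fin d → ℝ :=
  (hist A B π w t).1 t

/-- The action at time `t`. -/
def action {d k : ℕ} (A : Matrix (Fin d) (Fin d) ℝ) (B : Matrix (Fin d) (Fin k) ℝ)
    (π : (ℕ → Fin d → ℝ) → (ℕ → Fin k → ℝ) → ℕ → Fin k → ℝ) (w : ℕ → Fin d → ℝ) (t : ℕ) :
    Fin k → ℝ :=
  (hist A B π w t).2 t

/-- The stationary linear policy `u t = K x t`. -/
def linearPolicy {d k : ℕ} (K : Matrix (Fin k) (Fin d) ℝ) :
    (ℕ → Fin d → ℝ) → (ℕ → Fin k → ℝ) → ℕ → Fin k → ℝ :=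
  fun x _ t => K *ᵥ x t

/-! ### LQR systems -/

/-- An LQR system: transition matrices, cost matrices, and noise standard deviation. -/
structure System (d k : ℕ) where
  A : Matrix (Fin d) (Fin d) ℝ
  B : Matrix (Fin d) (Fin k) ℝ
  Q : Matrix (Fin d) (Fin d) ℝ
  R : Matrix (Fin k) (Fin k) ℝ
  σ : ℝ

/-- The Gaussian law `N(0, σ² I)` on `ℝ^d`. -/
def gaussianNoise (d : ℕ) (σ : ℝ) : Measure (Fin d → ℝ) :=
  Measure.pi fun _ => gaussianReal 0 (σ ^ 2).toNNReal

instance (d : ℕ) (σ : ℝ) : IsProbabilityMeasure (gaussianNoise d σ) := by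
  unfold gaussianNoise; infer_instance

/-- The law of an i.i.d. sequence of `N(0, σ² I)` vectors. -/
def noiseLaw (d : ℕ) (σ : ℝ) : Measure (ℕ → Fin d → ℝ) :=
  Measure.infinitePi fun _ => gaussianNoise d σ

namespace System

/-- The cost `c_t = x_tᵀ Q x_t + u_tᵀ R u_t`. -/
def cost {d k : ℕ} (S : System d k) (π : (ℕ → Fin d → ℝ) → (ℕ → Fin k → ℝ) → ℕ → Fin k → ℝ)
    (w : ℕ → Fin d → ℝ) (t : ℕ) : ℝ :=
  state S.A S.B π w t ⬝ᵥ S.Q *ᵥ state S.A S.B π w t +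
    action S.A S.B π w t ⬝ᵥ S.R *ᵥ action S.A S.B π w t

/-- The infinite-horizon expected average cost `J(K) ∈ [0, ∞]` of the policy `u t = K x t`.  (The
expected cost of time `t` is nondecreasing in `t`, so that the `limsup` of the averages is their
limit; it is `∞` exactly for the controllers whose average cost diverges.) -/
def J {d k : ℕ} (S : System d k) (K : Matrix (Fin k) (Fin d) ℝ) : ℝ≥0∞ :=
  limsup (fun T : ℕ =>
    (∫⁻ w, ENNReal.ofReal (∑ t ∈ Finset.Icc 1 T, S.cost (linearPolicy K) w t)
      ∂(noiseLaw d S.σ)) / (T : ℝ≥0∞)) atTop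

/-- The optimal infinite-horizon expected cost. -/
def Jstar {d k : ℕ} (S : System d k) : ℝ≥0∞ := ⨅ K, S.J K

/-- `K` is an optimal linear policy. -/
def IsOptimal {d k : ℕ} (S : System d k) (K : Matrix (Fin k) (Fin d) ℝ) : Prop :=
  ∀ K', S.J K ≤ S.J K'

/-- The regret over `T` rounds. -/
def regret {d k : ℕ} (S : System d k)
    (π : (ℕ → Fin d → ℝ) → (ℕ → Fin k → ℝ) → ℕ → Fin k → ℝ)
    (T : ℕ) (w : ℕ → Fin d → ℝ) : ℝ :=
  ∑ t ∈ Finset.Icc 1 T, (S.cost π w t - S.Jstar.toReal)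

/-- The standing assumptions on the system, on the initial controller `K₀`, and on the constants
known to the learner. -/
structure Admissible {d k : ℕ} (S : System d k) (K₀ : Matrix (Fin k) (Fin d) ℝ)
    (α₀ α₁ ϑ ν ν₀ : ℝ) : Prop where
  sigma_pos : 0 < S.σ
  alpha0_pos : 0 < α₀
  alpha1_pos : 0 < α₁
  theta_pos : 0 < ϑ
  nu_pos : 0 < ν
  nu0_pos : 0 < ν₀
  Q_posDef : S.Q.PosDef
  R_posDef : S.R.PosDef
  Q_le : ‖S.Q‖ ≤ α₁
  R_le : ‖S.R‖ ≤ α₁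
  Q_inv_le : ‖S.Q⁻¹‖ ≤ α₀⁻¹
  R_inv_le : ‖S.R⁻¹‖ ≤ α₀⁻¹
  A_le : ‖S.A‖ ≤ ϑ
  B_le : ‖S.B‖ ≤ ϑ
  Jstar_le : S.Jstar ≤ ENNReal.ofReal ν
  J_K0_le : S.J K₀ ≤ ENNReal.ofReal ν₀

/-- Within distance `ε ≤ ε₀` of the true system, the optimal controller of the perturbed system
exists, its excess cost is at most `C₀ ε²`, and it is `C₀ ε`-close to the optimal policy. -/
def PerturbationBound {d k : ℕ} (S : System d k) (C₀ ε₀ : ℝ) : Prop :=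
  ∀ (ε : ℝ) (A : Matrix (Fin d) (Fin d) ℝ) (B : Matrix (Fin d) (Fin k) ℝ),
    0 ≤ ε → ε ≤ ε₀ → ‖A - S.A‖ ≤ ε → ‖B - S.B‖ ≤ ε →
    (∃ P, IsRiccatiSol A B S.Q S.R P) ∧
    S.J (optController A B S.Q S.R) ≤ S.Jstar + ENNReal.ofReal (C₀ * ε ^ 2) ∧
    ∀ Kstar, S.IsOptimal Kstar → ‖optController A B S.Q S.R - Kstar‖ ≤ C₀ * ε

end System

/-! ### The algorithm -/

/-- What the algorithm receives: the cost matrices, the matrix `B`, the initial controller, the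
warm-up length `τ₀`, the state threshold `x_b`, the controller threshold `κ` and the
regularization parameter `λ`.  The matrix `A` is not among them. -/
structure AlgInput (d k : ℕ) where
  Q : Matrix (Fin d) (Fin d) ℝ
  R : Matrix (Fin k) (Fin k) ℝ
  B : Matrix (Fin d) (Fin k) ℝ
  K₀ : Matrix (Fin k) (Fin d) ℝ
  τ₀ : ℕ
  xb : ℝ
  κ : ℝ
  lam : ℝ

namespace AlgInput

/-- The least-squares objective at time `τ`:
`∑_{s=1}^{τ-1} ‖(x_{s+1} - B u_s) - A x_s‖² + λ ‖A‖_F²`. -/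
def lsObjective {d k : ℕ} (p : AlgInput d k) (x : ℕ → Fin d → ℝ) (u : ℕ → Fin k → ℝ) (τ : ℕ)
    (A : Matrix (Fin d) (Fin d) ℝ) : ℝ :=
  ∑ s ∈ Finset.Icc 1 (τ - 1),
      ((x (s + 1) - p.B *ᵥ u s) - A *ᵥ x s) ⬝ᵥ ((x (s + 1) - p.B *ᵥ u s) - A *ᵥ x s) +
    p.lam * ∑ i, ∑ j, A i j ^ 2

/-- The regularized least-squares estimate `A_τ`: a minimizer of the objective (it is unique
for `λ > 0`). -/
def estimate {d k : ℕ} (p : AlgInput d k) (x : ℕ → Fin d → ℝ) (u : ℕ → Fin k → ℝ) (τ : ℕ) :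
    Matrix (Fin d) (Fin d) ℝ :=
  Classical.epsilon fun A => ∀ A', p.lsObjective x u τ A ≤ p.lsObjective x u τ A'

/-- The greedy controller `K_τ`. -/
def greedy {d k : ℕ} (p : AlgInput d k) (x : ℕ → Fin d → ℝ) (u : ℕ → Fin k → ℝ) (τ : ℕ) :
    Matrix (Fin k) (Fin d) ℝ :=
  optController (p.estimate x u τ) p.B p.Q p.R

/-- The starting time `τ_i = τ₀ 4^i` of the phase that contains `t ≥ τ₀`, that is,
`τ_i ≤ t < τ_{i+1}`. -/
def phaseStart {d k : ℕ} (p : AlgInput d k) (t : ℕ) : ℕ :=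
  p.τ₀ * 4 ^ Nat.log 4 (t / p.τ₀)

/-- The fail condition has been met at some time `s` of the main loop with `s ≤ t`. -/
def Aborted {d k : ℕ} (p : AlgInput d k) (x : ℕ → Fin d → ℝ) (u : ℕ → Fin k → ℝ) (t : ℕ) : Prop :=
  ∃ s, p.τ₀ ≤ s ∧ s ≤ t ∧ (p.xb < x s ⬝ᵥ x s ∨ p.κ < ‖p.greedy x u (p.phaseStart s)‖)

open Classical in
/-- The algorithm: it plays `K₀` during the warm-up `t < τ₀`, then in each phase the greedy
controller computed at the start of the phase, until the fail condition is met, from which time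
on it plays `K₀` forever. -/
def policy {d k : ℕ} (p : AlgInput d k) (x : ℕ → Fin d → ℝ) (u : ℕ → Fin k → ℝ) (t : ℕ) :
    Fin k → ℝ :=
  if t < p.τ₀ ∨ p.Aborted x u t then p.K₀ *ᵥ x t else p.greedy x u (p.phaseStart t) *ᵥ x t

end AlgInput

/-! ### The choice of parameters -/

/-- `κ₀ = √(ν₀ / (α₀ σ²))`. -/
def kappa0 (α₀ ν₀ σ : ℝ) : ℝ := Real.sqrt (ν₀ / (α₀ * σ ^ 2))

/-- `κ = √((ν + ε₀² C₀) / (α₀ σ²))`. -/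
def kappa (α₀ ν σ C₀ ε₀ : ℝ) : ℝ := Real.sqrt ((ν + ε₀ ^ 2 * C₀) / (α₀ * σ ^ 2))

/-- `λ = x_b = 135 d κ² σ² max {κ₀⁶, 4 κ⁶} log (3T)`. -/
def lambda (d : ℕ) (α₀ ν ν₀ σ C₀ ε₀ : ℝ) (T : ℕ) : ℝ :=
  135 * d * kappa α₀ ν σ C₀ ε₀ ^ 2 * σ ^ 2 *
    max (kappa0 α₀ ν₀ σ ^ 6) (4 * kappa α₀ ν σ C₀ ε₀ ^ 6) * Real.log (3 * T)

/-- `τ₀ = ⌈80 d λ (1 + ϑ²) / (σ² ε₀²)⌉`. -/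
def tau0 (d : ℕ) (α₀ ϑ ν ν₀ σ C₀ ε₀ : ℝ) (T : ℕ) : ℕ :=
  ⌈80 * d * lambda d α₀ ν ν₀ σ C₀ ε₀ T * (1 + ϑ ^ 2) / (σ ^ 2 * ε₀ ^ 2)⌉₊

/-- The input of the algorithm on the system `S` for horizon `T`. -/
def algInput {d k : ℕ} (S : System d k) (K₀ : Matrix (Fin k) (Fin d) ℝ)
    (α₀ ϑ ν ν₀ C₀ ε₀ : ℝ) (T : ℕ) : AlgInput d k where
  Q := S.Q
  R := S.R
  B := S.B
  K₀ := K₀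
  τ₀ := tau0 d α₀ ϑ ν ν₀ S.σ C₀ ε₀ T
  xb := lambda d α₀ ν ν₀ S.σ C₀ ε₀ T
  κ := kappa α₀ ν S.σ C₀ ε₀
  lam := lambda d α₀ ν ν₀ S.σ C₀ ε₀ T

/-- The problem constants `(α₀⁻¹, α₁, ϑ, ν, ν₀, d, k, σ, σ⁻¹)` in which bounds are polynomial. -/
def consts (d k : ℕ) (α₀ α₁ ϑ ν ν₀ σ : ℝ) : Fin 9 → ℝ :=
  ![α₀⁻¹, α₁, ϑ, ν, ν₀, d, k, σ, σ⁻¹]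

/-! ### Running time

Running time is counted in a real-number machine with registers `ℕ → ℝ`.  In each time step the
machine runs one fixed straight-line program, whose running time is its number of instructions.
An instruction is an exact arithmetic operation, a selection by comparison, or a call of one of two
numerical linear algebra routines: the optimal controller of a given system (solution of a Riccati
equation), and the spectral norm of a `k × d` matrix.  Matrices are stored row by row. -/

/-- Instructions; the first argument is always the target register. -/
inductive Instr where
  | const (r : ℕ) (q : ℚ)
  | add (r a b : ℕ)
  | sub (r a b : ℕ)
  | mul (r a b : ℕ)
  | div (r a b : ℕ)
  | select (r a b c e : ℕ)
  | controller (r a b q c : ℕ)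
  | norm (r a : ℕ)

/-- The `m × n` matrix stored from register `a` on. -/
def readMat (m n a : ℕ) (s : ℕ → ℝ) : Matrix (Fin m) (Fin n) ℝ :=
  fun i j => s (a + finProdFinEquiv (i, j))

/-- Store an `m × n` matrix from register `a` on. -/
def writeMat {m n : ℕ} (a : ℕ) (M : Matrix (Fin m) (Fin n) ℝ) (s : ℕ → ℝ) : ℕ → ℝ :=
  fun r =>
    if h : a ≤ r ∧ r - a < m * n then
      M (finProdFinEquiv.symm ⟨r - a, h.2⟩).1 (finProdFinEquiv.symm ⟨r - a, h.2⟩).2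
    else s r

/-- The effect of one instruction. -/
def Instr.exec (d k : ℕ) (s : ℕ → ℝ) : Instr → (ℕ → ℝ)
  | .const r q => Function.update s r (q : ℝ)
  | .add r a b => Function.update s r (s a + s b)
  | .sub r a b => Function.update s r (s a - s b)
  | .mul r a b => Function.update s r (s a * s b)
  | .div r a b => Function.update s r (s a / s b)
  | .select r a b c e => Function.update s r (if s a ≤ s b then s c else s e)
  | .controller r a b q c =>
      writeMat r (optController (readMat d d a s) (readMat d k b s) (readMat d d q s)
        (readMat k k c s)) s
  | .norm r a => Function.update s r ‖readMat k d a s‖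

/-- Initial memory: registers `0, …, d-1` are reserved for the current state and `d, …, d+k-1` for
the action; then come `Q, R, B, K₀, τ₀, x_b, κ, λ`; everything else is `0`. -/
def initMem {d k : ℕ} (p : AlgInput d k) : ℕ → ℝ :=
  let q := d + k
  let r := q + d * d
  let b := r + k * k
  let c := b + d * k
  let e := c + k * d
  writeMat q p.Q <| writeMat r p.R <| writeMat b p.B <| writeMat c p.K₀ <|
    writeMat e (Matrix.of ![![(p.τ₀ : ℝ), p.xb, p.κ, p.lam]]) 0

/-- Memory after time step `t`: in each step the current state is written to registers
`0, …, d-1` and the program is run once. -/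
def progMem {d k : ℕ} (prog : List Instr) (p : AlgInput d k) (x : ℕ → Fin d → ℝ) : ℕ → (ℕ → ℝ)
  | 0 => initMem p
  | t + 1 =>
    prog.foldl (Instr.exec d k)
      (fun r => if h : r < d then x (t + 1) ⟨r, h⟩ else progMem prog p x t r)

/-- The action that the program outputs at time `t`, read from registers `d, …, d+k-1`. -/
def progAction {d k : ℕ} (prog : List Instr) (p : AlgInput d k) (x : ℕ → Fin d → ℝ) (t : ℕ) :
    Fin k → ℝ :=
  fun j => progMem prog p x t (d + j)

/-- The program carries out the algorithm: on all inputs with `τ₀ ≥ 1` and `λ > 0`, and on every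
sequence of observed states, it outputs the actions of the algorithm. -/
def Implements (d k : ℕ) (prog : List Instr) : Prop :=
  ∀ p : AlgInput d k, 1 ≤ p.τ₀ → 0 < p.lam →
    ∀ (x : ℕ → Fin d → ℝ) (u : ℕ → Fin k → ℝ), (∀ t, 1 ≤ t → u t = p.policy x u t) →
      ∀ t, 1 ≤ t → progAction prog p x t = u t

end LQ

end

/-! Regret is a second-order effect of the estimation error. Let `P` be the Riccati solution and K⋆
its gain. Completing the square in the one-step cost shows that the cost of a step plus the expected
increase of xᵀPx equals σ² tr P plus the Hessian form of u − K⋆x. Since J⋆ = σ² tr P (`Jstar_eq`),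
the expected regret is at most a polynomial factor times the expected sum of ‖u_t − K⋆x_t‖²
(`Setting.sum_cost_le`). The greedy gain is a Lipschitz function of the estimate, so a step with
estimation error e costs at most e²‖x_t‖² up to such factors. Because B⋆ is known, the process noise
alone excites every direction of the state, no exploration is needed, and e² has order 1/τ in the
phase that begins at τ. Summing 1/τ over time gives one logarithm; the other comes from the
threshold x_b on ‖x_t‖², from λ, and from the warm-up length.

Riccati theory is developed by comparison only. A matrix `Y` with `IsSuper` bounds the cost-to-go of
a linear controller. A controller of finite average cost has such a `Y`, given by the series of its
future costs (`exists_isSuper_of_J_le`). A Riccati solution lies below every supersolution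
(`IsRiccatiSol.le_of_isSuper`), and a supersolution forces a solution to exist, found by minimizing
a trace (`exists_isRiccatiSol`). A slight multiple of `P` is still a supersolution for a nearby
system, which makes `P` and the gain Lipschitz (`Bounded.near`, `Bounded.gain_sub_norm`); for the
true system with a nearby gain the required enlargement is quadratic in the distance, which gives
the C₀ε² excess cost (`Bounded.perturbationBound`).

Stability and accuracy depend on each other, and `Setting.fine_of_noiseGood` unties them by
induction on time. Accurate estimates so far mean that a Lyapunov function has contracted so far, so
the energy of the trajectory is linear in time; then the noise dominates the Gram matrix and the
next estimate is accurate again. The randomness enters through finitely many inequalities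
(`NoiseGood`) that come from exponential supermartingales and fail with probability at most d²/T²
(`measure_not_noiseGood_le`). On the failure event the abort rule still bounds the energy of every
path by x_b per step plus the noise energy, so its contribution to the expectation is controlled.

In expectation the estimation error is not bounded through the tail inequalities. States are set to
zero once their energy passes a linear level, which never happens at the relevant times on the good
event; the correlation of noise and truncated states is then a martingale whose second moment is
computed exactly (`integral_corrSq_le`).

For the running time, the inverse Gram matrix and the correlation matrix are maintained by rank-one
updates, and all stored quantities are normalized to vanish at time 0, so that zero memory is a
correct initialization (`exists_step_program`, `holds_initMem`).

One size parameter `g` controls all quantitative estimates; in the end g = θ³ with θ one plus the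
sum of the nine problem constants. -/

noncomputable section

namespace LQ

/-! ### Quadratic forms and the spectral norm -/

section QuadraticForms

variable {m n l : ℕ}

/-- The quadratic form `xᵀ M x`. -/
def qf (M : Matrix (Fin n) (Fin n) ℝ) (x : Fin n → ℝ) : ℝ := x ⬝ᵥ M *ᵥ x

lemma dot_self_nonneg (x : Fin n → ℝ) : 0 ≤ x ⬝ᵥ x :=
  Finset.sum_nonneg fun i _ => mul_self_nonneg (x i)

lemma dot_self_pos {x : Fin n → ℝ} (hx : x ≠ 0) : 0 < x ⬝ᵥ x :=
  lt_of_le_of_ne (dot_self_nonneg x) fun h => hx (dotProduct_self_eq_zero.1 h.symm)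

lemma norm_toLp_sq (x : Fin n → ℝ) : ‖(WithLp.toLp 2 x : EuclideanSpace ℝ (Fin n))‖ ^ 2 = x ⬝ᵥ x := by
  rw [EuclideanSpace.norm_sq_eq]
  simp [dotProduct, sq]

lemma dot_sq_le (x y : Fin n → ℝ) : (x ⬝ᵥ y) ^ 2 ≤ (x ⬝ᵥ x) * (y ⬝ᵥ y) := by
  have := Finset.sum_mul_sq_le_sq_mul_sq Finset.univ x y
  simpa [dotProduct, sq] using this

lemma two_dot_le (x y : Fin n → ℝ) {c : ℝ} (hc : 0 < c) :
    2 * (x ⬝ᵥ y) ≤ c * (x ⬝ᵥ x) + c⁻¹ * (y ⬝ᵥ y) := by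
  have h := dot_self_nonneg (c • x - y)
  have e : (c • x - y) ⬝ᵥ (c • x - y) = c ^ 2 * (x ⬝ᵥ x) - 2 * c * (x ⬝ᵥ y) + y ⬝ᵥ y := by
    simp only [sub_dotProduct, dotProduct_sub, smul_dotProduct, dotProduct_smul, smul_eq_mul]
    rw [dotProduct_comm y x]; ring
  rw [e] at h
  have h2 : 0 ≤ c⁻¹ * (c ^ 2 * (x ⬝ᵥ x) - 2 * c * (x ⬝ᵥ y) + y ⬝ᵥ y) := by positivity
  have h3 : c⁻¹ * (c ^ 2 * (x ⬝ᵥ x) - 2 * c * (x ⬝ᵥ y) + y ⬝ᵥ y) =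
      c * (x ⬝ᵥ x) + c⁻¹ * (y ⬝ᵥ y) - 2 * (x ⬝ᵥ y) := by field_simp; ring
  linarith

lemma dot_add_self_le (x y : Fin n → ℝ) : (x + y) ⬝ᵥ (x + y) ≤ 2 * (x ⬝ᵥ x) + 2 * (y ⬝ᵥ y) := by
  have h := two_dot_le x y one_pos
  simp only [add_dotProduct, dotProduct_add]
  rw [dotProduct_comm y x]; linarith

lemma dot_sub_self_le (x y : Fin n → ℝ) : (x - y) ⬝ᵥ (x - y) ≤ 2 * (x ⬝ᵥ x) + 2 * (y ⬝ᵥ y) := by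
  simpa [sub_eq_add_neg] using dot_add_self_le x (-y)

lemma mulVec_dot_self_le (M : Matrix (Fin m) (Fin n) ℝ) (x : Fin n → ℝ) :
    (M *ᵥ x) ⬝ᵥ (M *ᵥ x) ≤ ‖M‖ ^ 2 * (x ⬝ᵥ x) := by
  have h := Matrix.l2_opNorm_mulVec M (WithLp.toLp 2 x)
  have h2 : ‖(WithLp.toLp 2 (M *ᵥ x) : EuclideanSpace ℝ (Fin m))‖ ≤
      ‖M‖ * ‖(WithLp.toLp 2 x : EuclideanSpace ℝ (Fin n))‖ := h
  rw [← norm_toLp_sq, ← norm_toLp_sq, ← mul_pow]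
  exact pow_le_pow_left₀ (norm_nonneg _) h2 2

lemma norm_le_of_mulVec {M : Matrix (Fin m) (Fin n) ℝ} {c : ℝ} (hc : 0 ≤ c)
    (h : ∀ x, (M *ᵥ x) ⬝ᵥ (M *ᵥ x) ≤ c ^ 2 * (x ⬝ᵥ x)) : ‖M‖ ≤ c := by
  rw [Matrix.l2_opNorm_def]
  refine ContinuousLinearMap.opNorm_le_bound _ hc fun x => ?_
  have h1 := h x.ofLp
  rw [← norm_toLp_sq, ← norm_toLp_sq, ← mul_pow] at h1
  exact le_of_sq_le_sq h1 (by positivity)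
where
  le_of_sq_le_sq {a b : ℝ} (h : a ^ 2 ≤ b ^ 2) (hb : 0 ≤ b) : a ≤ b :=
    abs_le_of_sq_le_sq' h hb |>.2

lemma norm_transpose_le (M : Matrix (Fin m) (Fin n) ℝ) : ‖Mᵀ‖ = ‖M‖ := by
  have := Matrix.l2_opNorm_conjTranspose M
  rwa [Matrix.conjTranspose_eq_transpose_of_trivial] at this

lemma norm_mul_le' (M : Matrix (Fin m) (Fin n) ℝ) (N : Matrix (Fin n) (Fin l) ℝ) :
    ‖M * N‖ ≤ ‖M‖ * ‖N‖ := Matrix.l2_opNorm_mul M N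

lemma norm_mul₃_le (M : Matrix (Fin m) (Fin n) ℝ) (N : Matrix (Fin n) (Fin n) ℝ)
    (O : Matrix (Fin n) (Fin l) ℝ) {a b c : ℝ} (ha : ‖M‖ ≤ a) (hb : ‖N‖ ≤ b) (hc : ‖O‖ ≤ c) :
    ‖M * N * O‖ ≤ a * b * c := by
  have h0 : 0 ≤ ‖M‖ := norm_nonneg _
  have h1 : 0 ≤ ‖N‖ := norm_nonneg _
  calc ‖M * N * O‖ ≤ ‖M * N‖ * ‖O‖ := norm_mul_le' _ _
    _ ≤ ‖M‖ * ‖N‖ * ‖O‖ := by gcongr; exact norm_mul_le' _ _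
    _ ≤ a * b * c := by
      have := h0.trans ha; have := h1.trans hb
      gcongr

lemma dot_transpose_mulVec (M : Matrix (Fin m) (Fin n) ℝ) (x : Fin n → ℝ) (y : Fin m → ℝ) :
    x ⬝ᵥ Mᵀ *ᵥ y = (M *ᵥ x) ⬝ᵥ y := by
  rw [Matrix.dotProduct_transpose_mulVec, dotProduct_comm]

lemma dot_symm {M : Matrix (Fin n) (Fin n) ℝ} (hM : Mᵀ = M) (x y : Fin n → ℝ) :
    x ⬝ᵥ M *ᵥ y = y ⬝ᵥ M *ᵥ x := by
  conv_lhs => rw [← hM]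
  exact Matrix.dotProduct_transpose_mulVec M x y

lemma abs_dot_mulVec_le (M : Matrix (Fin m) (Fin n) ℝ) (x : Fin m → ℝ) (y : Fin n → ℝ) :
    2 * |x ⬝ᵥ M *ᵥ y| ≤ ‖M‖ * (x ⬝ᵥ x + y ⬝ᵥ y) := by
  have h1 := (dot_sq_le x (M *ᵥ y)).trans
    (mul_le_mul_of_nonneg_left (mulVec_dot_self_le M y) (dot_self_nonneg x))
  have hx := dot_self_nonneg x
  have hy := dot_self_nonneg y
  have hM := norm_nonneg M
  have : (2 * |x ⬝ᵥ M *ᵥ y|) ^ 2 ≤ (‖M‖ * (x ⬝ᵥ x + y ⬝ᵥ y)) ^ 2 := by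
    rw [mul_pow, sq_abs, mul_pow]
    nlinarith [mul_nonneg (sq_nonneg ‖M‖) (sq_nonneg (x ⬝ᵥ x - y ⬝ᵥ y))]
  exact (abs_le_of_sq_le_sq' this (by positivity)).2

lemma qf_le_norm (M : Matrix (Fin n) (Fin n) ℝ) (x : Fin n → ℝ) : qf M x ≤ ‖M‖ * (x ⬝ᵥ x) := by
  have h := abs_dot_mulVec_le M x x
  have := le_abs_self (qf M x)
  unfold qf at *
  linarith

lemma qf_add (M : Matrix (Fin n) (Fin n) ℝ) (hM : Mᵀ = M) (x y : Fin n → ℝ) :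
    qf M (x + y) = qf M x + 2 * (x ⬝ᵥ M *ᵥ y) + qf M y := by
  simp only [qf, Matrix.mulVec_add, add_dotProduct, dotProduct_add, dot_symm hM y x]; ring

lemma qf_smul (M : Matrix (Fin n) (Fin n) ℝ) (c : ℝ) (x : Fin n → ℝ) :
    qf M (c • x) = c ^ 2 * qf M x := by
  simp only [qf, Matrix.mulVec_smul, smul_dotProduct, dotProduct_smul, smul_eq_mul]; ring

lemma qf_neg (M : Matrix (Fin n) (Fin n) ℝ) (x : Fin n → ℝ) : qf M (-x) = qf M x := by
  simpa using qf_smul M (-1) x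

@[simp] lemma qf_zero (M : Matrix (Fin n) (Fin n) ℝ) : qf M 0 = 0 := by simp [qf]

lemma qf_add_left (M N : Matrix (Fin n) (Fin n) ℝ) (x : Fin n → ℝ) :
    qf (M + N) x = qf M x + qf N x := by simp [qf, Matrix.add_mulVec]

lemma qf_sub_left (M N : Matrix (Fin n) (Fin n) ℝ) (x : Fin n → ℝ) :
    qf (M - N) x = qf M x - qf N x := by simp [qf, Matrix.sub_mulVec]

lemma qf_smul_left (c : ℝ) (M : Matrix (Fin n) (Fin n) ℝ) (x : Fin n → ℝ) :
    qf (c • M) x = c * qf M x := by simp [qf, Matrix.smul_mulVec]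

lemma qf_conj (M : Matrix (Fin m) (Fin m) ℝ) (F : Matrix (Fin m) (Fin n) ℝ) (x : Fin n → ℝ) :
    qf (Fᵀ * M * F) x = qf M (F *ᵥ x) := by
  simp only [qf, ← Matrix.mulVec_mulVec]
  exact dot_transpose_mulVec F x _

/-- Symmetric with nonnegative quadratic form. -/
def PSD (M : Matrix (Fin n) (Fin n) ℝ) : Prop := Mᵀ = M ∧ ∀ x, 0 ≤ qf M x

lemma PSD.posSemidef {M : Matrix (Fin n) (Fin n) ℝ} (h : PSD M) : M.PosSemidef :=
  .of_dotProduct_mulVec_nonneg (by rw [Matrix.IsHermitian, Matrix.conjTranspose_eq_transpose_of_trivial, h.1])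
    fun x => by simpa [qf] using h.2 x

lemma transpose_eq_of_posDef {M : Matrix (Fin n) (Fin n) ℝ} (h : M.PosDef) : Mᵀ = M := by
  have := h.1
  rwa [Matrix.IsHermitian, Matrix.conjTranspose_eq_transpose_of_trivial] at this

lemma psd_of_posDef {M : Matrix (Fin n) (Fin n) ℝ} (h : M.PosDef) : PSD M :=
  ⟨transpose_eq_of_posDef h, fun x => by simpa [qf] using h.posSemidef.dotProduct_mulVec_nonneg x⟩

lemma posDef_of_le {M : Matrix (Fin n) (Fin n) ℝ} (h : Mᵀ = M) {a : ℝ} (ha : 0 < a)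
    (h2 : ∀ x, a * (x ⬝ᵥ x) ≤ qf M x) : M.PosDef :=
  .of_dotProduct_mulVec_pos (by rw [Matrix.IsHermitian, Matrix.conjTranspose_eq_transpose_of_trivial, h])
    fun x hx => by
      have := h2 x
      have h3 := mul_pos ha (dot_self_pos hx)
      simp only [star_trivial]; exact h3.trans_le this

lemma PSD.two_dot_le {M : Matrix (Fin n) (Fin n) ℝ} (h : PSD M) (x y : Fin n → ℝ) {c : ℝ} (hc : 0 < c) :
    2 * (x ⬝ᵥ M *ᵥ y) ≤ c * qf M x + c⁻¹ * qf M y := by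
  have h0 := h.2 (c • x + -y)
  rw [qf_add M h.1, qf_smul, qf_neg, Matrix.mulVec_neg, dotProduct_neg, smul_dotProduct, smul_eq_mul] at h0
  have h2 : 0 ≤ c⁻¹ * (c ^ 2 * qf M x + 2 * -(c * x ⬝ᵥ M *ᵥ y) + qf M y) := by positivity
  have h3 : c⁻¹ * (c ^ 2 * qf M x + 2 * -(c * x ⬝ᵥ M *ᵥ y) + qf M y) =
      c * qf M x + c⁻¹ * qf M y - 2 * (x ⬝ᵥ M *ᵥ y) := by field_simp; ring
  linarith

lemma PSD.qf_add_le {M : Matrix (Fin n) (Fin n) ℝ} (h : PSD M) (x y : Fin n → ℝ) {c : ℝ} (hc : 0 < c) :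
    qf M (x + y) ≤ (1 + c) * qf M x + (1 + c⁻¹) * qf M y := by
  rw [qf_add M h.1]; have := h.two_dot_le x y hc; linarith

lemma PSD.dot_sq_le {M : Matrix (Fin n) (Fin n) ℝ} (h : PSD M) (x y : Fin n → ℝ) :
    (x ⬝ᵥ M *ᵥ y) ^ 2 ≤ qf M x * qf M y := by
  have key : ∀ t : ℝ, 0 ≤ qf M x * (t * t) + (2 * (x ⬝ᵥ M *ᵥ y)) * t + qf M y := fun t => by
    have := h.2 (t • x + y)
    rw [qf_add M h.1, qf_smul, smul_dotProduct, smul_eq_mul] at this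
    linarith
  have := discrim_le_zero key
  rw [discrim] at this
  nlinarith

/-- Polarization: comparing the form at x + z and x − z bounds z·Mx, and z = e⁻¹Mx with e slightly
above c turns this into a bound on ‖Mx‖. Working with e > c avoids dividing by c when c = 0. -/
lemma norm_le_of_abs_qf_le {M : Matrix (Fin n) (Fin n) ℝ} (hM : Mᵀ = M) {c : ℝ} (hc : 0 ≤ c)
    (h : ∀ x, |qf M x| ≤ c * (x ⬝ᵥ x)) : ‖M‖ ≤ c := by
  refine le_of_forall_gt_imp_ge_of_dense fun e he => norm_le_of_mulVec (hc.trans he.le) fun x => ?_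
  have he0 : 0 < e := hc.trans_lt he
  set y := M *ᵥ x with hy
  have key : ∀ z, 4 * (z ⬝ᵥ y) ≤ 2 * c * (x ⬝ᵥ x) + 2 * c * (z ⬝ᵥ z) := fun z => by
    have h1 := (abs_le.1 (h (x + z))).2
    have h2 := (abs_le.1 (h (x + -z))).1
    rw [qf_add M hM] at h1 h2
    rw [qf_neg, Matrix.mulVec_neg, dotProduct_neg] at h2
    rw [dot_symm hM] at h1 h2
    simp only [add_dotProduct, dotProduct_add, neg_dotProduct, dotProduct_neg] at h1 h2
    linarith
  have h3 := key (e⁻¹ • y)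
  simp only [smul_dotProduct, dotProduct_smul, smul_eq_mul] at h3
  have hyy := dot_self_nonneg y
  have hxx := dot_self_nonneg x
  have h4 : 2 * c * (e⁻¹ * (e⁻¹ * (y ⬝ᵥ y))) ≤ 2 * e * (e⁻¹ * (e⁻¹ * (y ⬝ᵥ y))) := by gcongr
  have h5 : 2 * e * (e⁻¹ * (e⁻¹ * (y ⬝ᵥ y))) = 2 * (e⁻¹ * (y ⬝ᵥ y)) := by field_simp
  have h6 : 2 * c * (x ⬝ᵥ x) ≤ 2 * e * (x ⬝ᵥ x) := by gcongr
  have h7 : e⁻¹ * (y ⬝ᵥ y) ≤ e * (x ⬝ᵥ x) := by linarith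
  have h8 : y ⬝ᵥ y = e * (e⁻¹ * (y ⬝ᵥ y)) := by field_simp
  rw [h8, sq, mul_assoc]; gcongr

/-- Cauchy–Schwarz for the form of M, applied to M⁻¹x and x, reads (x·x)² ≤ (xᵀM⁻¹x)(xᵀMx); the
first factor is at most a⁻¹(x·x). -/
lemma qf_ge_of_norm_inv_le {M : Matrix (Fin n) (Fin n) ℝ} (hM : M.PosDef) {a : ℝ} (ha : 0 < a)
    (h : ‖M⁻¹‖ ≤ a⁻¹) (x : Fin n → ℝ) : a * (x ⬝ᵥ x) ≤ qf M x := by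
  have hu : IsUnit M.det := (Matrix.isUnit_iff_isUnit_det _).1 hM.isUnit
  have h1 := (psd_of_posDef hM).dot_sq_le (M⁻¹ *ᵥ x) x
  have hs := transpose_eq_of_posDef hM
  have e1 : (M⁻¹ *ᵥ x) ⬝ᵥ M *ᵥ x = x ⬝ᵥ x := by
    rw [dot_symm hs, Matrix.mulVec_mulVec, Matrix.mul_nonsing_inv _ hu, Matrix.one_mulVec]
  have e2 : qf M (M⁻¹ *ᵥ x) = qf M⁻¹ x := by
    rw [qf, Matrix.mulVec_mulVec, Matrix.mul_nonsing_inv _ hu, Matrix.one_mulVec, dotProduct_comm, qf]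
  rw [e1, e2] at h1
  have h2 := (qf_le_norm M⁻¹ x).trans (mul_le_mul_of_nonneg_right h (dot_self_nonneg x))
  have h3 := (psd_of_posDef hM).2 x
  rcases eq_or_ne x 0 with rfl | hx
  · simp
  have hp := dot_self_pos hx
  have h4 : (x ⬝ᵥ x) ^ 2 ≤ a⁻¹ * (x ⬝ᵥ x) * qf M x := h1.trans (by gcongr)
  have h5 : a * (x ⬝ᵥ x) * (x ⬝ᵥ x) ≤ qf M x * (x ⬝ᵥ x) := by
    calc a * (x ⬝ᵥ x) * (x ⬝ᵥ x) = a * (x ⬝ᵥ x) ^ 2 := by ring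
      _ ≤ a * (a⁻¹ * (x ⬝ᵥ x) * qf M x) := by gcongr
      _ = _ := by field_simp
  exact le_of_mul_le_mul_right h5 hp

/-- Linear systems with a coercive matrix are solved with norm control. This is used for the gain
equation, with the Hessian, and for the normal equations, with the Gram matrix. -/
lemma norm_le_of_mul_eq {M : Matrix (Fin n) (Fin n) ℝ} {Y N : Matrix (Fin n) (Fin m) ℝ} {a c : ℝ}
    (ha : 0 < a) (hM : ∀ x, a * (x ⬝ᵥ x) ≤ qf M x) (h : M * Y = N) (hN : ‖N‖ ≤ c) :
    ‖Y‖ ≤ a⁻¹ * c := by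
  have hc := (norm_nonneg N).trans hN
  refine norm_le_of_mulVec (by positivity) fun x => ?_
  have h1 := hM (Y *ᵥ x)
  rw [qf, Matrix.mulVec_mulVec, h] at h1
  have h2 := two_dot_le (Y *ᵥ x) (N *ᵥ x) ha
  have h3 := mulVec_dot_self_le N x
  have h4 : ‖N‖ ^ 2 * (x ⬝ᵥ x) ≤ c ^ 2 * (x ⬝ᵥ x) := by
    have := dot_self_nonneg x
    gcongr
  have h5 : a * ((Y *ᵥ x) ⬝ᵥ (Y *ᵥ x)) ≤ a⁻¹ * (c ^ 2 * (x ⬝ᵥ x)) := by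
    have := mul_le_mul_of_nonneg_left (h3.trans h4) (inv_pos.2 ha).le
    linarith
  calc _ = a⁻¹ * (a * ((Y *ᵥ x) ⬝ᵥ (Y *ᵥ x))) := by field_simp
    _ ≤ a⁻¹ * (a⁻¹ * (c ^ 2 * (x ⬝ᵥ x))) := by gcongr
    _ = _ := by ring

lemma trace_nonneg_of_qf {M : Matrix (Fin n) (Fin n) ℝ} (h : ∀ x, 0 ≤ qf M x) : 0 ≤ M.trace :=
  Finset.sum_nonneg fun i _ => by
    have := h (Pi.single i 1)
    simpa [qf] using this

lemma trace_mono {M N : Matrix (Fin n) (Fin n) ℝ} (h : ∀ x, qf M x ≤ qf N x) : M.trace ≤ N.trace := by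
  have := trace_nonneg_of_qf (M := N - M) fun x => by rw [qf_sub_left]; linarith [h x]
  rw [Matrix.trace_sub] at this; linarith

lemma eq_of_qf_le_of_trace_le {M N : Matrix (Fin n) (Fin n) ℝ} (hM : Mᵀ = M) (hN : Nᵀ = N)
    (h : ∀ x, qf M x ≤ qf N x) (ht : N.trace ≤ M.trace) : M = N := by
  have hp : PSD (N - M) := ⟨by rw [Matrix.transpose_sub, hM, hN], fun x => by
    rw [qf_sub_left]; linarith [h x]⟩
  have h0 : (N - M).trace = 0 := by rw [Matrix.trace_sub]; linarith [trace_mono h]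
  have := hp.posSemidef.trace_eq_zero_iff.1 h0
  exact (sub_eq_zero.1 this).symm

/-- The 2×2 minors give |M i j|² ≤ M i i · M j j, hence |x i M i j x j| is at most the average of x
i² M j j and x j² M i i; summing gives the trace. No spectral theorem is involved. -/
lemma PSD.qf_le_trace {M : Matrix (Fin n) (Fin n) ℝ} (h : PSD M) (x : Fin n → ℝ) :
    qf M x ≤ M.trace * (x ⬝ᵥ x) := by
  have hd : ∀ i, qf M (Pi.single i 1) = M i i := fun i => by simp [qf]
  have he : ∀ i j, (Pi.single i 1 : Fin n → ℝ) ⬝ᵥ M *ᵥ Pi.single j 1 = M i j := fun i j => by simp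
  have hij : ∀ i j, x i * M i j * x j ≤ (x i ^ 2 * M j j + x j ^ 2 * M i i) / 2 := fun i j => by
    have h1 := h.dot_sq_le (Pi.single i 1) (Pi.single j 1)
    have h2 := h.2 (Pi.single i 1)
    have h3 := h.2 (Pi.single j 1)
    rw [he, hd, hd] at h1
    rw [hd] at h2 h3
    have : (2 * (x i * M i j * x j)) ^ 2 ≤ (x i ^ 2 * M j j + x j ^ 2 * M i i) ^ 2 := by
      have := mul_le_mul_of_nonneg_left h1 (by positivity : 0 ≤ 4 * (x i * x j) ^ 2)
      nlinarith [sq_nonneg (x i ^ 2 * M j j - x j ^ 2 * M i i)]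
    have := (abs_le_of_sq_le_sq' this (by positivity)).2
    linarith
  calc qf M x = ∑ i, ∑ j, x i * M i j * x j := by
        simp only [qf, dotProduct, Matrix.mulVec, Finset.mul_sum, mul_assoc]
    _ ≤ ∑ i, ∑ j, (x i ^ 2 * M j j + x j ^ 2 * M i i) / 2 :=
        Finset.sum_le_sum fun i _ => Finset.sum_le_sum fun j _ => hij i j
    _ = M.trace * (x ⬝ᵥ x) := by
        have e1 : ∑ i, ∑ j, x i ^ 2 * M j j = M.trace * (x ⬝ᵥ x) := by
          simp only [← Finset.mul_sum, ← Finset.sum_mul, Matrix.trace, Matrix.diag, dotProduct, sq]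
          ring
        have e2 : ∑ i, ∑ j, x j ^ 2 * M i i = M.trace * (x ⬝ᵥ x) := by
          rw [Finset.sum_comm]; exact e1
        simp only [← Finset.sum_div, Finset.sum_add_distrib, e1, e2]; ring

end QuadraticForms


/-! ### The Riccati operator -/

section Riccati

variable {d k : ℕ} {A A' : Matrix (Fin d) (Fin d) ℝ} {B B' : Matrix (Fin d) (Fin k) ℝ}
  {Q : Matrix (Fin d) (Fin d) ℝ} {R : Matrix (Fin k) (Fin k) ℝ}
  {P X Y : Matrix (Fin d) (Fin d) ℝ} {K : Matrix (Fin k) (Fin d) ℝ}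

/-- The Hessian `R + BᵀPB` of the one-step cost in the action. -/
def hess (B : Matrix (Fin d) (Fin k) ℝ) (R : Matrix (Fin k) (Fin k) ℝ)
    (P : Matrix (Fin d) (Fin d) ℝ) : Matrix (Fin k) (Fin k) ℝ := R + Bᵀ * P * B

/-- The gain that minimizes the one-step cost with terminal cost `P`. -/
def gain (A : Matrix (Fin d) (Fin d) ℝ) (B : Matrix (Fin d) (Fin k) ℝ)
    (R : Matrix (Fin k) (Fin k) ℝ) (P : Matrix (Fin d) (Fin d) ℝ) : Matrix (Fin k) (Fin d) ℝ :=
  -((R + Bᵀ * P * B)⁻¹ * Bᵀ * P * A)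

/-- The Riccati operator. -/
def ric (A : Matrix (Fin d) (Fin d) ℝ) (B : Matrix (Fin d) (Fin k) ℝ)
    (Q : Matrix (Fin d) (Fin d) ℝ) (R : Matrix (Fin k) (Fin k) ℝ)
    (P : Matrix (Fin d) (Fin d) ℝ) : Matrix (Fin d) (Fin d) ℝ :=
  Q + Aᵀ * P * A - Aᵀ * P * B * (R + Bᵀ * P * B)⁻¹ * Bᵀ * P * A

lemma qf_hess (x : Fin k → ℝ) : qf (hess B R P) x = qf R x + qf P (B *ᵥ x) := by
  rw [hess, qf_add_left, qf_conj]

lemma hess_transpose (hR : Rᵀ = R) (hP : Pᵀ = P) : (hess B R P)ᵀ = hess B R P := by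
  simp [hess, Matrix.transpose_mul, hR, hP, Matrix.mul_assoc]

lemma hess_posDef (hR : R.PosDef) (hP : PSD P) : (hess B R P).PosDef :=
  .of_dotProduct_mulVec_pos (by
      rw [Matrix.IsHermitian, Matrix.conjTranspose_eq_transpose_of_trivial,
        hess_transpose (transpose_eq_of_posDef hR) hP.1])
    fun x hx => by
      have h1 := hR.dotProduct_mulVec_pos hx
      have h2 := hP.2 (B *ᵥ x)
      have h3 := qf_hess (B := B) (R := R) (P := P) x
      simp only [qf, star_trivial] at *
      linarith

lemma hess_det_isUnit (hR : R.PosDef) (hP : PSD P) : IsUnit (hess B R P).det :=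
  (Matrix.isUnit_iff_isUnit_det _).1 (hess_posDef hR hP).isUnit

lemma hess_mul_gain (hR : R.PosDef) (hP : PSD P) :
    hess B R P * gain A B R P = -(Bᵀ * P * A) := by
  have hu := hess_det_isUnit (B := B) hR hP
  rw [gain, ← hess, Matrix.mul_neg, Matrix.mul_assoc (hess B R P)⁻¹, Matrix.mul_assoc (hess B R P)⁻¹,
    ← Matrix.mul_assoc, Matrix.mul_nonsing_inv _ hu, Matrix.one_mul]

lemma ric_transpose (hQ : Qᵀ = Q) (hR : Rᵀ = R) (hP : Pᵀ = P) : (ric A B Q R P)ᵀ = ric A B Q R P := by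
  simp only [ric, Matrix.transpose_sub, Matrix.transpose_add, Matrix.transpose_mul,
    Matrix.transpose_transpose, Matrix.transpose_nonsing_inv, hQ, hR, hP, Matrix.mul_assoc]

/-- Completing the square in the one-step cost. -/
lemma complete_square (hR : R.PosDef) (hP : PSD P) (x : Fin d → ℝ) (u : Fin k → ℝ) :
    qf Q x + qf R u + qf P (A *ᵥ x + B *ᵥ u) =
      qf (ric A B Q R P) x + qf (hess B R P) (u - gain A B R P *ᵥ x) := by
  set G := gain A B R P with hG
  have hM := hess_transpose (B := B) (transpose_eq_of_posDef hR) hP.1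
  have hMG : hess B R P * G = -(Bᵀ * P * A) := hess_mul_gain hR hP
  have h1 : ric A B Q R P = Q + Aᵀ * P * A + Aᵀ * P * B * G := by
    rw [ric, hG, gain]; simp only [Matrix.mul_neg, Matrix.mul_assoc, sub_eq_add_neg]
  have hsub : u - G *ᵥ x = u + -(G *ᵥ x) := sub_eq_add_neg _ _
  have h2 : (u ⬝ᵥ hess B R P *ᵥ (G *ᵥ x)) = -((B *ᵥ u) ⬝ᵥ P *ᵥ (A *ᵥ x)) := by
    rw [Matrix.mulVec_mulVec, hMG, Matrix.neg_mulVec, dotProduct_neg, ← Matrix.mulVec_mulVec,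
      ← Matrix.mulVec_mulVec, dot_transpose_mulVec]
  have h3 : qf (hess B R P) (G *ᵥ x) = -((A *ᵥ x) ⬝ᵥ P *ᵥ (B *ᵥ (G *ᵥ x))) := by
    rw [qf, Matrix.mulVec_mulVec, hMG, Matrix.neg_mulVec, dotProduct_neg, ← Matrix.mulVec_mulVec,
      ← Matrix.mulVec_mulVec, dot_transpose_mulVec, dot_symm hP.1]
  have h4 : qf (Aᵀ * P * B * G) x = (A *ᵥ x) ⬝ᵥ P *ᵥ (B *ᵥ (G *ᵥ x)) := by
    rw [qf, ← Matrix.mulVec_mulVec, ← Matrix.mulVec_mulVec, ← Matrix.mulVec_mulVec, dot_transpose_mulVec]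
  rw [hsub, qf_add _ hM, qf_neg, Matrix.mulVec_neg, dotProduct_neg, h2, h3, h1, qf_add_left, qf_add_left,
    qf_conj, h4, qf_hess, qf_add _ hP.1, dot_symm hP.1 (A *ᵥ x)]
  ring

lemma ric_le (hR : R.PosDef) (hP : PSD P) (x : Fin d → ℝ) (u : Fin k → ℝ) :
    qf (ric A B Q R P) x ≤ qf Q x + qf R u + qf P (A *ᵥ x + B *ᵥ u) := by
  rw [complete_square hR hP]
  linarith [(psd_of_posDef (hess_posDef (B := B) hR hP)).2 (u - gain A B R P *ᵥ x)]

lemma ric_eq (hR : R.PosDef) (hP : PSD P) (x : Fin d → ℝ) :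
    qf (ric A B Q R P) x = qf Q x + qf R (gain A B R P *ᵥ x) +
      qf P (A *ᵥ x + B *ᵥ (gain A B R P *ᵥ x)) := by
  rw [complete_square hR hP]; simp

/-- The Riccati operator is a minimum over actions of a cost monotone in the terminal matrix: use
the minimizing action for `Y` as a competitor for `X`. -/
lemma ric_mono (hR : R.PosDef) (hX : PSD X) (hY : PSD Y) (h : ∀ x, qf X x ≤ qf Y x) (x : Fin d → ℝ) :
    qf (ric A B Q R X) x ≤ qf (ric A B Q R Y) x := by
  rw [ric_eq hR hY]
  exact (ric_le hR hX x _).trans (by gcongr; exact h _)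

/-- `Y` bounds the cost-to-go of the controller `K`. -/
def IsSuper (A : Matrix (Fin d) (Fin d) ℝ) (B : Matrix (Fin d) (Fin k) ℝ)
    (Q : Matrix (Fin d) (Fin d) ℝ) (R : Matrix (Fin k) (Fin k) ℝ) (K : Matrix (Fin k) (Fin d) ℝ)
    (Y : Matrix (Fin d) (Fin d) ℝ) : Prop :=
  PSD Y ∧ ∀ x, qf Q x + qf R (K *ᵥ x) + qf Y (A *ᵥ x + B *ᵥ (K *ᵥ x)) ≤ qf Y x

lemma IsRiccatiSol.isSuper (hR : R.PosDef) (h : IsRiccatiSol A B Q R P) :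
    IsSuper A B Q R (gain A B R P) P :=
  ⟨psd_of_posDef h.1, fun x => by
    rw [← ric_eq hR (psd_of_posDef h.1), ric, ← h.2]⟩

/-- A Riccati solution lies below every supersolution. -/
lemma IsRiccatiSol.le_of_isSuper {a : ℝ} (ha : 0 < a) (hQ : ∀ x, a * (x ⬝ᵥ x) ≤ qf Q x)
    (hR : R.PosDef) (h : IsRiccatiSol A B Q R P) (hY : IsSuper A B Q R K Y) (x : Fin d → ℝ) :
    qf P x ≤ qf Y x := by
  have hP := psd_of_posDef h.1
  let F : (Fin d → ℝ) → Fin d → ℝ := fun x => A *ᵥ x + B *ᵥ (K *ᵥ x)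
  -- Along the closed loop of `K` the gap between `Y` and `P` does not increase: `Y` loses at least
  -- the step cost, while `P`, being an optimal cost-to-go, loses at most the step cost.
  have hD : ∀ x, qf Y (F x) - qf P (F x) ≤ qf Y x - qf P x := fun x => by
    have h1 := hY.2 x
    have h2 := ric_le (A := A) (B := B) (Q := Q) hR hP x (K *ᵥ x)
    rw [ric, ← h.2] at h2
    simp only [F]; linarith
  have hD' : ∀ n, qf Y (F^[n] x) - qf P (F^[n] x) ≤ qf Y x - qf P x := fun n => by
    induction n with
    | zero => simp
    | succ n ih => rw [Function.iterate_succ_apply']; exact (hD _).trans ih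
  have hsum : ∀ n, ∑ i ∈ Finset.range n, a * (F^[i] x ⬝ᵥ F^[i] x) + qf Y (F^[n] x) ≤ qf Y x := fun n => by
    induction n with
    | zero => simp
    | succ n ih =>
      rw [Finset.sum_range_succ, Function.iterate_succ_apply']
      have h1 := hY.2 (F^[n] x)
      have h2 := hQ (F^[n] x)
      have h3 := (psd_of_posDef hR).2 (K *ᵥ F^[n] x)
      simp only [F] at *; linarith
  -- The total cost of the orbit is bounded by `qf Y x`, and `Q` is coercive, so the orbit is square
  -- summable and tends to 0. The gap is therefore at least −‖P‖‖F^i x‖² → 0.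
  have hs : Summable fun i => a * (F^[i] x ⬝ᵥ F^[i] x) :=
    summable_of_sum_range_le (c := qf Y x) (fun i => mul_nonneg ha.le (dot_self_nonneg _)) fun n => by
      linarith [hsum n, hY.1.2 (F^[n] x)]
  have ht := hs.tendsto_atTop_zero
  have ht2 : Tendsto (fun i => -(‖P‖ * a⁻¹ * (a * (F^[i] x ⬝ᵥ F^[i] x)))) atTop (nhds 0) := by
    simpa using (ht.const_mul (‖P‖ * a⁻¹)).neg
  have : 0 ≤ qf Y x - qf P x := by
    refine le_of_tendsto' ht2 fun i => ?_
    have h1 := hD' i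
    have h2 := qf_le_norm P (F^[i] x)
    have h3 := hY.1.2 (F^[i] x)
    have h4 : ‖P‖ * a⁻¹ * (a * (F^[i] x ⬝ᵥ F^[i] x)) = ‖P‖ * (F^[i] x ⬝ᵥ F^[i] x) := by field_simp
    rw [h4]; linarith
  linarith

lemma eq_of_qf_eq {M N : Matrix (Fin d) (Fin d) ℝ} (hM : Mᵀ = M) (hN : Nᵀ = N)
    (h : ∀ x, qf M x = qf N x) : M = N :=
  eq_of_qf_le_of_trace_le hM hN (fun x => (h x).le) (trace_mono fun x => (h x).ge)

lemma IsRiccatiSol.unique {a : ℝ} (ha : 0 < a) (hQ : ∀ x, a * (x ⬝ᵥ x) ≤ qf Q x)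
    (hR : R.PosDef) (h : IsRiccatiSol A B Q R P) (h' : IsRiccatiSol A B Q R X) : P = X :=
  eq_of_qf_eq (psd_of_posDef h.1).1 (psd_of_posDef h'.1).1 fun x =>
    le_antisymm (h.le_of_isSuper ha hQ hR (h'.isSuper hR) x) (h'.le_of_isSuper ha hQ hR (h.isSuper hR) x)

lemma optController_eq {a : ℝ} (ha : 0 < a) (hQ : ∀ x, a * (x ⬝ᵥ x) ≤ qf Q x)
    (hR : R.PosDef) (h : IsRiccatiSol A B Q R P) : optController A B Q R = gain A B R P := by
  have hex : ∃ P, IsRiccatiSol A B Q R P := ⟨P, h⟩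
  rw [optController, dif_pos hex, IsRiccatiSol.unique ha hQ hR hex.choose_spec h, gain]

lemma continuous_qf_left (x : Fin d → ℝ) : Continuous fun M : Matrix (Fin d) (Fin d) ℝ => qf M x := by
  unfold qf; fun_prop

lemma continuousOn_ric (hR : R.PosDef) :
    ContinuousOn (fun X => ric A B Q R X) {X | PSD X} := by
  have h1 : Continuous fun X : Matrix (Fin d) (Fin d) ℝ => R + Bᵀ * X * B := by fun_prop
  have h2 : ContinuousOn (fun X : Matrix (Fin d) (Fin d) ℝ => (R + Bᵀ * X * B)⁻¹) {X | PSD X} := by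
    simp only [Matrix.inv_def, Ring.inverse_eq_inv']
    refine ContinuousOn.smul (ContinuousOn.inv₀ h1.matrix_det.continuousOn fun X hX => ?_)
      h1.matrix_adjugate.continuousOn
    exact (hess_det_isUnit (B := B) hR hX).ne_zero
  unfold ric
  refine ContinuousOn.sub (by fun_prop) ?_
  rw [continuousOn_iff_continuous_domRestrict] at h2 ⊢
  have h3 : Continuous fun X : {X : Matrix (Fin d) (Fin d) ℝ | PSD X} => Aᵀ * (X : Matrix (Fin d) (Fin d) ℝ) * B := by
    fun_prop
  exact (((h3.matrix_mul h2).matrix_mul continuous_const).matrix_mul continuous_subtype_val).matrix_mul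
    continuous_const

/-- The Riccati equation is solvable as soon as there is a supersolution. -/
lemma exists_isRiccatiSol {a : ℝ} (ha : 0 < a) (hQt : Qᵀ = Q) (hQ : ∀ x, a * (x ⬝ᵥ x) ≤ qf Q x)
    (hR : R.PosDef) (hY : IsSuper A B Q R K Y) : ∃ P, IsRiccatiSol A B Q R P := by
  have hQ0 : ∀ x, 0 ≤ qf Q x := fun x => (mul_nonneg ha.le (dot_self_nonneg x)).trans (hQ x)
  have hRn := (psd_of_posDef hR).2
  let C : Set (Matrix (Fin d) (Fin d) ℝ) := {X | Xᵀ = X ∧ (∀ x, qf Q x ≤ qf X x) ∧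
    (∀ x, qf X x ≤ qf Y x)}
  have hCpsd : C ⊆ {X | PSD X} := fun X hX => ⟨hX.1, fun x => (hQ0 x).trans (hX.2.1 x)⟩
  -- Symmetric matrices between `Q` and `Y` that the Riccati operator does not increase. This set is
  -- compact, contains `Y`, and is stable under the operator by monotonicity.
  let D : Set (Matrix (Fin d) (Fin d) ℝ) := {X | X ∈ C ∧ ∀ x, qf (ric A B Q R X) x ≤ qf X x}
  have hCc : IsClosed C := by
    refine IsClosed.inter (isClosed_eq (by fun_prop) continuous_id) (IsClosed.inter ?_ ?_)
    · have : {X : Matrix (Fin d) (Fin d) ℝ | ∀ x, qf Q x ≤ qf X x} = ⋂ x, {X | qf Q x ≤ qf X x} := by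
        ext; simp
      have h2 : IsClosed {X : Matrix (Fin d) (Fin d) ℝ | ∀ x, qf Q x ≤ qf X x} := by
        rw [this]; exact isClosed_iInter fun x => isClosed_le continuous_const (continuous_qf_left x)
      exact h2
    · have : {X : Matrix (Fin d) (Fin d) ℝ | ∀ x, qf X x ≤ qf Y x} = ⋂ x, {X | qf X x ≤ qf Y x} := by
        ext; simp
      have h2 : IsClosed {X : Matrix (Fin d) (Fin d) ℝ | ∀ x, qf X x ≤ qf Y x} := by
        rw [this]; exact isClosed_iInter fun x => isClosed_le (continuous_qf_left x) continuous_const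
      exact h2
  have hCb : Bornology.IsBounded C := by
    refine (Metric.isBounded_closedBall (x := (0 : Matrix (Fin d) (Fin d) ℝ)) (r := ‖Y‖)).subset fun X hX => ?_
    rw [mem_closedBall_zero_iff]
    refine norm_le_of_abs_qf_le hX.1 (norm_nonneg _) fun x => ?_
    rw [abs_of_nonneg ((hCpsd hX).2 x)]
    exact (hX.2.2 x).trans (qf_le_norm Y x)
  have : ProperSpace (Matrix (Fin d) (Fin d) ℝ) := FiniteDimensional.proper ℝ _
  have hDc : IsClosed D := by
    have : D = ⋂ x, {X | X ∈ C ∧ qf (ric A B Q R X) x ≤ qf X x} := by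
      ext X; simp only [D, Set.mem_ofPred_eq, Set.mem_iInter]
      exact ⟨fun h x => ⟨h.1, h.2 x⟩, fun h => ⟨(h 0).1, fun x => (h x).2⟩⟩
    rw [this]
    refine isClosed_iInter fun x => hCc.isClosed_le ?_ (continuous_qf_left x).continuousOn
    exact (continuous_qf_left x).comp_continuousOn ((continuousOn_ric hR).mono hCpsd)
  have hDk : IsCompact D := Metric.isCompact_of_isClosed_isBounded hDc (hCb.subset fun X hX => hX.1)
  have hricY : ∀ x, qf (ric A B Q R Y) x ≤ qf Y x := fun x => (ric_le hR hY.1 x (K *ᵥ x)).trans (hY.2 x)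
  have hYC : Y ∈ C := ⟨hY.1.1, fun x => by
    linarith [hY.2 x, hRn (K *ᵥ x), hY.1.2 (A *ᵥ x + B *ᵥ (K *ᵥ x))], fun x => le_rfl⟩
  have hYD : Y ∈ D := ⟨hYC, hricY⟩
  obtain ⟨X, hX, hmin⟩ := hDk.exists_isMinOn ⟨Y, hYD⟩
    (f := fun X : Matrix (Fin d) (Fin d) ℝ => X.trace) (by fun_prop)
  have hXp := hCpsd hX.1
  have hrt := ric_transpose (A := A) (B := B) hQt (transpose_eq_of_posDef hR) hXp.1
  have hrC : ric A B Q R X ∈ C := ⟨hrt, fun x => by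
    rw [ric_eq hR hXp]; linarith [hRn (gain A B R X *ᵥ x), hXp.2 (A *ᵥ x + B *ᵥ (gain A B R X *ᵥ x))],
    fun x => (hX.2 x).trans (hX.1.2.2 x)⟩
  have hrD : ric A B Q R X ∈ D := ⟨hrC, ric_mono hR (hCpsd hrC) hXp hX.2⟩
  -- At a point of minimal trace, `ric X` lies below `X` and cannot have smaller trace; their
  -- difference is positive semidefinite of trace at most 0, so `X` is a fixed point.
  have heq := eq_of_qf_le_of_trace_le hrt hXp.1 hX.2 (hmin hrD)
  exact ⟨X, posDef_of_le hXp.1 ha fun x => (hQ x).trans (hX.1.2.1 x), heq.symm⟩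

end Riccati


/-! ### Perturbation of the Riccati equation -/

section Perturbation

variable {d k : ℕ} {A A' : Matrix (Fin d) (Fin d) ℝ} {B B' : Matrix (Fin d) (Fin k) ℝ}
  {Q : Matrix (Fin d) (Fin d) ℝ} {R : Matrix (Fin k) (Fin k) ℝ}
  {P P' X Y : Matrix (Fin d) (Fin d) ℝ} {K : Matrix (Fin k) (Fin d) ℝ} {g ε : ℝ}

lemma abs_qf_le_norm (M : Matrix (Fin d) (Fin d) ℝ) (x : Fin d → ℝ) : |qf M x| ≤ ‖M‖ * (x ⬝ᵥ x) := by
  have h := abs_dot_mulVec_le M x x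
  unfold qf; linarith

lemma norm_le_of_qf_le (hP : PSD P) (hg : 0 ≤ g) (h : ∀ x, qf P x ≤ g * (x ⬝ᵥ x)) : ‖P‖ ≤ g :=
  norm_le_of_abs_qf_le hP.1 hg fun x => by rw [abs_of_nonneg (hP.2 x)]; exact h x

lemma mulVec_dot_self_le_of_norm {m n : ℕ} {M : Matrix (Fin m) (Fin n) ℝ} {c : ℝ} (h : ‖M‖ ≤ c)
    (x : Fin n → ℝ) : (M *ᵥ x) ⬝ᵥ (M *ᵥ x) ≤ c ^ 2 * (x ⬝ᵥ x) :=
  (mulVec_dot_self_le M x).trans (by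
    have := dot_self_nonneg x
    have := norm_nonneg M
    gcongr)

/-- Quantitative well-posedness of an LQR problem together with its Riccati solution. -/
structure Bounded (A : Matrix (Fin d) (Fin d) ℝ) (B : Matrix (Fin d) (Fin k) ℝ)
    (Q : Matrix (Fin d) (Fin d) ℝ) (R : Matrix (Fin k) (Fin k) ℝ)
    (P : Matrix (Fin d) (Fin d) ℝ) (g : ℝ) : Prop where
  one_le : 1 ≤ g
  Q_symm : Qᵀ = Q
  R_posDef : R.PosDef
  Q_ge : ∀ x, g⁻¹ * (x ⬝ᵥ x) ≤ qf Q x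
  R_ge : ∀ u, g⁻¹ * (u ⬝ᵥ u) ≤ qf R u
  A_le : ‖A‖ ≤ g
  B_le : ‖B‖ ≤ g
  sol : IsRiccatiSol A B Q R P
  P_le : ∀ x, qf P x ≤ g * (x ⬝ᵥ x)

namespace Bounded

lemma pos (h : Bounded A B Q R P g) : 0 < g := one_pos.trans_le h.one_le

lemma psd (h : Bounded A B Q R P g) : PSD P := psd_of_posDef h.sol.1

lemma P_norm (h : Bounded A B Q R P g) : ‖P‖ ≤ g := norm_le_of_qf_le h.psd h.pos.le h.P_le

lemma step (h : Bounded A B Q R P g) (x : Fin d → ℝ) :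
    qf Q x + qf R (gain A B R P *ᵥ x) + qf P (A *ᵥ x + B *ᵥ (gain A B R P *ᵥ x)) = qf P x := by
  rw [← ric_eq h.R_posDef h.psd, ric, ← h.sol.2]

lemma Q_le_P (h : Bounded A B Q R P g) (x : Fin d → ℝ) : qf Q x ≤ qf P x := by
  rw [← h.step x]
  have h1 := (psd_of_posDef h.R_posDef).2 (gain A B R P *ᵥ x)
  have h2 := h.psd.2 (A *ᵥ x + B *ᵥ (gain A B R P *ᵥ x))
  linarith

lemma P_ge (h : Bounded A B Q R P g) (x : Fin d → ℝ) : g⁻¹ * (x ⬝ᵥ x) ≤ qf P x :=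
  (h.Q_ge x).trans (h.Q_le_P x)

lemma gain_norm (h : Bounded A B Q R P g) : ‖gain A B R P‖ ≤ g := by
  refine norm_le_of_mulVec h.pos.le fun x => ?_
  have h1 := h.step x
  have h2 := h.R_ge (gain A B R P *ᵥ x)
  have h3 := h.psd.2 (A *ᵥ x + B *ᵥ (gain A B R P *ᵥ x))
  have h4 := h.P_le x
  have h5 := (mul_nonneg (inv_pos.2 h.pos).le (dot_self_nonneg x)).trans (h.Q_ge x)
  have h6 : g⁻¹ * ((gain A B R P *ᵥ x) ⬝ᵥ (gain A B R P *ᵥ x)) ≤ g * (x ⬝ᵥ x) := by linarith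
  have hg := h.pos
  calc _ = g * (g⁻¹ * ((gain A B R P *ᵥ x) ⬝ᵥ (gain A B R P *ᵥ x))) := by field_simp
    _ ≤ g * (g * (x ⬝ᵥ x)) := by gcongr
    _ = _ := by ring

lemma hess_ge (h : Bounded A B Q R P g) (u : Fin k → ℝ) : g⁻¹ * (u ⬝ᵥ u) ≤ qf (hess B R P) u := by
  rw [qf_hess]; linarith [h.R_ge u, h.psd.2 (B *ᵥ u)]

/-- A scaled Riccati solution is a supersolution for all nearby systems. -/
lemma isSuper_of_near (h : Bounded A B Q R P g) (hε : 0 ≤ ε) (hε' : 16 * g ^ 3 * ε ≤ 1)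
    (hA : ‖A' - A‖ ≤ ε) (hB : ‖B' - B‖ ≤ ε) :
    IsSuper A' B' Q R (gain A B R P) ((1 + 16 * g ^ 3 * ε) • P) := by
  have hg := h.pos
  have hg1 := h.one_le
  refine ⟨⟨by rw [Matrix.transpose_smul, h.psd.1], fun x => ?_⟩, fun x => ?_⟩
  · rw [qf_smul_left]; exact mul_nonneg (by positivity) (h.psd.2 x)
  rw [qf_smul_left, qf_smul_left]
  set u := gain A B R P *ᵥ x with hu
  set y := A *ᵥ x + B *ᵥ u with hy
  set z := (A' - A) *ᵥ x + (B' - B) *ᵥ u with hz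
  have hyz : A' *ᵥ x + B' *ᵥ u = y + z := by
    rw [hy, hz, Matrix.sub_mulVec, Matrix.sub_mulVec]; abel
  have hxx := dot_self_nonneg x
  have huu : u ⬝ᵥ u ≤ g ^ 2 * (x ⬝ᵥ x) := mulVec_dot_self_le_of_norm h.gain_norm x
  have hz1 : z ⬝ᵥ z ≤ (2 * g * ε) ^ 2 * (x ⬝ᵥ x) := by
    have h1 := dot_add_self_le ((A' - A) *ᵥ x) ((B' - B) *ᵥ u)
    have h2 := mulVec_dot_self_le_of_norm hA x
    have h3 := mulVec_dot_self_le_of_norm hB u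
    have h4 : ε ^ 2 * (u ⬝ᵥ u) ≤ ε ^ 2 * (g ^ 2 * (x ⬝ᵥ x)) := by gcongr
    have h5 : ε ^ 2 * (x ⬝ᵥ x) ≤ ε ^ 2 * (g ^ 2 * (x ⬝ᵥ x)) := by
      have : 1 * (x ⬝ᵥ x) ≤ g ^ 2 * (x ⬝ᵥ x) := by gcongr; nlinarith
      rw [one_mul] at this; gcongr
    have e : z ⬝ᵥ z ≤ 4 * (ε ^ 2 * (g ^ 2 * (x ⬝ᵥ x))) := by rw [hz]; linarith
    linarith [e, (by ring : (2 * g * ε) ^ 2 * (x ⬝ᵥ x) = 4 * (ε ^ 2 * (g ^ 2 * (x ⬝ᵥ x))))]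
  have hstep := h.step x
  rw [← hu, ← hy] at hstep
  have hyP : qf P y ≤ g * (x ⬝ᵥ x) := by
    have h1 := (psd_of_posDef h.R_posDef).2 u
    have h2 := (mul_nonneg (inv_pos.2 hg).le hxx).trans (h.Q_ge x)
    linarith [h.P_le x]
  have hzP : qf P z ≤ g * ((2 * g * ε) ^ 2 * (x ⬝ᵥ x)) := (h.P_le z).trans (by gcongr)
  -- The weight 2gε in Young's inequality balances the size of y against ‖z‖ ≤ 2gε‖x‖. It is not
  -- available for ε = 0, where the term vanishes.
  have hcross : 2 * (y ⬝ᵥ P *ᵥ z) ≤ 4 * g ^ 2 * ε * (x ⬝ᵥ x) := by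
    rcases eq_or_lt_of_le hε with h0 | h0
    · have h1 := h.psd.dot_sq_le y z
      rw [← h0] at hzP
      have h2 : qf P z = 0 := le_antisymm (by simpa using hzP) (h.psd.2 z)
      rw [h2, mul_zero] at h1
      have : y ⬝ᵥ P *ᵥ z = 0 := by nlinarith
      rw [this, ← h0]; simp
    · have h1 := h.psd.two_dot_le y z (c := 2 * g * ε) (by positivity)
      have h2 : (2 * g * ε) * qf P y ≤ (2 * g * ε) * (g * (x ⬝ᵥ x)) := by gcongr
      have h3 : (2 * g * ε)⁻¹ * qf P z ≤ (2 * g * ε)⁻¹ * (g * ((2 * g * ε) ^ 2 * (x ⬝ᵥ x))) := by gcongr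
      have h4 : (2 * g * ε)⁻¹ * (g * ((2 * g * ε) ^ 2 * (x ⬝ᵥ x))) = 2 * g ^ 2 * ε * (x ⬝ᵥ x) := by
        field_simp
      linarith [(by ring : (2 * g * ε) * (g * (x ⬝ᵥ x)) = 2 * g ^ 2 * ε * (x ⬝ᵥ x))]
  have hzP2 : qf P z ≤ 4 * g ^ 2 * ε * (x ⬝ᵥ x) := by
    refine hzP.trans ?_
    have h1 : g * ε ≤ 1 := by
      have h3 : g ≤ g ^ 3 := by nlinarith [sq_nonneg g, mul_pos hg hg]
      have h4 : g * ε ≤ g ^ 3 * ε := by gcongr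
      have h5 : 0 ≤ g ^ 3 * ε := by positivity
      linarith
    have h2 : 4 * g ^ 2 * ε * (x ⬝ᵥ x) * (g * ε) ≤ 4 * g ^ 2 * ε * (x ⬝ᵥ x) * 1 := by gcongr
    linarith [(by ring : g * ((2 * g * ε) ^ 2 * (x ⬝ᵥ x)) = 4 * g ^ 2 * ε * (x ⬝ᵥ x) * (g * ε))]
  rw [hyz, qf_add _ h.psd.1]
  have hQx := h.Q_ge x
  have hRu := (psd_of_posDef h.R_posDef).2 u
  set e := 16 * g ^ 3 * ε with he
  have he0 : 0 ≤ e := by positivity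
  have hb : qf P y + 2 * (y ⬝ᵥ P *ᵥ z) + qf P z ≤ qf P y + 8 * g ^ 2 * ε * (x ⬝ᵥ x) := by linarith
  have h1 : (1 + e) * (qf P y + 2 * (y ⬝ᵥ P *ᵥ z) + qf P z) ≤
      (1 + e) * (qf P y + 8 * g ^ 2 * ε * (x ⬝ᵥ x)) := by gcongr
  have h2 : (1 + e) * (8 * g ^ 2 * ε * (x ⬝ᵥ x)) ≤ 2 * (8 * g ^ 2 * ε * (x ⬝ᵥ x)) := by
    gcongr; linarith
  -- Scaling `P` by 1 + e leaves e times the step cost to spare, which is at least e g⁻¹‖x‖² =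
  -- 16g²ε‖x‖². The perturbation of the next state costs at most (1 + e)·8g²ε‖x‖², and e ≤ 1.
  have h3 : e * (g⁻¹ * (x ⬝ᵥ x)) = 2 * (8 * g ^ 2 * ε * (x ⬝ᵥ x)) := by rw [he]; field_simp; ring
  have h4 : e * (g⁻¹ * (x ⬝ᵥ x)) ≤ e * (qf Q x + qf R u) := by
    apply mul_le_mul_of_nonneg_left _ he0; linarith
  have h5 : (1 + e) * qf P x = (1 + e) * (qf Q x + qf R u) + (1 + e) * qf P y := by rw [← hstep]; ring
  rw [h5]
  linarith

/-- Comparison in both directions. The enlarged `P` is a supersolution for the perturbed system, so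
a solution `P'` exists below (1 + 16g³ε)P and is bounded with parameter 2g. Now exchange the two
systems: the loss becomes 16(2g)³ε = 128g³ε, and the bound 2g on `P'` produces 256g⁴ε. -/
lemma near (h : Bounded A B Q R P g) (hε : 0 ≤ ε) (hε' : 128 * g ^ 3 * ε ≤ 1)
    (hA : ‖A' - A‖ ≤ ε) (hB : ‖B' - B‖ ≤ ε) :
    ∃ P', Bounded A' B' Q R P' (2 * g) ∧ ‖P' - P‖ ≤ 256 * g ^ 4 * ε := by
  have hg := h.pos
  have hg1 := h.one_le
  have hg3 : 0 ≤ g ^ 3 * ε := by positivity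
  have hs := h.isSuper_of_near hε (by linarith) hA hB
  obtain ⟨P', hP'⟩ := exists_isRiccatiSol (inv_pos.2 hg) h.Q_symm h.Q_ge h.R_posDef hs
  have hinv : (2 * g)⁻¹ ≤ g⁻¹ := by gcongr; linarith
  have hle : ∀ x, qf P' x ≤ (1 + 16 * g ^ 3 * ε) * qf P x := fun x => by
    rw [← qf_smul_left]; exact hP'.le_of_isSuper (inv_pos.2 hg) h.Q_ge h.R_posDef hs x
  have hε1 : ε ≤ g := by
    have : ε ≤ g ^ 3 * ε := le_mul_of_one_le_left hε (one_le_pow₀ hg1)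
    linarith
  have hb : Bounded A' B' Q R P' (2 * g) :=
    { one_le := by linarith
      Q_symm := h.Q_symm
      R_posDef := h.R_posDef
      Q_ge := fun x => (mul_le_mul_of_nonneg_right hinv (dot_self_nonneg x)).trans (h.Q_ge x)
      R_ge := fun x => (mul_le_mul_of_nonneg_right hinv (dot_self_nonneg x)).trans (h.R_ge x)
      A_le := by
        have := norm_add_le (A' - A) A
        rw [sub_add_cancel] at this; linarith [h.A_le]
      B_le := by
        have := norm_add_le (B' - B) B
        rw [sub_add_cancel] at this; linarith [h.B_le]
      sol := hP'
      P_le := fun x => by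
        have h1 := h.P_le x
        have h2 := h.psd.2 x
        have h3 : (1 + 16 * g ^ 3 * ε) * qf P x ≤ 2 * qf P x := by gcongr; linarith
        linarith [hle x] }
  refine ⟨P', hb, ?_⟩
  have hs' := hb.isSuper_of_near (A' := A) (B' := B) hε
    (by linarith [(by ring : 16 * (2 * g) ^ 3 * ε = 128 * g ^ 3 * ε)])
    (by rw [norm_sub_rev]; exact hA) (by rw [norm_sub_rev]; exact hB)
  have hle' : ∀ x, qf P x ≤ (1 + 128 * g ^ 3 * ε) * qf P' x := fun x => by
    have := h.sol.le_of_isSuper (inv_pos.2 hg) h.Q_ge h.R_posDef hs' x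
    rw [qf_smul_left] at this
    linarith [(by ring : (1 + 16 * (2 * g) ^ 3 * ε) * qf P' x = (1 + 128 * g ^ 3 * ε) * qf P' x)]
  refine norm_le_of_abs_qf_le (by rw [Matrix.transpose_sub, h.psd.1, hb.psd.1]) (by positivity) fun x => ?_
  have hxx := dot_self_nonneg x
  have h1 : g ^ 3 * ε * qf P x ≤ g ^ 3 * ε * (g * (x ⬝ᵥ x)) := by gcongr; exact h.P_le x
  have h2 : g ^ 3 * ε * qf P' x ≤ g ^ 3 * ε * (2 * g * (x ⬝ᵥ x)) := by gcongr; exact hb.P_le x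
  have h3 : 0 ≤ g ^ 4 * ε * (x ⬝ᵥ x) := by positivity
  rw [abs_le, qf_sub_left]
  constructor <;> linarith [hle x, hle' x]

/-- Subtracting the two gain equations gives the new Hessian times K' − K as a sum of terms, each
containing one of the differences A' − A, B' − B, P' − P. The new Hessian is coercive with constant
(2g)⁻¹. -/
lemma gain_sub_norm (h : Bounded A B Q R P g) (h' : Bounded A' B' Q R P' (2 * g))
    (hε : 0 ≤ ε) (hA : ‖A' - A‖ ≤ ε) (hB : ‖B' - B‖ ≤ ε) (hP : ‖P' - P‖ ≤ 256 * g ^ 4 * ε) :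
    ‖gain A' B' R P' - gain A B R P‖ ≤ 2100 * g ^ 8 * ε := by
  have hg := h.pos
  have hg1 := h.one_le
  set K := gain A B R P
  set K' := gain A' B' R P'
  have e1 : hess B R P * K = -(Bᵀ * P * A) := hess_mul_gain h.R_posDef h.psd
  have e2 : hess B' R P' * K' = -(B'ᵀ * P' * A') := hess_mul_gain h'.R_posDef h'.psd
  have e3 : hess B' R P' * (K' - K) =
      -((B' - B)ᵀ * P' * A' + Bᵀ * (P' - P) * A' + Bᵀ * P * (A' - A)) -
      ((B' - B)ᵀ * P' * B' + Bᵀ * (P' - P) * B' + Bᵀ * P * (B' - B)) * K := by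
    have e4 : hess B' R P' = hess B R P +
        ((B' - B)ᵀ * P' * B' + Bᵀ * (P' - P) * B' + Bᵀ * P * (B' - B)) := by
      simp only [hess, Matrix.transpose_sub, Matrix.sub_mul, Matrix.mul_sub]; abel
    rw [Matrix.mul_sub, e2]
    rw [e4, Matrix.add_mul, e1]
    simp only [Matrix.transpose_sub, Matrix.sub_mul, Matrix.mul_sub]; abel
  have hBt : ‖(B' - B)ᵀ‖ ≤ ε := by rw [norm_transpose_le]; exact hB
  have hBt2 : ‖Bᵀ‖ ≤ g := by rw [norm_transpose_le]; exact h.B_le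
  have hN : ‖(B' - B)ᵀ * P' * A' + Bᵀ * (P' - P) * A' + Bᵀ * P * (A' - A)‖ ≤ 517 * g ^ 6 * ε := by
    have n1 := norm_mul₃_le _ _ _ hBt h'.P_norm h'.A_le
    have n2 := norm_mul₃_le _ _ _ hBt2 hP h'.A_le
    have n3 := norm_mul₃_le _ _ _ hBt2 h.P_norm hA
    have n4 := norm_add₃_le (a := (B' - B)ᵀ * P' * A') (b := Bᵀ * (P' - P) * A') (c := Bᵀ * P * (A' - A))
    have p2 : g ^ 2 * ε ≤ g ^ 6 * ε := by gcongr; norm_num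
    linarith
  have hM : ‖(B' - B)ᵀ * P' * B' + Bᵀ * (P' - P) * B' + Bᵀ * P * (B' - B)‖ ≤ 517 * g ^ 6 * ε := by
    have n1 := norm_mul₃_le _ _ _ hBt h'.P_norm h'.B_le
    have n2 := norm_mul₃_le _ _ _ hBt2 hP h'.B_le
    have n3 := norm_mul₃_le _ _ _ hBt2 h.P_norm hB
    have n4 := norm_add₃_le (a := (B' - B)ᵀ * P' * B') (b := Bᵀ * (P' - P) * B') (c := Bᵀ * P * (B' - B))
    have p2 : g ^ 2 * ε ≤ g ^ 6 * ε := by gcongr; norm_num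
    linarith
  have hT : ‖hess B' R P' * (K' - K)‖ ≤ 1034 * g ^ 7 * ε := by
    rw [e3]
    refine (norm_sub_le _ _).trans ?_
    rw [norm_neg]
    have := (norm_mul_le' ((B' - B)ᵀ * P' * B' + Bᵀ * (P' - P) * B' + Bᵀ * P * (B' - B)) K).trans
      (mul_le_mul hM h.gain_norm (norm_nonneg _) (by positivity))
    have p2 : g ^ 6 * ε ≤ g ^ 7 * ε := by gcongr; norm_num
    linarith
  refine (norm_le_of_mul_eq (inv_pos.2 h'.pos) h'.hess_ge rfl hT).trans ?_
  rw [inv_inv]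
  have : 0 ≤ g ^ 8 * ε := by positivity
  linarith

/-- The performance-difference identity: the loss from an action is exactly quadratic in its
distance from the optimal one. It is the source of both ε² in the perturbation bound and the
logarithmic regret. -/
lemma advantage (h : Bounded A B Q R P g) (x : Fin d → ℝ) (u : Fin k → ℝ) :
    qf Q x + qf R u + qf P (A *ᵥ x + B *ᵥ u) =
      qf P x + qf (hess B R P) (u - gain A B R P *ᵥ x) := by
  rw [complete_square h.R_posDef h.psd, ric, ← h.sol.2]

lemma hess_le (h : Bounded A B Q R P g) (hR : ‖R‖ ≤ g) (u : Fin k → ℝ) :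
    qf (hess B R P) u ≤ 2 * g ^ 3 * (u ⬝ᵥ u) := by
  have hg := h.pos
  have hg1 := h.one_le
  have huu := dot_self_nonneg u
  rw [qf_hess]
  have h1 : qf R u ≤ g * (u ⬝ᵥ u) := (qf_le_norm R u).trans (by gcongr)
  have h2 : qf P (B *ᵥ u) ≤ g * (g ^ 2 * (u ⬝ᵥ u)) :=
    (h.P_le _).trans (by gcongr; exact mulVec_dot_self_le_of_norm h.B_le u)
  have h3 : g ^ 1 * (u ⬝ᵥ u) ≤ g ^ 3 * (u ⬝ᵥ u) := by gcongr; norm_num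
  linarith

lemma hess_sub_le (h : Bounded A B Q R P g) (hR : ‖R‖ ≤ g) {δ : ℝ}
    (hK : ‖K - gain A B R P‖ ≤ δ) (x : Fin d → ℝ) :
    qf (hess B R P) (K *ᵥ x - gain A B R P *ᵥ x) ≤ 2 * g ^ 3 * (δ ^ 2 * (x ⬝ᵥ x)) := by
  have hg := h.pos
  refine (h.hess_le hR _).trans ?_
  rw [← Matrix.sub_mulVec]
  gcongr
  exact mulVec_dot_self_le_of_norm hK x

/-- The Riccati solution, slightly enlarged, is a supersolution for controllers close to the
optimal one. -/
lemma isSuper_of_gain_near (h : Bounded A B Q R P g) (hR : ‖R‖ ≤ g) {δ : ℝ}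
    (hδ : 4 * g ^ 4 * δ ^ 2 ≤ 1) (hK : ‖K - gain A B R P‖ ≤ δ) :
    IsSuper A B Q R K ((1 + 4 * g ^ 4 * δ ^ 2) • P) := by
  have hg := h.pos
  refine ⟨⟨by rw [Matrix.transpose_smul, h.psd.1], fun x => ?_⟩, fun x => ?_⟩
  · rw [qf_smul_left]; exact mul_nonneg (by positivity) (h.psd.2 x)
  rw [qf_smul_left, qf_smul_left]
  have h1 := h.advantage x (K *ᵥ x)
  have h2 := h.hess_sub_le hR hK x
  have hxx := dot_self_nonneg x
  have h3 := h.Q_ge x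
  have h4 := (psd_of_posDef h.R_posDef).2 (K *ᵥ x)
  set e := 4 * g ^ 4 * δ ^ 2 with he
  have he0 : 0 ≤ e := by positivity
  have h5 : (1 + e) * (2 * g ^ 3 * (δ ^ 2 * (x ⬝ᵥ x))) ≤ 2 * (2 * g ^ 3 * (δ ^ 2 * (x ⬝ᵥ x))) := by
    gcongr; linarith
  have h6 : e * (g⁻¹ * (x ⬝ᵥ x)) = 2 * (2 * g ^ 3 * (δ ^ 2 * (x ⬝ᵥ x))) := by rw [he]; field_simp; ring
  have h7 : e * (g⁻¹ * (x ⬝ᵥ x)) ≤ e * (qf Q x + qf R (K *ᵥ x)) := by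
    apply mul_le_mul_of_nonneg_left _ he0; linarith
  have h8 : (1 + e) * qf (hess B R P) (K *ᵥ x - gain A B R P *ᵥ x) ≤
      (1 + e) * (2 * g ^ 3 * (δ ^ 2 * (x ⬝ᵥ x))) := by gcongr
  have h9 : qf P (A *ᵥ x + B *ᵥ (K *ᵥ x)) = qf P x + qf (hess B R P) (K *ᵥ x - gain A B R P *ᵥ x) -
    (qf Q x + qf R (K *ᵥ x)) := by linarith
  rw [h9]
  linarith

/-- Controllers close to the optimal one contract the Riccati solution. -/
lemma contract_of_gain_near (h : Bounded A B Q R P g) (hR : ‖R‖ ≤ g) {δ : ℝ}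
    (hδ : 4 * g ^ 4 * δ ^ 2 ≤ 1) (hK : ‖K - gain A B R P‖ ≤ δ) (x : Fin d → ℝ) :
    qf P (A *ᵥ x + B *ᵥ (K *ᵥ x)) ≤ qf P x - (2 * g)⁻¹ * (x ⬝ᵥ x) := by
  have hg := h.pos
  have h1 := h.advantage x (K *ᵥ x)
  have h2 := h.hess_sub_le hR hK x
  have hxx := dot_self_nonneg x
  have h3 := h.Q_ge x
  have h4 := (psd_of_posDef h.R_posDef).2 (K *ᵥ x)
  have h5 : 2 * g ^ 3 * (δ ^ 2 * (x ⬝ᵥ x)) = 4 * g ^ 4 * δ ^ 2 * ((2 * g)⁻¹ * (x ⬝ᵥ x)) := by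
    field_simp; ring
  have h6 : 4 * g ^ 4 * δ ^ 2 * ((2 * g)⁻¹ * (x ⬝ᵥ x)) ≤ 1 * ((2 * g)⁻¹ * (x ⬝ᵥ x)) := by gcongr
  have h7 : g⁻¹ * (x ⬝ᵥ x) = 2 * ((2 * g)⁻¹ * (x ⬝ᵥ x)) := by field_simp
  linarith

end Bounded

end Perturbation


/-! ### The noise process -/

section Noise

variable {d : ℕ} {σ : ℝ}

instance (d : ℕ) (σ : ℝ) : IsProbabilityMeasure (noiseLaw d σ) := by
  unfold noiseLaw; infer_instance

lemma measurePreserving_coord (i : Fin d) :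
    MeasurePreserving (fun w : Fin d → ℝ => w i) (gaussianNoise d σ) (gaussianReal 0 (σ ^ 2).toNNReal) :=
  measurePreserving_eval (fun _ : Fin d => gaussianReal 0 (σ ^ 2).toNNReal) i

lemma measurePreserving_noise (t : ℕ) :
    MeasurePreserving (fun ω : ℕ → Fin d → ℝ => ω t) (noiseLaw d σ) (gaussianNoise d σ) :=
  measurePreserving_eval_infinitePi (fun _ => gaussianNoise d σ) t

lemma indepFun_coord {i j : Fin d} (h : i ≠ j) :
    IndepFun (fun w : Fin d → ℝ => w i) (fun w => w j) (gaussianNoise d σ) := by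
  have := iIndepFun_pi (μ := fun _ : Fin d => gaussianReal 0 (σ ^ 2).toNNReal)
    (X := fun _ x => x) (fun _ => aemeasurable_id)
  exact this.indepFun h

lemma memLp_coord (i : Fin d) {p : ℝ≥0∞} (hp : p ≠ ⊤) :
    MemLp (fun w : Fin d → ℝ => w i) p (gaussianNoise d σ) :=
  (memLp_id_gaussianReal' p hp).comp_measurePreserving (measurePreserving_coord i)

lemma integral_coord (i : Fin d) : ∫ w : Fin d → ℝ, w i ∂(gaussianNoise d σ) = 0 := by
  have := (measurePreserving_coord (σ := σ) i).hasLaw.integral_eq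
  rw [this]; exact integral_id_gaussianReal

lemma integral_coord_mul (i j : Fin d) :
    ∫ w : Fin d → ℝ, w i * w j ∂(gaussianNoise d σ) = if i = j then σ ^ 2 else 0 := by
  split_ifs with h
  · subst h
    have h1 := (measurePreserving_coord (σ := σ) i).hasLaw.variance_eq
    rw [variance_id_gaussianReal, variance_of_integral_eq_zero (measurable_pi_apply i).aemeasurable (integral_coord i),
      Real.coe_toNNReal _ (sq_nonneg σ)] at h1
    simpa only [sq] using h1
  · rw [(indepFun_coord h).integral_fun_mul_eq_mul_integral
      (measurable_pi_apply i).aestronglyMeasurable (measurable_pi_apply j).aestronglyMeasurable,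
      integral_coord, zero_mul]

/-- The value of `X` is determined by the noise before time `t`. -/
def DependsBefore {α : Type*} (t : ℕ) (X : (ℕ → Fin d → ℝ) → α) : Prop :=
  ∀ ω ω', (∀ s < t, ω s = ω' s) → X ω = X ω'

/-- Such an `X` factors through the coordinates below t, because padding them with zeros does not
change its value; these coordinates are jointly independent of coordinate t. -/
lemma DependsBefore.indepFun {α : Type*} [MeasurableSpace α] {t : ℕ} {X : (ℕ → Fin d → ℝ) → α}
    (hX : DependsBefore t X) (hm : Measurable X) :
    IndepFun X (fun ω => ω t) (noiseLaw d σ) := by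
  have h0 : iIndepFun (fun (i : ℕ) (ω : ℕ → Fin d → ℝ) => ω i) (noiseLaw d σ) :=
    iIndepFun_infinitePi (P := fun _ : ℕ => gaussianNoise d σ) (X := fun _ x => x) (fun _ => measurable_id)
  have h1 := h0.indepFun_finset (Finset.range t) {t} (by simp) (fun i => measurable_pi_apply i)
  let ext : ((i : Finset.range t) → Fin d → ℝ) → ℕ → Fin d → ℝ :=
    fun f s => if h : s ∈ Finset.range t then f ⟨s, h⟩ else 0
  have hext : Measurable ext := by
    refine measurable_pi_lambda _ fun s => ?_
    by_cases h : s ∈ Finset.range t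
    · simp only [ext, h, dif_pos]; exact measurable_pi_apply _
    · simp only [ext, h, dif_neg, not_false_eq_true]; exact measurable_const
  have hev : Measurable fun f : (({t} : Finset ℕ) → Fin d → ℝ) => f ⟨t, by simp⟩ := measurable_pi_apply _
  have h2 := h1.comp (φ := X ∘ ext) (hm.comp hext) hev
  convert h2 using 1
  · ext ω
    exact hX _ _ fun s hs => by simp [ext, hs]
  · rfl

/-- Integrating out the noise of time `t`. -/
lemma lintegral_step {α : Type*} [MeasurableSpace α] {t : ℕ} {X : (ℕ → Fin d → ℝ) → α}
    (hX : DependsBefore t X) (hm : Measurable X) {F : α → (Fin d → ℝ) → ℝ≥0∞}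
    (hF : Measurable (Function.uncurry F)) :
    ∫⁻ ω, F (X ω) (ω t) ∂(noiseLaw d σ) =
      ∫⁻ ω, (∫⁻ w, F (X ω) w ∂(gaussianNoise d σ)) ∂(noiseLaw d σ) := by
  have h1 := (indepFun_iff_map_prod_eq_prod_map_map hm.aemeasurable
    (measurable_pi_apply t).aemeasurable).1 (hX.indepFun (σ := σ) hm)
  rw [(measurePreserving_noise t).map_eq] at h1
  have h2 : ∫⁻ ω, F (X ω) (ω t) ∂(noiseLaw d σ) =
      ∫⁻ z, Function.uncurry F z ∂((noiseLaw d σ).map fun ω => (X ω, ω t)) := by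
    rw [lintegral_map hF (hm.prodMk (measurable_pi_apply t))]; rfl
  rw [h2, h1, lintegral_prod _ hF.aemeasurable, lintegral_map hF.lintegral_prod_right' hm]
  rfl

/-- A product of factors with conditional expectation at most one. -/
lemma lintegral_exp_sum_le {Y : ℕ → (ℕ → Fin d → ℝ) → ℝ} {F : ℕ → ℝ → (Fin d → ℝ) → ℝ}
    (hY : ∀ s, DependsBefore (s + 1) (Y s)) (hYm : ∀ s, Measurable (Y s))
    (hF : ∀ s, Measurable (Function.uncurry (F s)))
    (h : ∀ s y, ∫⁻ w, ENNReal.ofReal (Real.exp (F s y w)) ∂(gaussianNoise d σ) ≤ 1) (n : ℕ) :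
    ∫⁻ ω, ENNReal.ofReal (Real.exp (∑ s ∈ Finset.range n, F s (Y s ω) (ω (s + 1)))) ∂(noiseLaw d σ) ≤ 1 := by
  induction n with
  | zero => simp
  | succ n ih =>
    have hm : ∀ s, Measurable fun ω : ℕ → Fin d → ℝ => F s (Y s ω) (ω (s + 1)) := fun s =>
      (hF s).comp ((hYm s).prodMk (measurable_pi_apply (s + 1)))
    set G : (ℕ → Fin d → ℝ) → ℝ≥0∞ := fun ω =>
      ENNReal.ofReal (Real.exp (∑ s ∈ Finset.range n, F s (Y s ω) (ω (s + 1)))) with hG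
    have hGm : Measurable G := by fun_prop
    have hGd : DependsBefore (n + 1) G := fun ω ω' hω => by
      simp only [hG]
      congr 2
      refine Finset.sum_congr rfl fun s hs => ?_
      have hs' := Finset.mem_range.1 hs
      rw [hY s ω ω' fun r hr => hω r (by omega), hω (s + 1) (by omega)]
    let F' : ℝ≥0∞ × ℝ → (Fin d → ℝ) → ℝ≥0∞ := fun z w => z.1 * ENNReal.ofReal (Real.exp (F n z.2 w))
    have h1 : ∀ ω : ℕ → Fin d → ℝ, ENNReal.ofReal (Real.exp (∑ s ∈ Finset.range (n + 1), F s (Y s ω) (ω (s + 1)))) =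
        F' (G ω, Y n ω) (ω (n + 1)) := fun ω => by
      rw [Finset.sum_range_succ, Real.exp_add, ENNReal.ofReal_mul (Real.exp_nonneg _)]
    simp_rw [h1]
    rw [lintegral_step (F := F') (X := fun ω => (G ω, Y n ω)) (t := n + 1)]
    · refine le_trans (lintegral_mono fun ω => ?_) ih
      have h2 : Measurable fun w => ENNReal.ofReal (Real.exp (F n (Y n ω) w)) :=
        ((Real.measurable_exp.comp ((hF n).comp (measurable_const.prodMk measurable_id)))).ennreal_ofReal
      dsimp only
      rw [lintegral_const_mul _ h2]
      exact mul_le_of_le_one_right' (h n _)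
    · exact fun ω ω' hω => Prod.ext (hGd ω ω' hω) (hY n ω ω' fun r hr => hω r hr)
    · exact hGm.prodMk (hYm n)
    · have : Measurable fun z : (ℝ≥0∞ × ℝ) × (Fin d → ℝ) => F n z.1.2 z.2 :=
        (hF n).comp ((measurable_snd.comp measurable_fst).prodMk measurable_snd)
      exact (measurable_fst.comp measurable_fst).mul (Real.measurable_exp.comp this).ennreal_ofReal

/-- Markov's inequality for the exponential supermartingale. Since `Y s` may depend on all noise
before time s + 1, the inequality applies to adapted processes. -/
lemma measure_sum_ge_le {Y : ℕ → (ℕ → Fin d → ℝ) → ℝ} {F : ℕ → ℝ → (Fin d → ℝ) → ℝ}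
    (hY : ∀ s, DependsBefore (s + 1) (Y s)) (hYm : ∀ s, Measurable (Y s))
    (hF : ∀ s, Measurable (Function.uncurry (F s)))
    (h : ∀ s y, ∫⁻ w, ENNReal.ofReal (Real.exp (F s y w)) ∂(gaussianNoise d σ) ≤ 1) (n : ℕ) (r : ℝ) :
    noiseLaw d σ {ω | r ≤ ∑ s ∈ Finset.range n, F s (Y s ω) (ω (s + 1))} ≤ ENNReal.ofReal (Real.exp (-r)) := by
  have hm : ∀ s, Measurable fun ω : ℕ → Fin d → ℝ => F s (Y s ω) (ω (s + 1)) := fun s =>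
    (hF s).comp ((hYm s).prodMk (measurable_pi_apply (s + 1)))
  have h1 := meas_ge_le_lintegral_div (μ := noiseLaw d σ)
    (f := fun ω => ENNReal.ofReal (Real.exp (∑ s ∈ Finset.range n, F s (Y s ω) (ω (s + 1)))))
    (by fun_prop) (ε := ENNReal.ofReal (Real.exp r)) (by simp [Real.exp_pos]) ENNReal.ofReal_ne_top
  have h2 : {ω : ℕ → Fin d → ℝ | r ≤ ∑ s ∈ Finset.range n, F s (Y s ω) (ω (s + 1))} ⊆
      {ω | ENNReal.ofReal (Real.exp r) ≤
        ENNReal.ofReal (Real.exp (∑ s ∈ Finset.range n, F s (Y s ω) (ω (s + 1))))} := fun ω hω =>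
    ENNReal.ofReal_le_ofReal (Real.exp_le_exp.2 hω)
  refine (measure_mono h2).trans (h1.trans ?_)
  rw [Real.exp_neg, ENNReal.ofReal_inv_of_pos (Real.exp_pos r), ← one_div]
  gcongr
  exact lintegral_exp_sum_le hY hYm hF h n

/-! ### Exponential moments of the noise -/

lemma lintegral_exp_linear (i : Fin d) (c : ℝ) :
    ∫⁻ w : Fin d → ℝ, ENNReal.ofReal (Real.exp (c * w i)) ∂(gaussianNoise d σ) =
      ENNReal.ofReal (Real.exp (σ ^ 2 * c ^ 2 / 2)) := by
  have h1 := (measurePreserving_coord (σ := σ) i).lintegral_comp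
    (f := fun x => ENNReal.ofReal (Real.exp (c * x))) (by fun_prop)
  rw [h1, ← ofReal_integral_eq_lintegral_ofReal (integrable_exp_mul_gaussianReal c)
    (ae_of_all _ fun x => Real.exp_nonneg _)]
  have h2 := congrFun (mgf_id_gaussianReal (μ := 0) (v := (σ ^ 2).toNNReal)) c
  rw [mgf, Real.coe_toNNReal _ (sq_nonneg σ), zero_mul, zero_add] at h2
  rw [← h2]; rfl

lemma lintegral_exp_sq_gaussianReal (hσ : σ ≠ 0) {c : ℝ} (hc : 2 * c * σ ^ 2 < 1) :
    ∫⁻ x, ENNReal.ofReal (Real.exp (c * x ^ 2)) ∂(gaussianReal 0 (σ ^ 2).toNNReal) =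
      ENNReal.ofReal (√(1 - 2 * c * σ ^ 2))⁻¹ := by
  have hσ2 : 0 < σ ^ 2 := by positivity
  have hv : (σ ^ 2).toNNReal ≠ 0 := by simpa using hσ
  rw [gaussianReal_of_var_ne_zero _ hv, lintegral_withDensity_eq_lintegral_mul _ (by fun_prop) (by fun_prop)]
  set b : ℝ := (1 - 2 * c * σ ^ 2) / (2 * σ ^ 2) with hb
  have hb0 : 0 < b := by apply div_pos <;> linarith
  have h1 : ∀ x : ℝ, (gaussianPDF 0 (σ ^ 2).toNNReal * fun x => ENNReal.ofReal (Real.exp (c * x ^ 2))) x =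
      ENNReal.ofReal ((√(2 * Real.pi * σ ^ 2))⁻¹ * Real.exp (-b * x ^ 2)) := fun x => by
    rw [Pi.mul_apply, gaussianPDF, ← ENNReal.ofReal_mul (gaussianPDFReal_nonneg _ _ _), gaussianPDFReal,
      mul_assoc, ← Real.exp_add, Real.coe_toNNReal _ hσ2.le]
    congr 3
    rw [hb]; field_simp; ring
  simp_rw [h1]
  rw [← ofReal_integral_eq_lintegral_ofReal ((integrable_exp_neg_mul_sq hb0).const_mul _)
    (ae_of_all _ fun x => by positivity), integral_const_mul, integral_gaussian]
  congr 1
  rw [← Real.sqrt_inv, ← Real.sqrt_inv, ← Real.sqrt_mul (by positivity)]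
  congr 1
  have : 1 - 2 * c * σ ^ 2 ≠ 0 := by linarith
  rw [hb]; field_simp

lemma lintegral_exp_sq_gaussianReal_le (hσ : σ ≠ 0) {c : ℝ} (hc : |c| * σ ^ 2 ≤ 1 / 4) :
    ∫⁻ x, ENNReal.ofReal (Real.exp (c * x ^ 2)) ∂(gaussianReal 0 (σ ^ 2).toNNReal) ≤
      ENNReal.ofReal (Real.exp (c * σ ^ 2 + 4 * (c * σ ^ 2) ^ 2)) := by
  have hσ2 : 0 < σ ^ 2 := by positivity
  set u := c * σ ^ 2 with hu
  have hu4 : |u| ≤ 1 / 4 := by rwa [hu, abs_mul, abs_of_pos hσ2]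
  obtain ⟨hu1, hu2⟩ := abs_le.1 hu4
  rw [lintegral_exp_sq_gaussianReal hσ (by rw [mul_assoc, ← hu]; linarith), mul_assoc, ← hu]
  refine ENNReal.ofReal_le_ofReal ?_
  have hpos : 0 < 1 - 2 * u := by linarith
  rw [← Real.sqrt_inv]
  refine Real.sqrt_le_iff.2 ⟨Real.exp_nonneg _, ?_⟩
  rw [← Real.exp_nat_mul, inv_le_iff_one_le_mul₀ hpos]
  -- After squaring, the claim is 1 ≤ exp(2u + 8u²)(1 − 2u). Bounding the exponential by 1 + 2u +
  -- 8u² leaves 1 + 4u²(1 − 4u), which is at least 1 as u ≤ 1/4.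
  have h1 := Real.add_one_le_exp ((2 : ℕ) * (u + 4 * u ^ 2))
  have h2 : ((2 : ℕ) * (u + 4 * u ^ 2) + 1) * (1 - 2 * u) ≤ Real.exp ((2 : ℕ) * (u + 4 * u ^ 2)) * (1 - 2 * u) := by
    gcongr
  push_cast at h2 ⊢
  nlinarith [sq_nonneg u, mul_nonneg (sq_nonneg u) (by linarith : 0 ≤ 1 - 4 * u)]

lemma lintegral_exp_coord_sq_le (hσ : σ ≠ 0) (i : Fin d) {c : ℝ} (hc : |c| * σ ^ 2 ≤ 1 / 4) :
    ∫⁻ w : Fin d → ℝ, ENNReal.ofReal (Real.exp (c * w i ^ 2)) ∂(gaussianNoise d σ) ≤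
      ENNReal.ofReal (Real.exp (c * σ ^ 2 + 4 * (c * σ ^ 2) ^ 2)) := by
  rw [(measurePreserving_coord (σ := σ) i).lintegral_comp
    (f := fun x => ENNReal.ofReal (Real.exp (c * x ^ 2))) (by fun_prop)]
  exact lintegral_exp_sq_gaussianReal_le hσ hc

/-- Integrate first over coordinate i: for fixed y = w j this is a linear Gaussian exponent and
gives exp(c²σ²y²/2). What remains is the exponential moment of a square, with u = c²σ⁴/2 ≤ 1/8. -/
lemma lintegral_exp_coord_mul_le (hσ : σ ≠ 0) {i j : Fin d} (hij : i ≠ j) {c : ℝ} (hc : |c| * σ ^ 2 ≤ 1 / 2) :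
    ∫⁻ w : Fin d → ℝ, ENNReal.ofReal (Real.exp (c * (w i * w j))) ∂(gaussianNoise d σ) ≤
      ENNReal.ofReal (Real.exp (c ^ 2 * σ ^ 4)) := by
  have h1 := (indepFun_iff_map_prod_eq_prod_map_map (measurable_pi_apply i).aemeasurable
    (measurable_pi_apply j).aemeasurable).1
    (indepFun_coord (σ := σ) hij)
  have hf : Measurable fun z : ℝ × ℝ => ENNReal.ofReal (Real.exp (c * (z.1 * z.2))) := by fun_prop
  have h2 : ∫⁻ w : Fin d → ℝ, ENNReal.ofReal (Real.exp (c * (w i * w j))) ∂(gaussianNoise d σ) =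
      ∫⁻ z : ℝ × ℝ, ENNReal.ofReal (Real.exp (c * (z.1 * z.2))) ∂((gaussianNoise d σ).map fun w => (w i, w j)) := by
    rw [lintegral_map hf (by fun_prop)]
  rw [h2, h1, (measurePreserving_coord j).map_eq, lintegral_prod_symm _ hf.aemeasurable]
  have h3 : ∀ y : ℝ, ∫⁻ x : ℝ, ENNReal.ofReal (Real.exp (c * (x * y))) ∂((gaussianNoise d σ).map fun w => w i) =
      ENNReal.ofReal (Real.exp (c ^ 2 * σ ^ 2 / 2 * y ^ 2)) := fun y => by
    rw [lintegral_map (by fun_prop) (by fun_prop)]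
    have := lintegral_exp_linear (σ := σ) i (c * y)
    rw [show c ^ 2 * σ ^ 2 / 2 * y ^ 2 = σ ^ 2 * (c * y) ^ 2 / 2 by ring, ← this]
    refine lintegral_congr fun w => ?_
    ring_nf
  simp_rw [h3]
  have hu : c ^ 2 * σ ^ 2 * σ ^ 2 ≤ 1 / 4 := by
    have : c ^ 2 * σ ^ 2 * σ ^ 2 = (|c| * σ ^ 2) ^ 2 := by rw [mul_pow, sq_abs]; ring
    rw [this]
    have h0 : 0 ≤ |c| * σ ^ 2 := by positivity
    nlinarith
  have h0 : 0 ≤ c ^ 2 * σ ^ 2 * σ ^ 2 := by positivity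
  refine (lintegral_exp_sq_gaussianReal_le hσ ?_).trans (ENNReal.ofReal_le_ofReal (Real.exp_le_exp.2 ?_))
  · rw [abs_of_nonneg (by positivity)]; linarith
  · nlinarith

end Noise


/-! ### Trajectories -/

section Trajectories

variable {d k : ℕ} {σ : ℝ} {A : Matrix (Fin d) (Fin d) ℝ} {B : Matrix (Fin d) (Fin k) ℝ}
  {π : (ℕ → Fin d → ℝ) → (ℕ → Fin k → ℝ) → ℕ → Fin k → ℝ}

/-- Stage t + 1 writes only the state of time t + 2, so an entry keeps its value from the stage at
which it was produced. -/
lemma hist_fst_stable (w : ℕ → Fin d → ℝ) {s t : ℕ} (h : s ≤ t + 1) :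
    (hist A B π w t).1 s = state A B π w s := by
  have key : ∀ t, s ≤ t + 1 → (hist A B π w (t + 1)).1 s = (hist A B π w t).1 s := fun t h => by
    rw [hist]; exact Function.update_of_ne (by omega) _ _
  rcases le_or_gt s t with h1 | h1
  · induction t, h1 using Nat.le_induction with
    | base => rfl
    | succ t h2 ih => rw [key t (by omega)]; exact ih (by omega)
  · obtain rfl : s = t + 1 := by omega
    exact (key t le_rfl).symm

lemma hist_snd_stable (w : ℕ → Fin d → ℝ) {s t : ℕ} (h : s ≤ t) :
    (hist A B π w t).2 s = action A B π w s := by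
  induction t, h using Nat.le_induction with
  | base => rfl
  | succ t h2 ih =>
    rw [← ih, hist]; exact Function.update_of_ne (by omega) _ _

@[simp] lemma state_one (w : ℕ → Fin d → ℝ) : state A B π w 1 = 0 := by
  rw [← hist_fst_stable w (t := 0) le_rfl]; rfl

lemma action_succ (w : ℕ → Fin d → ℝ) (t : ℕ) :
    action A B π w (t + 1) = π (hist A B π w t).1 (hist A B π w t).2 (t + 1) := by
  rw [action, hist]; exact Function.update_self _ _ _

lemma state_succ (w : ℕ → Fin d → ℝ) (t : ℕ) :
    state A B π w (t + 2) = A *ᵥ state A B π w (t + 1) + B *ᵥ action A B π w (t + 1) + w (t + 1) := by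
  rw [← hist_fst_stable w (t := t + 1) le_rfl, hist]
  simp only [Function.update_self]
  rw [hist_fst_stable w le_rfl, action_succ]

/-- The action of time `t` is a function of the states up to time `t` and the earlier actions. -/
def Causal (π : (ℕ → Fin d → ℝ) → (ℕ → Fin k → ℝ) → ℕ → Fin k → ℝ) : Prop :=
  ∀ x x' u u' t, 1 ≤ t → (∀ s, 1 ≤ s → s ≤ t → x s = x' s) → (∀ s, 1 ≤ s → s < t → u s = u' s) →
    π x u t = π x' u' t

lemma Causal.action_eq (h : Causal π) (w : ℕ → Fin d → ℝ) (t : ℕ) :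
    action A B π w (t + 1) = π (state A B π w) (action A B π w) (t + 1) := by
  rw [action_succ]
  exact h _ _ _ _ _ (by omega) (fun s _ hs => hist_fst_stable w hs) fun s _ hs => hist_snd_stable w (by omega)

lemma hist_dependsBefore (t : ℕ) : DependsBefore (t + 1) fun w => hist A B π w t := by
  induction t with
  | zero => intro ω ω' _; rfl
  | succ t ih =>
    intro ω ω' h
    have h1 := ih ω ω' fun s hs => h s (by omega)
    have h2 := h (t + 1) (by omega)
    simp only [hist] at h1 ⊢
    rw [h1, h2]

lemma state_dependsBefore (t : ℕ) : DependsBefore (t + 1) fun w => state A B π w (t + 1) :=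
  fun ω ω' h => by
    simp only [← hist_fst_stable _ (le_refl (t + 1))]
    exact congrArg (fun z => z.1 (t + 1)) (hist_dependsBefore (A := A) (B := B) (π := π) t ω ω' h)

lemma action_dependsBefore (t : ℕ) : DependsBefore (t + 1) fun w => action A B π w (t + 1) :=
  fun ω ω' h => by
    simp only [action_succ]
    exact congrArg (fun z => π z.1 z.2 (t + 1)) (hist_dependsBefore (A := A) (B := B) (π := π) t ω ω' h)

/-- All actions are measurable functions of the observations. -/
def MeasurablePolicy (π : (ℕ → Fin d → ℝ) → (ℕ → Fin k → ℝ) → ℕ → Fin k → ℝ) : Prop :=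
  ∀ t, Measurable fun z : (ℕ → Fin d → ℝ) × (ℕ → Fin k → ℝ) => π z.1 z.2 t

lemma measurable_mulVec {m n : ℕ} (M : Matrix (Fin m) (Fin n) ℝ) : Measurable fun x : Fin n → ℝ => M *ᵥ x :=
  (Continuous.matrix_mulVec continuous_const continuous_id).measurable

lemma measurable_update {α : Type*} [MeasurableSpace α] (t : ℕ) {n : ℕ}
    {f : α → ℕ → Fin n → ℝ} {g : α → Fin n → ℝ} (hf : Measurable f) (hg : Measurable g) :
    Measurable fun a => Function.update (f a) t (g a) := by
  refine measurable_pi_lambda _ fun s => ?_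
  by_cases h : s = t
  · subst h; simpa using hg
  · simp only [Function.update_of_ne h]; exact (measurable_pi_apply s).comp hf

lemma hist_measurable (hπ : MeasurablePolicy π) (t : ℕ) : Measurable fun w => hist A B π w t := by
  induction t with
  | zero => exact measurable_const
  | succ t ih =>
    have h1 := measurable_update (t + 1) ih.snd ((hπ (t + 1)).comp ih)
    have h2 : Measurable fun w => A *ᵥ (hist A B π w t).1 (t + 1) :=
      (measurable_mulVec A).comp ((measurable_pi_apply (t + 1)).comp ih.fst)
    have h3 := (measurable_mulVec B).comp ((measurable_pi_apply (t + 1)).comp h1)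
    exact (measurable_update (t + 2) ih.fst
      ((h2.add h3).add (measurable_pi_apply (t + 1)))).prodMk h1

lemma state_measurable (hπ : MeasurablePolicy π) (t : ℕ) : Measurable fun w => state A B π w t :=
  (measurable_pi_apply t).comp (hist_measurable hπ t).fst

lemma action_measurable (hπ : MeasurablePolicy π) (t : ℕ) : Measurable fun w => action A B π w t :=
  (measurable_pi_apply t).comp (hist_measurable hπ t).snd

/-! ### Second moments -/

/-- Square integrable random vectors. -/
def SqIntegrable {n : ℕ} (σ : ℝ) (X : (ℕ → Fin d → ℝ) → Fin n → ℝ) : Prop :=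
  ∀ i, MemLp (fun ω => X ω i) 2 (noiseLaw d σ)

lemma sqIntegrable_noise (t : ℕ) : SqIntegrable σ fun ω : ℕ → Fin d → ℝ => ω t := fun i =>
  (memLp_coord i (by simp)).comp_measurePreserving (measurePreserving_noise t)

lemma SqIntegrable.mulVec {m n : ℕ} {X : (ℕ → Fin d → ℝ) → Fin n → ℝ} (h : SqIntegrable σ X)
    (M : Matrix (Fin m) (Fin n) ℝ) : SqIntegrable σ fun ω => M *ᵥ X ω := fun i => by
  simp only [Matrix.mulVec, dotProduct]
  exact memLp_finsetSum _ fun j _ => (h j).const_mul (M i j)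

lemma SqIntegrable.add {n : ℕ} {X Y : (ℕ → Fin d → ℝ) → Fin n → ℝ} (h : SqIntegrable σ X)
    (h' : SqIntegrable σ Y) : SqIntegrable σ fun ω => X ω + Y ω := fun i => (h i).add (h' i)

lemma SqIntegrable.dot {n : ℕ} {X Y : (ℕ → Fin d → ℝ) → Fin n → ℝ} (h : SqIntegrable σ X)
    (h' : SqIntegrable σ Y) : Integrable (fun ω => X ω ⬝ᵥ Y ω) (noiseLaw d σ) := by
  simp only [dotProduct]
  exact integrable_finsetSum _ fun i _ => (h i).integrable_mul (h' i)

lemma SqIntegrable.qf {n : ℕ} {X : (ℕ → Fin d → ℝ) → Fin n → ℝ} (h : SqIntegrable σ X)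
    (M : Matrix (Fin n) (Fin n) ℝ) : Integrable (fun ω => LQ.qf M (X ω)) (noiseLaw d σ) :=
  h.dot (h.mulVec M)

lemma integral_dot_noise {t : ℕ} {X : (ℕ → Fin d → ℝ) → Fin d → ℝ} (hX : SqIntegrable σ X)
    (hm : Measurable X) (hd : DependsBefore t X) :
    ∫ ω, X ω ⬝ᵥ ω t ∂(noiseLaw d σ) = 0 := by
  simp only [dotProduct]
  have hint : ∀ i ∈ Finset.univ, Integrable (fun ω => X ω i * ω t i) (noiseLaw d σ) := fun i _ =>
    (hX i).integrable_mul (sqIntegrable_noise t i)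
  rw [integral_finsetSum _ hint]
  refine Finset.sum_eq_zero fun i _ => ?_
  have h1 := (hd.indepFun (σ := σ) hm).comp (measurable_pi_apply i) (measurable_pi_apply i)
  have h2 := h1.integral_fun_mul_eq_mul_integral (hX i).1 (sqIntegrable_noise t i).1
  have h3 : ∫ ω : ℕ → Fin d → ℝ, ω t i ∂(noiseLaw d σ) = 0 := by
    have := (measurePreserving_noise (d := d) (σ := σ) t).hasLaw.integral_comp
      (f := fun w => w i) (measurable_pi_apply i).aestronglyMeasurable
    simpa [integral_coord, Function.comp_def] using this
  simp only [Function.comp_def] at h2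
  rw [h2, h3, mul_zero]

lemma integral_qf_noise (M : Matrix (Fin d) (Fin d) ℝ) (t : ℕ) :
    ∫ ω : ℕ → Fin d → ℝ, qf M (ω t) ∂(noiseLaw d σ) = σ ^ 2 * M.trace := by
  have h0 : ∀ w : Fin d → ℝ, qf M w = ∑ i, ∑ j, M i j * (w i * w j) := fun w => by
    simp only [qf, dotProduct, Matrix.mulVec, Finset.mul_sum]
    exact Finset.sum_congr rfl fun i _ => Finset.sum_congr rfl fun j _ => by ring
  have h1 := (measurePreserving_noise (d := d) (σ := σ) t).hasLaw.integral_comp (f := qf M)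
    (by unfold qf; fun_prop)
  simp only [Function.comp_def] at h1
  rw [h1]
  have hi : ∀ i j, Integrable (fun w : Fin d → ℝ => M i j * (w i * w j)) (gaussianNoise d σ) := fun i j =>
    ((memLp_coord i (p := 2) (by simp)).integrable_mul (memLp_coord j (p := 2) (by simp))).const_mul _
  simp_rw [h0]
  rw [integral_finsetSum _ fun i _ => integrable_finsetSum _ fun j _ => hi i j]
  simp_rw [fun i => integral_finsetSum Finset.univ fun j _ => hi i j, integral_const_mul, integral_coord_mul]
  simp [Matrix.trace, Finset.mul_sum, mul_comm]

lemma integral_qf_add_noise {M : Matrix (Fin d) (Fin d) ℝ} (hM : Mᵀ = M) {t : ℕ}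
    {X : (ℕ → Fin d → ℝ) → Fin d → ℝ} (hX : SqIntegrable σ X) (hm : Measurable X) (hd : DependsBefore t X) :
    ∫ ω, qf M (X ω + ω t) ∂(noiseLaw d σ) = ∫ ω, qf M (X ω) ∂(noiseLaw d σ) + σ ^ 2 * M.trace := by
  simp_rw [qf_add M hM, dot_symm hM (X _)]
  have hc : ∀ ω : ℕ → Fin d → ℝ, ω t ⬝ᵥ M *ᵥ X ω = (M *ᵥ X ω) ⬝ᵥ ω t := fun ω => dotProduct_comm _ _
  simp_rw [hc]
  have hs := sqIntegrable_noise (d := d) (σ := σ) t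
  have h2 : ∫ ω, (M *ᵥ X ω) ⬝ᵥ ω t ∂(noiseLaw d σ) = 0 :=
    integral_dot_noise (hX.mulVec M) ((measurable_mulVec M).comp hm) fun ω ω' h => by simp only [hd ω ω' h]
  have i1 : Integrable (fun ω => qf M (X ω) + 2 * ((M *ᵥ X ω) ⬝ᵥ ω t)) (noiseLaw d σ) :=
    (hX.qf M).add (((hX.mulVec M).dot hs).const_mul 2)
  rw [integral_add i1 (hs.qf M), integral_add (hX.qf M) (((hX.mulVec M).dot hs).const_mul 2),
    integral_const_mul, h2, integral_qf_noise]
  ring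

end Trajectories


/-! ### The average cost of linear policies -/

section AverageCost

variable {d k : ℕ} {S : System d k} {K : Matrix (Fin k) (Fin d) ℝ}

lemma linearPolicy_measurable (K : Matrix (Fin k) (Fin d) ℝ) : MeasurablePolicy (linearPolicy K) :=
  fun t => (measurable_mulVec K).comp ((measurable_pi_apply t).comp measurable_fst)

lemma linear_action (A : Matrix (Fin d) (Fin d) ℝ) (B : Matrix (Fin d) (Fin k) ℝ) (w : ℕ → Fin d → ℝ) (t : ℕ) :
    action A B (linearPolicy K) w (t + 1) = K *ᵥ state A B (linearPolicy K) w (t + 1) := by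
  rw [action_succ, linearPolicy, hist_fst_stable w le_rfl]

lemma linear_state (A : Matrix (Fin d) (Fin d) ℝ) (B : Matrix (Fin d) (Fin k) ℝ) (w : ℕ → Fin d → ℝ) (t : ℕ) :
    state A B (linearPolicy K) w (t + 2) =
      (A + B * K) *ᵥ state A B (linearPolicy K) w (t + 1) + w (t + 1) := by
  rw [state_succ, linear_action, Matrix.add_mulVec, Matrix.mulVec_mulVec]

lemma linear_sqIntegrable (A : Matrix (Fin d) (Fin d) ℝ) (B : Matrix (Fin d) (Fin k) ℝ) (σ : ℝ) (t : ℕ) :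
    SqIntegrable σ fun w => state A B (linearPolicy K) w (t + 1) := by
  induction t with
  | zero => intro i; simp
  | succ t ih => simp only [linear_state]; exact (ih.mulVec _).add (sqIntegrable_noise _)

/-- The matrix of the quadratic form of the expected cost after `t` steps. -/
def costSum (F M : Matrix (Fin d) (Fin d) ℝ) (t : ℕ) : Matrix (Fin d) (Fin d) ℝ :=
  ∑ j ∈ Finset.range t, (F ^ j)ᵀ * M * F ^ j

/-- Splitting off the term j = 0. It mirrors one step of the dynamics: the expected form `M` at the
next state is the form FᵀMF at the present state plus σ² tr M from the fresh noise. -/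
lemma costSum_conj (F M : Matrix (Fin d) (Fin d) ℝ) (t : ℕ) :
    costSum F M (t + 1) = M + costSum F (Fᵀ * M * F) t := by
  rw [costSum, Finset.sum_range_succ', costSum, add_comm]
  congr 1
  · simp
  · refine Finset.sum_congr rfl fun j _ => ?_
    simp only [pow_succ', Matrix.transpose_mul, Matrix.mul_assoc]

lemma linear_integral_qf (A : Matrix (Fin d) (Fin d) ℝ) (B : Matrix (Fin d) (Fin k) ℝ) (σ : ℝ) (t : ℕ) :
    ∀ {M : Matrix (Fin d) (Fin d) ℝ}, Mᵀ = M →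
    ∫ w, qf M (state A B (linearPolicy K) w (t + 1)) ∂(noiseLaw d σ) =
      σ ^ 2 * (costSum (A + B * K) M t).trace := by
  induction t with
  | zero => intro M _; simp [costSum]
  | succ t ih =>
    intro M hM
    simp only [linear_state]
    have hm := state_measurable (A := A) (B := B) (linearPolicy_measurable K) (t + 1)
    rw [integral_qf_add_noise hM ((linear_sqIntegrable A B σ t).mulVec _) ((measurable_mulVec _).comp hm)
      fun ω ω' h => by
        have := state_dependsBefore (A := A) (B := B) (π := linearPolicy K) t ω ω' h
        simp only at this
        simp only [this]]
    simp_rw [← qf_conj]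
    rw [ih (by simp [Matrix.transpose_mul, hM, Matrix.mul_assoc]), costSum_conj, Matrix.trace_add]
    ring

/-- The quadratic form of the cost per step of the controller `K`. -/
def stepCost (S : System d k) (K : Matrix (Fin k) (Fin d) ℝ) : Matrix (Fin d) (Fin d) ℝ :=
  S.Q + Kᵀ * S.R * K

lemma qf_stepCost (x : Fin d → ℝ) : qf (stepCost S K) x = qf S.Q x + qf S.R (K *ᵥ x) := by
  rw [stepCost, qf_add_left, qf_conj]

lemma stepCost_symm (hQ : S.Qᵀ = S.Q) (hR : S.Rᵀ = S.R) : (stepCost S K)ᵀ = stepCost S K := by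
  simp [stepCost, Matrix.transpose_mul, hQ, hR, Matrix.mul_assoc]

lemma linear_cost (w : ℕ → Fin d → ℝ) (t : ℕ) :
    S.cost (linearPolicy K) w (t + 1) = qf (stepCost S K) (state S.A S.B (linearPolicy K) w (t + 1)) := by
  rw [System.cost, linear_action, qf_stepCost]; rfl

lemma lintegral_linear_cost (hQ : PSD S.Q) (hR : PSD S.R) (T : ℕ) :
    ∫⁻ w, ENNReal.ofReal (∑ t ∈ Finset.Icc 1 T, S.cost (linearPolicy K) w t) ∂(noiseLaw d S.σ) =
      ENNReal.ofReal (S.σ ^ 2 * ∑ t ∈ Finset.range T, (costSum (S.A + S.B * K) (stepCost S K) t).trace) := by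
  have h0 : ∀ w, ∑ t ∈ Finset.Icc 1 T, S.cost (linearPolicy K) w t =
      ∑ t ∈ Finset.range T, qf (stepCost S K) (state S.A S.B (linearPolicy K) w (t + 1)) := fun w => by
    rw [Finset.range_eq_Ico, Finset.sum_Ico_add' (fun t => qf (stepCost S K) (state S.A S.B (linearPolicy K) w t)) 0 T 1,
      zero_add, Finset.Ico_add_one_right_eq_Icc]
    refine Finset.sum_congr rfl fun t ht => ?_
    obtain ⟨s, rfl⟩ : ∃ s, t = s + 1 := ⟨t - 1, by have := (Finset.mem_Icc.1 ht).1; omega⟩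
    exact linear_cost w s
  simp_rw [h0]
  have hi : ∀ t ∈ Finset.range T, Integrable (fun w => qf (stepCost S K)
      (state S.A S.B (linearPolicy K) w (t + 1))) (noiseLaw d S.σ) := fun t _ =>
    (linear_sqIntegrable S.A S.B S.σ t).qf _
  rw [← ofReal_integral_eq_lintegral_ofReal (integrable_finsetSum _ hi) (ae_of_all _ fun w =>
    Finset.sum_nonneg fun t _ => by rw [qf_stepCost]; exact add_nonneg (hQ.2 _) (hR.2 _)),
    integral_finsetSum _ hi]
  rw [Finset.mul_sum]
  exact congrArg _ (Finset.sum_congr rfl fun t _ =>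
    linear_integral_qf (K := K) S.A S.B S.σ t (stepCost_symm hQ.1 hR.1))

lemma qf_costSum (F M : Matrix (Fin d) (Fin d) ℝ) (t : ℕ) (x : Fin d → ℝ) :
    qf (costSum F M t) x = ∑ j ∈ Finset.range t, qf M (F ^ j *ᵥ x) := by
  induction t with
  | zero => simp [costSum, qf]
  | succ t ih =>
    rw [costSum, Finset.sum_range_succ, ← costSum, qf_add_left, ih, Finset.sum_range_succ, qf_conj]

lemma IsSuper.costSum_le {Y : Matrix (Fin d) (Fin d) ℝ} (h : IsSuper S.A S.B S.Q S.R K Y) (t : ℕ)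
    (x : Fin d → ℝ) : qf (costSum (S.A + S.B * K) (stepCost S K) t) x ≤ qf Y x := by
  -- The induction needs the remaining cost-to-go on the left, as in a telescoping sum.
  have : qf (costSum (S.A + S.B * K) (stepCost S K) t) x + qf Y ((S.A + S.B * K) ^ t *ᵥ x) ≤ qf Y x := by
    induction t with
    | zero => simp [costSum, qf]
    | succ t ih =>
      rw [qf_costSum, Finset.sum_range_succ, ← qf_costSum, pow_succ', ← Matrix.mulVec_mulVec, qf_stepCost]
      have := h.2 ((S.A + S.B * K) ^ t *ᵥ x)
      rw [Matrix.add_mulVec (S.A), ← Matrix.mulVec_mulVec _ S.B K]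
      linarith
  linarith [h.1.2 ((S.A + S.B * K) ^ t *ᵥ x)]

lemma J_le_of_isSuper (hQ : PSD S.Q) (hR : PSD S.R) {Y : Matrix (Fin d) (Fin d) ℝ}
    (h : IsSuper S.A S.B S.Q S.R K Y) : S.J K ≤ ENNReal.ofReal (S.σ ^ 2 * Y.trace) := by
  have h1 : ∀ T : ℕ, (∫⁻ w, ENNReal.ofReal (∑ t ∈ Finset.Icc 1 T, S.cost (linearPolicy K) w t)
      ∂(noiseLaw d S.σ)) / (T : ℝ≥0∞) ≤ ENNReal.ofReal (S.σ ^ 2 * Y.trace) := fun T => by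
    rw [lintegral_linear_cost hQ hR]
    refine ENNReal.div_le_of_le_mul ?_
    rw [← ENNReal.ofReal_natCast T, ← ENNReal.ofReal_mul
      (mul_nonneg (sq_nonneg _) (trace_nonneg_of_qf h.1.2))]
    refine ENNReal.ofReal_le_ofReal ?_
    rw [mul_assoc]
    gcongr
    calc _ ≤ ∑ t ∈ Finset.range T, Y.trace :=
          Finset.sum_le_sum fun t _ => trace_mono (h.costSum_le t)
      _ = _ := by simp [mul_comm]
  exact limsup_le_of_le (by isBoundedDefault) (Eventually.of_forall h1)

lemma costSum_trace_mono {F M : Matrix (Fin d) (Fin d) ℝ} (hM : ∀ x, 0 ≤ qf M x) :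
    Monotone fun t => (costSum F M t).trace :=
  monotone_nat_of_le_succ fun t => trace_mono fun x => by
    rw [qf_costSum, qf_costSum, Finset.sum_range_succ]; linarith [hM (F ^ t *ᵥ x)]

/-- Expected costs are nonnegative and nondecreasing in time. If one of them were ν + 2δ, then from
that time on all would be, and the averages would eventually exceed ν + δ. -/
lemma costSum_trace_le_of_J_le (hQ : PSD S.Q) (hR : PSD S.R) {ν : ℝ} (hν : 0 ≤ ν)
    (h : S.J K ≤ ENNReal.ofReal ν) (n : ℕ) :
    S.σ ^ 2 * (costSum (S.A + S.B * K) (stepCost S K) n).trace ≤ ν := by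
  set a : ℕ → ℝ := fun t => (costSum (S.A + S.B * K) (stepCost S K) t).trace with ha
  have hM : ∀ x, 0 ≤ qf (stepCost S K) x := fun x => by
    rw [qf_stepCost]; exact add_nonneg (hQ.2 _) (hR.2 _)
  have hmono : Monotone a := costSum_trace_mono hM
  have ha0 : ∀ t, 0 ≤ a t := fun t => trace_nonneg_of_qf fun x => by
    rw [qf_costSum]; exact Finset.sum_nonneg fun _ _ => hM _
  by_contra! hlt
  set δ := (S.σ ^ 2 * a n - ν) / 2 with hδ
  have hδ0 : 0 < δ := by rw [hδ]; linarith
  have h1 : S.J K < ENNReal.ofReal (ν + δ) :=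
    h.trans_lt ((ENNReal.ofReal_lt_ofReal_iff (by linarith)).2 (by linarith))
  have h2 := eventually_lt_of_limsup_lt h1 (by isBoundedDefault)
  have h3 : ∀ᶠ T : ℕ in atTop, n * (ν + 2 * δ) < T * δ := by
    have : Tendsto (fun T : ℕ => (T : ℝ) * δ) atTop atTop :=
      tendsto_natCast_atTop_atTop.atTop_mul_const hδ0
    exact this.eventually_gt_atTop _
  obtain ⟨T, hT1, hT2, hT3, hT4⟩ := (h2.and (h3.and ((eventually_ge_atTop n).and (eventually_gt_atTop 0)))).exists
  rw [lintegral_linear_cost hQ hR, ENNReal.div_lt_iff (Or.inl (by positivity)) (Or.inl (by simp)),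
    ← ENNReal.ofReal_natCast T, ← ENNReal.ofReal_mul (by linarith),
    ENNReal.ofReal_lt_ofReal_iff (by positivity)] at hT1
  have h4 : ((T : ℝ) - n) * a n ≤ ∑ t ∈ Finset.range T, a t := by
    rw [← Finset.sum_range_add_sum_Ico a hT3]
    have h5 : ∑ t ∈ Finset.Ico n T, a n ≤ ∑ t ∈ Finset.Ico n T, a t :=
      Finset.sum_le_sum fun t ht => hmono (Finset.mem_Ico.1 ht).1
    have h6 : 0 ≤ ∑ t ∈ Finset.range n, a t := Finset.sum_nonneg fun t _ => ha0 t
    simp only [Finset.sum_const, Nat.card_Ico, nsmul_eq_mul, Nat.cast_sub hT3] at h5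
    linarith
  have h7 := mul_le_mul_of_nonneg_left h4 (sq_nonneg S.σ)
  have h8 : S.σ ^ 2 * a n = ν + 2 * δ := by rw [hδ]; ring
  have h9 : S.σ ^ 2 * (((T : ℝ) - n) * a n) = (T - n) * (ν + 2 * δ) := by rw [← h8]; ring
  rw [h9] at h7
  simp only [ha] at h7
  nlinarith

/-- A controller of finite average cost has a quadratic cost-to-go. -/
lemma exists_isSuper_of_J_le (hQ : PSD S.Q) (hR : PSD S.R) (hσ : 0 < S.σ) {ν : ℝ} (hν : 0 ≤ ν)
    (h : S.J K ≤ ENNReal.ofReal ν) :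
    ∃ Y, IsSuper S.A S.B S.Q S.R K Y ∧ S.σ ^ 2 * Y.trace ≤ ν := by
  set F := S.A + S.B * K with hF
  set M := stepCost S K with hMdef
  have hMs : Mᵀ = M := stepCost_symm hQ.1 hR.1
  have hM : ∀ x, 0 ≤ qf M x := fun x => by
    rw [qf_stepCost]; exact add_nonneg (hQ.2 _) (hR.2 _)
  have hterm : ∀ j, PSD ((F ^ j)ᵀ * M * F ^ j) := fun j =>
    ⟨by simp [Matrix.transpose_mul, hMs, Matrix.mul_assoc], fun x => by rw [qf_conj]; exact hM _⟩
  -- Each term is positive semidefinite, so its norm is at most its trace, and the partial sums of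
  -- the traces are bounded by ν/σ².
  have hsum : Summable fun j => (F ^ j)ᵀ * M * F ^ j := by
    refine Summable.of_norm_bounded (g := fun j => ((F ^ j)ᵀ * M * F ^ j).trace) ?_ fun j =>
      norm_le_of_qf_le (hterm j) (trace_nonneg_of_qf (hterm j).2) (hterm j).qf_le_trace
    refine summable_of_sum_range_le (c := ν / S.σ ^ 2) (fun j => trace_nonneg_of_qf (hterm j).2) fun n => ?_
    have := costSum_trace_le_of_J_le hQ hR hν h n
    rw [le_div_iff₀ (by positivity), ← Matrix.trace_sum, mul_comm]
    exact this
  set Y := ∑' j, (F ^ j)ᵀ * M * F ^ j with hY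
  have hlim : Tendsto (fun n => costSum F M n) atTop (nhds Y) := hsum.hasSum.tendsto_sum_nat
  have hqf : ∀ x, Tendsto (fun n => qf (costSum F M n) x) atTop (nhds (qf Y x)) := fun x =>
    ((continuous_qf_left x).tendsto Y).comp hlim
  have hYs : Yᵀ = Y := by
    refine tendsto_nhds_unique (((continuous_id.matrix_transpose).tendsto Y).comp hlim) ?_
    refine hlim.congr fun n => ?_
    simp only [Function.comp, id, costSum, Matrix.transpose_sum]
    exact Finset.sum_congr rfl fun j _ => (hterm j).1.symm
  refine ⟨Y, ⟨⟨hYs, fun x => ?_⟩, fun x => ?_⟩, ?_⟩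
  · refine ge_of_tendsto' (hqf x) fun n => ?_
    rw [qf_costSum]; exact Finset.sum_nonneg fun _ _ => hM _
  -- The Bellman inequality holds with equality: it is the limit of the identity obtained by
  -- removing the first term of a partial sum.
  · refine le_of_eq (tendsto_nhds_unique ?_ ((hqf x).comp (tendsto_add_atTop_nat 1)))
    have h1 := (hqf (S.A *ᵥ x + S.B *ᵥ (K *ᵥ x))).const_add (qf S.Q x + qf S.R (K *ᵥ x))
    refine h1.congr fun n => ?_
    simp only [Function.comp]
    rw [costSum_conj, qf_add_left, qf_costSum, qf_costSum, ← qf_stepCost]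
    congr 1
    refine Finset.sum_congr rfl fun j _ => ?_
    rw [qf_conj, Matrix.mulVec_mulVec, Matrix.mulVec_mulVec, ← Matrix.add_mulVec, Matrix.mulVec_mulVec,
      ← pow_succ', ← pow_succ]
  · have ht : Tendsto (fun n => S.σ ^ 2 * (costSum F M n).trace) atTop (nhds (S.σ ^ 2 * Y.trace)) :=
      (((continuous_id.matrix_trace).tendsto Y).comp hlim).const_mul _
    exact le_of_tendsto' ht fun n => costSum_trace_le_of_J_le hQ hR hν h n

end AverageCost


/-! ### Optimal control of an LQR system -/

section Optimal

variable {d k : ℕ} {S : System d k} {K K₀ : Matrix (Fin k) (Fin d) ℝ} {P : Matrix (Fin d) (Fin d) ℝ}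
  {α₀ α₁ ϑ ν ν₀ g : ℝ}

lemma exists_qf_ge {n : ℕ} {M : Matrix (Fin n) (Fin n) ℝ} (hM : M.PosDef) :
    ∃ a : ℝ, 0 < a ∧ ∀ x, a * (x ⬝ᵥ x) ≤ qf M x := by
  have h : 0 < (‖M⁻¹‖ + 1)⁻¹ := by positivity
  exact ⟨_, h, qf_ge_of_norm_inv_le hM h (by rw [inv_inv]; linarith)⟩

lemma trace_le_of_J_le (hQ : S.Q.PosDef) (hR : S.R.PosDef) (hσ : 0 < S.σ)
    (hP : IsRiccatiSol S.A S.B S.Q S.R P) {c : ℝ} (hc : 0 ≤ c) (h : S.J K ≤ ENNReal.ofReal c) :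
    S.σ ^ 2 * P.trace ≤ c := by
  obtain ⟨a, ha, hQa⟩ := exists_qf_ge hQ
  obtain ⟨Y, hY, hYt⟩ := exists_isSuper_of_J_le (psd_of_posDef hQ) (psd_of_posDef hR) hσ hc h
  refine le_trans ?_ hYt
  gcongr
  exact trace_mono (hP.le_of_isSuper ha hQa hR hY)

lemma J_gain_le (hQ : S.Q.PosDef) (hR : S.R.PosDef) (hP : IsRiccatiSol S.A S.B S.Q S.R P) :
    S.J (gain S.A S.B S.R P) ≤ ENNReal.ofReal (S.σ ^ 2 * P.trace) :=
  J_le_of_isSuper (psd_of_posDef hQ) (psd_of_posDef hR) (hP.isSuper hR)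

/-- The gain of `P` attains σ² tr P. Conversely, any controller of finite cost has a supersolution
with trace at most J/σ², and `P` lies below it. -/
lemma Jstar_eq (hQ : S.Q.PosDef) (hR : S.R.PosDef) (hσ : 0 < S.σ)
    (hP : IsRiccatiSol S.A S.B S.Q S.R P) : S.Jstar = ENNReal.ofReal (S.σ ^ 2 * P.trace) := by
  refine le_antisymm ((iInf_le _ _).trans (J_gain_le hQ hR hP)) (le_iInf fun K => ?_)
  rcases eq_or_ne (S.J K) ⊤ with h | h
  · rw [h]; exact le_top
  · rw [← ENNReal.ofReal_toReal h]
    exact ENNReal.ofReal_le_ofReal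
      (trace_le_of_J_le hQ hR hσ hP ENNReal.toReal_nonneg (ENNReal.ofReal_toReal h).ge)

lemma exists_isRiccatiSol_of_Jstar_le (hQ : S.Q.PosDef) (hR : S.R.PosDef) (hσ : 0 < S.σ)
    (h : S.Jstar ≤ ENNReal.ofReal ν) : ∃ P, IsRiccatiSol S.A S.B S.Q S.R P := by
  obtain ⟨K, hK⟩ := iInf_lt_iff.1 (h.trans_lt ENNReal.ofReal_lt_top)
  obtain ⟨a, ha, hQa⟩ := exists_qf_ge hQ
  obtain ⟨Y, hY, -⟩ := exists_isSuper_of_J_le (psd_of_posDef hQ) (psd_of_posDef hR) hσ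
    ENNReal.toReal_nonneg (ENNReal.ofReal_toReal hK.ne).ge
  exact exists_isRiccatiSol ha (transpose_eq_of_posDef hQ) hQa hR hY

/-- The supersolution of an optimal controller lies above `P` and has no larger trace, so it equals
`P`. Its Bellman inequality then leaves no room for the Hessian term of K − K⋆, and the Hessian
dominates the positive definite `R`. -/
lemma IsOptimal.eq_gain (hQ : S.Q.PosDef) (hR : S.R.PosDef) (hσ : 0 < S.σ)
    (hP : IsRiccatiSol S.A S.B S.Q S.R P) (h : S.IsOptimal K) : K = gain S.A S.B S.R P := by
  obtain ⟨a, ha, hQa⟩ := exists_qf_ge hQ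
  have hPp := psd_of_posDef hP.1
  obtain ⟨Y, hY, hYt⟩ := exists_isSuper_of_J_le (psd_of_posDef hQ) (psd_of_posDef hR) hσ
    (mul_nonneg (sq_nonneg _) (trace_nonneg_of_qf hPp.2)) ((h _).trans (J_gain_le hQ hR hP))
  have hle := hP.le_of_isSuper ha hQa hR hY
  have heq : P = Y := eq_of_qf_le_of_trace_le hPp.1 hY.1.1 hle
    (le_of_mul_le_mul_left hYt (by positivity))
  obtain ⟨b, hb, hRb⟩ := exists_qf_ge hR
  refine Matrix.ext_of_mulVec_single fun i => ?_
  have h1 := hY.2 (Pi.single i 1)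
  rw [← heq] at h1
  have h2 := complete_square (A := S.A) (B := S.B) (Q := S.Q) hR hPp (Pi.single i 1) (K *ᵥ Pi.single i 1)
  rw [ric, ← hP.2] at h2
  set v := K *ᵥ Pi.single i 1 - gain S.A S.B S.R P *ᵥ Pi.single i 1 with hv
  have h3 : qf (hess S.B S.R P) v ≤ 0 := by linarith
  rw [qf_hess] at h3
  have h4 := hRb v
  have h5 := hPp.2 (S.B *ᵥ v)
  have h6 := dot_self_nonneg v
  have h7 : v ⬝ᵥ v = 0 := by nlinarith
  exact sub_eq_zero.1 (dotProduct_self_eq_zero.1 h7)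

/-- The Riccati solution and its quantitative bounds. -/
lemma System.Admissible.exists_bounded (h : S.Admissible K₀ α₀ α₁ ϑ ν ν₀) (hg : 1 ≤ g)
    (h0 : α₀⁻¹ ≤ g) (hϑ : ϑ ≤ g) (hν : ν / S.σ ^ 2 ≤ g) :
    ∃ P, Bounded S.A S.B S.Q S.R P g ∧ S.σ ^ 2 * P.trace ≤ ν ∧
      S.Jstar = ENNReal.ofReal (S.σ ^ 2 * P.trace) := by
  obtain ⟨P, hP⟩ := exists_isRiccatiSol_of_Jstar_le h.Q_posDef h.R_posDef h.sigma_pos h.Jstar_le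
  have hPp := psd_of_posDef hP.1
  have hJ := Jstar_eq h.Q_posDef h.R_posDef h.sigma_pos hP
  have ht : S.σ ^ 2 * P.trace ≤ ν := by
    have := h.Jstar_le
    rw [hJ] at this
    exact (ENNReal.ofReal_le_ofReal_iff h.nu_pos.le).1 this
  have hσ := h.sigma_pos
  have hα : g⁻¹ ≤ α₀ := inv_le_of_inv_le₀ h.alpha0_pos h0
  refine ⟨P, ⟨hg, transpose_eq_of_posDef h.Q_posDef, h.R_posDef, fun x => ?_, fun x => ?_,
    h.A_le.trans hϑ, h.B_le.trans hϑ, hP, fun x => ?_⟩, ht, hJ⟩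
  · exact (mul_le_mul_of_nonneg_right hα (dot_self_nonneg x)).trans
      (qf_ge_of_norm_inv_le h.Q_posDef h.alpha0_pos h.Q_inv_le x)
  · exact (mul_le_mul_of_nonneg_right hα (dot_self_nonneg x)).trans
      (qf_ge_of_norm_inv_le h.R_posDef h.alpha0_pos h.R_inv_le x)
  · refine (hPp.qf_le_trace x).trans (mul_le_mul_of_nonneg_right (le_trans ?_ hν) (dot_self_nonneg x))
    rw [le_div_iff₀ (by positivity)]; linarith

lemma Bounded.optController_eq {A : Matrix (Fin d) (Fin d) ℝ} {B : Matrix (Fin d) (Fin k) ℝ}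
    {Q : Matrix (Fin d) (Fin d) ℝ} {R : Matrix (Fin k) (Fin k) ℝ} (h : Bounded A B Q R P g) :
    optController A B Q R = gain A B R P :=
  LQ.optController_eq (inv_pos.2 h.pos) h.Q_ge h.R_posDef h.sol

/-- The optimal controller is a Lipschitz function of the system. -/
lemma Bounded.optController_near {A A' : Matrix (Fin d) (Fin d) ℝ} {B B' : Matrix (Fin d) (Fin k) ℝ}
    {Q : Matrix (Fin d) (Fin d) ℝ} {R : Matrix (Fin k) (Fin k) ℝ} (h : Bounded A B Q R P g)
    {ε : ℝ} (hε : 0 ≤ ε) (hε' : 128 * g ^ 3 * ε ≤ 1) (hA : ‖A' - A‖ ≤ ε) (hB : ‖B' - B‖ ≤ ε) :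
    (∃ P', IsRiccatiSol A' B' Q R P') ∧
      ‖optController A' B' Q R - gain A B R P‖ ≤ 2100 * g ^ 8 * ε := by
  obtain ⟨P', h', hP'⟩ := h.near hε hε' hA hB
  exact ⟨⟨P', h'.sol⟩, by rw [h'.optController_eq]; exact h.gain_sub_norm h' hε hA hB hP'⟩

/-- With δ = 2100g⁸ε the gain lemma requires the relative enlargement 4g⁴δ² = (4200g¹⁰ε)² of `P`;
multiplied by σ² tr P ≤ g this is 17640000 g²¹ε². The hypothesis on ε₀ keeps the enlargement at most
1. -/
lemma Bounded.perturbationBound (h : Bounded S.A S.B S.Q S.R P g) (hQ : S.Q.PosDef) (hσ : 0 < S.σ)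
    (hR : ‖S.R‖ ≤ g) (ht : S.σ ^ 2 * P.trace ≤ g) {C₀ ε₀ : ℝ} (hC : 17640000 * g ^ 21 ≤ C₀)
    (hε₀ : 4200 * g ^ 10 * ε₀ ≤ 1) : S.PerturbationBound C₀ ε₀ := by
  intro ε A B hε hεε hA hB
  have hg := h.pos
  have hg1 := h.one_le
  have h42 : 4200 * g ^ 10 * ε ≤ 1 := le_trans (by gcongr) hε₀
  have hε' : 128 * g ^ 3 * ε ≤ 1 := by
    have : g ^ 3 * ε ≤ g ^ 10 * ε := by gcongr; norm_num
    have : 0 ≤ g ^ 10 * ε := by positivity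
    linarith
  obtain ⟨hex, hK⟩ := h.optController_near hε hε' hA hB
  have hJ := Jstar_eq hQ h.R_posDef hσ h.sol
  refine ⟨hex, ?_, fun Kstar hKs => ?_⟩
  · have e1 : 4 * g ^ 4 * (2100 * g ^ 8 * ε) ^ 2 = (4200 * g ^ 10 * ε) ^ 2 := by ring
    have hδ : 4 * g ^ 4 * (2100 * g ^ 8 * ε) ^ 2 ≤ 1 := by
      rw [e1]; exact pow_le_one₀ (by positivity) h42
    refine (J_le_of_isSuper (psd_of_posDef hQ) (psd_of_posDef h.R_posDef)
      (h.isSuper_of_gain_near hR hδ hK)).trans ?_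
    have h0 : 0 ≤ S.σ ^ 2 * P.trace := mul_nonneg (sq_nonneg _) (trace_nonneg_of_qf h.psd.2)
    rw [hJ, ← ENNReal.ofReal_add h0 (by nlinarith [pow_pos hg 21, sq_nonneg ε])]
    refine ENNReal.ofReal_le_ofReal ?_
    rw [Matrix.trace_smul, smul_eq_mul, e1]
    have h1 : (4200 * g ^ 10 * ε) ^ 2 * (S.σ ^ 2 * P.trace) ≤ (4200 * g ^ 10 * ε) ^ 2 * g := by gcongr
    have h2 : 17640000 * g ^ 21 * ε ^ 2 ≤ C₀ * ε ^ 2 := by gcongr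
    linarith
  · rw [IsOptimal.eq_gain hQ h.R_posDef hσ h.sol hKs]
    refine hK.trans ?_
    have : g ^ 8 * ε ≤ g ^ 21 * ε := by gcongr; norm_num
    have : 17640000 * g ^ 21 * ε ≤ C₀ * ε := by gcongr
    have : 0 ≤ g ^ 21 * ε := by positivity
    linarith

instance {m n : ℕ} : MeasurableSpace (Matrix (Fin m) (Fin n) ℝ) :=
  inferInstanceAs (MeasurableSpace (Fin m → Fin n → ℝ))

instance {m n : ℕ} : BorelSpace (Matrix (Fin m) (Fin n) ℝ) :=
  inferInstanceAs (BorelSpace (Fin m → Fin n → ℝ))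

/-- The optimal controller is a measurable function of the transition matrix. -/
lemma measurable_optController {B : Matrix (Fin d) (Fin k) ℝ}
    {Q : Matrix (Fin d) (Fin d) ℝ} {R : Matrix (Fin k) (Fin k) ℝ} (hQ : Q.PosDef) (hR : R.PosDef) :
    Measurable fun A : Matrix (Fin d) (Fin d) ℝ => optController A B Q R := by
  classical
  obtain ⟨a, ha, hQa⟩ := exists_qf_ge hQ
  obtain ⟨b, hb, hRb⟩ := exists_qf_ge hR
  set U : Set (Matrix (Fin d) (Fin d) ℝ) := {A | ∃ P, IsRiccatiSol A B Q R P} with hU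
  have key : ∀ A ∈ U, ∃ P g, Bounded A B Q R P g := fun A ⟨P, hP⟩ => by
    refine ⟨P, 1 + a⁻¹ + b⁻¹ + ‖A‖ + ‖B‖ + ‖P‖, ?_⟩
    set g := 1 + a⁻¹ + b⁻¹ + ‖A‖ + ‖B‖ + ‖P‖ with hg
    have h1 := norm_nonneg A
    have h2 := norm_nonneg B
    have h3 := norm_nonneg P
    have h4 := inv_pos.2 ha
    have h5 := inv_pos.2 hb
    refine ⟨by linarith, transpose_eq_of_posDef hQ, hR, fun x => ?_, fun x => ?_, by linarith, by linarith,
      hP, fun x => ?_⟩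
    · exact (mul_le_mul_of_nonneg_right (inv_le_of_inv_le₀ ha (by linarith)) (dot_self_nonneg x)).trans (hQa x)
    · exact (mul_le_mul_of_nonneg_right (inv_le_of_inv_le₀ hb (by linarith)) (dot_self_nonneg x)).trans (hRb x)
    · exact (qf_le_norm P x).trans (mul_le_mul_of_nonneg_right (by linarith) (dot_self_nonneg x))
  have hopen : IsOpen U := by
    rw [Metric.isOpen_iff]
    intro A hA
    obtain ⟨P, g, h⟩ := key A hA
    have hg := h.pos
    refine ⟨(128 * g ^ 3)⁻¹, by positivity, fun A' hA' => ?_⟩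
    rw [Metric.mem_ball, dist_eq_norm] at hA'
    exact (h.optController_near (ε := (128 * g ^ 3)⁻¹) (by positivity)
      (by rw [mul_inv_cancel₀ (by positivity)]) hA'.le (by simp; positivity)).1
  have hcont : ContinuousOn (fun A => optController A B Q R) U := by
    intro A hA
    refine ContinuousAt.continuousWithinAt ?_
    obtain ⟨P, g, h⟩ := key A hA
    have hg := h.pos
    rw [Metric.continuousAt_iff]
    intro e he
    refine ⟨min (128 * g ^ 3)⁻¹ (e / (2100 * g ^ 8)), by positivity, fun A' hA' => ?_⟩
    rw [dist_eq_norm] at hA' ⊢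
    obtain ⟨h1, h2⟩ := lt_min_iff.1 hA'
    rw [h.optController_eq]
    refine (h.optController_near (norm_nonneg (A' - A)) ?_ le_rfl (by simp)).2.trans_lt ?_
    · calc 128 * g ^ 3 * ‖A' - A‖ ≤ 128 * g ^ 3 * (128 * g ^ 3)⁻¹ := by gcongr
        _ = 1 := mul_inv_cancel₀ (by positivity)
    · rw [lt_div_iff₀ (by positivity)] at h2; linarith
  -- The controller is continuous on the open set of solvable systems and equals the default value 0
  -- off it, so it is Borel measurable although it need not be continuous.
  have h0 : (fun A => optController A B Q R) = U.piecewise (fun A => optController A B Q R) fun _ => 0 := by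
    funext A
    by_cases hA : A ∈ U
    · rw [Set.piecewise_eq_of_mem _ _ _ hA]
    · rw [Set.piecewise_eq_of_notMem _ _ _ hA, optController]; exact dif_neg hA
  rw [h0]
  exact hcont.measurable_piecewise continuousOn_const hopen.measurableSet

end Optimal


/-! ### The least-squares estimator -/

namespace AlgInput

variable {d k : ℕ} {p : AlgInput d k} {x : ℕ → Fin d → ℝ} {u : ℕ → Fin k → ℝ} {τ : ℕ}

/-- The regularized Gram matrix of the observed states. -/
def gram (p : AlgInput d k) (x : ℕ → Fin d → ℝ) (τ : ℕ) : Matrix (Fin d) (Fin d) ℝ :=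
  p.lam • 1 + ∑ s ∈ Finset.Icc 1 (τ - 1), Matrix.vecMulVec (x s) (x s)

/-- The correlation of the regression targets with the states. -/
def corr (p : AlgInput d k) (x : ℕ → Fin d → ℝ) (u : ℕ → Fin k → ℝ) (τ : ℕ) : Matrix (Fin d) (Fin d) ℝ :=
  ∑ s ∈ Finset.Icc 1 (τ - 1), Matrix.vecMulVec (x (s + 1) - p.B *ᵥ u s) (x s)

lemma vecMulVec_mulVec' {m n : ℕ} (a : Fin m → ℝ) (b v : Fin n → ℝ) :
    Matrix.vecMulVec a b *ᵥ v = (b ⬝ᵥ v) • a := by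
  ext i
  simp only [Matrix.mulVec, dotProduct, Matrix.vecMulVec_apply, Pi.smul_apply, smul_eq_mul, Finset.sum_mul]
  exact Finset.sum_congr rfl fun j _ => by ring

lemma sum_mulVec {ι : Type*} {m n : ℕ} (s : Finset ι) (f : ι → Matrix (Fin m) (Fin n) ℝ) (v : Fin n → ℝ) :
    (∑ i ∈ s, f i) *ᵥ v = ∑ i ∈ s, f i *ᵥ v := by
  classical
  induction s using Finset.induction_on with
  | empty => simp
  | insert a s ha ih => rw [Finset.sum_insert ha, Finset.sum_insert ha, Matrix.add_mulVec, ih]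

lemma qf_gram (v : Fin d → ℝ) :
    qf (p.gram x τ) v = p.lam * (v ⬝ᵥ v) + ∑ s ∈ Finset.Icc 1 (τ - 1), (x s ⬝ᵥ v) ^ 2 := by
  rw [gram, qf_add_left, qf_smul_left]
  congr 1
  · simp [qf]
  · rw [qf, sum_mulVec, dotProduct_sum]
    refine Finset.sum_congr rfl fun s _ => ?_
    rw [vecMulVec_mulVec', dotProduct_smul, smul_eq_mul, dotProduct_comm v]; ring

lemma gram_symm : (p.gram x τ)ᵀ = p.gram x τ := by
  simp only [gram, Matrix.transpose_add, Matrix.transpose_smul, Matrix.transpose_one, Matrix.transpose_sum]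
  congr 1
  exact Finset.sum_congr rfl fun s _ => by ext i j; simp [Matrix.vecMulVec_apply, mul_comm]

lemma gram_ge (v : Fin d → ℝ) : p.lam * (v ⬝ᵥ v) ≤ qf (p.gram x τ) v := by
  rw [qf_gram]
  have : 0 ≤ ∑ s ∈ Finset.Icc 1 (τ - 1), (x s ⬝ᵥ v) ^ 2 := Finset.sum_nonneg fun _ _ => sq_nonneg _
  linarith

lemma gram_isUnit_det (h : 0 < p.lam) : IsUnit (p.gram x τ).det :=
  (Matrix.isUnit_iff_isUnit_det _).1 (posDef_of_le gram_symm h gram_ge).isUnit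

lemma dot_mulVec_eq_sum (y v : Fin d → ℝ) (D : Matrix (Fin d) (Fin d) ℝ) :
    y ⬝ᵥ D *ᵥ v = ∑ i, ∑ j, D i j * Matrix.vecMulVec y v i j := by
  simp only [dotProduct, Matrix.mulVec, Finset.mul_sum, Matrix.vecMulVec_apply]
  exact Finset.sum_congr rfl fun i _ => Finset.sum_congr rfl fun j _ => by ring

/-- The normal equations characterize the minimizer of the least-squares objective. -/
lemma lsObjective_eq {A : Matrix (Fin d) (Fin d) ℝ} (hA : A * p.gram x τ = p.corr x u τ)
    (A' : Matrix (Fin d) (Fin d) ℝ) :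
    p.lsObjective x u τ A' = p.lsObjective x u τ A +
      ∑ s ∈ Finset.Icc 1 (τ - 1), ((A' - A) *ᵥ x s) ⬝ᵥ ((A' - A) *ᵥ x s) +
      p.lam * ∑ i, ∑ j, (A' - A) i j ^ 2 := by
  set D := A' - A with hD
  have hA' : A' = A + D := by rw [hD]; abel
  -- By the normal equations the residuals correlate with the states to exactly λA, so the cross
  -- term of the squares cancels the cross term of the regularizer.
  have h1 : ∑ s ∈ Finset.Icc 1 (τ - 1), ((x (s + 1) - p.B *ᵥ u s) - A *ᵥ x s) ⬝ᵥ (D *ᵥ x s) =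
      p.lam * ∑ i, ∑ j, D i j * A i j := by
    have e1 : ∑ s ∈ Finset.Icc 1 (τ - 1), Matrix.vecMulVec ((x (s + 1) - p.B *ᵥ u s) - A *ᵥ x s) (x s) =
        p.lam • A := by
      have : ∀ s, Matrix.vecMulVec ((x (s + 1) - p.B *ᵥ u s) - A *ᵥ x s) (x s) =
          Matrix.vecMulVec (x (s + 1) - p.B *ᵥ u s) (x s) - A * Matrix.vecMulVec (x s) (x s) := fun s => by
        rw [Matrix.sub_vecMulVec, Matrix.mul_vecMulVec]
      rw [Finset.sum_congr rfl fun s _ => this s, Finset.sum_sub_distrib, ← corr, ← hA, gram,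
        Matrix.mul_add, Matrix.mul_sum, add_sub_cancel_right, Matrix.mul_smul, Matrix.mul_one]
    have e2 : ∀ i j, ∑ s ∈ Finset.Icc 1 (τ - 1),
        Matrix.vecMulVec ((x (s + 1) - p.B *ᵥ u s) - A *ᵥ x s) (x s) i j = p.lam * A i j := fun i j => by
      have := congrFun (congrFun e1 i) j
      rwa [Matrix.sum_apply, Matrix.smul_apply, smul_eq_mul] at this
    simp_rw [dot_mulVec_eq_sum]
    rw [Finset.sum_comm, Finset.mul_sum]
    refine Finset.sum_congr rfl fun i _ => ?_
    rw [Finset.sum_comm, Finset.mul_sum]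
    refine Finset.sum_congr rfl fun j _ => ?_
    rw [← Finset.mul_sum, e2]; ring
  have h2 : ∀ s, ((x (s + 1) - p.B *ᵥ u s) - A' *ᵥ x s) ⬝ᵥ ((x (s + 1) - p.B *ᵥ u s) - A' *ᵥ x s) =
      ((x (s + 1) - p.B *ᵥ u s) - A *ᵥ x s) ⬝ᵥ ((x (s + 1) - p.B *ᵥ u s) - A *ᵥ x s) -
      2 * (((x (s + 1) - p.B *ᵥ u s) - A *ᵥ x s) ⬝ᵥ (D *ᵥ x s)) + (D *ᵥ x s) ⬝ᵥ (D *ᵥ x s) := fun s => by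
    rw [hA', Matrix.add_mulVec, ← sub_sub]
    set e := x (s + 1) - p.B *ᵥ u s - A *ᵥ x s
    simp only [sub_dotProduct, dotProduct_sub, dotProduct_comm (D *ᵥ x s) e]; ring
  have h3 : ∑ i, ∑ j, A' i j ^ 2 = ∑ i, ∑ j, A i j ^ 2 + 2 * ∑ i, ∑ j, D i j * A i j +
      ∑ i, ∑ j, D i j ^ 2 := by
    rw [Finset.mul_sum, ← Finset.sum_add_distrib, ← Finset.sum_add_distrib]
    refine Finset.sum_congr rfl fun i _ => ?_
    rw [Finset.mul_sum, ← Finset.sum_add_distrib, ← Finset.sum_add_distrib]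
    refine Finset.sum_congr rfl fun j _ => ?_
    rw [hA', Matrix.add_apply]; ring
  simp only [lsObjective]
  rw [Finset.sum_congr rfl fun s _ => h2 s, Finset.sum_add_distrib, Finset.sum_sub_distrib, ← Finset.mul_sum,
    h1, h3]
  ring

lemma estimate_eq (h : 0 < p.lam) : p.estimate x u τ = p.corr x u τ * (p.gram x τ)⁻¹ := by
  set A := p.corr x u τ * (p.gram x τ)⁻¹ with hA
  have hN : A * p.gram x τ = p.corr x u τ := by
    rw [hA, Matrix.mul_assoc, Matrix.nonsing_inv_mul _ (gram_isUnit_det h), Matrix.mul_one]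
  have hex : ∃ A, ∀ A', p.lsObjective x u τ A ≤ p.lsObjective x u τ A' := by
    refine ⟨A, fun A' => ?_⟩
    rw [lsObjective_eq hN A']
    have h1 : 0 ≤ ∑ s ∈ Finset.Icc 1 (τ - 1), ((A' - A) *ᵥ x s) ⬝ᵥ ((A' - A) *ᵥ x s) :=
      Finset.sum_nonneg fun s _ => dot_self_nonneg _
    have h2 : 0 ≤ p.lam * ∑ i, ∑ j, (A' - A) i j ^ 2 := by positivity
    linarith
  have hmin := Classical.epsilon_spec hex A
  change p.lsObjective x u τ (p.estimate x u τ) ≤ _ at hmin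
  set E := p.estimate x u τ
  rw [lsObjective_eq hN E] at hmin
  have h1 : 0 ≤ ∑ s ∈ Finset.Icc 1 (τ - 1), ((E - A) *ᵥ x s) ⬝ᵥ ((E - A) *ᵥ x s) :=
    Finset.sum_nonneg fun s _ => dot_self_nonneg _
  have h2 : 0 ≤ ∑ i, ∑ j, (E - A) i j ^ 2 := by positivity
  have h3 : ∑ i, ∑ j, (E - A) i j ^ 2 = 0 := by nlinarith
  ext i j
  have h4 := (Finset.sum_eq_zero_iff_of_nonneg fun i _ => by positivity).1 h3 i (Finset.mem_univ i)
  have h5 := (Finset.sum_eq_zero_iff_of_nonneg fun j _ => by positivity).1 h4 j (Finset.mem_univ j)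
  have h6 : (E - A) i j = 0 := by simpa using h5
  rw [Matrix.sub_apply] at h6
  linarith

lemma estimate_mul_gram (h : 0 < p.lam) : p.estimate x u τ * p.gram x τ = p.corr x u τ := by
  rw [estimate_eq h, Matrix.mul_assoc, Matrix.nonsing_inv_mul _ (gram_isUnit_det h), Matrix.mul_one]

/-- The error of the estimator in terms of the correlation of noise and states. -/
lemma estimate_sub_norm_le (h : 0 < p.lam) {A : Matrix (Fin d) (Fin d) ℝ} {w : ℕ → Fin d → ℝ}
    (hx : ∀ s, 1 ≤ s → s < τ → x (s + 1) = A *ᵥ x s + p.B *ᵥ u s + w s) {c b : ℝ} (hc : 0 < c)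
    (hV : ∀ v, c * (v ⬝ᵥ v) ≤ qf (p.gram x τ) v)
    (hS : ‖∑ s ∈ Finset.Icc 1 (τ - 1), Matrix.vecMulVec (w s) (x s)‖ ≤ b) :
    ‖p.estimate x u τ - A‖ ≤ c⁻¹ * (b + p.lam * ‖A‖) := by
  set N := ∑ s ∈ Finset.Icc 1 (τ - 1), Matrix.vecMulVec (w s) (x s) with hN
  have e1 : p.corr x u τ = A * p.gram x τ - p.lam • A + N := by
    have : ∀ s ∈ Finset.Icc 1 (τ - 1), Matrix.vecMulVec (x (s + 1) - p.B *ᵥ u s) (x s) =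
        A * Matrix.vecMulVec (x s) (x s) + Matrix.vecMulVec (w s) (x s) := fun s hs => by
      obtain ⟨h1, h2⟩ := Finset.mem_Icc.1 hs
      rw [hx s h1 (by omega), Matrix.mul_vecMulVec, ← Matrix.add_vecMulVec]
      congr 1; abel
    rw [corr, Finset.sum_congr rfl this, Finset.sum_add_distrib, gram, Matrix.mul_add, Matrix.mul_sum,
      Matrix.mul_smul, Matrix.mul_one, ← hN]
    abel
  -- The error satisfies (Â − A)V = N − λA. It is transposed because the solver bound has the
  -- coercive matrix on the left.
  have e2 : p.gram x τ * (p.estimate x u τ - A)ᵀ = (N - p.lam • A)ᵀ := by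
    have e3 : (p.estimate x u τ - A) * p.gram x τ = N - p.lam • A := by
      rw [Matrix.sub_mul, estimate_mul_gram h, e1]; abel
    rw [← e3, Matrix.transpose_mul, gram_symm]
  rw [← norm_transpose_le]
  refine norm_le_of_mul_eq hc hV e2 ?_
  rw [norm_transpose_le]
  refine (norm_sub_le _ _).trans ?_
  rw [norm_smul, Real.norm_of_nonneg h.le]
  gcongr

/-! ### Phases -/

lemma phaseStart_le (hτ : 1 ≤ p.τ₀) {t : ℕ} (ht : p.τ₀ ≤ t) : p.phaseStart t ≤ t := by
  have h1 : t / p.τ₀ ≠ 0 := (Nat.div_pos ht hτ).ne'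
  calc p.phaseStart t ≤ p.τ₀ * (t / p.τ₀) := Nat.mul_le_mul_left _ (Nat.pow_log_le_self 4 h1)
    _ ≤ t := Nat.mul_div_le t p.τ₀

lemma le_phaseStart (t : ℕ) : p.τ₀ ≤ p.phaseStart t := Nat.le_mul_of_pos_right _ (by positivity)

lemma lt_four_mul_phaseStart (hτ : 1 ≤ p.τ₀) (t : ℕ) : t < 4 * p.phaseStart t := by
  have h1 := Nat.lt_pow_succ_log_self (b := 4) (by norm_num) (t / p.τ₀)
  have h2 := Nat.lt_mul_div_succ t hτ
  calc t < p.τ₀ * (t / p.τ₀ + 1) := h2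
    _ ≤ p.τ₀ * 4 ^ (Nat.log 4 (t / p.τ₀)).succ := Nat.mul_le_mul_left _ h1
    _ = 4 * p.phaseStart t := by rw [phaseStart, Nat.pow_succ]; ring

/-! ### Causality and measurability of the algorithm -/

lemma estimate_congr {x' : ℕ → Fin d → ℝ} {u' : ℕ → Fin k → ℝ} (hx : ∀ s, 1 ≤ s → s ≤ τ → x s = x' s)
    (hu : ∀ s, 1 ≤ s → s < τ → u s = u' s) : p.estimate x u τ = p.estimate x' u' τ := by
  have : p.lsObjective x u τ = p.lsObjective x' u' τ := by
    funext A
    simp only [lsObjective]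
    congr 1
    refine Finset.sum_congr rfl fun s hs => ?_
    obtain ⟨h1, h2⟩ := Finset.mem_Icc.1 hs
    rw [hx s h1 (by omega), hx (s + 1) (by omega) (by omega), hu s h1 (by omega)]
  rw [estimate, estimate, this]

/-- An estimate at time τ reads states up to τ and actions before τ, and a phase in progress at s
began no later than s. This is where τ₀ ≥ 1 enters. -/
lemma policy_causal (hτ : 1 ≤ p.τ₀) : Causal p.policy := by
  intro x x' u u' t ht hx hu
  have hg : ∀ s, p.τ₀ ≤ s → s ≤ t → p.greedy x u (p.phaseStart s) = p.greedy x' u' (p.phaseStart s) :=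
    fun s hs hst => by
      have := phaseStart_le hτ hs
      rw [greedy, greedy, estimate_congr (fun r h1 h2 => hx r h1 (by omega)) fun r h1 h2 => hu r h1 (by omega)]
  have hab : p.Aborted x u t ↔ p.Aborted x' u' t := by
    refine exists_congr fun s => and_congr_right fun h1 => and_congr_right fun h2 => ?_
    rw [hg s h1 h2, hx s (by omega) h2]
  by_cases h : t < p.τ₀ ∨ p.Aborted x u t
  · rw [policy, policy, if_pos h, if_pos ((or_congr_right hab).1 h), hx t ht le_rfl]
  · have h' : ¬(t < p.τ₀ ∨ p.Aborted x' u' t) := mt (or_congr_right hab).2 h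
    rw [policy, policy, if_neg h, if_neg h', hg t (by omega) le_rfl, hx t ht le_rfl]

lemma measurable_matrix {α : Type*} [MeasurableSpace α] {m n : ℕ} {f : α → Matrix (Fin m) (Fin n) ℝ}
    (h : ∀ i j, Measurable fun a => f a i j) : Measurable f :=
  measurable_pi_lambda _ fun i => measurable_pi_lambda _ fun j => h i j

lemma measurable_matrix_apply {α : Type*} [MeasurableSpace α] {m n : ℕ} {f : α → Matrix (Fin m) (Fin n) ℝ}
    (h : Measurable f) (i : Fin m) (j : Fin n) : Measurable fun a => f a i j :=
  (measurable_pi_apply j).comp ((measurable_pi_apply i).comp h)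

lemma measurable_estimate (h : 0 < p.lam) (τ : ℕ) :
    Measurable fun z : (ℕ → Fin d → ℝ) × (ℕ → Fin k → ℝ) => p.estimate z.1 z.2 τ := by
  simp_rw [estimate_eq h]
  have hg : Continuous fun z : (ℕ → Fin d → ℝ) × (ℕ → Fin k → ℝ) => p.gram z.1 τ := by
    unfold gram
    refine continuous_const.add (continuous_finsetSum _ fun s _ => ?_)
    refine continuous_matrix fun i j => ?_
    simp only [Matrix.vecMulVec_apply]; fun_prop
  have hc : Continuous fun z : (ℕ → Fin d → ℝ) × (ℕ → Fin k → ℝ) => p.corr z.1 z.2 τ := by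
    unfold corr
    refine continuous_finsetSum _ fun s _ => ?_
    refine continuous_matrix fun i j => ?_
    simp only [Matrix.vecMulVec_apply, Matrix.mulVec, dotProduct, Pi.sub_apply]; fun_prop
  refine measurable_matrix fun i j => ?_
  simp only [Matrix.mul_apply, Matrix.inv_def, Ring.inverse_eq_inv', Matrix.smul_apply, smul_eq_mul]
  refine Finset.measurable_sum _ fun l _ => Measurable.mul (hc.matrix_elem i l).measurable ?_
  exact hg.matrix_det.measurable.inv.mul (hg.matrix_adjugate.matrix_elem l j).measurable

lemma measurable_greedy (h : 0 < p.lam) (hQ : p.Q.PosDef) (hR : p.R.PosDef) (τ : ℕ) :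
    Measurable fun z : (ℕ → Fin d → ℝ) × (ℕ → Fin k → ℝ) => p.greedy z.1 z.2 τ :=
  (measurable_optController hQ hR).comp (measurable_estimate h τ)

lemma measurable_dot_self {α : Type*} [MeasurableSpace α] {n : ℕ} {f : α → Fin n → ℝ} (hf : Measurable f) :
    Measurable fun a => f a ⬝ᵥ f a := by
  simp only [dotProduct]; fun_prop

lemma policy_measurable (h : 0 < p.lam) (hQ : p.Q.PosDef) (hR : p.R.PosDef) : MeasurablePolicy p.policy := by
  classical
  intro t
  have hx : Measurable fun z : (ℕ → Fin d → ℝ) × (ℕ → Fin k → ℝ) => z.1 t :=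
    (measurable_pi_apply t).comp measurable_fst
  have hset : MeasurableSet {z : (ℕ → Fin d → ℝ) × (ℕ → Fin k → ℝ) | t < p.τ₀ ∨ p.Aborted z.1 z.2 t} := by
    refine (MeasurableSet.const _).union ?_
    have : {z : (ℕ → Fin d → ℝ) × (ℕ → Fin k → ℝ) | p.Aborted z.1 z.2 t} =
        ⋃ s ∈ {s | p.τ₀ ≤ s ∧ s ≤ t}, ({z | p.xb < z.1 s ⬝ᵥ z.1 s} ∪
          {z | p.κ < ‖p.greedy z.1 z.2 (p.phaseStart s)‖}) := by
      ext z
      simp only [Aborted, Set.mem_iUnion, exists_prop, Set.mem_union, Set.mem_ofPred_eq, and_assoc]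
    have h2 : MeasurableSet {z : (ℕ → Fin d → ℝ) × (ℕ → Fin k → ℝ) | p.Aborted z.1 z.2 t} := by
      rw [this]
      refine MeasurableSet.biUnion (Set.to_countable _) fun s _ => MeasurableSet.union ?_ ?_
      · exact measurableSet_lt measurable_const
          (measurable_dot_self ((measurable_pi_apply s).comp measurable_fst))
      · exact measurableSet_lt measurable_const (measurable_greedy h hQ hR _).norm
    exact h2
  refine Measurable.ite hset ((measurable_mulVec _).comp hx) ?_
  refine measurable_pi_lambda _ fun i => ?_
  simp only [Matrix.mulVec, dotProduct]
  exact Finset.measurable_sum _ fun j _ =>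
    (measurable_matrix_apply (measurable_greedy h hQ hR _) i j).mul ((measurable_pi_apply j).comp hx)

end AlgInput


/-! ### Deterministic analysis of trajectories -/

section Deterministic

lemma sum_Icc_one {M : Type*} [AddCommMonoid M] (f : ℕ → M) (n : ℕ) :
    ∑ s ∈ Finset.Icc 1 n, f s = ∑ s ∈ Finset.range n, f (s + 1) := by
  rw [Finset.range_eq_Ico, Finset.sum_Ico_add' f 0 n 1, zero_add, Finset.Ico_add_one_right_eq_Icc]

/-- Summing a contracting recursion. -/
lemma sum_le_of_contract {Φ b : ℕ → ℝ} {δ : ℝ} {n : ℕ} (h0 : Φ 0 = 0) (hΦ : ∀ s, 0 ≤ Φ s)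
    (h : ∀ s < n, Φ (s + 1) ≤ (1 - δ) * Φ s + b s) (hδ : δ ≤ 1) :
    δ * ∑ s ∈ Finset.range (n + 1), Φ s ≤ ∑ s ∈ Finset.range n, b s := by
  have key : ∀ m ≤ n, δ * ∑ s ∈ Finset.range m, Φ s + Φ m ≤ ∑ s ∈ Finset.range m, b s := by
    intro m hm
    induction m with
    | zero => simp [h0]
    | succ m ih =>
      rw [Finset.sum_range_succ, Finset.sum_range_succ]
      have := h m (by omega)
      have := ih (by omega)
      linarith
  rw [Finset.sum_range_succ]
  have := key n le_rfl
  nlinarith [hΦ n]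

lemma le_of_contract {Φ : ℕ → ℝ} {δ β : ℝ} {n : ℕ} (h0 : Φ 0 = 0) (hδ0 : 0 < δ) (hδ : δ ≤ 1) (hβ : 0 ≤ β)
    (h : ∀ s < n, Φ (s + 1) ≤ (1 - δ) * Φ s + β) : Φ n ≤ β / δ := by
  have key : ∀ m ≤ n, Φ m ≤ β / δ := by
    intro m hm
    induction m with
    | zero => rw [h0]; positivity
    | succ m ih =>
      have h1 := h m (by omega)
      have h2 : (1 - δ) * Φ m ≤ (1 - δ) * (β / δ) :=
        mul_le_mul_of_nonneg_left (ih (by omega)) (by linarith)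
      have h3 : (1 - δ) * (β / δ) + β = β / δ := by field_simp; ring
      linarith
  exact key n le_rfl

variable {d k : ℕ}

/-- The hypothesis is a contraction of `qf P` by 1 − 2δ with δ = (4g²)⁻¹. Young's inequality with
weight δ gives up half of that rate and multiplies the noise term by 1 + δ⁻¹. -/
lemma contract_step {P : Matrix (Fin d) (Fin d) ℝ} {g : ℝ} (hg : 1 ≤ g) (hP : PSD P)
    (hPg : ∀ x, qf P x ≤ g * (x ⬝ᵥ x)) {x z : Fin d → ℝ}
    (h : qf P z ≤ qf P x - (2 * g)⁻¹ * (x ⬝ᵥ x)) (w : Fin d → ℝ) :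
    qf P (z + w) ≤ (1 - (4 * g ^ 2)⁻¹) * qf P x + 5 * g ^ 3 * (w ⬝ᵥ w) := by
  have hg0 : 0 < g := by linarith
  set δ := (4 * g ^ 2)⁻¹ with hδ
  have hδ0 : 0 < δ := by positivity
  have h1 := hP.qf_add_le z w hδ0
  have h2 : 2 * δ * qf P x ≤ (2 * g)⁻¹ * (x ⬝ᵥ x) := by
    calc 2 * δ * qf P x ≤ 2 * δ * (g * (x ⬝ᵥ x)) := by gcongr; exact hPg x
      _ = _ := by rw [hδ]; field_simp; ring
  have h3 : (1 + δ) * qf P z ≤ (1 + δ) * ((1 - 2 * δ) * qf P x) := by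
    gcongr; linarith
  have h4 : (1 + δ) * ((1 - 2 * δ) * qf P x) ≤ (1 - δ) * qf P x := by
    have := mul_nonneg (sq_nonneg δ) (hP.2 x)
    linarith
  have h5 : (1 + δ⁻¹) * qf P w ≤ 5 * g ^ 3 * (w ⬝ᵥ w) := by
    have hww := dot_self_nonneg w
    calc (1 + δ⁻¹) * qf P w ≤ (1 + δ⁻¹) * (g * (w ⬝ᵥ w)) := by gcongr; exact hPg w
      _ = (g + 4 * g ^ 3) * (w ⬝ᵥ w) := by rw [hδ, inv_inv]; ring
      _ ≤ _ := by
        gcongr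
        have : g ^ 1 ≤ g ^ 3 := pow_le_pow_right₀ hg (by norm_num)
        linarith
  linarith

/-- Standing assumptions of the regret analysis, in terms of a single size parameter `g`. -/
structure Setting (S : System d k) (p : AlgInput d k) (P Y₀ : Matrix (Fin d) (Fin d) ℝ)
    (g ε₀ : ℝ) (T : ℕ) : Prop where
  bdd : Bounded S.A S.B S.Q S.R P g
  R_le : ‖S.R‖ ≤ g
  sigma_pos : 0 < S.σ
  sigma_le : S.σ ≤ g
  sigma_inv_le : S.σ⁻¹ ≤ g
  dim_le : (d : ℝ) ≤ g
  Q_posDef : S.Q.PosDef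
  isSuper : IsSuper S.A S.B S.Q S.R p.K₀ Y₀
  Y_le : ∀ x, qf Y₀ x ≤ g * (x ⬝ᵥ x)
  B_eq : p.B = S.B
  Q_eq : p.Q = S.Q
  R_eq : p.R = S.R
  eps_pos : 0 < ε₀
  eps_le : 4200 * g ^ 10 * ε₀ ≤ 1
  T_pos : 1 ≤ T
  kappa_ge : g + 1 ≤ p.κ
  xb_ge : 280 * g ^ 11 * Real.log (3 * T) ≤ p.xb
  tau_ge_four : 4 ≤ p.τ₀
  tau_ge : 2 + 129600 * g ^ 32 * Real.log (3 * T) / ε₀ ^ 2 ≤ p.τ₀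
  lam_pos : 0 < p.lam
  lam_le : 8 * g ^ 3 * p.lam ≤ ε₀ * p.τ₀

/-- A trajectory of the system under the algorithm. -/
structure IsRun (S : System d k) (p : AlgInput d k) (x : ℕ → Fin d → ℝ) (u : ℕ → Fin k → ℝ)
    (w : ℕ → Fin d → ℝ) : Prop where
  x_one : x 1 = 0
  step : ∀ t, x (t + 2) = S.A *ᵥ x (t + 1) + S.B *ᵥ u (t + 1) + w (t + 1)
  act : ∀ t, u (t + 1) = p.policy x u (t + 1)

namespace Setting

variable {S : System d k} {p : AlgInput d k} {P Y₀ : Matrix (Fin d) (Fin d) ℝ} {g ε₀ : ℝ} {T : ℕ}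
  {x w : ℕ → Fin d → ℝ} {u : ℕ → Fin k → ℝ}

/-- The optimal controller. -/
abbrev Kopt (S : System d k) (P : Matrix (Fin d) (Fin d) ℝ) : Matrix (Fin k) (Fin d) ℝ :=
  gain S.A S.B S.R P

lemma one_le (h : Setting S p P Y₀ g ε₀ T) : 1 ≤ g := h.bdd.one_le

lemma pos (h : Setting S p P Y₀ g ε₀ T) : 0 < g := h.bdd.pos

lemma one_le_tau (h : Setting S p P Y₀ g ε₀ T) : 1 ≤ p.τ₀ := by have := h.tau_ge_four; omega

lemma Y_ge (h : Setting S p P Y₀ g ε₀ T) (y : Fin d → ℝ) : g⁻¹ * (y ⬝ᵥ y) ≤ qf Y₀ y := by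
  have h1 := h.isSuper.2 y
  have h2 := h.bdd.Q_ge y
  have h3 := (psd_of_posDef h.bdd.R_posDef).2 (p.K₀ *ᵥ y)
  have h4 := h.isSuper.1.2 (S.A *ᵥ y + S.B *ᵥ (p.K₀ *ᵥ y))
  linarith

lemma le_mul_of_inv_mul_le {a b g : ℝ} (hg : 0 < g) (h : g⁻¹ * a ≤ b) : a ≤ g * b := by
  rwa [inv_mul_le_iff₀ hg] at h

lemma Y_contract (h : Setting S p P Y₀ g ε₀ T) (y : Fin d → ℝ) :
    qf Y₀ (S.A *ᵥ y + S.B *ᵥ (p.K₀ *ᵥ y)) ≤ qf Y₀ y - (2 * g)⁻¹ * (y ⬝ᵥ y) := by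
  have h1 := h.isSuper.2 y
  have h2 := h.bdd.Q_ge y
  have h3 := (psd_of_posDef h.bdd.R_posDef).2 (p.K₀ *ᵥ y)
  have h4 : (2 * g)⁻¹ * (y ⬝ᵥ y) ≤ g⁻¹ * (y ⬝ᵥ y) := by
    have := h.pos
    have := dot_self_nonneg y
    gcongr; linarith
  linarith

lemma K0_norm (h : Setting S p P Y₀ g ε₀ T) : ‖p.K₀‖ ≤ g := by
  have hg := h.pos
  refine norm_le_of_mulVec hg.le fun y => ?_
  have h1 := h.isSuper.2 y
  have h2 := h.bdd.R_ge (p.K₀ *ᵥ y)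
  have h3 := (mul_nonneg (inv_pos.2 hg).le (dot_self_nonneg y)).trans (h.bdd.Q_ge y)
  have h4 := h.isSuper.1.2 (S.A *ᵥ y + S.B *ᵥ (p.K₀ *ᵥ y))
  have h5 := h.Y_le y
  have h6 := le_mul_of_inv_mul_le hg (h2.trans (by linarith : _ ≤ g * (y ⬝ᵥ y)))
  linarith

/-- Controllers computed from accurate estimates. -/
lemma greedy_near (h : Setting S p P Y₀ g ε₀ T) {ε : ℝ} (hε : 0 ≤ ε) (hε' : ε ≤ ε₀) {τ : ℕ}
    (he : ‖p.estimate x u τ - S.A‖ ≤ ε) : ‖p.greedy x u τ - Kopt S P‖ ≤ 2100 * g ^ 8 * ε := by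
  have hg := h.pos
  have h1 := h.one_le
  rw [AlgInput.greedy, h.B_eq, h.Q_eq, h.R_eq]
  refine (h.bdd.optController_near hε ?_ he (by simpa using hε)).2
  have : g ^ 3 * ε ≤ g ^ 10 * ε₀ := by gcongr; norm_num
  have : 0 ≤ g ^ 10 * ε₀ := by have := h.eps_pos; positivity
  linarith [h.eps_le]

/-- The left side is (4200g¹⁰ε₀)², so the bound on ε₀ is exactly what makes gains from ε₀-accurate
estimates contracting. -/
lemma near_small (h : Setting S p P Y₀ g ε₀ T) : 4 * g ^ 4 * (2100 * g ^ 8 * ε₀) ^ 2 ≤ 1 := by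
  have hg := h.pos
  have he := h.eps_pos
  have := mul_le_mul h.eps_le h.eps_le (by positivity) zero_le_one
  have h1 : g ^ 20 ≤ g ^ 20 := le_rfl
  nlinarith

lemma greedy_norm (h : Setting S p P Y₀ g ε₀ T) {τ : ℕ}
    (he : ‖p.estimate x u τ - S.A‖ ≤ ε₀) : ‖p.greedy x u τ‖ ≤ p.κ := by
  have hg := h.pos
  have h1 := h.greedy_near h.eps_pos.le le_rfl he
  have h2 := h.bdd.gain_norm
  have h3 : g ^ 8 * ε₀ ≤ g ^ 10 * ε₀ := by
    have := h.eps_pos.le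
    have := h.one_le
    gcongr; norm_num
  have h4 := norm_add_le (p.greedy x u τ - Kopt S P) (Kopt S P)
  rw [sub_add_cancel] at h4
  have h5 := h.eps_le
  have h6 : 0 ≤ g ^ 10 * ε₀ := by have := h.eps_pos; positivity
  linarith [h.kappa_ge]

/-- The estimate is accurate and the state is small. -/
def Fine (S : System d k) (p : AlgInput d k) (ε₀ : ℝ) (x : ℕ → Fin d → ℝ) (u : ℕ → Fin k → ℝ) (t : ℕ) : Prop :=
  ‖p.estimate x u t - S.A‖ ≤ ε₀ ∧ x t ⬝ᵥ x t ≤ p.xb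

lemma not_aborted (h : Setting S p P Y₀ g ε₀ T) {t : ℕ}
    (hf : ∀ s, p.τ₀ ≤ s → s ≤ t → Fine S p ε₀ x u s) : ¬p.Aborted x u t := by
  rintro ⟨s, h1, h2, h3 | h3⟩
  · exact (hf s h1 h2).2.not_gt h3
  · refine (h.greedy_norm ?_).not_gt h3
    exact (hf _ (AlgInput.le_phaseStart s) ((AlgInput.phaseStart_le h.one_le_tau h1).trans h2)).1

lemma action_of_lt (hr : IsRun S p x u w) {t : ℕ} (ht : t + 1 < p.τ₀) :
    u (t + 1) = p.K₀ *ᵥ x (t + 1) := by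
  rw [hr.act, AlgInput.policy, if_pos (Or.inl ht)]

lemma action_of_fine (h : Setting S p P Y₀ g ε₀ T) (hr : IsRun S p x u w) {t : ℕ} (ht : p.τ₀ ≤ t + 1)
    (hf : ∀ s, p.τ₀ ≤ s → s ≤ t + 1 → Fine S p ε₀ x u s) :
    u (t + 1) = p.greedy x u (p.phaseStart (t + 1)) *ᵥ x (t + 1) := by
  rw [hr.act, AlgInput.policy, if_neg]
  rintro (h1 | h1)
  · omega
  · exact h.not_aborted hf h1

/-- One step of the algorithm contracts a combined Lyapunov function as long as all is fine. -/
lemma lyapunov_step (h : Setting S p P Y₀ g ε₀ T) (hr : IsRun S p x u w) {t : ℕ}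
    (hf : ∀ s, p.τ₀ ≤ s → s ≤ t + 1 → Fine S p ε₀ x u s) :
    (if t + 2 < p.τ₀ then g ^ 2 * qf Y₀ (x (t + 2)) else qf P (x (t + 2))) ≤
      (1 - (4 * g ^ 2)⁻¹) * (if t + 1 < p.τ₀ then g ^ 2 * qf Y₀ (x (t + 1)) else qf P (x (t + 1))) +
        5 * g ^ 5 * (w (t + 1) ⬝ᵥ w (t + 1)) := by
  have hg := h.pos
  have hg1 := h.one_le
  have hww := dot_self_nonneg (w (t + 1))
  by_cases ht : t + 1 < p.τ₀
  · rw [if_pos ht]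
    have h1 := contract_step hg1 h.isSuper.1 h.Y_le (h.Y_contract (x (t + 1))) (w (t + 1))
    rw [← action_of_lt hr ht, ← hr.step] at h1
    have h2 : g ^ 2 * qf Y₀ (x (t + 2)) ≤ g ^ 2 * ((1 - (4 * g ^ 2)⁻¹) * qf Y₀ (x (t + 1)) +
      5 * g ^ 3 * (w (t + 1) ⬝ᵥ w (t + 1))) := by gcongr
    refine le_trans ?_ (h2.trans (le_of_eq (by ring)))
    split_ifs with ht2
    · exact le_rfl
    -- The switch from `Y₀` to `P` at time τ₀: the factor g² in front of `Y₀` pays for it, since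
    -- xᵀPx ≤ g‖x‖² ≤ g² xᵀY₀x.
    · have h3 := le_mul_of_inv_mul_le hg (h.Y_ge (x (t + 2)))
      calc qf P (x (t + 2)) ≤ g * (x (t + 2) ⬝ᵥ x (t + 2)) := h.bdd.P_le _
        _ ≤ g * (g * qf Y₀ (x (t + 2))) := by gcongr
        _ = _ := by ring
  · rw [if_neg ht, if_neg (by omega)]
    have hu := h.action_of_fine hr (by omega) hf
    have hn := h.greedy_near h.eps_pos.le le_rfl (hf (p.phaseStart (t + 1)) (AlgInput.le_phaseStart _)
      (AlgInput.phaseStart_le h.one_le_tau (by omega))).1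
    have h1 := contract_step hg1 h.bdd.psd h.bdd.P_le
      (h.bdd.contract_of_gain_near h.R_le h.near_small hn (x (t + 1))) (w (t + 1))
    rw [← hu, ← hr.step] at h1
    have h2 : 5 * g ^ 3 * (w (t + 1) ⬝ᵥ w (t + 1)) ≤ 5 * g ^ 5 * (w (t + 1) ⬝ᵥ w (t + 1)) := by
      gcongr; norm_num
    linarith

/-- The combined Lyapunov function. -/
def lyap (p : AlgInput d k) (P Y₀ : Matrix (Fin d) (Fin d) ℝ) (g : ℝ) (x : ℕ → Fin d → ℝ) (s : ℕ) : ℝ :=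
  if s + 1 < p.τ₀ then g ^ 2 * qf Y₀ (x (s + 1)) else qf P (x (s + 1))

lemma le_lyap (h : Setting S p P Y₀ g ε₀ T) (s : ℕ) :
    x (s + 1) ⬝ᵥ x (s + 1) ≤ g * lyap p P Y₀ g x s := by
  have hg := h.pos
  have hg1 := h.one_le
  have h1 := le_mul_of_inv_mul_le hg (h.Y_ge (x (s + 1)))
  have h2 := le_mul_of_inv_mul_le hg (h.bdd.P_ge (x (s + 1)))
  rw [lyap]
  split_ifs
  · refine h1.trans ?_
    have h3 := h.isSuper.1.2 (x (s + 1))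
    have : 1 * qf Y₀ (x (s + 1)) ≤ g ^ 2 * qf Y₀ (x (s + 1)) := by gcongr; exact one_le_pow₀ hg1
    gcongr; linarith
  · exact h2

lemma lyap_nonneg (h : Setting S p P Y₀ g ε₀ T) (s : ℕ) : 0 ≤ lyap p P Y₀ g x s :=
  nonneg_of_mul_nonneg_right ((dot_self_nonneg (x (s + 1))).trans (h.le_lyap s)) h.pos

lemma lyap_zero (hr : IsRun S p x u w) : lyap p P Y₀ g x 0 = 0 := by
  simp [lyap, hr.x_one]

lemma inv_le_one' (h : Setting S p P Y₀ g ε₀ T) : (4 * g ^ 2)⁻¹ ≤ 1 := by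
  have := one_le_pow₀ h.one_le (n := 2)
  exact inv_le_one_of_one_le₀ (by linarith)

lemma sum_state_le (h : Setting S p P Y₀ g ε₀ T) (hr : IsRun S p x u w) {n : ℕ}
    (hf : ∀ s, p.τ₀ ≤ s → s ≤ n → Fine S p ε₀ x u s) :
    ∑ s ∈ Finset.range (n + 1), x (s + 1) ⬝ᵥ x (s + 1) ≤
      20 * g ^ 8 * ∑ s ∈ Finset.range n, w (s + 1) ⬝ᵥ w (s + 1) := by
  have hg := h.pos
  have h1 := sum_le_of_contract (Φ := lyap p P Y₀ g x) (b := fun s => 5 * g ^ 5 * (w (s + 1) ⬝ᵥ w (s + 1)))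
    (δ := (4 * g ^ 2)⁻¹) (n := n) (lyap_zero hr) h.lyap_nonneg
    (fun s hs => h.lyapunov_step hr fun r h1 h2 => hf r h1 (by omega)) h.inv_le_one'
  rw [← Finset.mul_sum] at h1
  have h2 : ∑ s ∈ Finset.range (n + 1), x (s + 1) ⬝ᵥ x (s + 1) ≤
      g * ∑ s ∈ Finset.range (n + 1), lyap p P Y₀ g x s := by
    rw [Finset.mul_sum]; exact Finset.sum_le_sum fun s _ => h.le_lyap s
  have h3 := le_mul_of_inv_mul_le (by positivity) h1
  calc _ ≤ _ := h2
    _ ≤ g * (4 * g ^ 2 * (5 * g ^ 5 * ∑ s ∈ Finset.range n, w (s + 1) ⬝ᵥ w (s + 1))) := by gcongr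
    _ = _ := by ring

lemma state_le (h : Setting S p P Y₀ g ε₀ T) (hr : IsRun S p x u w) {n : ℕ} {β : ℝ} (hβ : 0 ≤ β)
    (hf : ∀ s, p.τ₀ ≤ s → s ≤ n → Fine S p ε₀ x u s)
    (hw : ∀ s < n, w (s + 1) ⬝ᵥ w (s + 1) ≤ β) : x (n + 1) ⬝ᵥ x (n + 1) ≤ 20 * g ^ 8 * β := by
  have hg := h.pos
  have h1 := le_of_contract (Φ := lyap p P Y₀ g x) (β := 5 * g ^ 5 * β)
    (δ := (4 * g ^ 2)⁻¹) (n := n) (lyap_zero hr) (by positivity) h.inv_le_one' (by positivity)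
    fun s hs => (h.lyapunov_step hr fun r h1 h2 => hf r h1 (by omega)).trans (by
      have := hw s hs
      rw [lyap]; gcongr)
  calc _ ≤ _ := h.le_lyap n
    _ ≤ g * (5 * g ^ 5 * β / (4 * g ^ 2)⁻¹) := by gcongr
    _ = _ := by field_simp; ring

end Setting

end Deterministic


/-! ### Consequences of concentration -/

section Concentration

variable {d k : ℕ}

lemma mulVec_dot_self_le_frob {m n : ℕ} (M : Matrix (Fin m) (Fin n) ℝ) (v : Fin n → ℝ) :
    (M *ᵥ v) ⬝ᵥ (M *ᵥ v) ≤ (∑ i, ∑ j, M i j ^ 2) * (v ⬝ᵥ v) := by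
  rw [Finset.sum_mul]
  refine Finset.sum_le_sum fun i _ => ?_
  have := dot_sq_le (M i) v
  calc (M *ᵥ v) i * (M *ᵥ v) i = (M i ⬝ᵥ v) ^ 2 := by rw [Matrix.mulVec, sq]
    _ ≤ _ := this
    _ = _ := by simp [dotProduct, sq]

lemma norm_sq_le_frob {m n : ℕ} (M : Matrix (Fin m) (Fin n) ℝ) : ‖M‖ ^ 2 ≤ ∑ i, ∑ j, M i j ^ 2 := by
  have h0 : 0 ≤ ∑ i, ∑ j, M i j ^ 2 := by positivity
  have : ‖M‖ ≤ √(∑ i, ∑ j, M i j ^ 2) := norm_le_of_mulVec (Real.sqrt_nonneg _) fun v => by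
    rw [Real.sq_sqrt h0]; exact mulVec_dot_self_le_frob M v
  calc ‖M‖ ^ 2 ≤ √(∑ i, ∑ j, M i j ^ 2) ^ 2 := by gcongr
    _ = _ := Real.sq_sqrt h0

lemma norm_le_of_entries {n : ℕ} {M : Matrix (Fin n) (Fin n) ℝ} {c : ℝ} (hc : 0 ≤ c)
    (h : ∀ i j, |M i j| ≤ c) : ‖M‖ ≤ n * c := by
  refine abs_le_of_sq_le_sq' ((norm_sq_le_frob M).trans ?_) (by positivity) |>.2
  calc ∑ i, ∑ j, M i j ^ 2 ≤ ∑ _i : Fin n, ∑ _j : Fin n, c ^ 2 :=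
        Finset.sum_le_sum fun i _ => Finset.sum_le_sum fun j _ => by
          rw [← sq_abs]; have := h i j; gcongr
    _ = (n * c) ^ 2 := by simp; ring

lemma qf_sum_vecMulVec {ι : Type*} {n : ℕ} (s : Finset ι) (a b : ι → Fin n → ℝ) (v : Fin n → ℝ) :
    qf (∑ i ∈ s, Matrix.vecMulVec (a i) (b i)) v = ∑ i ∈ s, (a i ⬝ᵥ v) * (b i ⬝ᵥ v) := by
  rw [qf, AlgInput.sum_mulVec, dotProduct_sum]
  refine Finset.sum_congr rfl fun i _ => ?_
  rw [AlgInput.vecMulVec_mulVec', dotProduct_smul, smul_eq_mul, dotProduct_comm v]; ring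

/-- The correlations of the noise with the predictable process `y` are small. -/
def CrossSmall (σ ξ L : ℝ) (T : ℕ) (y w : ℕ → Fin d → ℝ) : Prop :=
  ∀ n ≤ T, ∀ i j, |∑ s ∈ Finset.range n, w (s + 1) i * y (s + 1) j| ≤
    ξ * σ ^ 2 / 2 * ∑ s ∈ Finset.range n, y (s + 1) j ^ 2 + 3 * L / ξ

/-- The concentration event. -/
structure NoiseGood (σ ξ L : ℝ) (T : ℕ) (x z w : ℕ → Fin d → ℝ) : Prop where
  max_le : ∀ s < T, ∀ i, w (s + 1) i ^ 2 ≤ 14 * σ ^ 2 * L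
  sq_le : ∀ n ≤ T, ∀ i, |∑ s ∈ Finset.range n, (w (s + 1) i ^ 2 - σ ^ 2)| ≤ 4 * ξ * σ ^ 4 * n + 3 * L / ξ
  mul_le : ∀ n ≤ T, ∀ i j, i ≠ j → |∑ s ∈ Finset.range n, w (s + 1) i * w (s + 1) j| ≤
    ξ * σ ^ 4 * n + 3 * L / ξ
  cross_z : CrossSmall σ ξ L T z w
  cross_x : CrossSmall σ ξ L T x w

/-- The part of the state that is known before the noise. -/
def drift (S : System d k) (x : ℕ → Fin d → ℝ) (u : ℕ → Fin k → ℝ) (t : ℕ) : Fin d → ℝ :=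
  S.A *ᵥ x t + S.B *ᵥ u t

lemma sum_sq_coord_le (y : ℕ → Fin d → ℝ) (n : ℕ) (j : Fin d) :
    ∑ s ∈ Finset.range n, y (s + 1) j ^ 2 ≤ ∑ s ∈ Finset.range n, y (s + 1) ⬝ᵥ y (s + 1) :=
  Finset.sum_le_sum fun s _ => by
    rw [sq]
    exact Finset.single_le_sum (f := fun j => y (s + 1) j * y (s + 1) j)
      (fun i _ => mul_self_nonneg _) (Finset.mem_univ j)

namespace Setting

variable {S : System d k} {p : AlgInput d k} {P Y₀ : Matrix (Fin d) (Fin d) ℝ} {g ε₀ : ℝ} {T : ℕ}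
  {x w : ℕ → Fin d → ℝ} {u : ℕ → Fin k → ℝ}

/-- The scale of the exponential inequalities. -/
def xi (g ε₀ : ℝ) : ℝ := ε₀ / (360 * g ^ 16)

lemma xi_pos (h : Setting S p P Y₀ g ε₀ T) : 0 < xi g ε₀ := by
  have := h.pos; have := h.eps_pos; unfold xi; positivity

lemma log_ge_one (h : Setting S p P Y₀ g ε₀ T) : 1 ≤ Real.log (3 * T) := by
  have hT : (1 : ℝ) ≤ T := by exact_mod_cast h.T_pos
  rw [Real.le_log_iff_exp_le (by positivity)]
  linarith [Real.exp_one_lt_d9]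

lemma eps_le_one (h : Setting S p P Y₀ g ε₀ T) : 4200 * ε₀ ≤ 1 := by
  have h1 := h.eps_le
  have h2 := one_le_pow₀ h.one_le (n := 10)
  have := h.eps_pos
  nlinarith

/-- As 360² = 129600, the lower bound on τ₀ says log(3T) ≤ ξ²n for n ≥ τ₀ − 2. From then on the
logarithmic term of every deviation bound is dominated by its linear term. -/
lemma log_div_xi_le (h : Setting S p P Y₀ g ε₀ T) {n : ℕ} (hn : p.τ₀ ≤ n + 2) :
    3 * Real.log (3 * T) / xi g ε₀ ≤ 3 * xi g ε₀ * n := by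
  have hξ := h.xi_pos
  have hg := h.pos
  have he := h.eps_pos
  rw [div_le_iff₀ hξ]
  have h1 : 129600 * g ^ 32 * Real.log (3 * T) / ε₀ ^ 2 ≤ n := by
    have h2 := h.tau_ge
    have h3 : (p.τ₀ : ℝ) ≤ n + 2 := by exact_mod_cast hn
    linarith
  rw [div_le_iff₀ (by positivity)] at h1
  have e : xi g ε₀ * (360 * g ^ 16) = ε₀ := by unfold xi; field_simp
  have h4 : 129600 * g ^ 32 * Real.log (3 * T) ≤ 129600 * g ^ 32 * (xi g ε₀ ^ 2 * n) := by
    refine h1.trans (le_of_eq ?_)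
    have e2 : ε₀ ^ 2 = xi g ε₀ ^ 2 * (360 * g ^ 16) ^ 2 := by rw [← mul_pow, e]
    rw [e2]; ring
  have h5 := le_of_mul_le_mul_left h4 (by positivity)
  linarith

lemma xi_mul_le (h : Setting S p P Y₀ g ε₀ T) : 360 * g ^ 16 * xi g ε₀ = ε₀ := by
  have := h.pos; unfold xi; field_simp

lemma sigma_sq_inv_le (h : Setting S p P Y₀ g ε₀ T) : 1 ≤ g ^ 2 * S.σ ^ 2 := by
  have h1 := h.sigma_inv_le
  rw [inv_le_iff_one_le_mul₀ h.sigma_pos] at h1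
  rw [← mul_pow]; exact one_le_pow₀ h1

lemma sum_noise_le (h : Setting S p P Y₀ g ε₀ T) {z : ℕ → Fin d → ℝ}
    (hn : NoiseGood S.σ (xi g ε₀) (Real.log (3 * T)) T x z w) {n : ℕ} (h1 : p.τ₀ ≤ n + 2) (h2 : n ≤ T) :
    ∑ s ∈ Finset.range n, w (s + 1) ⬝ᵥ w (s + 1) ≤ 2 * g ^ 3 * n := by
  have hg := h.pos
  have hg1 := h.one_le
  have hξ := h.xi_pos
  have hσ := h.sigma_pos
  have hL := h.log_div_xi_le h1
  have hsw : ∑ s ∈ Finset.range n, w (s + 1) ⬝ᵥ w (s + 1) =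
      ∑ i, (∑ s ∈ Finset.range n, (w (s + 1) i ^ 2 - S.σ ^ 2) + n * S.σ ^ 2) := by
    simp only [dotProduct, Finset.sum_sub_distrib, Finset.sum_const, Finset.card_range, nsmul_eq_mul,
      sub_add_cancel, sq]
    exact Finset.sum_comm
  have hs2 : S.σ ^ 2 ≤ g ^ 2 := by have := h.sigma_le; gcongr
  have hs4 : S.σ ^ 4 ≤ g ^ 4 := by have := h.sigma_le; gcongr
  have hbd : ∀ i, ∑ s ∈ Finset.range n, (w (s + 1) i ^ 2 - S.σ ^ 2) + n * S.σ ^ 2 ≤ 2 * g ^ 2 * n := fun i => by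
    have h3 := (abs_le.1 (hn.sq_le n h2 i)).2
    have h4 : 4 * xi g ε₀ * S.σ ^ 4 * n ≤ 4 * xi g ε₀ * g ^ 4 * n := by gcongr
    have h5 : (n : ℝ) * S.σ ^ 2 ≤ n * g ^ 2 := by gcongr
    have h6 : 4 * xi g ε₀ * g ^ 4 + 3 * xi g ε₀ ≤ g ^ 2 := by
      have e := h.xi_mul_le
      have e2 := h.eps_le_one
      have : xi g ε₀ * g ^ 4 ≤ xi g ε₀ * g ^ 16 := by gcongr; norm_num
      have : xi g ε₀ * 1 ≤ xi g ε₀ * g ^ 16 := by gcongr; exact one_le_pow₀ hg1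
      have := one_le_pow₀ hg1 (n := 2)
      linarith
    have h7 : (4 * xi g ε₀ * g ^ 4 + 3 * xi g ε₀) * n ≤ g ^ 2 * n := by gcongr
    linarith
  rw [hsw]
  calc _ ≤ ∑ _i : Fin d, 2 * g ^ 2 * n := Finset.sum_le_sum fun i _ => hbd i
    _ = d * (2 * g ^ 2 * n) := by simp
    _ ≤ g * (2 * g ^ 2 * n) := by gcongr; exact h.dim_le
    _ = _ := by ring

/-- A linear energy bound turns the self-normalized inequality into a linear one: half of 84 plus
the 3 from the logarithmic term make 45. -/
lemma dev_le (h : Setting S p P Y₀ g ε₀ T) {y z : ℕ → Fin d → ℝ} {n : ℕ} (h1 : p.τ₀ ≤ n + 2) (h2 : n ≤ T)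
    (hc : CrossSmall S.σ (xi g ε₀) (Real.log (3 * T)) T y z)
    (hy : ∑ s ∈ Finset.range n, y (s + 1) ⬝ᵥ y (s + 1) ≤ 84 * g ^ 11 * n) (i j : Fin d) :
    |∑ s ∈ Finset.range n, z (s + 1) i * y (s + 1) j| ≤ 45 * g ^ 13 * xi g ε₀ * n := by
  have hg := h.pos
  have hg1 := h.one_le
  have hξ := h.xi_pos
  refine (hc n h2 i j).trans ?_
  have hs2 : S.σ ^ 2 ≤ g ^ 2 := by have := h.sigma_le; have := h.sigma_pos; gcongr
  have h3 : xi g ε₀ * S.σ ^ 2 / 2 * ∑ s ∈ Finset.range n, y (s + 1) j ^ 2 ≤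
      xi g ε₀ * g ^ 2 / 2 * (84 * g ^ 11 * n) := by
    have := (sum_sq_coord_le y n j).trans hy
    have h0 : 0 ≤ ∑ s ∈ Finset.range n, y (s + 1) j ^ 2 := by positivity
    gcongr
  have h4 := h.log_div_xi_le h1
  have h5 : xi g ε₀ * 1 * n ≤ xi g ε₀ * g ^ 13 * n := by gcongr; exact one_le_pow₀ hg1
  linarith

/-- The consequences of the concentration event at a time before which all was fine. -/
lemma estimate_of_fine (h : Setting S p P Y₀ g ε₀ T) (hr : IsRun S p x u w)
    (hn : NoiseGood S.σ (xi g ε₀) (Real.log (3 * T)) T x (drift S x u) w) {t : ℕ} (ht : p.τ₀ ≤ t) (htT : t ≤ T)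
    (hf : ∀ s, p.τ₀ ≤ s → s < t → Fine S p ε₀ x u s) :
    (∀ v, S.σ ^ 2 * t / 4 * (v ⬝ᵥ v) ≤ qf (p.gram x t) v) ∧
    (∑ s ∈ Finset.range (t - 1), x (s + 1) ⬝ᵥ x (s + 1) ≤ 40 * g ^ 11 * t) ∧
    ‖∑ s ∈ Finset.range (t - 1), Matrix.vecMulVec (w (s + 1)) (x (s + 1))‖ ≤ 45 * g ^ 14 * xi g ε₀ * t := by
  have hg := h.pos
  have hg1 := h.one_le
  have hξ := h.xi_pos
  have hσ := h.sigma_pos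
  have h4 := h.tau_ge_four
  obtain ⟨n, rfl⟩ : ∃ n, t = n + 2 := ⟨t - 2, by omega⟩
  have hnn : (0 : ℝ) ≤ n := Nat.cast_nonneg n
  have hW := h.sum_noise_le hn ht (by omega)
  have hX := h.sum_state_le hr (n := n) fun s h1 h2 => hf s h1 (by omega)
  have hX2 : ∑ s ∈ Finset.range (n + 1), x (s + 1) ⬝ᵥ x (s + 1) ≤ 40 * g ^ 11 * n := by
    calc _ ≤ _ := hX
      _ ≤ 20 * g ^ 8 * (2 * g ^ 3 * n) := by gcongr
      _ = _ := by ring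
  have hX3 : ∑ s ∈ Finset.range n, x (s + 2) ⬝ᵥ x (s + 2) ≤ 40 * g ^ 11 * n := by
    rw [Finset.sum_range_succ'] at hX2
    have := dot_self_nonneg (x (0 + 1))
    linarith
  set z := drift S x u with hz
  have hxz : ∀ s, x (s + 2) = z (s + 1) + w (s + 1) := fun s => by rw [hr.step, hz, drift]
  have hZ : ∑ s ∈ Finset.range n, z (s + 1) ⬝ᵥ z (s + 1) ≤ 84 * g ^ 11 * n := by
    have h5 : ∑ s ∈ Finset.range n, z (s + 1) ⬝ᵥ z (s + 1) ≤
        ∑ s ∈ Finset.range n, (2 * (x (s + 2) ⬝ᵥ x (s + 2)) + 2 * (w (s + 1) ⬝ᵥ w (s + 1))) :=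
      Finset.sum_le_sum fun s _ => by
        have := dot_sub_self_le (x (s + 2)) (w (s + 1))
        rwa [hxz, add_sub_cancel_right, ← hxz] at this
    rw [Finset.sum_add_distrib, ← Finset.mul_sum, ← Finset.mul_sum] at h5
    have h6 : g ^ 3 * n ≤ g ^ 11 * n := by gcongr; norm_num
    linarith
  have hD := h.xi_mul_le
  have he := h.eps_le_one
  have he0 := h.eps_pos
  have hDz := h.dev_le ht (by omega) hn.cross_z hZ
  refine ⟨fun v => ?_, ?_, ?_⟩
  · have hvv := dot_self_nonneg v
    set W := ∑ s ∈ Finset.range n, Matrix.vecMulVec (w (s + 1)) (w (s + 1)) with hWdef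
    set Z := ∑ s ∈ Finset.range n, Matrix.vecMulVec (w (s + 1)) (z (s + 1)) with hZdef
    -- From x = z + w, (x·v)² ≥ (w·v)² + 2(w·v)(z·v). The square of the drift is dropped: the noise
    -- alone suffices to excite direction v.
    have hsum : qf W v + 2 * qf Z v ≤ qf (p.gram x (n + 2)) v := by
      rw [AlgInput.qf_gram, sum_Icc_one, hWdef, hZdef, qf_sum_vecMulVec, qf_sum_vecMulVec,
        show n + 2 - 1 = n + 1 by omega, Finset.sum_range_succ', Finset.mul_sum, ← Finset.sum_add_distrib]
      have h5 : ∑ s ∈ Finset.range n, ((w (s + 1) ⬝ᵥ v) * (w (s + 1) ⬝ᵥ v) +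
          2 * ((w (s + 1) ⬝ᵥ v) * (z (s + 1) ⬝ᵥ v))) ≤ ∑ s ∈ Finset.range n, (x (s + 1 + 1) ⬝ᵥ v) ^ 2 :=
        Finset.sum_le_sum fun s _ => by
          rw [hxz, add_dotProduct]; nlinarith [sq_nonneg (z (s + 1) ⬝ᵥ v)]
      have h6 := mul_nonneg h.lam_pos.le hvv
      have h7 := sq_nonneg (x (0 + 1) ⬝ᵥ v)
      linarith
    have hent : ∀ i j, ∀ a b : ℕ → Fin d → ℝ, (∑ s ∈ Finset.range n, Matrix.vecMulVec (a (s + 1)) (b (s + 1))) i j =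
        ∑ s ∈ Finset.range n, a (s + 1) i * b (s + 1) j := fun i j a b => by
      simp [Matrix.sum_apply, Matrix.vecMulVec_apply]
    have hc0 : 0 ≤ 45 * g ^ 13 * xi g ε₀ * n := by positivity
    have hZn : ‖Z‖ ≤ d * (45 * g ^ 13 * xi g ε₀ * n) := norm_le_of_entries hc0 fun i j => by
      rw [hZdef, hent]; exact hDz i j
    set E := W - (n * S.σ ^ 2) • (1 : Matrix (Fin d) (Fin d) ℝ) with hE
    have hs4 : S.σ ^ 4 ≤ g ^ 4 := by have := h.sigma_le; gcongr
    have hLx := h.log_div_xi_le (n := n) ht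
    have hp1 : xi g ε₀ * g ^ 4 * n ≤ xi g ε₀ * g ^ 13 * n := by gcongr; norm_num
    have hp2 : xi g ε₀ * 1 * n ≤ xi g ε₀ * g ^ 13 * n := by gcongr; exact one_le_pow₀ hg1
    have hp3 : xi g ε₀ * S.σ ^ 4 * n ≤ xi g ε₀ * g ^ 4 * n := by gcongr
    have hp4 : 0 ≤ xi g ε₀ * g ^ 13 * n := by positivity
    have hEn : ‖E‖ ≤ d * (45 * g ^ 13 * xi g ε₀ * n) := norm_le_of_entries hc0 fun i j => by
      rw [hE, Matrix.sub_apply, hWdef, hent, Matrix.smul_apply, smul_eq_mul]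
      by_cases hij : i = j
      · subst hij
        have h5 := hn.sq_le n (by omega) i
        have e : ∑ s ∈ Finset.range n, w (s + 1) i * w (s + 1) i - n * S.σ ^ 2 * (1 : Matrix (Fin d) (Fin d) ℝ) i i =
            ∑ s ∈ Finset.range n, (w (s + 1) i ^ 2 - S.σ ^ 2) := by
          simp [Finset.sum_sub_distrib, sq]
        rw [e]
        linarith
      · rw [Matrix.one_apply_ne hij, mul_zero, sub_zero]
        have h5 := hn.mul_le n (by omega) i j hij
        linarith
    have hqW : qf W v = n * S.σ ^ 2 * (v ⬝ᵥ v) + qf E v := by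
      have : W = (n * S.σ ^ 2) • (1 : Matrix (Fin d) (Fin d) ℝ) + E := by rw [hE]; abel
      conv_lhs => rw [this]
      rw [qf_add_left, qf_smul_left]
      simp [qf]
    have h5 := neg_le_of_abs_le (abs_qf_le_norm E v)
    have h6 := neg_le_of_abs_le (abs_qf_le_norm Z v)
    -- The constant in ξ gives 45g¹⁶ξ = ε₀/8, far below 1/6, so the noise fluctuation and twice the
    -- cross term together remove at most half of nσ².
    have hgd : d * (45 * g ^ 13 * xi g ε₀ * n) ≤ S.σ ^ 2 * n / 6 := by
      calc d * (45 * g ^ 13 * xi g ε₀ * n) ≤ g * (45 * g ^ 13 * xi g ε₀ * n) := by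
            gcongr; exact h.dim_le
        _ ≤ g * (45 * g ^ 13 * xi g ε₀ * n) * (g ^ 2 * S.σ ^ 2) :=
            le_mul_of_one_le_right (by positivity) h.sigma_sq_inv_le
        _ = 45 * (g ^ 16 * xi g ε₀) * (S.σ ^ 2 * n) := by ring
        _ ≤ 1 / 6 * (S.σ ^ 2 * n) := by gcongr; linarith
        _ = _ := by ring
    have h7 : ‖E‖ * (v ⬝ᵥ v) ≤ S.σ ^ 2 * n / 6 * (v ⬝ᵥ v) := by gcongr; exact hEn.trans hgd
    have h8 : ‖Z‖ * (v ⬝ᵥ v) ≤ S.σ ^ 2 * n / 6 * (v ⬝ᵥ v) := by gcongr; exact hZn.trans hgd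
    have h9 : S.σ ^ 2 * ((n + 2 : ℕ) : ℝ) / 4 * (v ⬝ᵥ v) ≤ S.σ ^ 2 * n / 2 * (v ⬝ᵥ v) := by
      have : (2 : ℝ) ≤ n := by exact_mod_cast (by omega : 2 ≤ n)
      gcongr ?_ * _
      push_cast
      nlinarith [sq_nonneg S.σ]
    linarith
  · rw [show n + 2 - 1 = n + 1 by omega]
    refine hX2.trans ?_
    push_cast
    have : 0 ≤ g ^ 11 := by positivity
    nlinarith
  · rw [show n + 2 - 1 = n + 1 by omega]
    have hX4 : ∑ s ∈ Finset.range (n + 1), x (s + 1) ⬝ᵥ x (s + 1) ≤ 84 * g ^ 11 * ((n + 1 : ℕ) : ℝ) := by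
      refine hX2.trans ?_
      push_cast
      have : 0 ≤ g ^ 11 := by positivity
      nlinarith
    have h5 : ‖∑ s ∈ Finset.range (n + 1), Matrix.vecMulVec (w (s + 1)) (x (s + 1))‖ ≤
        d * (45 * g ^ 13 * xi g ε₀ * ((n + 1 : ℕ) : ℝ)) :=
      norm_le_of_entries (by positivity) fun i j => by
        simp only [Matrix.sum_apply, Matrix.vecMulVec_apply]
        exact h.dev_le (by omega) (by omega) hn.cross_x hX4 i j
    calc _ ≤ _ := h5
      _ ≤ g * (45 * g ^ 13 * xi g ε₀ * ((n + 2 : ℕ) : ℝ)) := by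
        gcongr
        · exact h.dim_le
        · norm_num
      _ = _ := by ring

/-- On the concentration event the algorithm never aborts and all estimates are accurate. -/
lemma fine_of_noiseGood (h : Setting S p P Y₀ g ε₀ T) (hr : IsRun S p x u w)
    (hn : NoiseGood S.σ (xi g ε₀) (Real.log (3 * T)) T x (drift S x u) w) :
    ∀ t, p.τ₀ ≤ t → t ≤ T → Fine S p ε₀ x u t := by
  intro t
  induction t using Nat.strong_induction_on with
  | _ t ih =>
  intro ht htT
  have hg := h.pos
  have hg1 := h.one_le
  have hσ := h.sigma_pos
  have hf : ∀ s, p.τ₀ ≤ s → s < t → Fine S p ε₀ x u s := fun s h1 h2 => ih s h2 h1 (by omega)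
  obtain ⟨hV, -, hS⟩ := h.estimate_of_fine hr hn ht htT hf
  have h4 := h.tau_ge_four
  have ht0 : (0 : ℝ) < t := by exact_mod_cast (by omega : 0 < t)
  constructor
  · rw [← sum_Icc_one (fun s => Matrix.vecMulVec (w s) (x s))] at hS
    have h1 := AlgInput.estimate_sub_norm_le (p := p) (u := u) (x := x) (τ := t) h.lam_pos (A := S.A) (w := w)
      (fun s h1 h2 => by
        obtain ⟨r, rfl⟩ : ∃ r, s = r + 1 := ⟨s - 1, by omega⟩
        rw [h.B_eq]; exact hr.step r) (c := S.σ ^ 2 * t / 4) (by positivity) hV hS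
    refine h1.trans ?_
    -- The error splits evenly: regularization and noise each contribute ε₀t/(8g²), and the inverse
    -- of the Gram bound is at most 4g²/t.
    have h5 : p.lam * ‖S.A‖ ≤ ε₀ / (8 * g ^ 2) * t := by
      have h6 : p.lam * ‖S.A‖ ≤ p.lam * g := by gcongr; exacts [h.lam_pos.le, h.bdd.A_le]
      have h7 : 8 * g ^ 3 * p.lam ≤ ε₀ * t := h.lam_le.trans (by
        have := h.eps_pos.le; gcongr)
      calc p.lam * ‖S.A‖ ≤ p.lam * g := h6
        _ = 8 * g ^ 3 * p.lam / (8 * g ^ 2) := by field_simp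
        _ ≤ ε₀ * t / (8 * g ^ 2) := by gcongr
        _ = _ := by ring
    have e1 : 45 * g ^ 14 * xi g ε₀ * t = ε₀ / (8 * g ^ 2) * t := by
      have e2 : ε₀ / (8 * g ^ 2) = 45 * g ^ 14 * xi g ε₀ := by
        unfold xi; field_simp; ring
      rw [e2]
    rw [e1]
    have h6 : (S.σ ^ 2 * t / 4)⁻¹ ≤ 4 * g ^ 2 / t := by
      rw [inv_le_iff_one_le_mul₀ (by positivity)]
      have := h.sigma_sq_inv_le
      calc (1 : ℝ) ≤ g ^ 2 * S.σ ^ 2 := this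
        _ = _ := by field_simp
    have he := h.eps_pos
    have h0 : 0 ≤ ε₀ / (8 * g ^ 2) * t + p.lam * ‖S.A‖ :=
      add_nonneg (by positivity) (mul_nonneg h.lam_pos.le (norm_nonneg _))
    calc (S.σ ^ 2 * t / 4)⁻¹ * (ε₀ / (8 * g ^ 2) * t + p.lam * ‖S.A‖)
        ≤ 4 * g ^ 2 / t * (ε₀ / (8 * g ^ 2) * t + ε₀ / (8 * g ^ 2) * t) := by gcongr
      _ = ε₀ := by field_simp; ring
  · obtain ⟨n, rfl⟩ : ∃ n, t = n + 1 := ⟨t - 1, by omega⟩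
    -- The state bound needs only earlier times: 20g⁸ times the maximal noise energy 14g³ log(3T) is
    -- the 280g¹¹ log(3T) required of x_b.
    have hL := h.log_ge_one
    refine (h.state_le hr (n := n) (β := 14 * g ^ 3 * Real.log (3 * T)) (by positivity)
      (fun s h1 h2 => hf s h1 (by omega)) fun s hs => ?_).trans ?_
    · have hs2 : S.σ ^ 2 ≤ g ^ 2 := by have := h.sigma_le; gcongr
      calc w (s + 1) ⬝ᵥ w (s + 1) ≤ ∑ _i : Fin d, 14 * S.σ ^ 2 * Real.log (3 * T) :=
            Finset.sum_le_sum fun i _ => by rw [← sq]; exact hn.max_le s (by omega) i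
        _ = d * (14 * S.σ ^ 2 * Real.log (3 * T)) := by simp
        _ ≤ g * (14 * g ^ 2 * Real.log (3 * T)) := by gcongr; exact h.dim_le
        _ = _ := by ring
    · refine le_trans (le_of_eq (by ring)) h.xb_ge

end Setting

end Concentration


/-! ### The probability of the concentration event -/

section NoiseProbability

variable {d k : ℕ} {σ : ℝ}

/-- A two-sided Chernoff bound with fixed exponent c = ±ξ. The compensator ξV may depend on the
past, so no deterministic bound on the conditional variance is needed. -/
lemma measure_abs_sum_gt_le {Y : ℕ → (ℕ → Fin d → ℝ) → ℝ} {X : ℝ → (Fin d → ℝ) → ℝ} {V : ℝ → ℝ} {ξ : ℝ}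
    (hY : ∀ s, DependsBefore (s + 1) (Y s)) (hYm : ∀ s, Measurable (Y s))
    (hX : Measurable (Function.uncurry X)) (hV : Measurable V) (hξ : 0 < ξ)
    (h : ∀ c : ℝ, |c| = ξ → ∀ y, ∫⁻ w, ENNReal.ofReal (Real.exp (c * X y w)) ∂(gaussianNoise d σ) ≤
      ENNReal.ofReal (Real.exp (ξ * V y))) (n : ℕ) (L : ℝ) :
    noiseLaw d σ {ω | ∑ s ∈ Finset.range n, V (Y s ω) + L / ξ < |∑ s ∈ Finset.range n, X (Y s ω) (ω (s + 1))|} ≤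
      2 * ENNReal.ofReal (Real.exp (-L)) := by
  have key : ∀ c : ℝ, |c| = ξ → noiseLaw d σ {ω | L ≤ ∑ s ∈ Finset.range n,
      (c * X (Y s ω) (ω (s + 1)) - ξ * V (Y s ω))} ≤ ENNReal.ofReal (Real.exp (-L)) := fun c hc => by
    have hXy : ∀ y, Measurable fun w => X y w := fun y => hX.comp (measurable_const.prodMk measurable_id)
    refine measure_sum_ge_le (F := fun _ y w => c * X y w - ξ * V y) hY hYm (fun s => ?_) (fun s y => ?_) n L
    · exact (hX.const_mul c).sub ((hV.comp measurable_fst).const_mul ξ)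
    · have e : ∀ w, ENNReal.ofReal (Real.exp (c * X y w - ξ * V y)) =
          ENNReal.ofReal (Real.exp (-(ξ * V y))) * ENNReal.ofReal (Real.exp (c * X y w)) := fun w => by
        rw [← ENNReal.ofReal_mul (Real.exp_nonneg _), ← Real.exp_add]; congr 2; ring
      simp_rw [e]
      have hmm := hXy y
      rw [lintegral_const_mul _ (by fun_prop)]
      calc _ ≤ ENNReal.ofReal (Real.exp (-(ξ * V y))) * ENNReal.ofReal (Real.exp (ξ * V y)) := by
            gcongr; exact h c hc y
        _ = 1 := by
          rw [← ENNReal.ofReal_mul (Real.exp_nonneg _), ← Real.exp_add]; simp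
  have hsub : {ω : ℕ → Fin d → ℝ | ∑ s ∈ Finset.range n, V (Y s ω) + L / ξ <
      |∑ s ∈ Finset.range n, X (Y s ω) (ω (s + 1))|} ⊆
      {ω | L ≤ ∑ s ∈ Finset.range n, (ξ * X (Y s ω) (ω (s + 1)) - ξ * V (Y s ω))} ∪
      {ω | L ≤ ∑ s ∈ Finset.range n, (-ξ * X (Y s ω) (ω (s + 1)) - ξ * V (Y s ω))} := fun ω hω => by
    simp only [Set.mem_union, Set.mem_ofPred_eq, Finset.sum_sub_distrib, ← Finset.mul_sum] at hω ⊢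
    have h1 : ξ * (∑ s ∈ Finset.range n, V (Y s ω) + L / ξ) < ξ * |∑ s ∈ Finset.range n, X (Y s ω) (ω (s + 1))| := by
      gcongr
    have h2 : ξ * (L / ξ) = L := by field_simp
    rcases abs_cases (∑ s ∈ Finset.range n, X (Y s ω) (ω (s + 1))) with ⟨h3, -⟩ | ⟨h3, -⟩
    · left; rw [h3] at h1; linarith
    · right; rw [h3] at h1; linarith
  refine (measure_mono hsub).trans ((measure_union_le _ _).trans ?_)
  rw [two_mul]
  exact add_le_add (key ξ (abs_of_pos hξ)) (key (-ξ) (by rw [abs_neg, abs_of_pos hξ]))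

lemma measure_sq_dev_le (hσ : σ ≠ 0) {ξ : ℝ} (hξ : 0 < ξ) (hξσ : ξ * σ ^ 2 ≤ 1 / 4) (i : Fin d) (n : ℕ) (L : ℝ) :
    noiseLaw d σ {ω | 4 * ξ * σ ^ 4 * n + L / ξ < |∑ s ∈ Finset.range n, (ω (s + 1) i ^ 2 - σ ^ 2)|} ≤
      2 * ENNReal.ofReal (Real.exp (-L)) := by
  have h := measure_abs_sum_gt_le (d := d) (σ := σ) (Y := fun _ _ => 0) (X := fun _ w => w i ^ 2 - σ ^ 2)
    (V := fun _ => 4 * ξ * σ ^ 4) (fun s ω ω' _ => rfl) (fun s => measurable_const) (by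
      unfold Function.uncurry; fun_prop) measurable_const hξ (fun c hc y => ?_) n L
  · simpa [mul_comm, mul_left_comm, mul_assoc] using h
  · have e : ∀ w : Fin d → ℝ, ENNReal.ofReal (Real.exp (c * (w i ^ 2 - σ ^ 2))) =
        ENNReal.ofReal (Real.exp (-(c * σ ^ 2))) * ENNReal.ofReal (Real.exp (c * w i ^ 2)) := fun w => by
      rw [← ENNReal.ofReal_mul (Real.exp_nonneg _), ← Real.exp_add]; congr 2; ring
    simp_rw [e]
    rw [lintegral_const_mul _ (by fun_prop)]
    calc _ ≤ ENNReal.ofReal (Real.exp (-(c * σ ^ 2))) *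
          ENNReal.ofReal (Real.exp (c * σ ^ 2 + 4 * (c * σ ^ 2) ^ 2)) := by
          gcongr; exact lintegral_exp_coord_sq_le hσ i (by rw [hc]; exact hξσ)
      _ ≤ _ := by
        rw [← ENNReal.ofReal_mul (Real.exp_nonneg _), ← Real.exp_add, ← hc, ← sq_abs (c * σ ^ 2), abs_mul,
          abs_of_nonneg (sq_nonneg σ), hc]
        refine ENNReal.ofReal_le_ofReal (Real.exp_le_exp.2 (le_of_eq ?_)); ring

lemma measure_mul_dev_le (hσ : σ ≠ 0) {ξ : ℝ} (hξ : 0 < ξ) (hξσ : ξ * σ ^ 2 ≤ 1 / 4) {i j : Fin d} (hij : i ≠ j)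
    (n : ℕ) (L : ℝ) :
    noiseLaw d σ {ω | ξ * σ ^ 4 * n + L / ξ < |∑ s ∈ Finset.range n, ω (s + 1) i * ω (s + 1) j|} ≤
      2 * ENNReal.ofReal (Real.exp (-L)) := by
  have h := measure_abs_sum_gt_le (d := d) (σ := σ) (Y := fun _ _ => 0) (X := fun _ w => w i * w j)
    (V := fun _ => ξ * σ ^ 4) (fun s ω ω' _ => rfl) (fun s => measurable_const) (by
      unfold Function.uncurry; fun_prop) measurable_const hξ (fun c hc y => ?_) n L
  · simpa [mul_comm, mul_left_comm, mul_assoc] using h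
  · refine (lintegral_exp_coord_mul_le hσ hij (by rw [hc]; linarith)).trans (le_of_eq ?_)
    rw [← sq_abs c, hc]; congr 2; ring

/-- Given the past, w i · y is a centered Gaussian with variance σ²y², so the compensator is ξσ²y²/2
exactly. The trajectory's own energy thus appears in the bound, and no a priori boundedness is
required. -/
lemma measure_cross_dev_le {ξ : ℝ} (hξ : 0 < ξ) {y : (ℕ → Fin d → ℝ) → ℕ → Fin d → ℝ}
    (hy : ∀ s, DependsBefore (s + 1) fun ω => y ω (s + 1)) (hym : ∀ s, Measurable fun ω => y ω (s + 1))
    (i j : Fin d) (n : ℕ) (L : ℝ) :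
    noiseLaw d σ {ω | ξ * σ ^ 2 / 2 * ∑ s ∈ Finset.range n, y ω (s + 1) j ^ 2 + L / ξ <
      |∑ s ∈ Finset.range n, ω (s + 1) i * y ω (s + 1) j|} ≤ 2 * ENNReal.ofReal (Real.exp (-L)) := by
  have h := measure_abs_sum_gt_le (d := d) (σ := σ) (Y := fun s ω => y ω (s + 1) j) (X := fun y w => w i * y)
    (V := fun y => ξ * σ ^ 2 / 2 * y ^ 2) (fun s ω ω' h => congrFun (hy s ω ω' h) j)
    (fun s => (measurable_pi_apply j).comp (hym s)) (by
      unfold Function.uncurry; fun_prop) (by fun_prop) hξ (fun c hc y => ?_) n L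
  · simpa only [Finset.mul_sum] using h
  · have e : ∀ w : Fin d → ℝ, c * (w i * y) = (c * y) * w i := fun w => by ring
    simp_rw [e, lintegral_exp_linear]
    refine le_of_eq ?_
    rw [mul_pow, ← sq_abs c, hc]; congr 2; ring

lemma measure_coord_gt_le (hσ : 0 < σ) (i : Fin d) (n : ℕ) {L : ℝ} (hL : 1 ≤ L) :
    noiseLaw d σ {ω | 14 * σ ^ 2 * L < ω (n + 1) i ^ 2} ≤ ENNReal.ofReal (Real.exp (-(3 * L))) := by
  have h := measure_sum_ge_le (d := d) (σ := σ) (Y := fun _ _ => 0)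
    -- A single noise value written as a sum with one nonzero term. The exponent is normalized by
    -- 1/2 = 1/4 + 4(1/4)².
    (F := fun s _ w => if s = n then (4 * σ ^ 2)⁻¹ * w i ^ 2 - 1 / 2 else 0)
    (fun s ω ω' _ => rfl) (fun s => measurable_const) (fun s => ?_) (fun s y => ?_) (n + 1) (3 * L)
  · refine (measure_mono fun ω hω => ?_).trans h
    simp only [Set.mem_ofPred_eq, Finset.sum_ite_eq', Finset.mem_range, Nat.lt_succ_self, if_true] at hω ⊢
    have h1 : (4 * σ ^ 2)⁻¹ * (14 * σ ^ 2 * L) ≤ (4 * σ ^ 2)⁻¹ * ω (n + 1) i ^ 2 := by gcongr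
    have h2 : (4 * σ ^ 2)⁻¹ * (14 * σ ^ 2 * L) = 7 / 2 * L := by field_simp; ring
    linarith
  · by_cases hs : s = n
    · simp only [hs, if_true]; unfold Function.uncurry; fun_prop
    · simp only [hs, if_false]; exact measurable_const
  · by_cases hs : s = n
    · simp only [hs, if_true]
      have e : ∀ w : Fin d → ℝ, ENNReal.ofReal (Real.exp ((4 * σ ^ 2)⁻¹ * w i ^ 2 - 1 / 2)) =
          ENNReal.ofReal (Real.exp (-(1 / 2))) * ENNReal.ofReal (Real.exp ((4 * σ ^ 2)⁻¹ * w i ^ 2)) := fun w => by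
        rw [← ENNReal.ofReal_mul (Real.exp_nonneg _), ← Real.exp_add]; congr 2; ring
      simp_rw [e]
      have e2 : (4 * σ ^ 2)⁻¹ * σ ^ 2 = 1 / 4 := by field_simp
      rw [lintegral_const_mul _ (by fun_prop)]
      calc _ ≤ ENNReal.ofReal (Real.exp (-(1 / 2))) * ENNReal.ofReal (Real.exp (1 / 4 + 4 * (1 / 4) ^ 2)) := by
            gcongr
            have := lintegral_exp_coord_sq_le hσ.ne' i (c := (4 * σ ^ 2)⁻¹)
              (by rw [abs_of_pos (by positivity), e2])
            rwa [e2] at this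
        _ = 1 := by
          rw [← ENNReal.ofReal_mul (Real.exp_nonneg _), ← Real.exp_add]; norm_num
    · simp [hs]

/-- The concentration event fails with probability of order `T⁻²`. -/
lemma measure_not_noiseGood_le (hσ : 0 < σ) {ξ : ℝ} (hξ : 0 < ξ) (hξσ : ξ * σ ^ 2 ≤ 1 / 4) {T : ℕ} (hT : 1 ≤ T)
    {x z : (ℕ → Fin d → ℝ) → ℕ → Fin d → ℝ}
    (hx : ∀ s, DependsBefore (s + 1) fun ω => x ω (s + 1)) (hxm : ∀ s, Measurable fun ω => x ω (s + 1))
    (hz : ∀ s, DependsBefore (s + 1) fun ω => z ω (s + 1)) (hzm : ∀ s, Measurable fun ω => z ω (s + 1)) :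
    noiseLaw d σ {ω | ¬NoiseGood σ ξ (Real.log (3 * T)) T (x ω) (z ω) ω} ≤ ENNReal.ofReal (d ^ 2 / T ^ 2) := by
  have hT' : (1 : ℝ) ≤ T := by exact_mod_cast hT
  set L := Real.log (3 * T) with hL
  have hL1 : 1 ≤ L := by
    rw [hL, Real.le_log_iff_exp_le (by positivity)]
    linarith [Real.exp_one_lt_d9]
  set δ := ENNReal.ofReal (Real.exp (-(3 * L))) with hδ
  let B1 : ℕ → Fin d → Set (ℕ → Fin d → ℝ) := fun n i => {ω | 14 * σ ^ 2 * L < ω (n + 1) i ^ 2}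
  let B2 : ℕ → Fin d → Set (ℕ → Fin d → ℝ) := fun n i =>
    {ω | 4 * ξ * σ ^ 4 * n + 3 * L / ξ < |∑ s ∈ Finset.range n, (ω (s + 1) i ^ 2 - σ ^ 2)|}
  let B3 : ℕ → Fin d → Fin d → Set (ℕ → Fin d → ℝ) := fun n i j =>
    {ω | i ≠ j ∧ ξ * σ ^ 4 * n + 3 * L / ξ < |∑ s ∈ Finset.range n, ω (s + 1) i * ω (s + 1) j|}
  let C : ((ℕ → Fin d → ℝ) → ℕ → Fin d → ℝ) → ℕ → Fin d → Fin d → Set (ℕ → Fin d → ℝ) := fun y n i j =>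
    {ω | ξ * σ ^ 2 / 2 * ∑ s ∈ Finset.range n, y ω (s + 1) j ^ 2 + 3 * L / ξ <
      |∑ s ∈ Finset.range n, ω (s + 1) i * y ω (s + 1) j|}
  let B : ℕ → Fin d → Fin d → Set (ℕ → Fin d → ℝ) := fun n i j =>
    B1 n i ∪ (B2 n i ∪ (B3 n i j ∪ (C z n i j ∪ C x n i j)))
  have hB : ∀ n i j, noiseLaw d σ (B n i j) ≤ 9 * δ := fun n i j => by
    have h1 : noiseLaw d σ (B1 n i) ≤ δ := measure_coord_gt_le hσ i n hL1
    have h2 : noiseLaw d σ (B2 n i) ≤ 2 * δ := measure_sq_dev_le hσ.ne' hξ hξσ i n (3 * L)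
    have h3 : noiseLaw d σ (B3 n i j) ≤ 2 * δ := by
      by_cases hij : i = j
      · have : B3 n i j = ∅ := by ext ω; simp [B3, hij]
        rw [this]; simp
      · refine (measure_mono fun ω hω => ?_).trans (measure_mul_dev_le hσ.ne' hξ hξσ hij n (3 * L))
        exact hω.2
    have h4 : noiseLaw d σ (C z n i j) ≤ 2 * δ := measure_cross_dev_le hξ hz hzm i j n (3 * L)
    have h5 : noiseLaw d σ (C x n i j) ≤ 2 * δ := measure_cross_dev_le hξ hx hxm i j n (3 * L)
    calc noiseLaw d σ (B n i j) ≤ δ + (2 * δ + (2 * δ + (2 * δ + 2 * δ))) := by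
          refine (measure_union_le _ _).trans (add_le_add h1 ?_)
          refine (measure_union_le _ _).trans (add_le_add h2 ?_)
          refine (measure_union_le _ _).trans (add_le_add h3 ?_)
          exact (measure_union_le _ _).trans (add_le_add h4 h5)
      _ = 9 * δ := by ring
  -- Union bound over n ≤ T and pairs of coordinates. With exponent 3L each event has probability of
  -- order (3T)⁻³, so one factor T is lost and T⁻² remains.
  have hsub : {ω | ¬NoiseGood σ ξ L T (x ω) (z ω) ω} ⊆
      ⋃ a ∈ (Finset.range (T + 1) ×ˢ (Finset.univ : Finset (Fin d × Fin d))), B a.1 a.2.1 a.2.2 := by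
    intro ω hω
    by_contra hno
    apply hω
    have hall : ∀ n ≤ T, ∀ i j, ω ∉ B n i j := fun n hn i j hmem => hno (by
      simp only [Set.mem_iUnion]
      exact ⟨(n, i, j), by simp; omega, hmem⟩)
    simp only [B, Set.mem_union, not_or] at hall
    refine ⟨fun s hs i => ?_, fun n hn i => ?_, fun n hn i j hij => ?_, fun n hn i j => ?_, fun n hn i j => ?_⟩
    · exact not_lt.1 (hall s hs.le i i).1
    · exact not_lt.1 (hall n hn i i).2.1
    · exact not_lt.1 fun h => (hall n hn i j).2.2.1 ⟨hij, h⟩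
    · exact not_lt.1 (hall n hn i j).2.2.2.1
    · exact not_lt.1 (hall n hn i j).2.2.2.2
  refine (measure_mono hsub).trans ((measure_biUnion_finset_le _ _).trans ?_)
  calc _ ≤ ∑ _a ∈ (Finset.range (T + 1) ×ˢ (Finset.univ : Finset (Fin d × Fin d))), 9 * δ :=
        Finset.sum_le_sum fun a _ => hB _ _ _
    _ = ENNReal.ofReal (((T + 1 : ℕ) * (d * d : ℕ) : ℝ) * (9 * Real.exp (-(3 * L)))) := by
        rw [Finset.sum_const, nsmul_eq_mul, ← Nat.cast_mul, ENNReal.ofReal_mul (Nat.cast_nonneg _), hδ,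
          ENNReal.ofReal_mul (by norm_num), Finset.card_product, Finset.card_range, Finset.card_univ,
          Fintype.card_prod, Fintype.card_fin, ENNReal.ofReal_natCast]
        simp
    _ ≤ _ := by
        refine ENNReal.ofReal_le_ofReal ?_
        have e : Real.exp (-(3 * L)) = ((3 * (T : ℝ)) ^ 3)⁻¹ := by
          rw [Real.exp_neg, show 3 * L = ((3 : ℕ) : ℝ) * L by norm_num, Real.exp_nat_mul, hL,
            Real.exp_log (by positivity)]
        rw [e]
        have h1 : ((T + 1 : ℕ) : ℝ) ≤ 2 * T := by push_cast; linarith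
        calc ((T + 1 : ℕ) * (d * d : ℕ) : ℝ) * (9 * ((3 * (T : ℝ)) ^ 3)⁻¹)
            ≤ (2 * T * (d * d : ℕ)) * (9 * ((3 * (T : ℝ)) ^ 3)⁻¹) := by gcongr
          _ = 2 / 3 * (d ^ 2 / T ^ 2) := by push_cast; field_simp; ring
          _ ≤ _ := by
            have : 0 ≤ (d : ℝ) ^ 2 / T ^ 2 := by positivity
            linarith

/-! ### Truncated martingales -/

/-- A term is kept only while the full partial sum including it is at most c. The induction carries
the minimum of c and the full sum, since the truncated sum is also below the full one. -/
lemma sum_truncated_le {a : ℕ → ℝ} (ha : ∀ s, 0 ≤ a s) {c : ℝ} (hc : 0 ≤ c) (n : ℕ) :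
    ∑ s ∈ Finset.range n, (if ∑ r ∈ Finset.range (s + 1), a r ≤ c then a s else 0) ≤ c := by
  have key : ∑ s ∈ Finset.range n, (if ∑ r ∈ Finset.range (s + 1), a r ≤ c then a s else 0) ≤
      min c (∑ s ∈ Finset.range n, a s) := by
    induction n with
    | zero => simp [hc]
    | succ n ih =>
      obtain ⟨h1, h2⟩ := le_min_iff.1 ih
      rw [Finset.sum_range_succ]
      split_ifs with h
      · rw [Finset.sum_range_succ] at h ⊢
        exact le_min (by linarith) (by linarith)
      · rw [Finset.sum_range_succ a n]
        exact le_min (by linarith) (by linarith [ha n])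
  exact key.trans (min_le_left _ _)

/-- Orthogonality of martingale increments, for bounded predictable multipliers. -/
lemma integral_sq_martingale {Y : ℕ → (ℕ → Fin d → ℝ) → ℝ} (hY : ∀ s, DependsBefore (s + 1) (Y s))
    (hYm : ∀ s, Measurable (Y s)) {C : ℝ} (hC : ∀ s ω, |Y s ω| ≤ C) (i : Fin d) (n : ℕ) :
    MemLp (fun ω => ∑ s ∈ Finset.range n, ω (s + 1) i * Y s ω) 2 (noiseLaw d σ) ∧
    ∫ ω, (∑ s ∈ Finset.range n, ω (s + 1) i * Y s ω) ^ 2 ∂(noiseLaw d σ) =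
      σ ^ 2 * ∫ ω, ∑ s ∈ Finset.range n, Y s ω ^ 2 ∂(noiseLaw d σ) := by
  have hYL : ∀ s, MemLp (Y s) 2 (noiseLaw d σ) := fun s =>
    MemLp.of_bound (hYm s).aestronglyMeasurable C (ae_of_all _ fun ω => hC s ω)
  have hterm : ∀ s, MemLp (fun ω : ℕ → Fin d → ℝ => ω (s + 1) i * Y s ω) 2 (noiseLaw d σ) := fun s => by
    refine ((sqIntegrable_noise (s + 1) i).const_mul C).of_le
      ((sqIntegrable_noise (σ := σ) (s + 1) i).1.mul (hYm s).aestronglyMeasurable) (ae_of_all _ fun ω => ?_)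
    rw [norm_mul, norm_mul, mul_comm, Real.norm_eq_abs (Y s ω), Real.norm_eq_abs C]
    exact mul_le_mul_of_nonneg_right ((hC s ω).trans (le_abs_self C)) (norm_nonneg _)
  have hL : ∀ n, MemLp (fun ω : ℕ → Fin d → ℝ => ∑ s ∈ Finset.range n, ω (s + 1) i * Y s ω) 2 (noiseLaw d σ) :=
    fun n => memLp_finsetSum _ fun s _ => hterm s
  refine ⟨hL n, ?_⟩
  induction n with
  | zero => simp
  | succ n ih =>
    simp_rw [Finset.sum_range_succ]
    set M : (ℕ → Fin d → ℝ) → ℝ := fun ω => ∑ s ∈ Finset.range n, ω (s + 1) i * Y s ω with hM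
    have hMm : Measurable M := by
      have : ∀ s, Measurable fun ω : ℕ → Fin d → ℝ => ω (s + 1) i * Y s ω := fun s => by
        have h1 : Measurable fun ω : ℕ → Fin d → ℝ => ω (s + 1) i :=
          (measurable_pi_apply i).comp (measurable_pi_apply (s + 1))
        exact h1.mul (hYm s)
      exact Finset.measurable_sum _ fun s _ => this s
    have hMd : DependsBefore (n + 1) M := fun ω ω' h => by
      refine Finset.sum_congr rfl fun s hs => ?_
      have := Finset.mem_range.1 hs
      rw [h (s + 1) (by omega), hY s ω ω' fun r hr => h r (by omega)]
    have e : ∀ ω : ℕ → Fin d → ℝ, (M ω + ω (n + 1) i * Y n ω) ^ 2 =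
        M ω ^ 2 + 2 * ((M ω * Y n ω) * ω (n + 1) i) + (Y n ω ^ 2 * ω (n + 1) i ^ 2) := fun ω => by ring
    have hw : MemLp (fun ω : ℕ → Fin d → ℝ => ω (n + 1) i) 2 (noiseLaw d σ) := sqIntegrable_noise (n + 1) i
    have hMY : MemLp (fun ω => M ω * Y n ω) 2 (noiseLaw d σ) := by
      refine ((hL n).const_mul C).of_le ((hL n).1.mul (hYm n).aestronglyMeasurable) (ae_of_all _ fun ω => ?_)
      rw [norm_mul, norm_mul, mul_comm, Real.norm_eq_abs (Y n ω), Real.norm_eq_abs C]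
      exact mul_le_mul_of_nonneg_right ((hC n ω).trans (le_abs_self C)) (norm_nonneg _)
    have i1 : Integrable (fun ω => M ω ^ 2) (noiseLaw d σ) := (hL n).integrable_sq
    have i2 : Integrable (fun ω : ℕ → Fin d → ℝ => (M ω * Y n ω) * ω (n + 1) i) (noiseLaw d σ) :=
      hMY.integrable_mul hw
    have i3 : Integrable (fun ω : ℕ → Fin d → ℝ => Y n ω ^ 2 * ω (n + 1) i ^ 2) (noiseLaw d σ) := by
      have := (hterm n).integrable_sq
      refine this.congr (ae_of_all _ fun ω => ?_)
      simp only; ring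
    have z2 : ∫ ω : ℕ → Fin d → ℝ, (M ω * Y n ω) * ω (n + 1) i ∂(noiseLaw d σ) = 0 := by
      have hd : DependsBefore (n + 1) fun ω => M ω * Y n ω := fun ω ω' h => by
        simp only [hMd ω ω' h, hY n ω ω' h]
      have h1 := (hd.indepFun (σ := σ) (hMm.mul (hYm n))).comp measurable_id (measurable_pi_apply i)
      have h2 := h1.integral_fun_mul_eq_mul_integral hMY.1 hw.1
      have h3 : ∫ ω : ℕ → Fin d → ℝ, ω (n + 1) i ∂(noiseLaw d σ) = 0 := by
        have := (measurePreserving_noise (d := d) (σ := σ) (n + 1)).hasLaw.integral_comp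
          (f := fun w => w i) (measurable_pi_apply i).aestronglyMeasurable
        simpa [integral_coord, Function.comp_def] using this
      simp only [Function.comp_def, id] at h2
      rw [h2, h3, mul_zero]
    have z3 : ∫ ω : ℕ → Fin d → ℝ, Y n ω ^ 2 * ω (n + 1) i ^ 2 ∂(noiseLaw d σ) =
        σ ^ 2 * ∫ ω, Y n ω ^ 2 ∂(noiseLaw d σ) := by
      have h1 := ((hY n).indepFun (σ := σ) (hYm n)).comp (φ := fun y => y ^ 2) (ψ := fun w => w i ^ 2)
        (by fun_prop) (by fun_prop)
      have h2 := h1.integral_fun_mul_eq_mul_integral (hYL n).integrable_sq.1 hw.integrable_sq.1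
      have h3 : ∫ ω : ℕ → Fin d → ℝ, ω (n + 1) i ^ 2 ∂(noiseLaw d σ) = σ ^ 2 := by
        have h4 := (measurePreserving_noise (d := d) (σ := σ) (n + 1)).hasLaw.integral_comp
          (f := fun w => w i ^ 2) ((measurable_pi_apply i).pow_const 2).aestronglyMeasurable
        have h5 := integral_coord_mul (σ := σ) i i
        simp only [Function.comp_def] at h4
        rw [h4]; simpa [sq] using h5
      simp only [Function.comp_def] at h2
      rw [h2, h3, mul_comm]
    rw [integral_congr_ae (ae_of_all _ e)]
    have i12 : Integrable (fun ω : ℕ → Fin d → ℝ => M ω ^ 2 + 2 * (M ω * Y n ω * ω (n + 1) i)) (noiseLaw d σ) :=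
      i1.add (i2.const_mul 2)
    rw [integral_add i12 i3, integral_add i1 (i2.const_mul 2), integral_const_mul, z2, z3, ih,
      integral_add (integrable_finsetSum _ fun s _ => (hYL s).integrable_sq) (hYL n).integrable_sq]
    ring

end NoiseProbability


/-! ### Pathwise regret bounds -/

section Pathwise

variable {d k : ℕ}

/-- The state at time `s + 1`, set to zero once the energy of the trajectory exceeds `c`. -/
def trunc (c : ℝ) (x : ℕ → Fin d → ℝ) (s : ℕ) (j : Fin d) : ℝ :=
  if ∑ r ∈ Finset.range (s + 1), x (r + 1) ⬝ᵥ x (r + 1) ≤ c then x (s + 1) j else 0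

/-- The squared Frobenius norm of the correlation of the noise with the truncated states. -/
def corrSq (c : ℝ) (x w : ℕ → Fin d → ℝ) (n : ℕ) : ℝ :=
  ∑ i, ∑ j, (∑ s ∈ Finset.range n, w (s + 1) i * trunc c x s j) ^ 2

lemma corrSq_nonneg (c : ℝ) (x w : ℕ → Fin d → ℝ) (n : ℕ) : 0 ≤ corrSq c x w n := by
  unfold corrSq; positivity

lemma corrSq_eq {c : ℝ} {x w : ℕ → Fin d → ℝ} {n : ℕ}
    (h : ∑ r ∈ Finset.range n, x (r + 1) ⬝ᵥ x (r + 1) ≤ c) :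
    corrSq c x w n = ∑ i, ∑ j, (∑ s ∈ Finset.range n, Matrix.vecMulVec (w (s + 1)) (x (s + 1))) i j ^ 2 := by
  refine Finset.sum_congr rfl fun i _ => Finset.sum_congr rfl fun j _ => ?_
  rw [Matrix.sum_apply]
  congr 1
  refine Finset.sum_congr rfl fun s hs => ?_
  rw [trunc, if_pos, Matrix.vecMulVec_apply]
  refine le_trans (Finset.sum_le_sum_of_subset_of_nonneg ?_ fun r _ _ => dot_self_nonneg _) h
  exact Finset.range_mono (Finset.mem_range.1 hs)

namespace Setting

variable {S : System d k} {p : AlgInput d k} {P Y₀ : Matrix (Fin d) (Fin d) ℝ} {g ε₀ : ℝ} {T : ℕ}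
  {x w : ℕ → Fin d → ℝ} {u : ℕ → Fin k → ℝ}

/-- The squared deviation from the optimal action. -/
def dev (S : System d k) (P : Matrix (Fin d) (Fin d) ℝ) (x : ℕ → Fin d → ℝ) (u : ℕ → Fin k → ℝ) (t : ℕ) : ℝ :=
  (u t - Kopt S P *ᵥ x t) ⬝ᵥ (u t - Kopt S P *ᵥ x t)

/-- The performance-difference identity summed along the path. The values of `qf P` telescope from
x₁ = 0, the final one is nonnegative and dropped, and the noise leaves a martingale term plus `qf P
w`, whose mean is J⋆. -/
lemma sum_cost_le (h : Setting S p P Y₀ g ε₀ T) (hr : IsRun S p x u w) (n : ℕ) :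
    ∑ s ∈ Finset.range n, (qf S.Q (x (s + 1)) + qf S.R (u (s + 1))) ≤
      2 * g ^ 3 * ∑ s ∈ Finset.range n, dev S P x u (s + 1) +
      ∑ s ∈ Finset.range n, (2 * ((P *ᵥ drift S x u (s + 1)) ⬝ᵥ w (s + 1)) + qf P (w (s + 1))) := by
  have key : ∑ s ∈ Finset.range n, (qf S.Q (x (s + 1)) + qf S.R (u (s + 1))) + qf P (x (n + 1)) ≤
      2 * g ^ 3 * ∑ s ∈ Finset.range n, dev S P x u (s + 1) +
      ∑ s ∈ Finset.range n, (2 * ((P *ᵥ drift S x u (s + 1)) ⬝ᵥ w (s + 1)) + qf P (w (s + 1))) := by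
    induction n with
    | zero => simp [hr.x_one, qf_zero]
    | succ n ih =>
      rw [Finset.sum_range_succ, Finset.sum_range_succ, Finset.sum_range_succ, hr.step]
      have h1 := h.bdd.advantage (x (n + 1)) (u (n + 1))
      have h2 := h.bdd.hess_le h.R_le (u (n + 1) - Kopt S P *ᵥ x (n + 1))
      have h3 := qf_add P (transpose_eq_of_posDef h.bdd.sol.1) (drift S x u (n + 1)) (w (n + 1))
      have h4 : (P *ᵥ drift S x u (n + 1)) ⬝ᵥ w (n + 1) = drift S x u (n + 1) ⬝ᵥ P *ᵥ w (n + 1) := by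
        rw [dotProduct_comm, dot_symm (transpose_eq_of_posDef h.bdd.sol.1)]
      rw [drift] at h3 h4 ⊢
      rw [h4, h3]
      rw [dev]
      linarith
  linarith [h.bdd.psd.2 (x (n + 1))]

lemma sum_dev_warmup_le (h : Setting S p P Y₀ g ε₀ T) (hr : IsRun S p x u w) (n : ℕ) :
    ∑ s ∈ Finset.range n, (if s + 1 < p.τ₀ then dev S P x u (s + 1) else 0) ≤
      80 * g ^ 10 * ∑ s ∈ Finset.range p.τ₀, w (s + 1) ⬝ᵥ w (s + 1) := by
  have hg := h.pos
  have h4 := h.tau_ge_four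
  -- Before τ₀ the accuracy hypothesis is vacuous, so the energy bound holds on every path.
  have h1 := h.sum_state_le hr (n := p.τ₀ - 2) fun s h1 h2 => by omega
  have hK : ‖p.K₀ - Kopt S P‖ ≤ 2 * g :=
    (norm_sub_le _ _).trans (by linarith [h.K0_norm, h.bdd.gain_norm])
  have h2 : ∑ s ∈ Finset.range n, (if s + 1 < p.τ₀ then dev S P x u (s + 1) else 0) ≤
      ∑ s ∈ Finset.range (p.τ₀ - 2 + 1), (2 * g) ^ 2 * (x (s + 1) ⬝ᵥ x (s + 1)) := by
    rw [← Finset.sum_filter]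
    refine le_trans (Finset.sum_le_sum fun s hs => ?_)
      (Finset.sum_le_sum_of_subset_of_nonneg (s := {s ∈ Finset.range n | s + 1 < p.τ₀}) (fun s hs => ?_)
        fun s _ _ => by have := dot_self_nonneg (x (s + 1)); positivity)
    · rw [dev, action_of_lt hr (Finset.mem_filter.1 hs).2, ← Matrix.sub_mulVec]
      exact mulVec_dot_self_le_of_norm hK _
    · have := (Finset.mem_filter.1 hs).2
      exact Finset.mem_range.2 (by omega)
  rw [← Finset.mul_sum] at h2
  have h3 : ∑ s ∈ Finset.range (p.τ₀ - 2), w (s + 1) ⬝ᵥ w (s + 1) ≤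
      ∑ s ∈ Finset.range p.τ₀, w (s + 1) ⬝ᵥ w (s + 1) :=
    Finset.sum_le_sum_of_subset_of_nonneg (Finset.range_mono (by omega)) fun s _ _ => dot_self_nonneg _
  calc _ ≤ _ := h2
    _ ≤ (2 * g) ^ 2 * (20 * g ^ 8 * ∑ s ∈ Finset.range p.τ₀, w (s + 1) ⬝ᵥ w (s + 1)) := by
        gcongr; exact h1.trans (by gcongr)
    _ = _ := by ring

/-- The energy level at which states are truncated. -/
def level (g : ℝ) (t : ℕ) : ℝ := 40 * g ^ 11 * t

/-- On the good event accuracy ε₀ is known, which permits the Lipschitz bound with the actual error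
e. That error is then re-expressed by the correlation of noise and states, whose expectation has the
right order in τ. -/
lemma dev_le_of_noiseGood (h : Setting S p P Y₀ g ε₀ T) (hr : IsRun S p x u w)
    (hn : NoiseGood S.σ (xi g ε₀) (Real.log (3 * T)) T x (drift S x u) w) {t : ℕ} (ht : p.τ₀ ≤ t + 1)
    (htT : t + 1 ≤ T) {τ : ℕ} (hτ : τ = p.phaseStart (t + 1)) :
    dev S P x u (t + 1) ≤ 141120000 * g ^ 20 * p.xb *
      ((corrSq (level g τ) x w (τ - 1) + p.lam ^ 2 * g ^ 2) / τ ^ 2) := by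
  have hg := h.pos
  have hσ := h.sigma_pos
  have h4 := h.tau_ge_four
  have hτ1 : p.τ₀ ≤ τ := hτ ▸ AlgInput.le_phaseStart _
  have hτ2 : τ ≤ t + 1 := hτ ▸ AlgInput.phaseStart_le h.one_le_tau ht
  have hfine := h.fine_of_noiseGood hr hn
  obtain ⟨hV, hX, -⟩ := h.estimate_of_fine hr hn hτ1 (hτ2.trans htT) fun s h1 h2 => hfine s h1 (by omega)
  have hτ0 : (0 : ℝ) < τ := by exact_mod_cast (by omega : 0 < τ)
  set N := ∑ s ∈ Finset.range (τ - 1), Matrix.vecMulVec (w (s + 1)) (x (s + 1)) with hN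
  -- On the good event the energy stays below the level, so truncation changes nothing; it serves
  -- only to make the martingale square integrable with a known bound.
  have hc : ‖N‖ ^ 2 ≤ corrSq (level g τ) x w (τ - 1) := by
    rw [corrSq_eq (by rw [level]; exact hX)]; exact norm_sq_le_frob N
  have he := AlgInput.estimate_sub_norm_le (p := p) (u := u) (x := x) (τ := τ) h.lam_pos (A := S.A) (w := w)
    (fun s h1 h2 => by
      obtain ⟨r, rfl⟩ : ∃ r, s = r + 1 := ⟨s - 1, by omega⟩
      rw [h.B_eq]; exact hr.step r) (c := S.σ ^ 2 * τ / 4) (b := ‖N‖) (by positivity) hV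
      (by rw [sum_Icc_one (fun s => Matrix.vecMulVec (w s) (x s))])
  obtain ⟨hf1, -⟩ := hfine τ hτ1 (hτ2.trans htT)
  obtain ⟨-, hf2⟩ := hfine (t + 1) ht htT
  set e := ‖p.estimate x u τ - S.A‖ with hedef
  have he0 : 0 ≤ e := norm_nonneg _
  have hK := h.greedy_near (x := x) (u := u) (τ := τ) he0 hf1 le_rfl
  have h1 : dev S P x u (t + 1) ≤ (2100 * g ^ 8 * e) ^ 2 * (x (t + 1) ⬝ᵥ x (t + 1)) := by
    rw [dev, h.action_of_fine hr ht fun s h1 h2 => hfine s h1 (by omega), ← Matrix.sub_mulVec, ← hτ]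
    exact mulVec_dot_self_le_of_norm hK _
  have h6 : (S.σ ^ 2 * τ / 4)⁻¹ ≤ 4 * g ^ 2 / τ := by
    rw [inv_le_iff_one_le_mul₀ (by positivity)]
    have := h.sigma_sq_inv_le
    calc (1 : ℝ) ≤ g ^ 2 * S.σ ^ 2 := this
      _ = _ := by field_simp
  have hlA : p.lam * ‖S.A‖ ≤ p.lam * g := mul_le_mul_of_nonneg_left h.bdd.A_le h.lam_pos.le
  have hl := h.lam_pos
  have h7 : e ^ 2 ≤ 32 * g ^ 4 * ((corrSq (level g τ) x w (τ - 1) + p.lam ^ 2 * g ^ 2) / τ ^ 2) := by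
    have h8 : e ≤ 4 * g ^ 2 / τ * (‖N‖ + p.lam * g) := he.trans (by gcongr)
    calc e ^ 2 ≤ (4 * g ^ 2 / τ * (‖N‖ + p.lam * g)) ^ 2 := by gcongr
      _ = 16 * g ^ 4 * (‖N‖ + p.lam * g) ^ 2 / τ ^ 2 := by field_simp; ring
      _ ≤ 16 * g ^ 4 * (2 * (corrSq (level g τ) x w (τ - 1) + p.lam ^ 2 * g ^ 2)) / τ ^ 2 := by
        gcongr
        nlinarith [sq_nonneg (‖N‖ - p.lam * g)]
      _ = _ := by ring
  calc _ ≤ _ := h1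
    _ ≤ (2100 * g ^ 8 * e) ^ 2 * p.xb := by gcongr
    _ = 4410000 * g ^ 16 * p.xb * e ^ 2 := by ring
    _ ≤ 4410000 * g ^ 16 * p.xb *
          (32 * g ^ 4 * ((corrSq (level g τ) x w (τ - 1) + p.lam ^ 2 * g ^ 2) / τ ^ 2)) := by
        have := (dot_self_nonneg (x (t + 1))).trans hf2
        gcongr
    _ = _ := by ring

lemma kappa_ge_one (h : Setting S p P Y₀ g ε₀ T) : 1 ≤ p.κ := by linarith [h.kappa_ge, h.pos]

lemma xb_nonneg (h : Setting S p P Y₀ g ε₀ T) : 0 ≤ p.xb := by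
  have := h.xb_ge; have := h.log_ge_one; have := h.pos
  exact le_trans (by positivity) h.xb_ge

/-- In every step the action is a bounded linear function of the state, and it is either the
stabilizing one or the state is small. -/
lemma action_cases (hr : IsRun S p x u w) (t : ℕ) :
    u (t + 1) = p.K₀ *ᵥ x (t + 1) ∨
      x (t + 1) ⬝ᵥ x (t + 1) ≤ p.xb ∧ ∃ K : Matrix (Fin k) (Fin d) ℝ, ‖K‖ ≤ p.κ ∧ u (t + 1) = K *ᵥ x (t + 1) := by
  rw [hr.act, AlgInput.policy]
  split_ifs with h1
  · exact Or.inl rfl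
  · right
    rw [not_or] at h1
    have h2 : ¬(p.xb < x (t + 1) ⬝ᵥ x (t + 1) ∨ p.κ < ‖p.greedy x u (p.phaseStart (t + 1))‖) :=
      fun h2 => h1.2 ⟨t + 1, not_lt.1 h1.1, le_rfl, h2⟩
    rw [not_or] at h2
    exact ⟨not_lt.1 h2.1, _, not_lt.1 h2.2, rfl⟩

lemma action_norm_le (h : Setting S p P Y₀ g ε₀ T) (hr : IsRun S p x u w) (t : ℕ) :
    ∃ K : Matrix (Fin k) (Fin d) ℝ, ‖K‖ ≤ p.κ ∧ u (t + 1) = K *ᵥ x (t + 1) := by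
  rcases action_cases hr t with h1 | ⟨-, h1⟩
  · exact ⟨p.K₀, by linarith [h.K0_norm, h.kappa_ge], h1⟩
  · exact h1

lemma dev_le_state (h : Setting S p P Y₀ g ε₀ T) (hr : IsRun S p x u w) (t : ℕ) :
    dev S P x u (t + 1) ≤ 4 * p.κ ^ 2 * (x (t + 1) ⬝ᵥ x (t + 1)) := by
  obtain ⟨K, hK, hu⟩ := h.action_norm_le hr t
  have h1 : ‖K - Kopt S P‖ ≤ 2 * p.κ :=
    (norm_sub_le _ _).trans (by linarith [h.kappa_ge, h.bdd.gain_norm])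
  rw [dev, hu, ← Matrix.sub_mulVec]
  exact (mulVec_dot_self_le_of_norm h1 _).trans (le_of_eq (by ring))

/-- A crude bound on the energy of the trajectory that holds on every path. -/
lemma sum_state_le_crude (h : Setting S p P Y₀ g ε₀ T) (hr : IsRun S p x u w) (n : ℕ) :
    ∑ s ∈ Finset.range (n + 1), x (s + 1) ⬝ᵥ x (s + 1) ≤
      32 * g ^ 6 * p.κ ^ 2 * ∑ s ∈ Finset.range n, (p.xb + w (s + 1) ⬝ᵥ w (s + 1)) := by
  have hg := h.pos
  have hg1 := h.one_le
  have hκ := h.kappa_ge_one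
  have hκ2 := one_le_pow₀ hκ (n := 2)
  have hxb := h.xb_nonneg
  have hstep : ∀ s < n, qf Y₀ (x (s + 1 + 1)) ≤ (1 - (4 * g ^ 2)⁻¹) * qf Y₀ (x (s + 1)) +
      8 * g ^ 3 * p.κ ^ 2 * (p.xb + w (s + 1) ⬝ᵥ w (s + 1)) := fun s _ => by
    have hww := dot_self_nonneg (w (s + 1))
    rcases action_cases hr s with h1 | ⟨h1, K, hK, hu⟩
    · have h2 := contract_step hg1 h.isSuper.1 h.Y_le (h.Y_contract (x (s + 1))) (w (s + 1))
      rw [← h1, ← hr.step] at h2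
      refine h2.trans (add_le_add le_rfl ?_)
      calc 5 * g ^ 3 * (w (s + 1) ⬝ᵥ w (s + 1)) ≤ 8 * g ^ 3 * 1 * (0 + w (s + 1) ⬝ᵥ w (s + 1)) := by
            have : 0 ≤ g ^ 3 * (w (s + 1) ⬝ᵥ w (s + 1)) := by positivity
            linarith
        _ ≤ _ := by gcongr
    -- Before an abort the controller need not be stabilizing, but the state is at most x_b and the
    -- gain at most κ, so the next state is bounded outright and no contraction is used.
    · have h0 : 0 ≤ (1 - (4 * g ^ 2)⁻¹) * qf Y₀ (x (s + 1)) :=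
        mul_nonneg (by linarith [h.inv_le_one']) (h.isSuper.1.2 _)
      have h2 : x (s + 1 + 1) ⬝ᵥ x (s + 1 + 1) ≤
          2 * (2 * (g ^ 2 * p.xb) + 2 * (g ^ 2 * (p.κ ^ 2 * p.xb))) + 2 * (w (s + 1) ⬝ᵥ w (s + 1)) := by
        rw [hr.step]
        refine (dot_add_self_le _ _).trans ?_
        gcongr
        refine (dot_add_self_le _ _).trans ?_
        gcongr
        · exact (mulVec_dot_self_le_of_norm h.bdd.A_le _).trans (by gcongr)
        · refine (mulVec_dot_self_le_of_norm h.bdd.B_le _).trans ?_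
          rw [hu]
          gcongr
          exact (mulVec_dot_self_le_of_norm hK _).trans (by gcongr)
      have h3 : qf Y₀ (x (s + 1 + 1)) ≤ g * _ := (h.Y_le _).trans (mul_le_mul_of_nonneg_left h2 hg.le)
      have h4 : g ^ 3 * 1 * p.xb ≤ g ^ 3 * p.κ ^ 2 * p.xb := by gcongr
      have h5 : g * 1 * (w (s + 1) ⬝ᵥ w (s + 1)) ≤ g ^ 3 * p.κ ^ 2 * (w (s + 1) ⬝ᵥ w (s + 1)) := by
        gcongr; exact le_self_pow₀ hg1 (by norm_num)
      have h6 : 0 ≤ g ^ 3 * p.κ ^ 2 * (w (s + 1) ⬝ᵥ w (s + 1)) := by positivity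
      linarith
  have h1 := sum_le_of_contract (Φ := fun s => qf Y₀ (x (s + 1)))
    (b := fun s => 8 * g ^ 3 * p.κ ^ 2 * (p.xb + w (s + 1) ⬝ᵥ w (s + 1)))
    (δ := (4 * g ^ 2)⁻¹) (n := n) (by simp [hr.x_one, qf_zero]) (fun s => h.isSuper.1.2 _) hstep h.inv_le_one'
  rw [← Finset.mul_sum] at h1
  have h2 : ∑ s ∈ Finset.range (n + 1), x (s + 1) ⬝ᵥ x (s + 1) ≤
      g * ∑ s ∈ Finset.range (n + 1), qf Y₀ (x (s + 1)) := by
    rw [Finset.mul_sum]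
    exact Finset.sum_le_sum fun s _ => le_mul_of_inv_mul_le hg (h.Y_ge _)
  have h3 := le_mul_of_inv_mul_le (by positivity) h1
  calc _ ≤ _ := h2
    _ ≤ g * (4 * g ^ 2 * (8 * g ^ 3 * p.κ ^ 2 * ∑ s ∈ Finset.range n, (p.xb + w (s + 1) ⬝ᵥ w (s + 1)))) := by gcongr
    _ = _ := by ring

/-- The total deviation from the optimal actions, on every path. -/
lemma sum_dev_le (h : Setting S p P Y₀ g ε₀ T) (hr : IsRun S p x u w) {b : ℝ} (hb : 0 ≤ b)
    (hbad : ¬NoiseGood S.σ (xi g ε₀) (Real.log (3 * T)) T x (drift S x u) w → b = 1) :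
    ∑ s ∈ Finset.range T, dev S P x u (s + 1) ≤
      80 * g ^ 10 * ∑ s ∈ Finset.range p.τ₀, w (s + 1) ⬝ᵥ w (s + 1) +
      141120000 * g ^ 20 * p.xb * ∑ t ∈ Finset.Icc p.τ₀ T,
        (corrSq (level g (p.phaseStart t)) x w (p.phaseStart t - 1) + p.lam ^ 2 * g ^ 2) / p.phaseStart t ^ 2 +
      128 * g ^ 6 * p.κ ^ 4 * ∑ s ∈ Finset.range T, b * (p.xb + w (s + 1) ⬝ᵥ w (s + 1)) := by
  have hg := h.pos
  have hxb := h.xb_nonneg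
  have h4 := h.tau_ge_four
  have e1 : 0 ≤ 80 * g ^ 10 * ∑ s ∈ Finset.range p.τ₀, w (s + 1) ⬝ᵥ w (s + 1) :=
    mul_nonneg (by positivity) (Finset.sum_nonneg fun s _ => dot_self_nonneg _)
  have e2 : 0 ≤ 141120000 * g ^ 20 * p.xb * ∑ t ∈ Finset.Icc p.τ₀ T,
        (corrSq (level g (p.phaseStart t)) x w (p.phaseStart t - 1) + p.lam ^ 2 * g ^ 2) / p.phaseStart t ^ 2 :=
    mul_nonneg (by positivity) (Finset.sum_nonneg fun t _ => by
      have := corrSq_nonneg (level g (p.phaseStart t)) x w (p.phaseStart t - 1); positivity)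
  have hsum : 0 ≤ ∑ s ∈ Finset.range T, (p.xb + w (s + 1) ⬝ᵥ w (s + 1)) :=
    Finset.sum_nonneg fun s _ => add_nonneg hxb (dot_self_nonneg _)
  rw [← Finset.mul_sum _ _ b]
  -- On the good event the first two sums suffice; otherwise b = 1 and the last sum alone dominates.
  -- All three are nonnegative, so both cases fit one bound.
  by_cases hn : NoiseGood S.σ (xi g ε₀) (Real.log (3 * T)) T x (drift S x u) w
  · have e3 : 0 ≤ 128 * g ^ 6 * p.κ ^ 4 * (b * ∑ s ∈ Finset.range T, (p.xb + w (s + 1) ⬝ᵥ w (s + 1))) := by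
      positivity
    have hw := h.sum_dev_warmup_le hr T
    have hl : ∑ s ∈ Finset.range T, (if s + 1 < p.τ₀ then 0 else dev S P x u (s + 1)) ≤
        141120000 * g ^ 20 * p.xb * ∑ t ∈ Finset.Icc p.τ₀ T,
        (corrSq (level g (p.phaseStart t)) x w (p.phaseStart t - 1) + p.lam ^ 2 * g ^ 2) / p.phaseStart t ^ 2 := by
      rw [← sum_Icc_one (fun t => if t < p.τ₀ then 0 else dev S P x u t)]
      have : Finset.Icc p.τ₀ T = {t ∈ Finset.Icc 1 T | ¬t < p.τ₀} := by
        ext t; simp only [Finset.mem_Icc, Finset.mem_filter]; omega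
      rw [this, Finset.mul_sum, Finset.sum_filter]
      refine Finset.sum_le_sum fun t ht => ?_
      by_cases h1 : t < p.τ₀
      · simp [h1]
      · rw [if_neg h1, if_pos h1]
        obtain ⟨r, rfl⟩ : ∃ r, t = r + 1 := ⟨t - 1, by omega⟩
        exact h.dev_le_of_noiseGood hr hn (by omega) (Finset.mem_Icc.1 ht).2 rfl
    have : ∑ s ∈ Finset.range T, dev S P x u (s + 1) =
        ∑ s ∈ Finset.range T, (if s + 1 < p.τ₀ then dev S P x u (s + 1) else 0) +
        ∑ s ∈ Finset.range T, (if s + 1 < p.τ₀ then 0 else dev S P x u (s + 1)) := by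
      rw [← Finset.sum_add_distrib]
      exact Finset.sum_congr rfl fun s _ => by split_ifs <;> simp
    linarith
  · rw [hbad hn, one_mul]
    have h1 : ∑ s ∈ Finset.range T, dev S P x u (s + 1) ≤
        4 * p.κ ^ 2 * ∑ s ∈ Finset.range (T + 1), x (s + 1) ⬝ᵥ x (s + 1) := by
      rw [Finset.mul_sum]
      refine (Finset.sum_le_sum fun s _ => h.dev_le_state hr s).trans
        (Finset.sum_le_sum_of_subset_of_nonneg (Finset.range_mono (by omega)) fun s _ _ => ?_)
      have := dot_self_nonneg (x (s + 1)); positivity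
    have h2 : 4 * p.κ ^ 2 * ∑ s ∈ Finset.range (T + 1), x (s + 1) ⬝ᵥ x (s + 1) ≤ 4 * p.κ ^ 2 * _ :=
      mul_le_mul_of_nonneg_left (h.sum_state_le_crude hr T) (by positivity)
    have h3 : 4 * p.κ ^ 2 * (32 * g ^ 6 * p.κ ^ 2 * ∑ s ∈ Finset.range T, (p.xb + w (s + 1) ⬝ᵥ w (s + 1))) =
      128 * g ^ 6 * p.κ ^ 4 * ∑ s ∈ Finset.range T, (p.xb + w (s + 1) ⬝ᵥ w (s + 1)) := by ring
    linarith

end Setting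

end Pathwise

/-! ### Expected regret -/

section ExpectedRegret

variable {d k : ℕ} {σ : ℝ}

lemma SqIntegrable.of_dot_le {m n : ℕ} {X : (ℕ → Fin d → ℝ) → Fin m → ℝ} {Y : (ℕ → Fin d → ℝ) → Fin n → ℝ}
    (hX : SqIntegrable σ X) (hY : Measurable Y) {c : ℝ} (h : ∀ ω, Y ω ⬝ᵥ Y ω ≤ c * (X ω ⬝ᵥ X ω)) :
    SqIntegrable σ Y := fun i => by
  have hm : Measurable fun ω => Y ω i := (measurable_pi_apply i).comp hY
  rw [memLp_two_iff_integrable_sq hm.aestronglyMeasurable]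
  refine (((hX.dot hX).const_mul c)).mono' (hm.pow_const 2).aestronglyMeasurable (ae_of_all _ fun ω => ?_)
  rw [Real.norm_of_nonneg (sq_nonneg _), sq]
  exact (Finset.single_le_sum (f := fun j => Y ω j * Y ω j) (fun j _ => mul_self_nonneg _)
    (Finset.mem_univ i)).trans (h ω)

lemma integral_sum_noise (n : ℕ) :
    Integrable (fun ω : ℕ → Fin d → ℝ => ∑ s ∈ Finset.range n, ω (s + 1) ⬝ᵥ ω (s + 1)) (noiseLaw d σ) ∧
    ∫ ω : ℕ → Fin d → ℝ, ∑ s ∈ Finset.range n, ω (s + 1) ⬝ᵥ ω (s + 1) ∂(noiseLaw d σ) = n * (d * σ ^ 2) := by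
  have hi : ∀ s, Integrable (fun ω : ℕ → Fin d → ℝ => ω (s + 1) ⬝ᵥ ω (s + 1)) (noiseLaw d σ) := fun s =>
    (sqIntegrable_noise (s + 1)).dot (sqIntegrable_noise (s + 1))
  refine ⟨integrable_finsetSum _ fun s _ => hi s, ?_⟩
  rw [integral_finsetSum _ fun s _ => hi s]
  have h1 : ∀ s, ∫ ω : ℕ → Fin d → ℝ, ω (s + 1) ⬝ᵥ ω (s + 1) ∂(noiseLaw d σ) = d * σ ^ 2 := fun s => by
    have := integral_qf_noise (σ := σ) (1 : Matrix (Fin d) (Fin d) ℝ) (s + 1)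
    simp only [qf, Matrix.one_mulVec, Matrix.trace_one, Fintype.card_fin] at this
    rw [this]; ring
  simp [h1]

lemma integrable_coord_pow_four (i : Fin d) :
    Integrable (fun w : Fin d → ℝ => w i ^ 4) (gaussianNoise d σ) := by
  have := (memLp_coord (σ := σ) i (p := 4) (by simp)).integrable_norm_pow (by norm_num)
  refine this.congr (ae_of_all _ fun w => ?_)
  simp only [Real.norm_eq_abs]
  exact Even.pow_abs (by decide) (w i)

/-- From y²/2 ≤ eʸ with y = w²/(4σ²) and the exponential moment already available; the constant is
not sharp. -/
lemma integral_coord_pow_four_le (hσ : 0 < σ) (i : Fin d) :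
    ∫ w : Fin d → ℝ, w i ^ 4 ∂(gaussianNoise d σ) ≤ 64 * σ ^ 4 := by
  rw [integral_eq_lintegral_of_nonneg_ae (ae_of_all _ fun w => by positivity)
    (integrable_coord_pow_four i).1]
  refine ENNReal.toReal_le_of_le_ofReal (by positivity) ?_
  have e2 : (4 * σ ^ 2)⁻¹ * σ ^ 2 = 1 / 4 := by field_simp
  have h1 := lintegral_exp_coord_sq_le hσ.ne' i (c := (4 * σ ^ 2)⁻¹)
    (by rw [abs_of_pos (by positivity), e2])
  rw [e2] at h1
  calc ∫⁻ w : Fin d → ℝ, ENNReal.ofReal (w i ^ 4) ∂(gaussianNoise d σ)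
      ≤ ∫⁻ w : Fin d → ℝ, ENNReal.ofReal (32 * σ ^ 4) *
          ENNReal.ofReal (Real.exp ((4 * σ ^ 2)⁻¹ * w i ^ 2)) ∂(gaussianNoise d σ) := by
        refine lintegral_mono fun w => ?_
        rw [← ENNReal.ofReal_mul (by positivity)]
        refine ENNReal.ofReal_le_ofReal ?_
        have hy : 0 ≤ (4 * σ ^ 2)⁻¹ * w i ^ 2 := by positivity
        have h2 := Real.quadratic_le_exp_of_nonneg hy
        calc w i ^ 4 = 32 * σ ^ 4 * (((4 * σ ^ 2)⁻¹ * w i ^ 2) ^ 2 / 2) := by field_simp; ring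
          _ ≤ _ := by gcongr; linarith
    _ ≤ ENNReal.ofReal (32 * σ ^ 4) * ENNReal.ofReal (Real.exp (1 / 4 + 4 * (1 / 4) ^ 2)) := by
        rw [lintegral_const_mul' _ _ ENNReal.ofReal_ne_top]; gcongr
    _ ≤ _ := by
        rw [← ENNReal.ofReal_mul (by positivity)]
        refine ENNReal.ofReal_le_ofReal ?_
        have h3 : Real.exp (1 / 4 + 4 * (1 / 4) ^ 2) ≤ 2 := by
          have h4 : Real.exp (1 / 4 + 4 * (1 / 4) ^ 2) ^ 2 ≤ 2 ^ 2 := by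
            rw [← Real.exp_nat_mul]; norm_num; linarith [Real.exp_one_lt_d9]
          exact (abs_le_of_sq_le_sq' h4 (by norm_num)).2
        have : 0 ≤ σ ^ 4 := by positivity
        nlinarith

lemma integral_noise_sq_le (hσ : 0 < σ) (t : ℕ) :
    Integrable (fun ω : ℕ → Fin d → ℝ => (ω t ⬝ᵥ ω t) ^ 2) (noiseLaw d σ) ∧
    ∫ ω : ℕ → Fin d → ℝ, (ω t ⬝ᵥ ω t) ^ 2 ∂(noiseLaw d σ) ≤ 64 * d ^ 2 * σ ^ 4 := by
  have hm := measurePreserving_noise (d := d) (σ := σ) t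
  have hle : ∀ w : Fin d → ℝ, (w ⬝ᵥ w) ^ 2 ≤ d * ∑ i, w i ^ 4 := fun w => by
    have := sq_sum_le_card_mul_sum_sq (s := Finset.univ) (f := fun i => w i * w i)
    simp only [Finset.card_univ, Fintype.card_fin] at this
    refine this.trans (le_of_eq ?_)
    congr 1
    exact Finset.sum_congr rfl fun i _ => by ring
  have hi : Integrable (fun w : Fin d → ℝ => d * ∑ i, w i ^ 4) (gaussianNoise d σ) :=
    (integrable_finsetSum _ fun i _ => integrable_coord_pow_four i).const_mul _
  have hs : Measurable fun w : Fin d → ℝ => (w ⬝ᵥ w) ^ 2 := (AlgInput.measurable_dot_self measurable_id).pow_const 2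
  have hw : Integrable (fun w : Fin d → ℝ => (w ⬝ᵥ w) ^ 2) (gaussianNoise d σ) :=
    hi.mono' hs.aestronglyMeasurable (ae_of_all _ fun w => by
      rw [Real.norm_of_nonneg (sq_nonneg _)]; exact hle w)
  refine ⟨hm.integrable_comp_of_integrable hw, ?_⟩
  have h1 := hm.hasLaw.integral_comp (f := fun w => (w ⬝ᵥ w) ^ 2) hs.aestronglyMeasurable
  simp only [Function.comp_def] at h1
  rw [h1]
  calc _ ≤ ∫ w : Fin d → ℝ, d * ∑ i, w i ^ 4 ∂(gaussianNoise d σ) := integral_mono hw hi hle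
    _ = d * ∑ i, ∫ w : Fin d → ℝ, w i ^ 4 ∂(gaussianNoise d σ) := by
        rw [integral_const_mul, integral_finsetSum _ fun i _ => integrable_coord_pow_four i]
    _ ≤ d * ∑ _i : Fin d, 64 * σ ^ 4 := by gcongr; exact integral_coord_pow_four_le hσ _
    _ = _ := by simp; ring

lemma sum_trunc_sq_le {c : ℝ} (hc : 0 ≤ c) (x : ℕ → Fin d → ℝ) (n : ℕ) :
    ∑ j, ∑ s ∈ Finset.range n, trunc c x s j ^ 2 ≤ c := by
  rw [Finset.sum_comm]
  refine le_trans (le_of_eq (Finset.sum_congr rfl fun s _ => ?_))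
    (sum_truncated_le (a := fun s => x (s + 1) ⬝ᵥ x (s + 1)) (fun s => dot_self_nonneg _) hc n)
  simp only [trunc]
  split_ifs
  · simp [dotProduct, sq]
  · simp

lemma abs_trunc_le {c : ℝ} (hc : 0 ≤ c) (x : ℕ → Fin d → ℝ) (s : ℕ) (j : Fin d) : |trunc c x s j| ≤ √c := by
  rw [← Real.sqrt_sq_eq_abs]
  refine Real.sqrt_le_sqrt (le_trans ?_ (sum_trunc_sq_le hc x (s + 1)))
  refine le_trans ?_ (Finset.single_le_sum (f := fun j => ∑ s ∈ Finset.range (s + 1), trunc c x s j ^ 2)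
    (fun j _ => Finset.sum_nonneg fun s _ => sq_nonneg _) (Finset.mem_univ j))
  exact Finset.single_le_sum (f := fun s => trunc c x s j ^ 2) (fun s _ => sq_nonneg _)
    (Finset.mem_range.2 (Nat.lt_succ_self s))

/-- Orthogonality of martingale increments gives σ² times the expected energy of the truncated
states for each row i, and truncation bounds that energy by c on every path. -/
lemma integral_corrSq_le {x : (ℕ → Fin d → ℝ) → ℕ → Fin d → ℝ}
    (hx : ∀ s, DependsBefore (s + 1) fun ω => x ω (s + 1)) (hxm : ∀ s, Measurable fun ω => x ω (s + 1))
    {c : ℝ} (hc : 0 ≤ c) (n : ℕ) :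
    Integrable (fun ω => corrSq c (x ω) ω n) (noiseLaw d σ) ∧
    ∫ ω, corrSq c (x ω) ω n ∂(noiseLaw d σ) ≤ d * σ ^ 2 * c := by
  have hd : ∀ j s, DependsBefore (s + 1) fun ω => trunc c (x ω) s j := fun j s ω ω' h => by
    have h1 : ∀ r ≤ s, x ω (r + 1) = x ω' (r + 1) := fun r hr => hx r ω ω' fun q hq => h q (by omega)
    have h2 : ∑ r ∈ Finset.range (s + 1), x ω (r + 1) ⬝ᵥ x ω (r + 1) =
        ∑ r ∈ Finset.range (s + 1), x ω' (r + 1) ⬝ᵥ x ω' (r + 1) :=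
      Finset.sum_congr rfl fun r hr => by rw [h1 r (by have := Finset.mem_range.1 hr; omega)]
    simp only [trunc]
    rw [h2, h1 s le_rfl]
  have hm : ∀ j s, Measurable fun ω => trunc c (x ω) s j := fun j s => by
    have : Measurable fun ω => ∑ r ∈ Finset.range (s + 1), x ω (r + 1) ⬝ᵥ x ω (r + 1) :=
      Finset.measurable_sum _ fun r _ => AlgInput.measurable_dot_self (hxm r)
    exact Measurable.ite (measurableSet_le this measurable_const)
      ((measurable_pi_apply j).comp (hxm s)) measurable_const
  have hmart := fun i j => integral_sq_martingale (σ := σ) (hd j) (hm j) (fun s ω => abs_trunc_le hc (x ω) s j) i n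
  have hi : ∀ i j, Integrable (fun ω : ℕ → Fin d → ℝ => (∑ s ∈ Finset.range n, ω (s + 1) i * trunc c (x ω) s j) ^ 2)
      (noiseLaw d σ) := fun i j => (hmart i j).1.integrable_sq
  have hi2 : ∀ j s, Integrable (fun ω => trunc c (x ω) s j ^ 2) (noiseLaw d σ) := fun j s =>
    (MemLp.of_bound (p := 2) (hm j s).aestronglyMeasurable (√c)
      (ae_of_all _ fun ω => abs_trunc_le hc (x ω) s j)).integrable_sq
  unfold corrSq
  refine ⟨integrable_finsetSum _ fun i _ => integrable_finsetSum _ fun j _ => hi i j, ?_⟩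
  rw [integral_finsetSum _ fun i _ => integrable_finsetSum _ fun j _ => hi i j]
  calc _ ≤ ∑ _i : Fin d, σ ^ 2 * c := Finset.sum_le_sum fun i _ => by
        rw [integral_finsetSum _ fun j _ => hi i j, Finset.sum_congr rfl fun j _ => (hmart i j).2,
          ← Finset.mul_sum, ← integral_finsetSum _ fun j _ => integrable_finsetSum _ fun s _ => hi2 j s]
        gcongr
        calc _ ≤ ∫ _ω : ℕ → Fin d → ℝ, c ∂(noiseLaw d σ) :=
              integral_mono (integrable_finsetSum _ fun j _ => integrable_finsetSum _ fun s _ => hi2 j s)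
                (integrable_const c) fun ω => sum_trunc_sq_le hc (x ω) n
          _ = c := by simp
    _ = _ := by simp; ring

/-- The contribution of an event of probability `O(T⁻²)`. -/
lemma integral_indicator_le (hσ : 0 < σ) {E : Set (ℕ → Fin d → ℝ)} (hE : MeasurableSet E) {T : ℕ} (hT : 1 ≤ T)
    (hP : noiseLaw d σ E ≤ ENNReal.ofReal (d ^ 2 / T ^ 2)) {b : ℝ} (hb : 0 ≤ b) :
    Integrable (fun ω : ℕ → Fin d → ℝ => ∑ s ∈ Finset.range T, E.indicator 1 ω * (b + ω (s + 1) ⬝ᵥ ω (s + 1)))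
      (noiseLaw d σ) ∧
    ∫ ω : ℕ → Fin d → ℝ, ∑ s ∈ Finset.range T, E.indicator 1 ω * (b + ω (s + 1) ⬝ᵥ ω (s + 1)) ∂(noiseLaw d σ) ≤
      d ^ 2 * b + d ^ 2 + 32 * d ^ 2 * σ ^ 4 := by
  have hT' : (1 : ℝ) ≤ T := by exact_mod_cast hT
  have hI : Integrable (E.indicator (1 : (ℕ → Fin d → ℝ) → ℝ)) (noiseLaw d σ) :=
    (integrable_const (1 : ℝ)).indicator hE
  have hIint : ∫ ω, E.indicator (1 : (ℕ → Fin d → ℝ) → ℝ) ω ∂(noiseLaw d σ) ≤ d ^ 2 / T ^ 2 := by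
    rw [integral_indicator_one hE]
    exact ENNReal.toReal_le_of_le_ofReal (by positivity) hP
  have hw : ∀ s, Integrable (fun ω : ℕ → Fin d → ℝ => ω (s + 1) ⬝ᵥ ω (s + 1)) (noiseLaw d σ) := fun s =>
    (sqIntegrable_noise (s + 1)).dot (sqIntegrable_noise (s + 1))
  have e : ∀ s (ω : ℕ → Fin d → ℝ), E.indicator 1 ω * (b + ω (s + 1) ⬝ᵥ ω (s + 1)) =
      E.indicator (fun ω => b + ω (s + 1) ⬝ᵥ ω (s + 1)) ω := fun s ω => by
    by_cases h : ω ∈ E <;> simp [h]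
  have hterm : ∀ s, Integrable (fun ω : ℕ → Fin d → ℝ => E.indicator 1 ω * (b + ω (s + 1) ⬝ᵥ ω (s + 1)))
      (noiseLaw d σ) := fun s => by
    simp_rw [e s]
    exact ((integrable_const b).add (hw s)).indicator hE
  refine ⟨integrable_finsetSum _ fun s _ => hterm s, ?_⟩
  rw [integral_finsetSum _ fun s _ => hterm s]
  have hbound : ∀ s, ∫ ω : ℕ → Fin d → ℝ, E.indicator 1 ω * (b + ω (s + 1) ⬝ᵥ ω (s + 1)) ∂(noiseLaw d σ) ≤
      (b + T / 2) * (d ^ 2 / T ^ 2) + (2 * T : ℝ)⁻¹ * (64 * d ^ 2 * σ ^ 4) := fun s => by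
    obtain ⟨h4i, h4⟩ := integral_noise_sq_le (d := d) hσ (s + 1)
    have hr : Integrable (fun ω : ℕ → Fin d → ℝ => (b + T / 2) * E.indicator 1 ω +
        (2 * T : ℝ)⁻¹ * (ω (s + 1) ⬝ᵥ ω (s + 1)) ^ 2) (noiseLaw d σ) :=
      (hI.const_mul _).add (h4i.const_mul _)
    calc _ ≤ ∫ ω : ℕ → Fin d → ℝ, (b + T / 2) * E.indicator 1 ω +
          (2 * T : ℝ)⁻¹ * (ω (s + 1) ⬝ᵥ ω (s + 1)) ^ 2 ∂(noiseLaw d σ) := by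
          refine integral_mono (hterm s) hr fun ω => ?_
          set v := ω (s + 1) ⬝ᵥ ω (s + 1)
          simp only
          by_cases h : ω ∈ E
          · simp only [Set.indicator_of_mem h, Pi.one_apply, one_mul, mul_one]
            -- Young's inequality v ≤ T/2 + v²/(2T) separates the event from the noise: the first
            -- part is paid by P(E) ≤ d²/T², the second by the fourth moment, and each stays bounded
            -- after summing T terms.
            have : 0 ≤ (2 * T : ℝ)⁻¹ * (v - T) ^ 2 := by positivity
            have e3 : (2 * T : ℝ)⁻¹ * (v - T) ^ 2 = (2 * T : ℝ)⁻¹ * v ^ 2 - v + T / 2 := by field_simp; ring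
            linarith
          · simp only [Set.indicator_of_notMem h, zero_mul, mul_zero, zero_add]
            positivity
      _ = (b + T / 2) * ∫ ω, E.indicator (1 : (ℕ → Fin d → ℝ) → ℝ) ω ∂(noiseLaw d σ) +
          (2 * T : ℝ)⁻¹ * ∫ ω : ℕ → Fin d → ℝ, (ω (s + 1) ⬝ᵥ ω (s + 1)) ^ 2 ∂(noiseLaw d σ) := by
          rw [integral_add (hI.const_mul _) (h4i.const_mul _), integral_const_mul, integral_const_mul]
      _ ≤ _ := by gcongr
  refine (Finset.sum_le_sum fun s _ => hbound s).trans ?_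
  rw [Finset.sum_const, Finset.card_range, nsmul_eq_mul]
  have e4 : (T : ℝ) * ((b + T / 2) * (d ^ 2 / T ^ 2) + (2 * T : ℝ)⁻¹ * (64 * d ^ 2 * σ ^ 4)) =
      d ^ 2 * b / T + d ^ 2 / 2 + 32 * d ^ 2 * σ ^ 4 := by field_simp; ring
  rw [e4]
  have h5 : d ^ 2 * b / T ≤ d ^ 2 * b := div_le_self (by positivity) hT'
  have h6 : 0 ≤ (d : ℝ) ^ 2 := by positivity
  linarith

lemma sum_inv_sq_le {m n : ℕ} (hm : 1 ≤ m) : ∑ t ∈ Finset.Icc m n, ((t : ℝ) ^ 2)⁻¹ ≤ 2 / m := by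
  have h1 : Finset.Icc m n = Finset.Ioo (m - 1) (n + 1) := by ext t; simp; omega
  rw [h1]
  refine (sum_Ioo_inv_sq_le (m - 1) (n + 1)).trans (le_of_eq ?_)
  congr 1
  rw [← Nat.cast_add_one, Nat.sub_add_cancel hm]

lemma sum_inv_le {m n : ℕ} (hm : 1 ≤ m) : ∑ t ∈ Finset.Icc m n, (t : ℝ)⁻¹ ≤ 1 + Real.log n := by
  have h1 : ∑ t ∈ Finset.Icc m n, (t : ℝ)⁻¹ ≤ ∑ t ∈ Finset.Icc 1 n, (t : ℝ)⁻¹ :=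
    Finset.sum_le_sum_of_subset_of_nonneg (Finset.Icc_subset_Icc_left hm) fun t _ _ => by positivity
  refine h1.trans (le_trans (le_of_eq ?_) (harmonic_le_one_add_log n))
  rw [harmonic_eq_sum_Icc]; push_cast; rfl

end ExpectedRegret

/-! ### Integrating the pathwise bounds -/

section RegretBound

variable {d k : ℕ} {S : System d k} {p : AlgInput d k} {P Y₀ : Matrix (Fin d) (Fin d) ℝ} {g ε₀ : ℝ} {T : ℕ}

namespace Setting

lemma isRun (h : Setting S p P Y₀ g ε₀ T) (ω : ℕ → Fin d → ℝ) :
    IsRun S p (state S.A S.B p.policy ω) (action S.A S.B p.policy ω) ω :=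
  ⟨state_one ω, state_succ ω, (AlgInput.policy_causal h.one_le_tau).action_eq ω⟩

lemma measurablePolicy (h : Setting S p P Y₀ g ε₀ T) : MeasurablePolicy p.policy :=
  AlgInput.policy_measurable h.lam_pos (h.Q_eq ▸ h.Q_posDef) (h.R_eq ▸ h.bdd.R_posDef)

lemma sqIntegrable_action (h : Setting S p P Y₀ g ε₀ T) (t : ℕ)
    (hx : SqIntegrable S.σ fun ω => state S.A S.B p.policy ω (t + 1)) :
    SqIntegrable S.σ fun ω => action S.A S.B p.policy ω (t + 1) :=
  hx.of_dot_le (action_measurable h.measurablePolicy (t + 1)) (c := p.κ ^ 2) fun ω => by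
    obtain ⟨K, hK, hu⟩ := h.action_norm_le (h.isRun ω) t
    rw [hu]; exact mulVec_dot_self_le_of_norm hK _

lemma sqIntegrable_state (h : Setting S p P Y₀ g ε₀ T) (t : ℕ) :
    SqIntegrable S.σ fun ω => state S.A S.B p.policy ω (t + 1) := by
  induction t with
  | zero => simp only [zero_add, state_one]; exact fun i => MemLp.zero
  | succ t ih =>
    simp only [state_succ]
    exact ((ih.mulVec S.A).add ((h.sqIntegrable_action t ih).mulVec S.B)).add (sqIntegrable_noise (t + 1))

/-- The drift of the algorithm as a function of the noise. -/
abbrev runDrift (S : System d k) (p : AlgInput d k) (ω : ℕ → Fin d → ℝ) : ℕ → Fin d → ℝ :=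
  drift S (state S.A S.B p.policy ω) (action S.A S.B p.policy ω)

lemma runDrift_dependsBefore (t : ℕ) : DependsBefore (t + 1) fun ω => runDrift S p ω (t + 1) :=
  fun ω ω' hω => by
    have h1 : state S.A S.B p.policy ω (t + 1) = state S.A S.B p.policy ω' (t + 1) := state_dependsBefore t ω ω' hω
    have h2 : action S.A S.B p.policy ω (t + 1) = action S.A S.B p.policy ω' (t + 1) := action_dependsBefore t ω ω' hω
    simp only [drift, h1, h2]

lemma measurable_runDrift (h : Setting S p P Y₀ g ε₀ T) (t : ℕ) : Measurable fun ω => runDrift S p ω t :=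
  ((measurable_mulVec S.A).comp (state_measurable h.measurablePolicy t)).add
    ((measurable_mulVec S.B).comp (action_measurable h.measurablePolicy t))

lemma sqIntegrable_runDrift (h : Setting S p P Y₀ g ε₀ T) (t : ℕ) :
    SqIntegrable S.σ fun ω => runDrift S p ω (t + 1) :=
  ((h.sqIntegrable_state t).mulVec S.A).add ((h.sqIntegrable_action t (h.sqIntegrable_state t)).mulVec S.B)

lemma regret_eq (h : Setting S p P Y₀ g ε₀ T) (ω : ℕ → Fin d → ℝ) :
    S.regret p.policy T ω = ∑ s ∈ Finset.range T, (qf S.Q (state S.A S.B p.policy ω (s + 1)) +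
      qf S.R (action S.A S.B p.policy ω (s + 1))) - T * (S.σ ^ 2 * P.trace) := by
  have hJ : S.Jstar.toReal = S.σ ^ 2 * P.trace := by
    rw [Jstar_eq h.Q_posDef h.bdd.R_posDef h.sigma_pos h.bdd.sol, ENNReal.toReal_ofReal]
    exact mul_nonneg (sq_nonneg _) (trace_nonneg_of_qf h.bdd.psd.2)
  rw [System.regret, sum_Icc_one, Finset.sum_sub_distrib, hJ]
  simp [System.cost, qf]

lemma integrable_regret (h : Setting S p P Y₀ g ε₀ T) :
    Integrable (S.regret p.policy T) (noiseLaw d S.σ) := by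
  have : S.regret p.policy T = _ := funext h.regret_eq
  rw [this]
  refine Integrable.sub (integrable_finsetSum _ fun s _ => ?_) (integrable_const _)
  exact ((h.sqIntegrable_state s).qf S.Q).add ((h.sqIntegrable_action s (h.sqIntegrable_state s)).qf S.R)

lemma measurable_regret (h : Setting S p P Y₀ g ε₀ T) : Measurable (S.regret p.policy T) := by
  have : S.regret p.policy T = _ := funext h.regret_eq
  rw [this]
  refine Measurable.sub (Finset.measurable_sum _ fun s _ => ?_) measurable_const
  have hq : ∀ {n : ℕ} (M : Matrix (Fin n) (Fin n) ℝ), Measurable (qf M) := fun M => by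
    have : Continuous (qf M) := by unfold qf; fun_prop
    exact this.measurable
  exact ((hq _).comp (state_measurable h.measurablePolicy _)).add
    ((hq _).comp (action_measurable h.measurablePolicy _))

/-- The expected squared deviation from the optimal actions. -/
lemma integral_sum_dev_le (h : Setting S p P Y₀ g ε₀ T) {D : (ℕ → Fin d → ℝ) → ℝ}
    (hD : ∀ ω, D ω = ∑ s ∈ Finset.range T,
      dev S P (state S.A S.B p.policy ω) (action S.A S.B p.policy ω) (s + 1))
    (hDi : Integrable D (noiseLaw d S.σ)) :
    ∫ ω, D ω ∂(noiseLaw d S.σ) ≤ 80 * g ^ 13 * p.τ₀ +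
      141120000 * g ^ 20 * p.xb * (160 * g ^ 14 * (1 + Real.log T) + 32 * g ^ 2 * p.lam) +
      128 * g ^ 6 * p.κ ^ 4 * (g ^ 2 * p.xb + 33 * g ^ 6) := by
  have hg := h.pos
  have hg1 := h.one_le
  have hσ := h.sigma_pos
  have hxb := h.xb_nonneg
  have hl := h.lam_pos
  have hτ1 := h.one_le_tau
  have hτr : (1 : ℝ) ≤ p.τ₀ := by exact_mod_cast hτ1
  have hd := h.dim_le
  have hs2 : S.σ ^ 2 ≤ g ^ 2 := by have := h.sigma_le; gcongr
  have hs4 : S.σ ^ 4 ≤ g ^ 4 := by have := h.sigma_le; gcongr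
  have hξσ : xi g ε₀ * S.σ ^ 2 ≤ 1 / 4 := by
    have e := h.xi_mul_le
    have e2 := h.eps_le_one
    have hξ := h.xi_pos
    have h1 : xi g ε₀ * S.σ ^ 2 ≤ xi g ε₀ * g ^ 16 := by
      have : g ^ 2 ≤ g ^ 16 := by gcongr; norm_num
      gcongr; linarith
    linarith
  -- The failure event is replaced by a measurable hull of equal measure, which spares a proof that
  -- it is measurable.
  set G := {ω | ¬NoiseGood S.σ (xi g ε₀) (Real.log (3 * T)) T (state S.A S.B p.policy ω) (runDrift S p ω) ω} with hG
  have hPG : noiseLaw d S.σ (toMeasurable (noiseLaw d S.σ) G) ≤ ENNReal.ofReal (d ^ 2 / T ^ 2) := by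
    rw [measure_toMeasurable]
    exact measure_not_noiseGood_le hσ h.xi_pos hξσ h.T_pos (state_dependsBefore ·)
      (fun s => state_measurable h.measurablePolicy _) runDrift_dependsBefore fun s => h.measurable_runDrift _
  set E := toMeasurable (noiseLaw d S.σ) G with hE
  obtain ⟨iW, hW⟩ := integral_sum_noise (d := d) (σ := S.σ) p.τ₀
  obtain ⟨iE, hEi⟩ := integral_indicator_le (d := d) hσ (measurableSet_toMeasurable _ G) h.T_pos hPG hxb
  have hc : ∀ τ : ℕ, 0 ≤ level g τ := fun τ => by unfold level; positivity
  have hC := fun τ n => integral_corrSq_le (σ := S.σ) (d := d)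
    (x := fun ω => state S.A S.B p.policy ω) (state_dependsBefore ·)
    (fun s => state_measurable h.measurablePolicy _) (hc τ) n
  have iC : ∀ t, Integrable (fun ω => (corrSq (level g (p.phaseStart t)) (state S.A S.B p.policy ω) ω
      (p.phaseStart t - 1) + p.lam ^ 2 * g ^ 2) / p.phaseStart t ^ 2) (noiseLaw d S.σ) := fun t =>
    ((hC (p.phaseStart t) _).1.add (integrable_const _)).div_const _
  have hCt : ∀ t ∈ Finset.Icc p.τ₀ T, ∫ ω, (corrSq (level g (p.phaseStart t)) (state S.A S.B p.policy ω) ω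
      (p.phaseStart t - 1) + p.lam ^ 2 * g ^ 2) / p.phaseStart t ^ 2 ∂(noiseLaw d S.σ) ≤
      160 * g ^ 14 * (t : ℝ)⁻¹ + 16 * (p.lam ^ 2 * g ^ 2) * ((t : ℝ) ^ 2)⁻¹ := fun t ht => by
    have ht1 : 1 ≤ t := hτ1.trans (Finset.mem_Icc.1 ht).1
    have ht0 : (0 : ℝ) < t := by exact_mod_cast ht1
    have h4 : (t : ℝ) ≤ 4 * p.phaseStart t := by exact_mod_cast (AlgInput.lt_four_mul_phaseStart hτ1 t).le
    set τ := p.phaseStart t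
    have hτ0 : (0 : ℝ) < τ := by linarith
    rw [integral_div, integral_add (hC τ _).1 (integrable_const _), integral_const]
    simp only [probReal_univ, one_smul]
    -- The level is linear in τ, so dividing by τ² leaves order 1/τ; since phases grow by the factor
    -- 4, 1/τ ≤ 4/t, and the sum over t is logarithmic.
    have h5 : d * S.σ ^ 2 * level g τ ≤ 40 * g ^ 14 * τ := by
      calc d * S.σ ^ 2 * level g τ ≤ g * g ^ 2 * level g τ := by have := hc τ; gcongr
        _ = _ := by rw [level]; ring
    have h6 : (τ : ℝ)⁻¹ ≤ 4 * (t : ℝ)⁻¹ := by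
      rw [inv_le_iff_one_le_mul₀ hτ0]
      calc (1 : ℝ) = t * (t : ℝ)⁻¹ := by field_simp
        _ ≤ 4 * τ * (t : ℝ)⁻¹ := by gcongr
        _ = _ := by ring
    calc _ ≤ (40 * g ^ 14 * τ + p.lam ^ 2 * g ^ 2) / τ ^ 2 := by
          gcongr; exact (hC τ _).2.trans h5
      _ = 40 * g ^ 14 * (τ : ℝ)⁻¹ + p.lam ^ 2 * g ^ 2 * (τ : ℝ)⁻¹ ^ 2 := by field_simp
      _ ≤ 40 * g ^ 14 * (4 * (t : ℝ)⁻¹) + p.lam ^ 2 * g ^ 2 * (4 * (t : ℝ)⁻¹) ^ 2 := by gcongr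
      _ = _ := by ring
  have hpath : ∀ ω, D ω ≤ 80 * g ^ 10 * ∑ s ∈ Finset.range p.τ₀, ω (s + 1) ⬝ᵥ ω (s + 1) +
      141120000 * g ^ 20 * p.xb * ∑ t ∈ Finset.Icc p.τ₀ T,
        (corrSq (level g (p.phaseStart t)) (state S.A S.B p.policy ω) ω (p.phaseStart t - 1) +
          p.lam ^ 2 * g ^ 2) / p.phaseStart t ^ 2 +
      128 * g ^ 6 * p.κ ^ 4 * ∑ s ∈ Finset.range T, E.indicator 1 ω * (p.xb + ω (s + 1) ⬝ᵥ ω (s + 1)) := fun ω => by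
    rw [hD]
    refine h.sum_dev_le (h.isRun ω) (Set.indicator_nonneg (fun _ _ => zero_le_one) ω) fun hn => ?_
    have : ω ∈ E := subset_toMeasurable _ _ hn
    simp [this]
  have iC2 := integrable_finsetSum (Finset.Icc p.τ₀ T) fun t _ => iC t
  have i12 := (iW.const_mul (80 * g ^ 10)).add (iC2.const_mul (141120000 * g ^ 20 * p.xb))
  have i3 := iE.const_mul (128 * g ^ 6 * p.κ ^ 4)
  refine (integral_mono hDi (i12.add i3) hpath).trans ?_
  rw [integral_add' i12 i3, integral_add' (iW.const_mul _) (iC2.const_mul _), integral_const_mul, integral_const_mul,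
    integral_const_mul, hW, integral_finsetSum _ fun t _ => iC t]
  refine add_le_add (add_le_add ?_ ?_) ?_
  · calc 80 * g ^ 10 * (p.τ₀ * (d * S.σ ^ 2)) ≤ 80 * g ^ 10 * (p.τ₀ * (g * g ^ 2)) := by gcongr
      _ = _ := by ring
  · gcongr
    refine (Finset.sum_le_sum hCt).trans ?_
    rw [Finset.sum_add_distrib, ← Finset.mul_sum, ← Finset.mul_sum]
    refine add_le_add (by gcongr; exact sum_inv_le hτ1) ?_
    -- The regularization bias would contribute λ²∑t⁻² ≤ 2λ²/τ₀. As λ ≤ τ₀ this is linear in λ, so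
    -- only one more logarithm appears.
    have h7 : p.lam ≤ p.τ₀ := by
      have h8 := h.lam_le
      have h9 := h.eps_le_one
      have h10 := one_le_pow₀ hg1 (n := 3)
      have h11 := h.eps_pos
      nlinarith
    calc 16 * (p.lam ^ 2 * g ^ 2) * ∑ t ∈ Finset.Icc p.τ₀ T, ((t : ℝ) ^ 2)⁻¹
        ≤ 16 * (p.lam ^ 2 * g ^ 2) * (2 / p.τ₀) := by gcongr; exact sum_inv_sq_le hτ1
      _ = 32 * g ^ 2 * p.lam * (p.lam / p.τ₀) := by ring
      _ ≤ 32 * g ^ 2 * p.lam * 1 := by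
          gcongr; exact div_le_one_of_le₀ h7 (by linarith)
      _ = _ := by ring
  · gcongr
    refine hEi.trans ?_
    have hd2 : (d : ℝ) ^ 2 ≤ g ^ 2 := by gcongr
    have h8 : (d : ℝ) ^ 2 * p.xb ≤ g ^ 2 * p.xb := by gcongr
    have h9 : (d : ℝ) ^ 2 * S.σ ^ 4 ≤ g ^ 2 * g ^ 4 := by gcongr
    have h10 : g ^ 2 ≤ g ^ 6 := by gcongr; norm_num
    linarith

/-- The martingale term has mean zero by independence, and the mean of `qf P w` is σ² tr P = J⋆.
Only the squared deviations survive. -/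
lemma integral_regret_le (h : Setting S p P Y₀ g ε₀ T) :
    ∫ ω, S.regret p.policy T ω ∂(noiseLaw d S.σ) ≤ 2 * g ^ 3 * (80 * g ^ 13 * p.τ₀ +
      141120000 * g ^ 20 * p.xb * (160 * g ^ 14 * (1 + Real.log T) + 32 * g ^ 2 * p.lam) +
      128 * g ^ 6 * p.κ ^ 4 * (g ^ 2 * p.xb + 33 * g ^ 6)) := by
  have hg := h.pos
  set D : (ℕ → Fin d → ℝ) → ℝ := fun ω => ∑ s ∈ Finset.range T,
      dev S P (state S.A S.B p.policy ω) (action S.A S.B p.policy ω) (s + 1) with hD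
  have hDi : Integrable D (noiseLaw d S.σ) := integrable_finsetSum _ fun s _ => by
    have hu := h.sqIntegrable_action s (h.sqIntegrable_state s)
    have hx := (h.sqIntegrable_state s).mulVec (-Kopt S P)
    have := (hu.add hx).dot (hu.add hx)
    simpa only [dev, Matrix.neg_mulVec, ← sub_eq_add_neg] using this
  have hM : ∀ s, Integrable (fun ω : ℕ → Fin d → ℝ => 2 * ((P *ᵥ runDrift S p ω (s + 1)) ⬝ᵥ ω (s + 1)) + qf P (ω (s + 1)))
      (noiseLaw d S.σ) := fun s =>
    ((((h.sqIntegrable_runDrift s).mulVec P).dot (sqIntegrable_noise (s + 1))).const_mul 2).add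
      ((sqIntegrable_noise (s + 1)).qf P)
  have hM0 : ∀ s, ∫ ω : ℕ → Fin d → ℝ, 2 * ((P *ᵥ runDrift S p ω (s + 1)) ⬝ᵥ ω (s + 1)) + qf P (ω (s + 1))
      ∂(noiseLaw d S.σ) = S.σ ^ 2 * P.trace := fun s => by
    rw [integral_add ((((h.sqIntegrable_runDrift s).mulVec P).dot (sqIntegrable_noise (s + 1))).const_mul 2)
      ((sqIntegrable_noise (s + 1)).qf P), integral_const_mul,
      integral_dot_noise ((h.sqIntegrable_runDrift s).mulVec P) ((measurable_mulVec P).comp (h.measurable_runDrift _))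
        (fun ω ω' hω => by simp only [runDrift_dependsBefore s ω ω' hω]), integral_qf_noise]
    ring
  have hMi := integrable_finsetSum (Finset.range T) fun s _ => hM s
  have hpath : ∀ ω, S.regret p.policy T ω ≤ 2 * g ^ 3 * D ω + (∑ s ∈ Finset.range T,
      (2 * ((P *ᵥ runDrift S p ω (s + 1)) ⬝ᵥ ω (s + 1)) + qf P (ω (s + 1))) - T * (S.σ ^ 2 * P.trace)) := fun ω => by
    rw [h.regret_eq, ← add_sub_assoc]
    exact sub_le_sub_right (h.sum_cost_le (h.isRun ω) T) _
  have i1 := hDi.const_mul (2 * g ^ 3)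
  have i2 := hMi.sub (integrable_const (T * (S.σ ^ 2 * P.trace)))
  refine (integral_mono h.integrable_regret (i1.add i2) hpath).trans ?_
  rw [integral_add' i1 i2, integral_sub' hMi (integrable_const _), integral_finsetSum _ fun s _ => hM s,
    Finset.sum_congr rfl fun s _ => hM0 s, integral_const_mul, integral_const]
  simp only [Finset.sum_const, Finset.card_range, nsmul_eq_mul, probReal_univ, one_smul, sub_self, add_zero]
  gcongr
  exact h.integral_sum_dev_le (fun ω => rfl) hDi

end Setting

end RegretBound

/-! ### The choice of the constants -/

section Constants

variable {d k : ℕ} {S : System d k} {K₀ : Matrix (Fin k) (Fin d) ℝ} {α₀ α₁ ϑ ν ν₀ : ℝ}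

/-- The size of a problem instance: one plus the sum of all constants. -/
def size (d k : ℕ) (α₀ α₁ ϑ ν ν₀ σ : ℝ) : ℝ := 1 + ∑ i, consts d k α₀ α₁ ϑ ν ν₀ σ i

lemma size_eq (σ : ℝ) : size d k α₀ α₁ ϑ ν ν₀ σ = 1 + α₀⁻¹ + α₁ + ϑ + ν + ν₀ + d + k + σ + σ⁻¹ := by
  simp [size, consts, Fin.sum_univ_succ]; ring

/-- The bounds on the constants in terms of the size. -/
structure SizeBound (S : System d k) (α₀ α₁ ϑ ν ν₀ θ : ℝ) : Prop where
  three_le : 3 ≤ θ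
  alpha0_inv_le : α₀⁻¹ ≤ θ
  alpha1_le : α₁ ≤ θ
  theta_le : 1 + ϑ ≤ θ
  nu_le : ν ≤ θ
  nu0_le : ν₀ ≤ θ
  dim_le : (d : ℝ) ≤ θ
  sigma_le : S.σ ≤ θ
  sigma_inv_le : S.σ⁻¹ ≤ θ

lemma System.Admissible.sizeBound (h : S.Admissible K₀ α₀ α₁ ϑ ν ν₀) :
    SizeBound S α₀ α₁ ϑ ν ν₀ (size d k α₀ α₁ ϑ ν ν₀ S.σ) := by
  have h0 := inv_pos.2 h.alpha0_pos
  have h1 := h.alpha1_pos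
  have h2 := h.theta_pos
  have h3 := h.nu_pos
  have h4 := h.nu0_pos
  have h5 := h.sigma_pos
  have h6 := inv_pos.2 h.sigma_pos
  have h7 : (0 : ℝ) ≤ d := Nat.cast_nonneg d
  have h8 : (0 : ℝ) ≤ k := Nat.cast_nonneg k
  -- This gives θ ≥ 3, so numerical constants can be absorbed into powers of θ.
  have h9 : 2 ≤ S.σ + S.σ⁻¹ := by
    have : S.σ * S.σ⁻¹ = 1 := mul_inv_cancel₀ h5.ne'
    nlinarith [sq_nonneg (S.σ - S.σ⁻¹)]
  rw [size_eq]
  constructor <;> linarith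

namespace SizeBound

variable {θ : ℝ}

lemma pos (hb : SizeBound S α₀ α₁ ϑ ν ν₀ θ) : 0 < θ := by linarith [hb.three_le]

lemma one_le (hb : SizeBound S α₀ α₁ ϑ ν ν₀ θ) : 1 ≤ θ := by linarith [hb.three_le]

lemma le_cube (hb : SizeBound S α₀ α₁ ϑ ν ν₀ θ) : θ ≤ θ ^ 3 := le_self_pow₀ hb.one_le (by norm_num)

lemma sigma_inv_sq_le (hb : SizeBound S α₀ α₁ ϑ ν ν₀ θ) (h : S.Admissible K₀ α₀ α₁ ϑ ν ν₀) :
    (S.σ ^ 2)⁻¹ ≤ θ ^ 2 := by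
  have := hb.sigma_inv_le
  have := inv_pos.2 h.sigma_pos
  rw [← inv_pow]; gcongr

lemma div_sigma_sq_le (hb : SizeBound S α₀ α₁ ϑ ν ν₀ θ) (h : S.Admissible K₀ α₀ α₁ ϑ ν ν₀) {a : ℝ} (ha : a ≤ θ) :
    a / S.σ ^ 2 ≤ θ ^ 3 := by
  have h1 := hb.sigma_inv_sq_le h
  have h2 := hb.pos
  have h3 : 0 ≤ (S.σ ^ 2)⁻¹ := by positivity
  calc a / S.σ ^ 2 = a * (S.σ ^ 2)⁻¹ := div_eq_mul_inv _ _
    _ ≤ θ * (S.σ ^ 2)⁻¹ := by gcongr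
    _ ≤ θ * θ ^ 2 := by gcongr
    _ = _ := by ring

lemma exists_bounded (hb : SizeBound S α₀ α₁ ϑ ν ν₀ θ) (h : S.Admissible K₀ α₀ α₁ ϑ ν ν₀) :
    ∃ P, Bounded S.A S.B S.Q S.R P (θ ^ 3) ∧ S.σ ^ 2 * P.trace ≤ ν ∧
      S.Jstar = ENNReal.ofReal (S.σ ^ 2 * P.trace) :=
  h.exists_bounded (one_le_pow₀ hb.one_le) (hb.alpha0_inv_le.trans hb.le_cube)
    ((by linarith [hb.theta_le] : ϑ ≤ θ).trans hb.le_cube) (hb.div_sigma_sq_le h hb.nu_le)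

lemma exists_isSuper (hb : SizeBound S α₀ α₁ ϑ ν ν₀ θ) (h : S.Admissible K₀ α₀ α₁ ϑ ν ν₀) :
    ∃ Y, IsSuper S.A S.B S.Q S.R K₀ Y ∧ ∀ x, qf Y x ≤ θ ^ 3 * (x ⬝ᵥ x) := by
  obtain ⟨Y, hY, ht⟩ := exists_isSuper_of_J_le (psd_of_posDef h.Q_posDef) (psd_of_posDef h.R_posDef) h.sigma_pos
    h.nu0_pos.le h.J_K0_le
  refine ⟨Y, hY, fun x => (hY.1.qf_le_trace x).trans ?_⟩
  have := dot_self_nonneg x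
  have h1 : Y.trace ≤ θ ^ 3 := by
    refine le_trans ?_ (hb.div_sigma_sq_le h hb.nu0_le)
    rw [le_div_iff₀ (by have := h.sigma_pos; positivity)]
    linarith
  gcongr

/-- From 1 = ‖QQ⁻¹‖ ≤ α₁/α₀, which needs d ≥ 1. Only through this is α₀ bounded above by θ, as the
lower bound on κ requires. -/
lemma alpha0_le (h : S.Admissible K₀ α₀ α₁ ϑ ν ν₀) (hd : 1 ≤ d) : α₀ ≤ α₁ := by
  have : Nonempty (Fin d) := ⟨⟨0, hd⟩⟩
  have h1 : S.Q * S.Q⁻¹ = 1 := Matrix.mul_nonsing_inv _ ((Matrix.isUnit_iff_isUnit_det _).1 h.Q_posDef.isUnit)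
  have h2 : (1 : ℝ) ≤ ‖S.Q‖ * ‖S.Q⁻¹‖ := by
    rw [← norm_one (α := Matrix (Fin d) (Fin d) ℝ), ← h1]; exact norm_mul_le _ _
  have h3 : ‖S.Q‖ * ‖S.Q⁻¹‖ ≤ α₁ * α₀⁻¹ := by
    have := h.alpha1_pos
    gcongr
    exacts [h.Q_le, h.Q_inv_le]
  have h4 := h2.trans h3
  rwa [← div_eq_mul_inv, one_le_div h.alpha0_pos] at h4

variable {ε₀ C₀ : ℝ}

lemma kappa_sq (h : S.Admissible K₀ α₀ α₁ ϑ ν ν₀) (hM : ε₀ ^ 2 * C₀ = θ ^ 30) (hθ : 0 < θ) :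
    kappa α₀ ν S.σ C₀ ε₀ ^ 2 = (ν + θ ^ 30) / (α₀ * S.σ ^ 2) := by
  have h0 := h.alpha0_pos
  have h1 := h.nu_pos
  rw [kappa, hM, Real.sq_sqrt (by positivity)]

/-- Even without ν, the term ε₀²C₀ = θ³⁰ divided by α₀σ² ≤ θ³ makes κ large; this is why C₀ is
chosen beyond what the perturbation bound needs. -/
lemma kappa_sq_ge (hb : SizeBound S α₀ α₁ ϑ ν ν₀ θ) (h : S.Admissible K₀ α₀ α₁ ϑ ν ν₀) (hd : 1 ≤ d)
    (hM : ε₀ ^ 2 * C₀ = θ ^ 30) : θ ^ 27 ≤ kappa α₀ ν S.σ C₀ ε₀ ^ 2 := by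
  have hθ := hb.pos
  have h0 := h.alpha0_pos
  have h1 := h.nu_pos
  have h2 := h.sigma_pos
  rw [kappa_sq h hM hθ, le_div_iff₀ (by positivity)]
  have h3 := (alpha0_le h hd).trans hb.alpha1_le
  have h4 := hb.sigma_le
  calc θ ^ 27 * (α₀ * S.σ ^ 2) ≤ θ ^ 27 * (θ * θ ^ 2) := by gcongr
    _ = θ ^ 30 := by ring
    _ ≤ _ := by linarith

lemma kappa_sq_le (hb : SizeBound S α₀ α₁ ϑ ν ν₀ θ) (h : S.Admissible K₀ α₀ α₁ ϑ ν ν₀)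
    (hM : ε₀ ^ 2 * C₀ = θ ^ 30) : kappa α₀ ν S.σ C₀ ε₀ ^ 2 ≤ 2 * θ ^ 33 := by
  have hθ := hb.pos
  have h0 := h.alpha0_pos
  have h2 := hb.sigma_inv_sq_le h
  have h3 := hb.alpha0_inv_le
  have h4 : ν ≤ θ ^ 30 := hb.nu_le.trans (le_self_pow₀ hb.one_le (by norm_num))
  have h5 := inv_pos.2 h0
  rw [kappa_sq h hM hθ]
  calc (ν + θ ^ 30) / (α₀ * S.σ ^ 2) = (ν + θ ^ 30) * (α₀⁻¹ * (S.σ ^ 2)⁻¹) := by rw [div_eq_mul_inv, mul_inv]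
    _ ≤ (θ ^ 30 + θ ^ 30) * (θ * θ ^ 2) := by gcongr
    _ = _ := by ring

lemma kappa0_pow_le (hb : SizeBound S α₀ α₁ ϑ ν ν₀ θ) (h : S.Admissible K₀ α₀ α₁ ϑ ν ν₀) :
    kappa0 α₀ ν₀ S.σ ^ 6 ≤ θ ^ 12 := by
  have hθ := hb.pos
  have h0 := h.alpha0_pos
  have h1 := h.nu0_pos
  have h2 := hb.sigma_inv_sq_le h
  have h3 := hb.alpha0_inv_le
  have h4 := hb.nu0_le
  have h5 : kappa0 α₀ ν₀ S.σ ^ 2 ≤ θ ^ 4 := by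
    rw [kappa0, Real.sq_sqrt (by positivity)]
    calc ν₀ / (α₀ * S.σ ^ 2) = ν₀ * (α₀⁻¹ * (S.σ ^ 2)⁻¹) := by rw [div_eq_mul_inv, mul_inv]
      _ ≤ θ * (θ * θ ^ 2) := by gcongr
      _ = _ := by ring
  calc kappa0 α₀ ν₀ S.σ ^ 6 = (kappa0 α₀ ν₀ S.σ ^ 2) ^ 3 := by ring
    _ ≤ (θ ^ 4) ^ 3 := by gcongr
    _ = _ := by ring

lemma lambda_ge (hb : SizeBound S α₀ α₁ ϑ ν ν₀ θ) (h : S.Admissible K₀ α₀ α₁ ϑ ν ν₀) (hd : 1 ≤ d)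
    (hM : ε₀ ^ 2 * C₀ = θ ^ 30) {T : ℕ} (hL : 0 ≤ Real.log (3 * T)) :
    540 * θ ^ 106 * Real.log (3 * T) ≤ lambda d α₀ ν ν₀ S.σ C₀ ε₀ T := by
  have hθ := hb.pos
  have hσ := h.sigma_pos
  have h1 := hb.kappa_sq_ge h hd hM
  have hd' : (1 : ℝ) ≤ d := by exact_mod_cast hd
  have h2 : 1 ≤ θ ^ 2 * S.σ ^ 2 := by
    have := hb.sigma_inv_le
    rw [inv_le_iff_one_le_mul₀ hσ] at this
    rw [← mul_pow]; exact one_le_pow₀ this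
  have h3 : 4 * (θ ^ 27) ^ 3 ≤ max (kappa0 α₀ ν₀ S.σ ^ 6) (4 * kappa α₀ ν S.σ C₀ ε₀ ^ 6) := by
    refine le_trans ?_ (le_max_right _ _)
    calc 4 * (θ ^ 27) ^ 3 ≤ 4 * (kappa α₀ ν S.σ C₀ ε₀ ^ 2) ^ 3 := by gcongr
      _ = _ := by ring
  rw [lambda]
  refine mul_le_mul_of_nonneg_right ?_ hL
  calc 540 * θ ^ 106 = 135 * 1 * θ ^ 25 * 1 * (4 * (θ ^ 27) ^ 3) := by ring
    _ ≤ 135 * d * θ ^ 25 * (θ ^ 2 * S.σ ^ 2) * (4 * (θ ^ 27) ^ 3) := by gcongr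
    _ = 135 * d * θ ^ 27 * S.σ ^ 2 * (4 * (θ ^ 27) ^ 3) := by ring
    _ ≤ _ := by gcongr

lemma lambda_le (hb : SizeBound S α₀ α₁ ϑ ν ν₀ θ) (h : S.Admissible K₀ α₀ α₁ ϑ ν ν₀)
    (hM : ε₀ ^ 2 * C₀ = θ ^ 30) {T : ℕ} (hL : 0 ≤ Real.log (3 * T)) :
    lambda d α₀ ν ν₀ S.σ C₀ ε₀ T ≤ 8910 * θ ^ 135 * Real.log (3 * T) := by
  have hθ := hb.pos
  have hσ := h.sigma_pos
  have h1 := hb.kappa_sq_le h hM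
  have h3 : max (kappa0 α₀ ν₀ S.σ ^ 6) (4 * kappa α₀ ν S.σ C₀ ε₀ ^ 6) ≤ 33 * θ ^ 99 := by
    refine max_le ?_ ?_
    · refine (hb.kappa0_pow_le h).trans ?_
      have : θ ^ 12 ≤ θ ^ 99 := pow_le_pow_right₀ hb.one_le (by norm_num)
      have : 0 ≤ θ ^ 99 := by positivity
      linarith
    · calc 4 * kappa α₀ ν S.σ C₀ ε₀ ^ 6 = 4 * (kappa α₀ ν S.σ C₀ ε₀ ^ 2) ^ 3 := by ring
        _ ≤ 4 * (2 * θ ^ 33) ^ 3 := by gcongr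
        _ = 32 * θ ^ 99 := by ring
        _ ≤ _ := by gcongr; norm_num
  have h4 := hb.dim_le
  have h5 := hb.sigma_le
  rw [lambda]
  calc _ ≤ 135 * θ * (2 * θ ^ 33) * θ ^ 2 * (33 * θ ^ 99) * Real.log (3 * T) := by gcongr
    _ = _ := by ring

lemma setting (hb : SizeBound S α₀ α₁ ϑ ν ν₀ θ) (h : S.Admissible K₀ α₀ α₁ ϑ ν ν₀) (hd : 1 ≤ d)
    (hε : ε₀ = (4200 * θ ^ 30)⁻¹) (hM : ε₀ ^ 2 * C₀ = θ ^ 30) {T : ℕ} (hT : 1 ≤ T) :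
    ∃ P Y, Setting S (algInput S K₀ α₀ ϑ ν ν₀ C₀ ε₀ T) P Y (θ ^ 3) ε₀ T := by
  obtain ⟨P, hP, -, -⟩ := hb.exists_bounded h
  obtain ⟨Y, hY, hYle⟩ := hb.exists_isSuper h
  have hθ := hb.pos
  have hθ1 := hb.one_le
  have h3 := hb.three_le
  have hσ := h.sigma_pos
  have hT' : (1 : ℝ) ≤ T := by exact_mod_cast hT
  have hd' : (1 : ℝ) ≤ d := by exact_mod_cast hd
  have hL : 1 ≤ Real.log (3 * T) := by
    rw [Real.le_log_iff_exp_le (by positivity)]; linarith [Real.exp_one_lt_d9]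
  have hlam := hb.lambda_ge h hd hM (zero_le_one.trans hL)
  have hκ := hb.kappa_sq_ge h hd hM
  have hε0 : 0 < ε₀ := by rw [hε]; positivity
  have hεi : ε₀ * (4200 * θ ^ 30) = 1 := by rw [hε]; field_simp
  set l := lambda d α₀ ν ν₀ S.σ C₀ ε₀ T with hl
  have hl0 : 0 < l := lt_of_lt_of_le (by positivity) hlam
  -- A lower bound on τ₀ that is linear in λ: it supplies both the required warm-up length, through
  -- λ ≥ 540θ¹⁰⁶ log(3T), and the smallness of λ relative to ε₀τ₀.
  have hτ : 80 * (θ ^ 2)⁻¹ * l / ε₀ ^ 2 ≤ tau0 d α₀ ϑ ν ν₀ S.σ C₀ ε₀ T := by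
    refine le_trans ?_ (Nat.le_ceil _)
    rw [← hl]
    have hs : (θ ^ 2)⁻¹ ≤ (S.σ ^ 2)⁻¹ := by have := hb.sigma_le; gcongr
    calc 80 * (θ ^ 2)⁻¹ * l / ε₀ ^ 2 ≤ 80 * (S.σ ^ 2)⁻¹ * l / ε₀ ^ 2 := by gcongr
      _ = 80 * 1 * l * 1 / (S.σ ^ 2 * ε₀ ^ 2) := by field_simp
      _ ≤ _ := by
        gcongr
        linarith [sq_nonneg ϑ]
  have hτge : 2 + 129600 * (θ ^ 3) ^ 32 * Real.log (3 * T) / ε₀ ^ 2 ≤ tau0 d α₀ ϑ ν ν₀ S.σ C₀ ε₀ T := by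
    refine le_trans ?_ hτ
    have h1 : 80 * (θ ^ 2)⁻¹ * (540 * θ ^ 106 * Real.log (3 * T)) / ε₀ ^ 2 ≤ 80 * (θ ^ 2)⁻¹ * l / ε₀ ^ 2 := by gcongr
    refine le_trans ?_ h1
    have h2 : 80 * (θ ^ 2)⁻¹ * (540 * θ ^ 106 * Real.log (3 * T)) / ε₀ ^ 2 =
        43200 * θ ^ 8 * (θ ^ 96 * Real.log (3 * T) / ε₀ ^ 2) := by field_simp; ring
    have h4 : 1 ≤ θ ^ 96 * Real.log (3 * T) / ε₀ ^ 2 := by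
      rw [one_le_div (by positivity)]
      have h5 : 1 ≤ θ ^ 30 := one_le_pow₀ hθ1
      have h6 : ε₀ ≤ 1 := by nlinarith
      have h7 : 1 ≤ θ ^ 96 := one_le_pow₀ hθ1
      calc ε₀ ^ 2 ≤ 1 := pow_le_one₀ hε0.le h6
        _ ≤ θ ^ 96 * Real.log (3 * T) := one_le_mul_of_one_le_of_one_le h7 hL
    have h5 : (3 : ℝ) ^ 8 ≤ θ ^ 8 := by gcongr
    have h6 : 3 ^ 8 * (θ ^ 96 * Real.log (3 * T) / ε₀ ^ 2) ≤ θ ^ 8 * (θ ^ 96 * Real.log (3 * T) / ε₀ ^ 2) := by gcongr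
    have h7 : 129600 * (θ ^ 3) ^ 32 * Real.log (3 * T) / ε₀ ^ 2 = 129600 * (θ ^ 96 * Real.log (3 * T) / ε₀ ^ 2) := by
      ring
    rw [h2, h7]
    linarith
  refine ⟨P, Y, {
    bdd := hP
    R_le := h.R_le.trans (hb.alpha1_le.trans hb.le_cube)
    sigma_pos := hσ
    sigma_le := hb.sigma_le.trans hb.le_cube
    sigma_inv_le := hb.sigma_inv_le.trans hb.le_cube
    dim_le := hb.dim_le.trans hb.le_cube
    Q_posDef := h.Q_posDef
    isSuper := hY
    Y_le := hYle
    B_eq := rfl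
    Q_eq := rfl
    R_eq := rfl
    eps_pos := hε0
    eps_le := ?_
    T_pos := hT
    kappa_ge := ?_
    xb_ge := ?_
    tau_ge_four := ?_
    tau_ge := hτge
    lam_pos := hl0
    lam_le := ?_ }⟩
  · rw [← hεi]; exact le_of_eq (by ring)
  · refine abs_le_of_sq_le_sq' (le_trans ?_ hκ) (Real.sqrt_nonneg _) |>.2
    have h1 : θ ^ 3 + 1 ≤ θ ^ 4 := by
      have : 1 ≤ θ ^ 3 := one_le_pow₀ hθ1
      nlinarith
    calc (θ ^ 3 + 1) ^ 2 ≤ (θ ^ 4) ^ 2 := by gcongr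
      _ = θ ^ 8 := by ring
      _ ≤ θ ^ 27 := pow_le_pow_right₀ hθ1 (by norm_num)
  · refine le_trans (mul_le_mul_of_nonneg_right ?_ (by linarith)) hlam
    calc 280 * (θ ^ 3) ^ 11 = 280 * θ ^ 33 := by ring
      _ ≤ 540 * θ ^ 106 := by gcongr <;> norm_num
  · have h1 : (4 : ℝ) ≤ tau0 d α₀ ϑ ν ν₀ S.σ C₀ ε₀ T := by
      refine le_trans ?_ hτge
      have h2 : (2 : ℝ) ≤ 129600 * (θ ^ 3) ^ 32 * Real.log (3 * T) / ε₀ ^ 2 := by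
        rw [le_div_iff₀ (by positivity)]
        have h5 : 1 ≤ θ ^ 30 := one_le_pow₀ hθ1
        have h6 : ε₀ ^ 2 ≤ 1 := pow_le_one₀ hε0.le (by nlinarith)
        have h7 : 1 ≤ (θ ^ 3) ^ 32 := one_le_pow₀ (one_le_pow₀ hθ1)
        have h8 := one_le_mul_of_one_le_of_one_le h7 hL
        linarith
      linarith
    exact_mod_cast h1
  · have h1 : ε₀ * (80 * (θ ^ 2)⁻¹ * l / ε₀ ^ 2) ≤ ε₀ * tau0 d α₀ ϑ ν ν₀ S.σ C₀ ε₀ T := by gcongr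
    refine le_trans ?_ h1
    have h2 : ε₀ * (80 * (θ ^ 2)⁻¹ * l / ε₀ ^ 2) = 336000 * θ ^ 28 * l := by
      have : ε₀ * (80 * (θ ^ 2)⁻¹ * l / ε₀ ^ 2) = 80 * (θ ^ 2)⁻¹ * l * ε₀⁻¹ := by field_simp
      rw [this, hε, inv_inv]; field_simp; ring
    rw [h2]
    calc 8 * (θ ^ 3) ^ 3 * l = 8 * θ ^ 9 * l := by ring
      _ ≤ 336000 * θ ^ 28 * l := by gcongr <;> norm_num

lemma tau0_le (hb : SizeBound S α₀ α₁ ϑ ν ν₀ θ) (h : S.Admissible K₀ α₀ α₁ ϑ ν ν₀)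
    (hε : ε₀ = (4200 * θ ^ 30)⁻¹) (hM : ε₀ ^ 2 * C₀ = θ ^ 30) {T : ℕ} (hL : 1 ≤ Real.log (3 * T))
    (hl0 : 0 ≤ lambda d α₀ ν ν₀ S.σ C₀ ε₀ T) :
    tau0 d α₀ ϑ ν ν₀ S.σ C₀ ε₀ T ≤ 20000000000000 * θ ^ 200 * Real.log (3 * T) := by
  have hθ := hb.pos
  have hl := hb.lambda_le h hM (zero_le_one.trans hL)
  have h0 := h.theta_pos
  refine (Nat.ceil_lt_add_one (by positivity)).le.trans ?_
  have h1 : 1 + ϑ ^ 2 ≤ θ ^ 2 := by nlinarith [hb.theta_le]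
  have h2 := hb.sigma_inv_sq_le h
  have h3 := hb.dim_le
  have h4 : 80 * d * lambda d α₀ ν ν₀ S.σ C₀ ε₀ T * (1 + ϑ ^ 2) / (S.σ ^ 2 * ε₀ ^ 2) ≤
      80 * θ * (8910 * θ ^ 135 * Real.log (3 * T)) * θ ^ 2 * (θ ^ 2 * (4200 * θ ^ 30) ^ 2) := by
    rw [div_eq_mul_inv, mul_inv, ← inv_pow ε₀, hε, inv_inv]
    rw [hε] at hl hl0
    gcongr
  have h5 : 1 ≤ θ ^ 200 * Real.log (3 * T) := one_le_mul_of_one_le_of_one_le (one_le_pow₀ hb.one_le) hL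
  refine (add_le_add h4 h5).trans ?_
  have e : 80 * θ * (8910 * θ ^ 135 * Real.log (3 * T)) * θ ^ 2 * (θ ^ 2 * (4200 * θ ^ 30) ^ 2) =
      12573792000000 * (θ ^ 200 * Real.log (3 * T)) := by ring
  rw [e]
  linarith

/-- The regret on the canonical probability space. -/
lemma integral_regret_le (hb : SizeBound S α₀ α₁ ϑ ν ν₀ θ) (h : S.Admissible K₀ α₀ α₁ ϑ ν ν₀) (hd : 1 ≤ d)
    (hε : ε₀ = (4200 * θ ^ 30)⁻¹) (hM : ε₀ ^ 2 * C₀ = θ ^ 30) {T : ℕ} (hT : 3 ≤ T) :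
    Integrable (S.regret (algInput S K₀ α₀ ϑ ν ν₀ C₀ ε₀ T).policy T) (noiseLaw d S.σ) ∧
    Measurable (S.regret (algInput S K₀ α₀ ϑ ν ν₀ C₀ ε₀ T).policy T) ∧
    ∫ ω, S.regret (algInput S K₀ α₀ ϑ ν ν₀ C₀ ε₀ T).policy T ω ∂(noiseLaw d S.σ) ≤
      5000000000000000000 * θ ^ 345 * Real.log T ^ 2 := by
  obtain ⟨P, Y, hs⟩ := hb.setting h hd hε hM (by omega : 1 ≤ T)
  refine ⟨hs.integrable_regret, hs.measurable_regret, hs.integral_regret_le.trans ?_⟩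
  have hθ := hb.pos
  have hθ1 := hb.one_le
  have hT' : (3 : ℝ) ≤ T := by exact_mod_cast hT
  set ℓ := Real.log T with hℓ
  have hℓ1 : 1 ≤ ℓ := by
    rw [hℓ, Real.le_log_iff_exp_le (by positivity)]; linarith [Real.exp_one_lt_d9]
  have hL : Real.log (3 * T) ≤ 2 * ℓ := by
    rw [Real.log_mul (by norm_num) (by positivity)]
    have : Real.log 3 ≤ ℓ := Real.log_le_log (by norm_num) hT'
    linarith
  have hL1 := hs.log_ge_one
  have hl0 : 0 < lambda d α₀ ν ν₀ S.σ C₀ ε₀ T := hs.lam_pos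
  have hτ := hb.tau0_le h hε hM hL1 hl0.le
  have hl := hb.lambda_le h hM (zero_le_one.trans hL1)
  have hκ := hb.kappa_sq_le h hM
  change 2 * (θ ^ 3) ^ 3 * (80 * (θ ^ 3) ^ 13 * (tau0 d α₀ ϑ ν ν₀ S.σ C₀ ε₀ T) +
      141120000 * (θ ^ 3) ^ 20 * lambda d α₀ ν ν₀ S.σ C₀ ε₀ T *
        (160 * (θ ^ 3) ^ 14 * (1 + ℓ) + 32 * (θ ^ 3) ^ 2 * lambda d α₀ ν ν₀ S.σ C₀ ε₀ T) +
      128 * (θ ^ 3) ^ 6 * kappa α₀ ν S.σ C₀ ε₀ ^ 4 *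
        ((θ ^ 3) ^ 2 * lambda d α₀ ν ν₀ S.σ C₀ ε₀ T + 33 * (θ ^ 3) ^ 6)) ≤ _
  set l := lambda d α₀ ν ν₀ S.σ C₀ ε₀ T
  set κ := kappa α₀ ν S.σ C₀ ε₀
  set τ := Nat.cast (R := ℝ) (tau0 d α₀ ϑ ν ν₀ S.σ C₀ ε₀ T)
  have hl2 : l ≤ 17820 * θ ^ 135 * ℓ := by
    calc l ≤ _ := hl
      _ ≤ 8910 * θ ^ 135 * (2 * ℓ) := by gcongr
      _ = _ := by ring
  have hτ2 : τ ≤ 40000000000000 * θ ^ 200 * ℓ ^ 2 := by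
    calc τ ≤ _ := hτ
      _ ≤ 20000000000000 * θ ^ 200 * (2 * ℓ ^ 2) := by gcongr; nlinarith
      _ = _ := by ring
  have hκ4 : κ ^ 4 ≤ 4 * θ ^ 66 := by
    calc κ ^ 4 = (κ ^ 2) ^ 2 := by ring
      _ ≤ (2 * θ ^ 33) ^ 2 := by gcongr
      _ = _ := by ring
  have hp : ∀ {m n : ℕ}, m ≤ n → θ ^ m ≤ θ ^ n := fun h => pow_le_pow_right₀ hθ1 h
  calc _ ≤ 2 * (θ ^ 3) ^ 3 * (80 * (θ ^ 3) ^ 13 * (40000000000000 * θ ^ 200 * ℓ ^ 2) +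
      141120000 * (θ ^ 3) ^ 20 * (17820 * θ ^ 135 * ℓ) *
        (160 * (θ ^ 3) ^ 14 * (ℓ + ℓ) + 32 * (θ ^ 3) ^ 2 * (17820 * θ ^ 135 * ℓ)) +
      128 * (θ ^ 3) ^ 6 * (4 * θ ^ 66) *
        ((θ ^ 3) ^ 2 * (17820 * θ ^ 135 * ℓ) + 33 * (θ ^ 3) ^ 6)) := by gcongr
    -- The warm-up and the product of x_b with log T or λ give log² T; the largest power, 345, comes
    -- from x_b·λ. The failure event contributes the lower-order terms.
    _ = (6400000000000000 * θ ^ 248 + 1609445376000000 * θ ^ 246 + 2868031660032000000 * θ ^ 345) * ℓ ^ 2 +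
        18247680 * θ ^ 234 * ℓ + 33792 * θ ^ 111 := by ring
    _ ≤ (6400000000000000 * θ ^ 345 + 1609445376000000 * θ ^ 345 + 2868031660032000000 * θ ^ 345) * ℓ ^ 2 +
        18247680 * θ ^ 345 * ℓ ^ 2 + 33792 * (θ ^ 345 * ℓ ^ 2) := by
        have h1 : ℓ ≤ ℓ ^ 2 := by nlinarith
        have h2 : θ ^ 111 * 1 ≤ θ ^ 345 * ℓ ^ 2 :=
          mul_le_mul (hp (by norm_num)) (one_le_pow₀ hℓ1) zero_le_one (by positivity)
        have h3 := hp (m := 248) (n := 345) (by norm_num)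
        have h4 := hp (m := 246) (n := 345) (by norm_num)
        have h5 := hp (m := 234) (n := 345) (by norm_num)
        rw [mul_one] at h2
        gcongr
    _ ≤ _ := by
        have : 0 ≤ θ ^ 345 * ℓ ^ 2 := by positivity
        linarith

end SizeBound

end Constants

/-! ### Transfer to an arbitrary probability space -/

section Transfer

variable {d k : ℕ} {S : System d k} {K₀ : Matrix (Fin k) (Fin d) ℝ} {α₀ α₁ ϑ ν ν₀ : ℝ}

lemma map_eq_noiseLaw {Ω : Type*} [MeasurableSpace Ω] {P : Measure Ω} [IsProbabilityMeasure P] {σ : ℝ}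
    {w : ℕ → Ω → Fin d → ℝ} (hw : ∀ t, HasLaw (w t) (gaussianNoise d σ) P) (hi : iIndepFun w P) :
    P.map (fun ω t => w t ω) = noiseLaw d σ := by
  rw [(iIndepFun_iff_map_fun_eq_infinitePi_map₀' fun t => (hw t).aemeasurable).1 hi, noiseLaw]
  congr 1
  funext t
  exact (hw t).map_eq

/-- For d = 0 the prescribed λ and τ₀ vanish and the general analysis does not apply, but states and
actions are zero and so is the cost. -/
lemma regret_eq_zero_of_dim_zero {S : System 0 k} {K₀ : Matrix (Fin k) (Fin 0) ℝ}
    (h : S.Admissible K₀ α₀ α₁ ϑ ν ν₀) (p : AlgInput 0 k) (T : ℕ) (w : ℕ → Fin 0 → ℝ) :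
    S.regret p.policy T w = 0 := by
  obtain ⟨P, -, -, hJ⟩ := h.sizeBound.exists_bounded h
  have hJ0 : S.Jstar.toReal = 0 := by rw [hJ]; simp [Matrix.trace]
  refine Finset.sum_eq_zero fun t ht => ?_
  obtain ⟨s, rfl⟩ : ∃ s, t = s + 1 := ⟨t - 1, by have := (Finset.mem_Icc.1 ht).1; omega⟩
  have hu : action S.A S.B p.policy w (s + 1) = 0 := by
    rw [action_succ, AlgInput.policy]
    split_ifs <;> · ext i; simp [Matrix.mulVec, dotProduct]
  rw [hJ0, System.cost, hu]
  simp [dotProduct]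

/-- The regret half of the theorem. -/
theorem exists_regret_polynomials : ∃ pC pε pT pR : MvPolynomial (Fin 9) ℝ,
      ∀ (d k : ℕ) (S : System d k) (K₀ : Matrix (Fin k) (Fin d) ℝ) (α₀ α₁ ϑ ν ν₀ C₀ ε₀ : ℝ),
        S.Admissible K₀ α₀ α₁ ϑ ν ν₀ →
        C₀ = MvPolynomial.eval (consts d k α₀ α₁ ϑ ν ν₀ S.σ) pC →
        ε₀ = (MvPolynomial.eval (consts d k α₀ α₁ ϑ ν ν₀ S.σ) pε)⁻¹ →
        0 < C₀ ∧ 0 < ε₀ ∧ S.PerturbationBound C₀ ε₀ ∧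
        ∀ T : ℕ, MvPolynomial.eval (consts d k α₀ α₁ ϑ ν ν₀ S.σ) pT ≤ (T : ℝ) →
          ∀ (Ω : Type*) [MeasurableSpace Ω] (P : Measure Ω) [IsProbabilityMeasure P]
            (w : ℕ → Ω → Fin d → ℝ),
            (∀ t, HasLaw (w t) (gaussianNoise d S.σ) P) → iIndepFun w P →
            Integrable (fun ω => S.regret (algInput S K₀ α₀ ϑ ν ν₀ C₀ ε₀ T).policy T
              (fun t => w t ω)) P ∧
            ∫ ω, S.regret (algInput S K₀ α₀ ϑ ν ν₀ C₀ ε₀ T).policy T (fun t => w t ω) ∂P ≤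
              MvPolynomial.eval (consts d k α₀ α₁ ϑ ν ν₀ S.σ) pR * Real.log T ^ 2 := by
  set Θ : MvPolynomial (Fin 9) ℝ := 1 + ∑ i, MvPolynomial.X i with hΘ
  -- With g = θ³, ε₀⁻¹ = 4200g¹⁰ is the accuracy needed. The perturbation bound would allow C₀ of
  -- order g²¹ = θ⁶³; the exponent 90 makes ε₀²C₀ = θ³⁰, since 17640000 = 4200². The threshold T ≥ 3
  -- gives log T ≥ 1.
  refine ⟨MvPolynomial.C 17640000 * Θ ^ 90, MvPolynomial.C 4200 * Θ ^ 30, MvPolynomial.C 3,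
    MvPolynomial.C 5000000000000000000 * Θ ^ 345, ?_⟩
  intro d k S K₀ α₀ α₁ ϑ ν ν₀ C₀ ε₀ h hC hε
  have hΘe : MvPolynomial.eval (consts d k α₀ α₁ ϑ ν ν₀ S.σ) Θ = size d k α₀ α₁ ϑ ν ν₀ S.σ := by
    simp [hΘ, size]
  simp only [map_mul, map_pow, MvPolynomial.eval_C, hΘe] at hC hε ⊢
  have hb := h.sizeBound
  set θ := size d k α₀ α₁ ϑ ν ν₀ S.σ
  have hθ := hb.pos
  have hM : ε₀ ^ 2 * C₀ = θ ^ 30 := by rw [hC, hε]; field_simp; ring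
  have hC0 : 0 < C₀ := by rw [hC]; positivity
  have hε0 : 0 < ε₀ := by rw [hε]; positivity
  refine ⟨hC0, hε0, ?_, fun T hT Ω _ P _ w hw hi => ?_⟩
  · obtain ⟨P, hP, ht, -⟩ := hb.exists_bounded h
    refine hP.perturbationBound h.Q_posDef h.sigma_pos (h.R_le.trans (hb.alpha1_le.trans hb.le_cube))
      (ht.trans (hb.nu_le.trans hb.le_cube)) ?_ ?_
    · rw [hC, ← pow_mul]
      have : θ ^ (3 * 21) ≤ θ ^ 90 := pow_le_pow_right₀ hb.one_le (by norm_num)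
      linarith
    · rw [hε, ← pow_mul]
      exact le_of_eq (by field_simp)
  · have hT3 : 3 ≤ T := by exact_mod_cast hT
    rcases Nat.eq_zero_or_pos d with rfl | hd
    · simp only [regret_eq_zero_of_dim_zero h]
      refine ⟨integrable_zero _ _ _, ?_⟩
      rw [integral_zero]; positivity
    · obtain ⟨h1, h2, h3⟩ := hb.integral_regret_le h hd hε hM hT3
      have hmap := map_eq_noiseLaw hw hi
      have hm : AEMeasurable (fun ω t => w t ω) P := aemeasurable_pi_lambda _ fun t => (hw t).aemeasurable
      rw [← hmap] at h1 h3
      rw [integral_map hm h2.aestronglyMeasurable] at h3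
      exact ⟨(integrable_map_measure h2.aestronglyMeasurable hm).1 h1, h3⟩

end Transfer

/-! ### Straight-line programs -/

section Machine

variable {d k : ℕ}

/-- The effect of a program. -/
abbrev run (d k : ℕ) (prog : List Instr) (s : ℕ → ℝ) : ℕ → ℝ := prog.foldl (Instr.exec d k) s

lemma run_append (P P' : List Instr) (s : ℕ → ℝ) : run d k (P ++ P') s = run d k P' (run d k P s) :=
  List.foldl_append

/-- Two memories agree below `M`. -/
def Agree (M : ℕ) (s s' : ℕ → ℝ) : Prop := ∀ r < M, s r = s' r

lemma Agree.trans {M M' : ℕ} {s s' s'' : ℕ → ℝ} (h : Agree M s s') (h' : Agree M' s' s'') (hM : M' ≤ M) :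
    Agree M' s s'' := fun r hr => (h r (by omega)).trans (h' r hr)

lemma readMat_index_lt {m n : ℕ} (i : Fin m) (j : Fin n) : (finProdFinEquiv (i, j) : ℕ) < m * n :=
  (finProdFinEquiv (i, j)).isLt

lemma Agree.readMat {M m n a : ℕ} {s s' : ℕ → ℝ} (h : Agree M s s') (ha : a + m * n ≤ M) :
    readMat m n a s = readMat m n a s' := by
  ext i j
  exact h _ (by have := readMat_index_lt i j; omega)

lemma readMat_writeMat_self {m n a : ℕ} (N : Matrix (Fin m) (Fin n) ℝ) (s : ℕ → ℝ) :
    readMat m n a (writeMat a N s) = N := by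
  ext i j
  have h := readMat_index_lt i j
  simp only [readMat, writeMat]
  rw [dif_pos ⟨by omega, by omega⟩]
  simp only [Nat.add_sub_cancel_left, Fin.eta, Equiv.symm_apply_apply]

lemma readMat_writeMat_of_disjoint {m n a m' n' a' : ℕ} (N : Matrix (Fin m') (Fin n') ℝ) (s : ℕ → ℝ)
    (h : a + m * n ≤ a' ∨ a' + m' * n' ≤ a) : readMat m n a (writeMat a' N s) = readMat m n a s := by
  ext i j
  have h1 := readMat_index_lt i j
  simp only [readMat, writeMat]
  rw [dif_neg]
  omega

lemma agree_writeMat {m n a : ℕ} (N : Matrix (Fin m) (Fin n) ℝ) (s : ℕ → ℝ) : Agree a (writeMat a N s) s :=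
  fun r hr => by simp only [writeMat]; rw [dif_neg]; omega

/-- A scalar function of the registers below `M` that `n` instructions compute into any register
`m ≥ M`, leaving the registers below `m` unchanged. -/
def Comp (d k M n : ℕ) (f : (ℕ → ℝ) → ℝ) : Prop :=
  (∀ s s', Agree M s s' → f s = f s') ∧ ∀ m, M ≤ m → ∃ P : List Instr, P.length ≤ n ∧
    ∀ s, run d k P s m = f s ∧ Agree m (run d k P s) s

namespace Comp

variable {M n n₁ n₂ n₃ n₄ : ℕ} {f f₁ f₂ f₃ f₄ : (ℕ → ℝ) → ℝ}

lemma mono (h : Comp d k M n f) (hn : n ≤ n₁) : Comp d k M n₁ f :=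
  ⟨h.1, fun m hm => by
    obtain ⟨P, h1, h2⟩ := h.2 m hm
    exact ⟨P, h1.trans hn, h2⟩⟩

lemma agree_update (m : ℕ) (s : ℕ → ℝ) (v : ℝ) : Agree m (Function.update s m v) s :=
  fun r hr => Function.update_of_ne (by omega) _ _

lemma single {I : ℕ → Instr} (hf : ∀ s s', Agree M s s' → f s = f s')
    (h : ∀ m s, M ≤ m → Instr.exec d k s (I m) = Function.update s m (f s)) : Comp d k M 1 f :=
  ⟨hf, fun m hm => ⟨[I m], le_rfl, fun s => by
    change Instr.exec d k s (I m) m = f s ∧ Agree m (Instr.exec d k s (I m)) s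
    rw [h m s hm]
    exact ⟨Function.update_self _ _ _, agree_update _ _ _⟩⟩⟩

lemma const (q : ℚ) : Comp d k M 1 fun _ => (q : ℝ) :=
  single (I := fun m => .const m q) (fun _ _ _ => rfl) fun _ _ _ => rfl

lemma one : Comp d k M 1 fun _ => (1 : ℝ) := by simpa using const (d := d) (k := k) (M := M) 1

lemma zero : Comp d k M 1 fun _ => (0 : ℝ) := by simpa using const (d := d) (k := k) (M := M) 0

/-- A selection with all sources equal serves as a move instruction. -/
lemma reg {r : ℕ} (hr : r < M) : Comp d k M 1 fun s => s r :=
  single (I := fun m => .select m r r r r) (fun _ _ h => h r hr) fun m s _ => by simp [Instr.exec]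

lemma readMat {m n a : ℕ} (h : a + m * n ≤ M) (i : Fin m) (j : Fin n) :
    Comp d k M 1 fun s => LQ.readMat m n a s i j :=
  reg (by have := readMat_index_lt i j; omega)

/-- The first operand is left in register m and the second is computed into m + 1, which preserves
m; the result then overwrites m. The target thus acts as the top of a stack. -/
lemma bin {op : ℝ → ℝ → ℝ} {I : ℕ → ℕ → ℕ → Instr}
    (hI : ∀ r a b s, Instr.exec d k s (I r a b) = Function.update s r (op (s a) (s b)))
    (h₁ : Comp d k M n₁ f₁) (h₂ : Comp d k M n₂ f₂) : Comp d k M (n₁ + n₂ + 1) fun s => op (f₁ s) (f₂ s) :=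
  ⟨fun s s' h => by simp only [h₁.1 s s' h, h₂.1 s s' h], fun m hm => by
    obtain ⟨P₁, l₁, e₁⟩ := h₁.2 m hm
    obtain ⟨P₂, l₂, e₂⟩ := h₂.2 (m + 1) (by omega)
    refine ⟨P₁ ++ P₂ ++ [I m m (m + 1)], by simp; omega, fun s => ?_⟩
    rw [run_append, run_append]
    set s₁ := run d k P₁ s with hs₁
    set s₂ := run d k P₂ s₁ with hs₂
    obtain ⟨v₁, a₁⟩ := e₁ s
    obtain ⟨v₂, a₂⟩ := e₂ s₁
    change Instr.exec d k s₂ (I m m (m + 1)) m = _ ∧ Agree m (Instr.exec d k s₂ (I m m (m + 1))) s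
    rw [hI, Function.update_self]
    refine ⟨?_, (agree_update m s₂ _).trans (a₂.trans a₁ (by omega)) le_rfl⟩
    rw [hs₂, v₂, a₂ m (by omega), hs₁, v₁, h₂.1 s₁ s fun r hr => a₁ r (by omega)]⟩

lemma add (h₁ : Comp d k M n₁ f₁) (h₂ : Comp d k M n₂ f₂) : Comp d k M (n₁ + n₂ + 1) fun s => f₁ s + f₂ s :=
  bin (op := fun a b => a + b) (I := .add) (fun _ _ _ _ => rfl) h₁ h₂

lemma sub (h₁ : Comp d k M n₁ f₁) (h₂ : Comp d k M n₂ f₂) : Comp d k M (n₁ + n₂ + 1) fun s => f₁ s - f₂ s :=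
  bin (op := fun a b => a - b) (I := .sub) (fun _ _ _ _ => rfl) h₁ h₂

lemma mul (h₁ : Comp d k M n₁ f₁) (h₂ : Comp d k M n₂ f₂) : Comp d k M (n₁ + n₂ + 1) fun s => f₁ s * f₂ s :=
  bin (op := fun a b => a * b) (I := .mul) (fun _ _ _ _ => rfl) h₁ h₂

lemma div (h₁ : Comp d k M n₁ f₁) (h₂ : Comp d k M n₂ f₂) : Comp d k M (n₁ + n₂ + 1) fun s => f₁ s / f₂ s :=
  bin (op := fun a b => a / b) (I := .div) (fun _ _ _ _ => rfl) h₁ h₂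

lemma select (h₁ : Comp d k M n₁ f₁) (h₂ : Comp d k M n₂ f₂) (h₃ : Comp d k M n₃ f₃) (h₄ : Comp d k M n₄ f₄) :
    Comp d k M (n₁ + n₂ + n₃ + n₄ + 1) fun s => if f₁ s ≤ f₂ s then f₃ s else f₄ s :=
  ⟨fun s s' h => by simp only [h₁.1 s s' h, h₂.1 s s' h, h₃.1 s s' h, h₄.1 s s' h], fun m hm => by
    obtain ⟨P₁, l₁, e₁⟩ := h₁.2 m hm
    obtain ⟨P₂, l₂, e₂⟩ := h₂.2 (m + 1) (by omega)
    obtain ⟨P₃, l₃, e₃⟩ := h₃.2 (m + 2) (by omega)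
    obtain ⟨P₄, l₄, e₄⟩ := h₄.2 (m + 3) (by omega)
    refine ⟨P₁ ++ P₂ ++ P₃ ++ P₄ ++ [.select m m (m + 1) (m + 2) (m + 3)], by simp; omega, fun s => ?_⟩
    rw [run_append, run_append, run_append, run_append]
    set s₁ := run d k P₁ s with hs₁
    set s₂ := run d k P₂ s₁ with hs₂
    set s₃ := run d k P₃ s₂ with hs₃
    set s₄ := run d k P₄ s₃ with hs₄
    obtain ⟨v₁, a₁⟩ := e₁ s
    obtain ⟨v₂, a₂⟩ := e₂ s₁
    obtain ⟨v₃, a₃⟩ := e₃ s₂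
    obtain ⟨v₄, a₄⟩ := e₄ s₃
    rw [← hs₁] at v₁ a₁
    rw [← hs₂] at v₂ a₂
    rw [← hs₃] at v₃ a₃
    rw [← hs₄] at v₄ a₄
    have b₂ : Agree m s₂ s := a₂.trans a₁ (by omega)
    have b₃ : Agree m s₃ s := a₃.trans b₂ (by omega)
    change Instr.exec d k s₄ (.select m m (m + 1) (m + 2) (m + 3)) m = _ ∧
      Agree m (Instr.exec d k s₄ (.select m m (m + 1) (m + 2) (m + 3))) s
    simp only [Instr.exec, Function.update_self]
    refine ⟨?_, (agree_update m s₄ _).trans (a₄.trans b₃ (by omega)) le_rfl⟩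
    have w₁ : s₄ m = f₁ s := by
      rw [a₄ m (by omega), a₃ m (by omega), a₂ m (by omega), v₁]
    have w₂ : s₄ (m + 1) = f₂ s := by
      rw [a₄ _ (by omega), a₃ _ (by omega), v₂, h₂.1 s₁ s fun r hr => a₁ r (by omega)]
    have w₃ : s₄ (m + 2) = f₃ s := by
      rw [a₄ _ (by omega), v₃, h₃.1 s₂ s fun r hr => b₂ r (by omega)]
    have w₄ : s₄ (m + 3) = f₄ s := by
      rw [v₄, h₄.1 s₃ s fun r hr => b₃ r (by omega)]
    rw [w₁, w₂, w₃, w₄]⟩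

lemma sum {N : ℕ} {f : Fin N → (ℕ → ℝ) → ℝ} (h : ∀ i, Comp d k M n (f i)) :
    Comp d k M (N * (n + 1) + 1) fun s => ∑ i, f i s := by
  induction N with
  | zero => simpa using zero (d := d) (k := k) (M := M)
  | succ N ih =>
    simp only [Fin.sum_univ_castSucc]
    exact ((ih fun i => h i.castSucc).add (h (Fin.last N))).mono (by ring_nf; omega)

end Comp

/-- A list of computable values can be stored consecutively. -/
lemma exists_block {M n N : ℕ} {f : (ℕ → ℝ) → ℕ → ℝ} (h : ∀ i < N, Comp d k M n fun s => f s i) :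
    ∃ P : List Instr, P.length ≤ N * n ∧ ∀ s, (∀ i < N, run d k P s (M + i) = f s i) ∧ Agree M (run d k P s) s := by
  induction N with
  | zero => exact ⟨[], by simp, fun s => ⟨fun i hi => by omega, fun r _ => rfl⟩⟩
  | succ N ih =>
    obtain ⟨P, l, e⟩ := ih fun i hi => h i (by omega)
    obtain ⟨P', l', e'⟩ := (h N (by omega)).2 (M + N) (by omega)
    refine ⟨P ++ P', by rw [List.length_append, Nat.succ_mul]; omega, fun s => ?_⟩
    rw [run_append]
    obtain ⟨v, a⟩ := e s
    obtain ⟨v', a'⟩ := e' (run d k P s)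
    refine ⟨fun i hi => ?_, a'.trans a (by omega)⟩
    rcases Nat.lt_succ_iff_lt_or_eq.1 hi with hi | rfl
    · rw [a' _ (by omega), v i hi]
    · rw [v', (h i (by omega)).1 _ s a]

lemma exists_matBlock {M n a b : ℕ} {F : (ℕ → ℝ) → Matrix (Fin a) (Fin b) ℝ}
    (h : ∀ i j, Comp d k M n fun s => F s i j) :
    ∃ P : List Instr, P.length ≤ a * b * n ∧ ∀ s, readMat a b M (run d k P s) = F s ∧ Agree M (run d k P s) s := by
  obtain ⟨P, l, e⟩ := exists_block (d := d) (k := k) (M := M) (n := n) (N := a * b)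
    (f := fun s r => if hr : r < a * b then
      F s (finProdFinEquiv.symm ⟨r, hr⟩).1 (finProdFinEquiv.symm ⟨r, hr⟩).2 else 0)
    fun r hr => by simp only [dif_pos hr]; exact h _ _
  refine ⟨P, l, fun s => ⟨?_, (e s).2⟩⟩
  ext i j
  have h1 := readMat_index_lt i j
  rw [readMat, (e s).1 _ h1]
  simp only [dif_pos h1, Fin.eta, Equiv.symm_apply_apply]

/-- Copying a matrix. -/
lemma exists_copy {a b t r : ℕ} (h : t + a * b ≤ r ∨ r + a * b ≤ t) :
    ∃ P : List Instr, P.length ≤ a * b ∧ ∀ s, run d k P s = writeMat t (readMat a b r s) s := by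
  have key : ∀ N, t + N ≤ r ∨ r + N ≤ t → ∃ P : List Instr, P.length ≤ N ∧
      ∀ s q, run d k P s q = if t ≤ q ∧ q - t < N then s (r + (q - t)) else s q := by
    intro N hN
    induction N with
    | zero => exact ⟨[], by simp, fun s q => by simp⟩
    | succ N ih =>
      obtain ⟨P, l, e⟩ := ih (by omega)
      refine ⟨P ++ [.select (t + N) (r + N) (r + N) (r + N) (r + N)], by simp; omega, fun s q => ?_⟩
      rw [run_append]
      change Instr.exec d k (run d k P s) (.select (t + N) (r + N) (r + N) (r + N) (r + N)) q = _
      simp only [Instr.exec, le_refl, if_true]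
      by_cases hq : q = t + N
      · subst hq
        rw [Function.update_self, e, if_neg (by omega), if_pos (by omega), Nat.add_sub_cancel_left]
      · rw [Function.update_of_ne hq, e]
        by_cases h1 : t ≤ q ∧ q - t < N
        · rw [if_pos h1, if_pos (by omega)]
        · rw [if_neg h1, if_neg (by omega)]
  obtain ⟨P, l, e⟩ := key (a * b) h
  refine ⟨P, l, fun s => funext fun q => ?_⟩
  rw [e, writeMat]
  split_ifs with hq
  · simp [readMat, Nat.mod_add_div]
  · rfl

end Machine

/-! ### One time step of the algorithm as a straight-line program -/

section StepProgram

/-- The data held in memory: the current state, the last action, the inputs, the number of completed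
time steps, the abort flag, the phase counter `f` (the next phase starts at time `τ₀ (1 + f)`), the
previous state, the inverse Gram matrix minus `λ⁻¹ I`, the correlation matrix and the current
greedy controller. -/
structure Regs (d k : ℕ) where
  x : Fin d → ℝ
  u : Fin k → ℝ
  Q : Matrix (Fin d) (Fin d) ℝ
  R : Matrix (Fin k) (Fin k) ℝ
  B : Matrix (Fin d) (Fin k) ℝ
  K₀ : Matrix (Fin k) (Fin d) ℝ
  τ₀ : ℝ
  xb : ℝ
  κ : ℝ
  lam : ℝ
  cnt : ℝ
  ab : ℝ
  f : ℝ
  xp : Fin d → ℝ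
  W : Matrix (Fin d) (Fin d) ℝ
  M : Matrix (Fin d) (Fin d) ℝ
  K : Matrix (Fin k) (Fin d) ℝ

variable {d k : ℕ}

/-- The memory `s` holds the data `m`. -/
structure Holds (m : Regs d k) (s : ℕ → ℝ) : Prop where
  x : readMat 1 d 0 s = fun _ => m.x
  u : readMat 1 k d s = fun _ => m.u
  Q : readMat d d (d + k) s = m.Q
  R : readMat k k (d + k + d * d) s = m.R
  B : readMat d k (d + k + d * d + k * k) s = m.B
  K₀ : readMat k d (d + k + d * d + k * k + d * k) s = m.K₀
  par : readMat 1 4 (d + k + d * d + k * k + d * k + k * d) s = ![![m.τ₀, m.xb, m.κ, m.lam]]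
  ctl : readMat 1 3 (d + k + d * d + k * k + d * k + k * d + 4) s = ![![m.cnt, m.ab, m.f]]
  xp : readMat 1 d (d + k + d * d + k * k + d * k + k * d + 7) s = fun _ => m.xp
  W : readMat d d (d + k + d * d + k * k + d * k + k * d + 7 + d) s = m.W
  M : readMat d d (d + k + d * d + k * k + d * k + k * d + 7 + d + d * d) s = m.M
  K : readMat k d (d + k + d * d + k * k + d * k + k * d + 7 + d + d * d + d * d) s = m.K

lemma Holds.congr {m : Regs d k} {s s' : ℕ → ℝ} {z : ℕ} (h : Holds m s) (ha : Agree z s' s)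
    (hz : d + k + d * d + k * k + d * k + k * d + 7 + d + d * d + d * d + k * d ≤ z) : Holds m s' := by
  constructor
  · rw [ha.readMat (by omega)]; exact h.x
  · rw [ha.readMat (by omega)]; exact h.u
  · rw [ha.readMat (by omega)]; exact h.Q
  · rw [ha.readMat (by omega)]; exact h.R
  · rw [ha.readMat (by omega)]; exact h.B
  · rw [ha.readMat (by omega)]; exact h.K₀
  · rw [ha.readMat (by omega)]; exact h.par
  · rw [ha.readMat (by omega)]; exact h.ctl
  · rw [ha.readMat (by omega)]; exact h.xp
  · rw [ha.readMat (by omega)]; exact h.W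
  · rw [ha.readMat (by omega)]; exact h.M
  · rw [ha.readMat (by omega)]; exact h.K

namespace Regs

/-- The inverse Gram matrix applied to the previous state. -/
def v (m : Regs d k) (j : Fin d) : ℝ := ∑ l, m.W j l * m.xp l + m.xp j / m.lam

/-- The rank-one update of the inverse Gram matrix. -/
def nextW (m : Regs d k) : Matrix (Fin d) (Fin d) ℝ :=
  fun i j => m.W i j - m.v i * m.v j / (1 + ∑ l, m.xp l * m.v l)

/-- The rank-one update of the correlation matrix. -/
def nextM (m : Regs d k) : Matrix (Fin d) (Fin d) ℝ :=
  fun i j => m.M i j + (m.x i - ∑ l, m.B i l * m.u l) * m.xp j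

/-- The current estimate. -/
def est (m : Regs d k) : Matrix (Fin d) (Fin d) ℝ :=
  fun i j => ∑ l, m.nextM i l * m.nextW l j + m.nextM i j / m.lam

/-- The controller of the current phase. -/
def nextK (m : Regs d k) : Matrix (Fin k) (Fin d) ℝ :=
  fun i j => if m.τ₀ * (1 + m.f) ≤ m.cnt + 1 then optController m.est m.B m.Q m.R i j else m.K i j

/-- The abort flag. -/
def nextAb (m : Regs d k) : ℝ :=
  if m.τ₀ ≤ m.cnt + 1 then
    if ∑ l, m.x l * m.x l ≤ m.xb then if ‖m.nextK‖ ≤ m.κ then m.ab else 1 else 1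
  else m.ab

/-- The phase counter. -/
def nextF (m : Regs d k) : ℝ :=
  if m.τ₀ * (1 + m.f) ≤ m.cnt + 1 then 3 + 4 * m.f else m.f

/-- The action. -/
def nextU (m : Regs d k) (j : Fin k) : ℝ :=
  if m.τ₀ ≤ m.cnt + 1 then
    if m.nextAb ≤ 0 then ∑ l, m.nextK j l * m.x l else ∑ l, m.K₀ j l * m.x l
  else ∑ l, m.K₀ j l * m.x l

/-- The data after one time step. -/
def next (m : Regs d k) : Regs d k :=
  { m with
    u := m.nextU, cnt := m.cnt + 1, ab := m.nextAb, f := m.nextF, xp := m.x, W := m.nextW, M := m.nextM,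
    K := m.nextK }

end Regs

set_option maxHeartbeats 1000000 in
/-- A program for one time step. -/
lemma exists_step_program (d k : ℕ) : ∃ P : List Instr, P.length ≤ 200 * (1 + d + k) ^ 3 ∧
    ∀ (m : Regs d k) (s : ℕ → ℝ), Holds m s → Holds m.next (run d k P s) := by
  obtain ⟨aR, hR⟩ : ∃ a, a = d + k + d * d := ⟨_, rfl⟩
  obtain ⟨aB, hB⟩ : ∃ a, a = aR + k * k := ⟨_, rfl⟩
  obtain ⟨aK₀, hK₀⟩ : ∃ a, a = aB + d * k := ⟨_, rfl⟩
  obtain ⟨aP, hP⟩ : ∃ a, a = aK₀ + k * d := ⟨_, rfl⟩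
  obtain ⟨aW, hW⟩ : ∃ a, a = aP + 7 + d := ⟨_, rfl⟩
  obtain ⟨aM, hM⟩ : ∃ a, a = aW + d * d := ⟨_, rfl⟩
  obtain ⟨aK, hK⟩ : ∃ a, a = aM + d * d := ⟨_, rfl⟩
  obtain ⟨z, hz⟩ : ∃ a, a = aK + k * d := ⟨_, rfl⟩
  obtain ⟨z₂, hz₂⟩ : ∃ a, a = z + d := ⟨_, rfl⟩
  obtain ⟨z₃, hz₃⟩ : ∃ a, a = z₂ + d * d := ⟨_, rfl⟩
  obtain ⟨z₄, hz₄⟩ : ∃ a, a = z₃ + d * d := ⟨_, rfl⟩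
  obtain ⟨z₅, hz₅⟩ : ∃ a, a = z₄ + d * d := ⟨_, rfl⟩
  obtain ⟨z₆, hz₆⟩ : ∃ a, a = z₅ + k * d := ⟨_, rfl⟩
  obtain ⟨z₇, hz₇⟩ : ∃ a, a = z₆ + k * d := ⟨_, rfl⟩
  obtain ⟨z₈, hz₈⟩ : ∃ a, a = z₇ + 1 := ⟨_, rfl⟩
  obtain ⟨z₉, hz₉⟩ : ∃ a, a = z₈ + 3 := ⟨_, rfl⟩
  -- the values that the blocks compute, as functions of the memory
  let rx : (ℕ → ℝ) → Fin d → ℝ := fun s => readMat 1 d 0 s 0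
  let rτ : (ℕ → ℝ) → ℝ := fun s => readMat 1 4 aP s 0 0
  let rcnt : (ℕ → ℝ) → ℝ := fun s => readMat 1 3 (aP + 4) s 0 0
  let rf : (ℕ → ℝ) → ℝ := fun s => readMat 1 3 (aP + 4) s 0 2
  let rlam : (ℕ → ℝ) → ℝ := fun s => readMat 1 4 aP s 0 3
  let rxp : (ℕ → ℝ) → Fin d → ℝ := fun s => readMat 1 d (aP + 7) s 0
  let F₁ : (ℕ → ℝ) → Matrix (Fin 1) (Fin d) ℝ := fun s _ j =>
    ∑ l, readMat d d aW s j l * rxp s l + rxp s j / rlam s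
  let F₂ : (ℕ → ℝ) → Matrix (Fin d) (Fin d) ℝ := fun s i j =>
    readMat d d aW s i j - readMat 1 d z s 0 i * readMat 1 d z s 0 j / (1 + ∑ l, rxp s l * readMat 1 d z s 0 l)
  let F₃ : (ℕ → ℝ) → Matrix (Fin d) (Fin d) ℝ := fun s i j =>
    readMat d d aM s i j + (rx s i - ∑ l, readMat d k aB s i l * readMat 1 k d s 0 l) * rxp s j
  let F₄ : (ℕ → ℝ) → Matrix (Fin d) (Fin d) ℝ := fun s i j =>
    ∑ l, readMat d d z₃ s i l * readMat d d z₂ s l j + readMat d d z₃ s i j / rlam s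
  let F₆ : (ℕ → ℝ) → Matrix (Fin k) (Fin d) ℝ := fun s i j =>
    if rτ s * (1 + rf s) ≤ rcnt s + 1 then readMat k d z₅ s i j else readMat k d aK s i j
  let F₈ : (ℕ → ℝ) → Matrix (Fin 1) (Fin 3) ℝ := fun s => ![![rcnt s + 1,
    if rτ s ≤ rcnt s + 1 then
      if ∑ l, rx s l * rx s l ≤ readMat 1 4 aP s 0 1 then
        if readMat 1 1 z₇ s 0 0 ≤ readMat 1 4 aP s 0 2 then readMat 1 3 (aP + 4) s 0 1 else 1 else 1
    else readMat 1 3 (aP + 4) s 0 1,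
    if rτ s * (1 + rf s) ≤ rcnt s + 1 then 3 + 4 * rf s else rf s]]
  let F₉ : (ℕ → ℝ) → Matrix (Fin 1) (Fin k) ℝ := fun s _ j =>
    if rτ s ≤ rcnt s + 1 then
      if readMat 1 3 z₈ s 0 1 ≤ 0 then ∑ l, readMat k d z₆ s j l * rx s l else ∑ l, readMat k d aK₀ s j l * rx s l
    else ∑ l, readMat k d aK₀ s j l * rx s l
  obtain ⟨P₁, l₁, e₁⟩ : ∃ P : List Instr, P.length ≤ 1 * d * (4 * d + 5) ∧
      ∀ s, readMat 1 d z (run d k P s) = F₁ s ∧ Agree z (run d k P s) s :=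
    exists_matBlock fun _ j => by
      refine Comp.mono (Comp.add (Comp.sum fun l => Comp.mul (Comp.readMat (by omega) _ _)
        (Comp.readMat (by omega) _ _)) (Comp.div (Comp.readMat (by omega) _ _) (Comp.readMat (by omega) _ _))) ?_
      omega
  obtain ⟨P₂, l₂, e₂⟩ : ∃ P : List Instr, P.length ≤ d * d * (4 * d + 9) ∧
      ∀ s, readMat d d z₂ (run d k P s) = F₂ s ∧ Agree z₂ (run d k P s) s :=
    exists_matBlock fun i j => by
      refine Comp.mono (Comp.sub (Comp.readMat (by omega) _ _) (Comp.div (Comp.mul (Comp.readMat (by omega) _ _)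
        (Comp.readMat (by omega) _ _)) (Comp.add Comp.one (Comp.sum fun l => Comp.mul (Comp.readMat (by omega) _ _)
        (Comp.readMat (by omega) _ _))))) ?_
      omega
  obtain ⟨P₃, l₃, e₃⟩ : ∃ P : List Instr, P.length ≤ d * d * (4 * k + 7) ∧
      ∀ s, readMat d d z₃ (run d k P s) = F₃ s ∧ Agree z₃ (run d k P s) s :=
    exists_matBlock fun i j => by
      refine Comp.mono (Comp.add (Comp.readMat (by omega) _ _) (Comp.mul (Comp.sub (Comp.readMat (by omega) _ _)
        (Comp.sum fun l => Comp.mul (Comp.readMat (by omega) _ _) (Comp.readMat (by omega) _ _)))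
        (Comp.readMat (by omega) _ _))) ?_
      omega
  obtain ⟨P₄, l₄, e₄⟩ : ∃ P : List Instr, P.length ≤ d * d * (4 * d + 5) ∧
      ∀ s, readMat d d z₄ (run d k P s) = F₄ s ∧ Agree z₄ (run d k P s) s :=
    exists_matBlock fun i j => by
      refine Comp.mono (Comp.add (Comp.sum fun l => Comp.mul (Comp.readMat (by omega) _ _)
        (Comp.readMat (by omega) _ _)) (Comp.div (Comp.readMat (by omega) _ _) (Comp.readMat (by omega) _ _))) ?_
      omega
  obtain ⟨P₆, l₆, e₆⟩ : ∃ P : List Instr, P.length ≤ k * d * 11 ∧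
      ∀ s, readMat k d z₆ (run d k P s) = F₆ s ∧ Agree z₆ (run d k P s) s :=
    exists_matBlock fun i j => by
      refine Comp.mono (Comp.select (Comp.mul (Comp.readMat (by omega) _ _) (Comp.add Comp.one
        (Comp.readMat (by omega) _ _))) (Comp.add (Comp.readMat (by omega) _ _) Comp.one)
        (Comp.readMat (by omega) _ _) (Comp.readMat (by omega) _ _)) ?_
      omega
  obtain ⟨P₈, l₈, e₈⟩ : ∃ P : List Instr, P.length ≤ 1 * 3 * (4 * d + 15) ∧
      ∀ s, readMat 1 3 z₈ (run d k P s) = F₈ s ∧ Agree z₈ (run d k P s) s :=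
    exists_matBlock fun i j => by
      have c1 : Comp d k z₈ 3 fun s => rcnt s + 1 := Comp.add (Comp.readMat (by omega) _ _) Comp.one
      have c2 : Comp d k z₈ 5 fun s => rτ s * (1 + rf s) :=
        Comp.mul (Comp.readMat (by omega) _ _) (Comp.add Comp.one (Comp.readMat (by omega) _ _))
      obtain rfl : i = 0 := Subsingleton.elim _ _
      fin_cases j
      · exact c1.mono (by omega)
      · refine Comp.mono (Comp.select (Comp.readMat (by omega) _ _) c1 (Comp.select (Comp.sum fun l => Comp.mul
          (Comp.readMat (by omega) _ _) (Comp.readMat (by omega) _ _)) (Comp.readMat (by omega) _ _)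
          (Comp.select (Comp.readMat (by omega) _ _) (Comp.readMat (by omega) _ _) (Comp.readMat (by omega) _ _)
          Comp.one) Comp.one) (Comp.readMat (by omega) _ _)) ?_
        omega
      · have c3 : Comp d k z₈ 1 fun _ => (3 : ℝ) := by simpa using Comp.const (d := d) (k := k) (M := z₈) 3
        have c4 : Comp d k z₈ 1 fun _ => (4 : ℝ) := by simpa using Comp.const (d := d) (k := k) (M := z₈) 4
        refine Comp.mono (Comp.select c2 c1 (Comp.add c3 (Comp.mul c4 (Comp.readMat (by omega) _ _)))
          (Comp.readMat (by omega) _ _)) ?_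
        omega
  obtain ⟨P₉, l₉, e₉⟩ : ∃ P : List Instr, P.length ≤ 1 * k * (12 * d + 12) ∧
      ∀ s, readMat 1 k z₉ (run d k P s) = F₉ s ∧ Agree z₉ (run d k P s) s :=
    exists_matBlock fun i j => by
      have c0 : Comp d k z₉ (d * 4 + 1) fun s => ∑ l, readMat k d aK₀ s j l * rx s l :=
        Comp.sum fun l => Comp.mul (Comp.readMat (by omega) _ _) (Comp.readMat (by omega) _ _)
      refine Comp.mono (Comp.select (Comp.readMat (by omega) _ _) (Comp.add (Comp.readMat (by omega) _ _) Comp.one)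
        (Comp.select (Comp.readMat (by omega) _ _) Comp.zero (Comp.sum fun l => Comp.mul
        (Comp.readMat (by omega) _ _) (Comp.readMat (by omega) _ _)) c0) c0) ?_
      omega
  obtain ⟨Pu, lu, eu⟩ := exists_copy (d := d) (k := k) (a := 1) (b := k) (t := d) (r := z₉) (by omega)
  obtain ⟨Pc, lc, ec⟩ := exists_copy (d := d) (k := k) (a := 1) (b := 3) (t := aP + 4) (r := z₈) (by omega)
  obtain ⟨Px, lx, ex⟩ := exists_copy (d := d) (k := k) (a := 1) (b := d) (t := aP + 7) (r := 0) (by omega)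
  obtain ⟨PW, lW, eW⟩ := exists_copy (d := d) (k := k) (a := d) (b := d) (t := aW) (r := z₂) (by omega)
  obtain ⟨PM, lM, eM⟩ := exists_copy (d := d) (k := k) (a := d) (b := d) (t := aM) (r := z₃) (by omega)
  obtain ⟨PK, lK, eK⟩ := exists_copy (d := d) (k := k) (a := k) (b := d) (t := aK) (r := z₆) (by omega)
  -- All results go to scratch registers from `z` on, and the persistent data are overwritten only
  -- by the final copies, so every block reads the old values. There are no jumps: the Riccati
  -- solver runs in every step, and its output is kept only when a phase begins.
  refine ⟨P₁ ++ P₂ ++ P₃ ++ P₄ ++ [.controller z₅ z₄ aB (d + k) aR] ++ P₆ ++ [.norm z₇ z₆] ++ P₈ ++ P₉ ++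
    Pu ++ Pc ++ Px ++ PW ++ PM ++ PK, ?_, fun m s h => ?_⟩
  · simp only [List.length_append, List.length_singleton]
    have e1 : 200 * (1 + d + k) ^ 3 = 200 + 600 * d + 600 * k + 600 * (d * d) + 600 * (k * k) + 600 * (d * k) +
        600 * (k * d) + 200 * (d * d * d) + 600 * (d * d * k) + 600 * (d * (k * k)) + 200 * (k * k * k) := by ring
    rw [e1]
    have f1 : 1 * d * (4 * d + 5) = 4 * (d * d) + 5 * d := by ring
    have f2 : d * d * (4 * d + 9) = 4 * (d * d * d) + 9 * (d * d) := by ring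
    have f3 : d * d * (4 * k + 7) = 4 * (d * d * k) + 7 * (d * d) := by ring
    have f4 : d * d * (4 * d + 5) = 4 * (d * d * d) + 5 * (d * d) := by ring
    have f5 : 1 * k * (12 * d + 12) = 12 * (d * k) + 12 * k := by ring
    omega
  · simp only [run_append]
    subst hK hM hW hP hK₀ hB hR
    obtain ⟨q₁, a₁⟩ := e₁ s
    set s₁ := run d k P₁ s
    have h₁ : Holds m s₁ := h.congr a₁ (by omega)
    have r₁ : readMat 1 d z s₁ = fun _ => m.v := by
      rw [q₁]; ext i j; simp only [F₁, rxp, rlam, h.W, h.xp, h.par]; rfl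
    obtain ⟨q₂, a₂⟩ := e₂ s₁
    set s₂ := run d k P₂ s₁
    have h₂ : Holds m s₂ := h₁.congr a₂ (by omega)
    have r₂ : readMat d d z₂ s₂ = m.nextW := by
      rw [q₂]; ext i j; simp only [F₂, rxp, h₁.W, h₁.xp, r₁]; rfl
    obtain ⟨q₃, a₃⟩ := e₃ s₂
    set s₃ := run d k P₃ s₂
    have h₃ : Holds m s₃ := h₂.congr a₃ (by omega)
    have r₃ : readMat d d z₃ s₃ = m.nextM := by
      rw [q₃]; ext i j; simp only [F₃, rx, rxp, h₂.M, h₂.B, h₂.u, h₂.x, h₂.xp]; rfl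
    rw [← a₃.readMat (by omega)] at r₂
    obtain ⟨q₄, a₄⟩ := e₄ s₃
    set s₄ := run d k P₄ s₃
    have h₄ : Holds m s₄ := h₃.congr a₄ (by omega)
    have r₄ : readMat d d z₄ s₄ = m.est := by
      rw [q₄]; ext i j; simp only [F₄, rlam, r₂, r₃, h₃.par]; rfl
    rw [← a₄.readMat (by omega)] at r₂ r₃
    rw [show ∀ a b c e f, run d k [.controller a b c e f] s₄ = writeMat a (optController (readMat d d b s₄)
      (readMat d k c s₄) (readMat d d e s₄) (readMat k k f s₄)) s₄ from fun _ _ _ _ _ => rfl, r₄, h₄.B, h₄.Q, h₄.R]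
    set s₅ := writeMat z₅ (optController m.est m.B m.Q m.R) s₄
    have a₅ := agree_writeMat (a := z₅) (optController m.est m.B m.Q m.R) s₄
    have h₅ : Holds m s₅ := h₄.congr a₅ (by omega)
    have r₅ : readMat k d z₅ s₅ = optController m.est m.B m.Q m.R := readMat_writeMat_self _ s₄
    rw [← a₅.readMat (by omega)] at r₂ r₃
    obtain ⟨q₆, a₆⟩ := e₆ s₅
    set s₆ := run d k P₆ s₅
    have h₆ : Holds m s₆ := h₅.congr a₆ (by omega)
    have r₆ : readMat k d z₆ s₆ = m.nextK := by
      rw [q₆]; ext i j; simp only [F₆, rτ, rf, rcnt, r₅, h₅.par, h₅.ctl, h₅.K]; rfl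
    rw [← a₆.readMat (by omega)] at r₂ r₃
    rw [show ∀ a b, run d k [.norm a b] s₆ = Function.update s₆ a ‖readMat k d b s₆‖ from fun _ _ => rfl, r₆]
    set s₇ := Function.update s₆ z₇ ‖m.nextK‖
    have a₇ := Comp.agree_update z₇ s₆ ‖m.nextK‖
    have h₇ : Holds m s₇ := h₆.congr a₇ (by omega)
    have r₇ : readMat 1 1 z₇ s₇ 0 0 = ‖m.nextK‖ := Function.update_self _ _ _
    rw [← a₇.readMat (by omega)] at r₂ r₃ r₆
    obtain ⟨q₈, a₈⟩ := e₈ s₇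
    set s₈ := run d k P₈ s₇
    have h₈ : Holds m s₈ := h₇.congr a₈ (by omega)
    have r₈ : readMat 1 3 z₈ s₈ = ![![m.cnt + 1, m.nextAb, m.nextF]] := by
      rw [q₈]; simp only [F₈, rx, rτ, rf, rcnt, r₇, h₇.par, h₇.ctl, h₇.x]; rfl
    rw [← a₈.readMat (by omega)] at r₂ r₃ r₆
    obtain ⟨q₉, a₉⟩ := e₉ s₈
    set s₉ := run d k P₉ s₈
    have h₉ : Holds m s₉ := h₈.congr a₉ (by omega)
    have r₉ : readMat 1 k z₉ s₉ = fun _ => m.nextU := by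
      rw [q₉]; ext i j; simp only [F₉, rx, rτ, rcnt, r₈, r₆, h₈.par, h₈.ctl, h₈.x, h₈.K₀]; rfl
    rw [← a₉.readMat (by omega)] at r₂ r₃ r₆ r₈
    rw [eu, ec, ex, eW, eM, eK]
    constructor <;> simp (disch := omega) only [readMat_writeMat_self, readMat_writeMat_of_disjoint]
    · exact h₉.x
    · exact r₉
    · exact h₉.Q
    · exact h₉.R
    · exact h₉.B
    · exact h₉.K₀
    · exact h₉.par
    · exact r₈
    · exact h₉.x
    · exact r₂
    · exact r₃
    · exact r₆

end StepProgram

/-! ### Correctness of the program -/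

section Correctness

variable {d k : ℕ}

/-- A symmetric rank-one update of an inverse matrix. -/
lemma inv_add_vecMulVec {n : ℕ} {V : Matrix (Fin n) (Fin n) ℝ} (hV : IsUnit V.det) (hs : Vᵀ = V) {z v : Fin n → ℝ}
    (hv : V⁻¹ *ᵥ z = v) (h : 1 + z ⬝ᵥ v ≠ 0) :
    (V + Matrix.vecMulVec z z)⁻¹ = V⁻¹ - (1 + z ⬝ᵥ v)⁻¹ • Matrix.vecMulVec v v := by
  have h1 : V *ᵥ v = z := by rw [← hv, Matrix.mulVec_mulVec, Matrix.mul_nonsing_inv _ hV, Matrix.one_mulVec]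
  have h2 : z ᵥ* V⁻¹ = v := by
    rw [← hv, ← Matrix.mulVec_transpose, Matrix.transpose_nonsing_inv, hs]
  refine Matrix.inv_eq_right_inv ?_
  have h3 : Matrix.vecMulVec z z * Matrix.vecMulVec v v = (z ⬝ᵥ v) • Matrix.vecMulVec z v := by
    ext i j
    simp only [Matrix.mul_apply, Matrix.vecMulVec_apply, Matrix.smul_apply, smul_eq_mul, dotProduct, Finset.sum_mul]
    exact Finset.sum_congr rfl fun l _ => by ring
  rw [Matrix.add_mul, Matrix.mul_sub, Matrix.mul_sub, Matrix.mul_nonsing_inv _ hV, Matrix.mul_smul, Matrix.mul_smul,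
    Matrix.mul_vecMulVec, h1, Matrix.vecMulVec_mul, h2, h3, smul_smul]
  -- The coefficients of z vᵀ in the product sum to zero: (1 + z·v)⁻¹(1 + z·v) = 1.
  have h4 : Matrix.vecMulVec z v = ((1 + z ⬝ᵥ v)⁻¹ + (1 + z ⬝ᵥ v)⁻¹ * (z ⬝ᵥ v)) • Matrix.vecMulVec z v := by
    rw [show (1 + z ⬝ᵥ v)⁻¹ + (1 + z ⬝ᵥ v)⁻¹ * (z ⬝ᵥ v) = 1 by field_simp, one_smul]
  rw [add_smul] at h4
  rw [sub_add_sub_comm, ← h4, add_sub_cancel_right]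

namespace AlgInput

variable (p : AlgInput d k) (x : ℕ → Fin d → ℝ) (u : ℕ → Fin k → ℝ)

/-- A sequence with its entry at time `0` set to zero. -/
def fromOne {n : ℕ} (y : ℕ → Fin n → ℝ) (t : ℕ) : Fin n → ℝ := if t = 0 then 0 else y t

/-- At t = 0 nothing may be added, because time 0 carries no data; the zero entry of `fromOne` makes
the uniform rank-one update correct there too. -/
lemma gram_succ (t : ℕ) :
    p.gram x (t + 1) = p.gram x t + Matrix.vecMulVec (fromOne x t) (fromOne x t) := by
  cases t with
  | zero => simp [gram, fromOne]
  | succ t =>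
    simp only [gram, fromOne, Nat.add_sub_cancel, Nat.add_one_ne_zero, if_false]
    rw [Finset.sum_Icc_succ_top (by omega), add_assoc]

lemma corr_succ (t : ℕ) : p.corr x u (t + 1) = p.corr x u t +
    Matrix.vecMulVec (x (t + 1) - p.B *ᵥ fromOne u t) (fromOne x t) := by
  cases t with
  | zero => simp [corr, fromOne]
  | succ t =>
    simp only [corr, fromOne, Nat.add_sub_cancel, Nat.add_one_ne_zero, if_false]
    rw [Finset.sum_Icc_succ_top (by omega)]

/-- The next phase after time `t` starts at time `τ₀ * nextMult t`. -/
def nextMult (t : ℕ) : ℕ := if t < p.τ₀ then 1 else 4 ^ (Nat.log 4 (t / p.τ₀) + 1)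

variable {p}

lemma lt_mul_nextMult (hτ : 1 ≤ p.τ₀) (t : ℕ) : t < p.τ₀ * p.nextMult t := by
  unfold nextMult
  split_ifs with h
  · simpa using h
  · have := lt_four_mul_phaseStart hτ t
    rw [phaseStart] at this
    calc t < _ := this
      _ = _ := by ring

/-- The multiplier is a power 4^j and t < τ₀4^j always holds, so reaching it at t + 1 forces t + 1 =
τ₀4^j, which is the exact start of a phase. -/
lemma phase_start (hτ : 1 ≤ p.τ₀) {t : ℕ} (h : p.τ₀ * p.nextMult t ≤ t + 1) :
    p.τ₀ ≤ t + 1 ∧ p.phaseStart (t + 1) = t + 1 ∧ p.nextMult (t + 1) = 4 * p.nextMult t := by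
  obtain ⟨j, hj⟩ : ∃ j, p.nextMult t = 4 ^ j := by
    unfold nextMult; split_ifs
    exacts [⟨0, rfl⟩, ⟨_, rfl⟩]
  have h1 : t + 1 = p.τ₀ * 4 ^ j := by
    have := lt_mul_nextMult hτ t
    rw [hj] at this h; omega
  have h2 : p.τ₀ ≤ t + 1 := by rw [h1]; exact Nat.le_mul_of_pos_right _ (by positivity)
  have h3 : Nat.log 4 ((t + 1) / p.τ₀) = j := by
    rw [h1, Nat.mul_div_cancel_left _ (by omega), Nat.log_pow (by norm_num)]
  refine ⟨h2, by rw [phaseStart, h3, h1], ?_⟩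
  rw [nextMult, if_neg (by omega), h3, hj, pow_succ]; ring

lemma phase_continue (hτ : 1 ≤ p.τ₀) {t : ℕ} (h : ¬p.τ₀ * p.nextMult t ≤ t + 1) :
    p.nextMult (t + 1) = p.nextMult t ∧ (p.τ₀ ≤ t + 1 ↔ p.τ₀ ≤ t) ∧
      (p.τ₀ ≤ t → p.phaseStart (t + 1) = p.phaseStart t) := by
  by_cases ht : t < p.τ₀
  · rw [nextMult, if_pos ht, mul_one] at h
    exact ⟨by rw [nextMult, nextMult, if_pos ht, if_pos (by omega)], by omega, fun h => by omega⟩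
  · rw [nextMult, if_neg ht] at h
    have h0 : t / p.τ₀ ≠ 0 := (Nat.div_pos (by omega) hτ).ne'
    have h1 : Nat.log 4 ((t + 1) / p.τ₀) = Nat.log 4 (t / p.τ₀) := by
      refine Nat.log_eq_of_pow_le_of_lt_pow ?_ ?_
      · exact (Nat.pow_log_le_self 4 h0).trans (Nat.div_le_div_right (by omega))
      · rw [Nat.div_lt_iff_lt_mul hτ, mul_comm]; omega
    exact ⟨by rw [nextMult, nextMult, if_neg ht, if_neg (by omega), h1], by omega,
      fun _ => by rw [phaseStart, phaseStart, h1]⟩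

lemma aborted_succ (t : ℕ) : p.Aborted x u (t + 1) ↔ p.Aborted x u t ∨ p.τ₀ ≤ t + 1 ∧
    (p.xb < x (t + 1) ⬝ᵥ x (t + 1) ∨ p.κ < ‖p.greedy x u (p.phaseStart (t + 1))‖) := by
  constructor
  · rintro ⟨s, h1, h2, h3⟩
    rcases Nat.lt_or_ge s (t + 1) with h | h
    · exact Or.inl ⟨s, h1, by omega, h3⟩
    · obtain rfl : s = t + 1 := by omega
      exact Or.inr ⟨h1, h3⟩
  · rintro (⟨s, h1, h2, h3⟩ | ⟨h1, h3⟩)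
    · exact ⟨s, h1, by omega, h3⟩
    · exact ⟨t + 1, h1, le_rfl, h3⟩

variable (p)

open Classical in
/-- The data that the program has in memory after time step `t`. -/
def regsAt (t : ℕ) : Regs d k where
  x := fromOne x t
  u := fromOne u t
  Q := p.Q
  R := p.R
  B := p.B
  K₀ := p.K₀
  τ₀ := p.τ₀
  xb := p.xb
  κ := p.κ
  lam := p.lam
  cnt := t
  ab := if p.Aborted x u t then 1 else 0
  f := p.nextMult t - 1
  xp := fromOne x t
  W := (p.gram x t)⁻¹ - p.lam⁻¹ • 1
  M := p.corr x u t
  K := if p.τ₀ ≤ t then p.greedy x u (p.phaseStart t) else 0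

/-- The data when the program starts on time step `t + 1`. -/
def regsBefore (t : ℕ) : Regs d k := { p.regsAt x u t with x := x (t + 1) }

variable {p x u}

/-- The stored matrix lacks λ⁻¹I, which the term xp/λ restores. -/
lemma regs_v (t : ℕ) : (p.regsBefore x u t).v = (p.gram x t)⁻¹ *ᵥ fromOne x t := by
  funext j
  simp only [Regs.v, regsBefore, regsAt, Matrix.sub_apply, Matrix.smul_apply, Matrix.one_apply, smul_eq_mul, sub_mul,
    Finset.sum_sub_distrib, Matrix.mulVec, dotProduct, mul_ite, mul_one, mul_zero, ite_mul, zero_mul,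
    Finset.sum_ite_eq, Finset.mem_univ, if_true]
  ring

lemma regs_nextW (hl : 0 < p.lam) (t : ℕ) :
    (p.regsBefore x u t).nextW = (p.gram x (t + 1))⁻¹ - p.lam⁻¹ • 1 := by
  set v := (p.gram x t)⁻¹ *ᵥ fromOne x t with hv
  -- The Gram matrix is positive definite, so the denominator 1 + z·v of the rank-one update is at
  -- least 1.
  have h1 : 0 ≤ fromOne x t ⬝ᵥ v := by
    have h2 : p.gram x t *ᵥ v = fromOne x t := by
      rw [hv, Matrix.mulVec_mulVec, Matrix.mul_nonsing_inv _ (gram_isUnit_det hl), Matrix.one_mulVec]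
    have h3 := (mul_nonneg hl.le (dot_self_nonneg v)).trans (gram_ge (p := p) (x := x) (τ := t) v)
    rwa [qf, h2, dotProduct_comm] at h3
  rw [gram_succ, inv_add_vecMulVec (gram_isUnit_det hl) gram_symm hv.symm (by linarith)]
  ext i j
  have hr := regs_v (p := p) (x := x) (u := u) t
  rw [← hv] at hr
  simp only [Regs.nextW, hr, Matrix.sub_apply, Matrix.smul_apply, Matrix.vecMulVec_apply, smul_eq_mul]
  simp only [regsBefore, regsAt, Matrix.sub_apply, Matrix.smul_apply, smul_eq_mul, dotProduct]
  rw [div_eq_inv_mul]; ring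

lemma regs_nextM (t : ℕ) : (p.regsBefore x u t).nextM = p.corr x u (t + 1) := by
  rw [corr_succ]
  ext i j
  simp [Regs.nextM, regsBefore, regsAt, Matrix.vecMulVec_apply, Matrix.mulVec, dotProduct]

lemma regs_est (hl : 0 < p.lam) (t : ℕ) : (p.regsBefore x u t).est = p.estimate x u (t + 1) := by
  rw [estimate_eq hl]
  ext i j
  simp only [Regs.est, regs_nextW hl, regs_nextM, Matrix.mul_apply, Matrix.sub_apply, Matrix.smul_apply, Matrix.one_apply,
    smul_eq_mul, mul_sub, Finset.sum_sub_distrib, mul_ite, mul_one, mul_zero, Finset.sum_ite_eq', Finset.mem_univ, if_true]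
  simp only [regsBefore, regsAt]
  ring

lemma regs_phase_iff (t : ℕ) : (p.regsBefore x u t).τ₀ * (1 + (p.regsBefore x u t).f) ≤
    (p.regsBefore x u t).cnt + 1 ↔ p.τ₀ * p.nextMult t ≤ t + 1 := by
  simp only [regsBefore, regsAt, add_sub_cancel]
  exact_mod_cast Iff.rfl

lemma regs_started_iff (t : ℕ) : (p.regsBefore x u t).τ₀ ≤ (p.regsBefore x u t).cnt + 1 ↔ p.τ₀ ≤ t + 1 := by
  simp only [regsBefore, regsAt]
  exact_mod_cast Iff.rfl

lemma regs_nextK (hτ : 1 ≤ p.τ₀) (hl : 0 < p.lam) (t : ℕ) :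
    (p.regsBefore x u t).nextK = if p.τ₀ ≤ t + 1 then p.greedy x u (p.phaseStart (t + 1)) else 0 := by
  ext i j
  simp only [Regs.nextK, regs_phase_iff, regs_est hl]
  by_cases h : p.τ₀ * p.nextMult t ≤ t + 1
  · obtain ⟨h1, h2, -⟩ := phase_start hτ h
    rw [if_pos h, if_pos h1, h2]; rfl
  · obtain ⟨-, h1, h2⟩ := phase_continue hτ h
    rw [if_neg h]
    simp only [regsBefore, regsAt, h1]
    split_ifs with h3
    · rw [h2 h3]
    · rfl

/-- The counter is the multiplier minus one, so multiplication by 4 becomes f ↦ 4(1 + f) − 1 = 3 +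
4f. -/
lemma regs_nextF (hτ : 1 ≤ p.τ₀) (t : ℕ) : (p.regsBefore x u t).nextF = p.nextMult (t + 1) - 1 := by
  simp only [Regs.nextF, regs_phase_iff]
  by_cases h : p.τ₀ * p.nextMult t ≤ t + 1
  · rw [if_pos h, (phase_start hτ h).2.2]
    simp only [regsBefore, regsAt]; push_cast; ring
  · rw [if_neg h, (phase_continue hτ h).1]; rfl

open Classical in
lemma regs_nextAb (hτ : 1 ≤ p.τ₀) (hl : 0 < p.lam) (t : ℕ) :
    (p.regsBefore x u t).nextAb = if p.Aborted x u (t + 1) then 1 else 0 := by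
  simp only [Regs.nextAb, regs_started_iff, regs_nextK hτ hl, aborted_succ]
  by_cases h : p.τ₀ ≤ t + 1
  · simp only [h, true_and]
    change (if x (t + 1) ⬝ᵥ x (t + 1) ≤ p.xb then if ‖p.greedy x u (p.phaseStart (t + 1))‖ ≤ p.κ then
      (if p.Aborted x u t then 1 else 0) else 1 else 1) = _
    by_cases h1 : x (t + 1) ⬝ᵥ x (t + 1) ≤ p.xb
    · by_cases h2 : ‖p.greedy x u (p.phaseStart (t + 1))‖ ≤ p.κ
      · simp [h1, h2, not_lt.2 h1, not_lt.2 h2]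
      · simp [h1, h2, not_le.1 h2]
    · simp [h1, not_le.1 h1]
  · simp only [h, false_and, or_false]; rfl

lemma regs_nextU (hτ : 1 ≤ p.τ₀) (hl : 0 < p.lam) (hu : ∀ t, 1 ≤ t → u t = p.policy x u t) (t : ℕ) :
    (p.regsBefore x u t).nextU = u (t + 1) := by
  classical
  rw [hu (t + 1) (by omega), policy]
  funext j
  simp only [Regs.nextU, regs_started_iff, regs_nextAb hτ hl, regs_nextK hτ hl]
  by_cases h : p.τ₀ ≤ t + 1
  · rw [if_pos h]
    by_cases h1 : p.Aborted x u (t + 1)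
    · rw [if_pos h1, if_neg (by norm_num), if_pos (Or.inr h1)]; rfl
    · rw [if_neg h1, if_pos le_rfl, if_pos h, if_neg (by rintro (h2 | h2); exacts [by omega, h1 h2])]; rfl
  · rw [if_neg h, if_pos (Or.inl (by omega))]; rfl

lemma regs_next (hτ : 1 ≤ p.τ₀) (hl : 0 < p.lam) (hu : ∀ t, 1 ≤ t → u t = p.policy x u t) (t : ℕ) :
    (p.regsBefore x u t).next = p.regsAt x u (t + 1) := by
  rw [Regs.next, regs_nextU hτ hl hu, regs_nextAb hτ hl, regs_nextF hτ, regs_nextW hl, regs_nextM, regs_nextK hτ hl]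
  simp [regsBefore, regsAt, fromOne]

end AlgInput

/-- Zero memory is correct at time 0: the multiplier is 1 since τ₀ ≥ 1, the Gram matrix is λI with
inverse λ⁻¹I, the correlation sum is empty, and no phase has begun. -/
lemma holds_initMem (p : AlgInput d k) (hτ : 1 ≤ p.τ₀) (hl : 0 < p.lam) (x : ℕ → Fin d → ℝ) (u : ℕ → Fin k → ℝ) :
    Holds (p.regsAt x u 0) (initMem p) := by
  have hz : ∀ m n a, readMat m n a (0 : ℕ → ℝ) = 0 := fun _ _ _ => rfl
  have hτ' : ¬p.τ₀ ≤ 0 := by omega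
  have hab : ¬p.Aborted x u 0 := by rintro ⟨s, h1, h2, -⟩; omega
  constructor <;>
    simp (disch := omega) only [initMem, readMat_writeMat_self, readMat_writeMat_of_disjoint, hz, AlgInput.regsAt]
  · rfl
  · rfl
  · rfl
  · ext i j
    fin_cases i; fin_cases j
    · simp
    · simp [hab]
    · simp [AlgInput.nextMult, Nat.pos_of_ne_zero (Nat.one_le_iff_ne_zero.1 hτ)]
  · rfl
  · have : p.gram x 0 = p.lam • 1 := by simp [AlgInput.gram]
    have hinv : (p.lam • (1 : Matrix (Fin d) (Fin d) ℝ))⁻¹ = p.lam⁻¹ • 1 := Matrix.inv_eq_right_inv (by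
      rw [Matrix.smul_mul, Matrix.one_mul, smul_smul, mul_inv_cancel₀ hl.ne', one_smul])
    rw [this, hinv, sub_self]
  · simp [AlgInput.corr]
  · rw [if_neg hτ']

lemma Holds.set_state {m : Regs d k} {s : ℕ → ℝ} (h : Holds m s) (y : Fin d → ℝ) :
    Holds { m with x := y } fun r => if hr : r < d then y ⟨r, hr⟩ else s r := by
  have key : ∀ a b c, d ≤ c → readMat a b c (fun r => if hr : r < d then y ⟨r, hr⟩ else s r) = readMat a b c s :=
    fun a b c hc => by
      ext i j
      simp only [readMat]
      rw [dif_neg (by omega)]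
  constructor
  · ext i j
    have h1 := readMat_index_lt i j
    obtain rfl : i = 0 := Subsingleton.elim _ _
    simp [readMat]
  · rw [key _ _ _ (by omega)]; exact h.u
  · rw [key _ _ _ (by omega)]; exact h.Q
  · rw [key _ _ _ (by omega)]; exact h.R
  · rw [key _ _ _ (by omega)]; exact h.B
  · rw [key _ _ _ (by omega)]; exact h.K₀
  · rw [key _ _ _ (by omega)]; exact h.par
  · rw [key _ _ _ (by omega)]; exact h.ctl
  · rw [key _ _ _ (by omega)]; exact h.xp
  · rw [key _ _ _ (by omega)]; exact h.W
  · rw [key _ _ _ (by omega)]; exact h.M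
  · rw [key _ _ _ (by omega)]; exact h.K

/-- The algorithm is implemented by a program of polynomial length. -/
theorem exists_program : ∃ pTime : MvPolynomial (Fin 2) ℕ, ∀ d k : ℕ, ∃ prog : List Instr,
    prog.length ≤ MvPolynomial.eval ![d, k] pTime ∧ Implements d k prog := by
  refine ⟨MvPolynomial.C 200 * (1 + MvPolynomial.X 0 + MvPolynomial.X 1) ^ 3, fun d k => ?_⟩
  obtain ⟨P, hP, hs⟩ := exists_step_program d k
  refine ⟨P, by simpa using hP, fun p hτ hl x u hu => ?_⟩
  have key : ∀ t, Holds (p.regsAt x u t) (progMem P p x t) := fun t => by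
    induction t with
    | zero => exact holds_initMem p hτ hl x u
    | succ t ih =>
      rw [← AlgInput.regs_next hτ hl hu]
      exact hs _ _ (ih.set_state (x (t + 1)))
  intro t ht
  funext j
  have h1 := congrFun (congrFun (key t).u 0) j
  have h2 : readMat 1 k d (progMem P p x t) 0 j = progAction P p x t j := by simp [readMat, progAction]
  rw [← h2, h1]
  simp only [AlgInput.regsAt, AlgInput.fromOne]
  rw [if_neg (by omega)]

end Correctness

end LQ

end

theorem theorem1 :
    -- the algorithm runs in time polynomial in `d` and `k` per time step
    (∃ pTime : MvPolynomial (Fin 2) ℕ, ∀ d k : ℕ, ∃ prog : List LQ.Instr,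
      prog.length ≤ MvPolynomial.eval ![d, k] pTime ∧ LQ.Implements d k prog) ∧
    -- and its expected regret is polylogarithmic
    (∃ pC pε pT pR : MvPolynomial (Fin 9) ℝ,
      ∀ (d k : ℕ) (S : LQ.System d k) (K₀ : Matrix (Fin k) (Fin d) ℝ) (α₀ α₁ ϑ ν ν₀ C₀ ε₀ : ℝ),
        S.Admissible K₀ α₀ α₁ ϑ ν ν₀ →
        C₀ = MvPolynomial.eval (LQ.consts d k α₀ α₁ ϑ ν ν₀ S.σ) pC →
        ε₀ = (MvPolynomial.eval (LQ.consts d k α₀ α₁ ϑ ν ν₀ S.σ) pε)⁻¹ →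
        0 < C₀ ∧ 0 < ε₀ ∧ S.PerturbationBound C₀ ε₀ ∧
        ∀ T : ℕ, MvPolynomial.eval (LQ.consts d k α₀ α₁ ϑ ν ν₀ S.σ) pT ≤ (T : ℝ) →
          ∀ (Ω : Type*) [MeasurableSpace Ω] (P : Measure Ω) [IsProbabilityMeasure P]
            (w : ℕ → Ω → Fin d → ℝ),
            (∀ t, HasLaw (w t) (LQ.gaussianNoise d S.σ) P) → iIndepFun w P →
            Integrable (fun ω => S.regret (LQ.algInput S K₀ α₀ ϑ ν ν₀ C₀ ε₀ T).policy T
              (fun t => w t ω)) P ∧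
            ∫ ω, S.regret (LQ.algInput S K₀ α₀ ϑ ν ν₀ C₀ ε₀ T).policy T (fun t => w t ω) ∂P ≤
              MvPolynomial.eval (LQ.consts d k α₀ α₁ ϑ ν ν₀ S.σ) pR * Real.log T ^ 2) := by
  exact ⟨LQ.exists_program, LQ.exists_regret_polynomials⟩
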